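/- **Marked squares.** An edge marking is a triple $(abc)$ with direction $a\in\{+,-\}$ ($+$ outward, $-$ inward), sidedness $b\in\{0,+,-\}$ and channel $c\in\{0,1,2,3\}$; write $(+)=(+00)$, $(-)=(-00)$. Two markings fit together across an edge iff their $a$'s are opposite, their $b$'s are opposite and their $c$'s are equal. Reflection of a marking changes the sign of $b$. A tile is a unit square of the square lattice, cornered or uncornered, with a marking on each edge, and may be moved by the symmetries of the square lattice (a reflection also reflects the markings). In a configuration, markings fit across common edges and no two cornered tiles meet at a vertex; in a tiling (of the plane), every lattice square is occupied and every vertex meets exactly one cornered tile. A set of tiles is *aperiodic* if it admits a tiling but admits no tiling that is invariant under a non-zero translation. **The tiles.** The four outward tiles $\mathcal T_+$ are, cornered and uncornered, the tiles with markings, clockwise from the north, $(+),(+),(++1),(+-0)$ and $(+),(+-2),(+),(++3)$. The crossing tiles $[hv]$, $h\in\{-,0,1,3,-3\}$, $v\in\{+,0,1,2,3\}$, are uncornered. Their (west, east) markings are $(-),(-)$ for $h=-$; $(--0),(-+0)$ for $h=0$; $(--1),(-+2)$ for $h=1$; $(--3),(-+3)$ for $h=3$; $(-+3),(--3)$ for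 $h=-3$. Their (north, south) markings are $(+),(-)$ for $v=+$ and $(++v),(--v)$ for $v=0,1,2,3$. Let $\mathcal T_{hv}$ be the 23 crossing tiles other than $[00],[01]$, let $\mathcal T_1=\mathcal T_+\cup\mathcal T_{hv}$ (27 tiles), $\mathcal K_1=\{[02],[03],[10],[11],[12],[13]\}$ (the key tiles), $\mathcal U_1=\mathcal T_{hv}\setminus\mathcal K_1$, and - $\mathcal T_{t}=\mathcal T_+\cup\{[02],[11],[32],[-32],[-0],[-1],[-3],[-+],[0+],[1+],[3+],[-3+]\}$, - $\mathcal T_{p}=\mathcal T_+\cup\{[03],[10],[30],[-30],[-0],[-1],[-2],[-3],[-+],[0+],[1+],[3+],[-3+]\}$, - $\mathcal T_{q}=\mathcal T_+\cup\{[11],[12],[13],[30],[-30],[-0],[-1],[-2],[-3],[-+],[0+],[1+],[3+],[-3+]\}$, - $\mathcal T_{a}=\mathcal T_1\setminus\{[02]\}$. **Domino substitutions.** The domino is a $2\times1$ rectangle; a domino tiling is a covering of the Euclidean plane by congruent copies of it with disjoint interiors. A rule replaces the domino, inflated by the factor 2 to a $4\times 2$ rectangle, by four dominoes, each placed by a specified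 isometry. Consider the rules whose four dominoes are: $t$ (the table) one upright domino at either end and two horizontal ones stacked between them; $p$: four dominoes parallel to the parent; $q$: four dominoes perpendicular to the parent; $a$ (the asymmetric rules): two parallel dominoes filling one half, two perpendicular ones filling the other, all choices of the isometries placing them being allowed (for $t,p,q$ the choice does not matter). For a set $S$ of rules, the domino is a $0$-level supertile, isometric copies of $n$-level supertiles are $n$-level supertiles, and inflating an $n$-level supertile by 2 and replacing each of its dominoes by a rule of $S$ (chosen for each domino) gives an $(n+1)$-level supertile. A domino tiling $C$ is *hierarchical* under $S$ if for every $t\in C$ there are $\{t\}=C_0\subset C_1\subset C_2\subset\cdots\subset C$ with $C_n$ an $n$-level supertile. Scale the squares to side $1/4$. A *local derivation* is given by finitely many finite configurations $C_i$ admitted by the set of tiles and, for each, a finite configuration $\Phi(C_i)$ of dominoes, and maps $\tau$ to $\Phi(\tau)=\bigcup_{gC_i\subset\tau}g\Phi(C_i)$, where $g$ runs over the isometries; it is required that every tiling $\tau$ admitted by the set is a union of configurations of the form $gC_i$. A set of tiles *enforces* $S$ if for some such $\Phi$, for every tiling $\tau$ that the set admits, $\Phi(\tau)$ is a domino tiling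 that is hierarchical under $S$. **Theorem.** Each of the nine sets $\mathcal T_t$, $\mathcal T_p$, $\mathcal T_q$, $\mathcal T_a$, $\mathcal T_t\cup\mathcal T_p$, $\mathcal T_t\cup\mathcal T_q$, $\mathcal T_p\cup\mathcal T_q$, $\mathcal T_t\cup\mathcal T_p\cup\mathcal T_q$, $\mathcal T_1$ enforces, respectively, the substitution system given by the rules $\{t\}$, $\{p\}$, $\{q\}$, $\{p,q,a\}$, $\{t,p\}$, $\{t,q\}$, $\{p,q\}$, $\{t,p,q\}$, $\{t,p,q,a\}$. Moreover, in each of its tilings, erasing the markings (replacing every $3\times7$ block of squares framed by eight cornered tiles by the domino with the same centre and the same long direction) yields a hierarchical tiling under that system. Each of the nine sets is aperiodic. For each of them, its union with $\mathcal U_1$ enforces the same substitution system, and every domino substitution system (with inflation factor 2) enforced by this union is enforced by the set itself. No proper subset of $\mathcal T_t$, $\mathcal T_p$ or $\mathcal T_q$ admits a tiling. -/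

import Mathlib

namespace DominoTiles

/-! ### Marked squares -/

/-- A marking of an edge of a square: direction (`out` is `+`, inward is `-`), sidedness
(`1`, `-1` or `0`) and the `c`-channel. The plain markings have sidedness and channel `0`. -/
@[ext]
structure Marking where
  out : Bool
  side : SignType
  chan : Fin 4
deriving DecidableEq

/-- Two edge markings fit together across a common edge. -/
def Marking.Fits (m m' : Marking) : Prop :=
  m'.out = !m.out ∧ m'.side = -m.side ∧ m'.chan = m.chan

/-- The reflection of an edge marking. -/
def Marking.reflect (m : Marking) : Marking := ⟨m.out, -m.side, m.chan⟩

/-- A marked square in a given position: cornered or uncornered, with the markings of its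
north, east, south and west edges. -/
@[ext]
structure Cell where
  cornered : Bool
  n : Marking
  e : Marking
  s : Marking
  w : Marking
deriving DecidableEq

/-- Quarter turn, clockwise. -/
def Cell.turn (c : Cell) : Cell := ⟨c.cornered, c.w, c.n, c.e, c.s⟩

/-- Reflection exchanging east and west. -/
def Cell.flip (c : Cell) : Cell :=
  ⟨c.cornered, c.n.reflect, c.w.reflect, c.s.reflect, c.e.reflect⟩

/-- The symmetries of the square acting on marked squares. -/
def Cell.move (flip : Bool) (turns : Fin 4) (c : Cell) : Cell :=
  Cell.turn^[turns.val] (if flip then c.flip else c)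

/-! ### The tiles -/

/-- The plain markings `(+)` and `(-)`. -/
def plainOut : Marking := ⟨true, 0, 0⟩
def plainIn : Marking := ⟨false, 0, 0⟩

/-- The outward tile `(+)(+)(++1)(+-0)`, edges listed clockwise from the north. -/
def tileA (cornered : Bool) : Cell :=
  ⟨cornered, plainOut, plainOut, ⟨true, 1, 1⟩, ⟨true, -1, 0⟩⟩

/-- The outward tile `(+)(+-2)(+)(++3)`, edges listed clockwise from the north. -/
def tileB (cornered : Bool) : Cell :=
  ⟨cornered, plainOut, ⟨true, -1, 2⟩, plainOut, ⟨true, 1, 3⟩⟩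

/-- The names `-, 0, 1, 3, -3` of the horizontal markings of a crossing tile. -/
inductive Hor where
  | plain | zero | one | three | negThree
deriving DecidableEq

/-- The names `+, 0, 1, 2, 3` of the vertical markings of a crossing tile. -/
inductive Ver where
  | plain | zero | one | two | three
deriving DecidableEq

def Hor.west : Hor → Marking
  | .plain => plainIn
  | .zero => ⟨false, -1, 0⟩
  | .one => ⟨false, -1, 1⟩
  | .three => ⟨false, -1, 3⟩
  | .negThree => ⟨false, 1, 3⟩

def Hor.east : Hor → Marking
  | .plain => plainIn
  | .zero => ⟨false, 1, 0⟩
  | .one => ⟨false, 1, 2⟩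
  | .three => ⟨false, 1, 3⟩
  | .negThree => ⟨false, -1, 3⟩

def Ver.north : Ver → Marking
  | .plain => plainOut
  | .zero => ⟨true, 1, 0⟩
  | .one => ⟨true, 1, 1⟩
  | .two => ⟨true, 1, 2⟩
  | .three => ⟨true, 1, 3⟩

def Ver.south : Ver → Marking
  | .plain => plainIn
  | .zero => ⟨false, -1, 0⟩
  | .one => ⟨false, -1, 1⟩
  | .two => ⟨false, -1, 2⟩
  | .three => ⟨false, -1, 3⟩

/-- The crossing tile `[hv]`: inward on the west, east and south edges, outward on the north. -/
def cross (h : Hor) (v : Ver) : Cell := ⟨false, v.north, h.east, v.south, h.west⟩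

/-- The four outward tiles. -/
def outwardTiles : Set Cell := {tileA false, tileA true, tileB false, tileB true}

/-- The twenty-three crossing tiles. -/
def crossingTiles : Set Cell :=
  {c | ∃ h v, c = cross h v} \ {cross .zero .zero, cross .zero .one}

/-- The set `𝒯₁` of twenty-seven tiles. -/
def tiles1 : Set Cell := outwardTiles ∪ crossingTiles

/-- The key tiles `𝒦₁`: signed markings cross. -/
def keyTiles1 : Set Cell :=
  {c | ∃ h v, (h = .zero ∨ h = .one) ∧ v ≠ .plain ∧ c = cross h v} ∩ crossingTiles

/-- The remaining crossing tiles `𝒰₁`. -/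
def restTiles1 : Set Cell := crossingTiles \ keyTiles1

/-- The sixteen tiles for the table rule. -/
def tableTiles : Set Cell := outwardTiles ∪
  {cross .zero .two, cross .one .one, cross .three .two, cross .negThree .two,
   cross .plain .zero, cross .plain .one, cross .plain .three,
   cross .plain .plain, cross .zero .plain, cross .one .plain, cross .three .plain,
   cross .negThree .plain}

/-- The seventeen tiles for the rule with four children parallel to their parent. -/
def parallelTiles : Set Cell := outwardTiles ∪
  {cross .zero .three, cross .one .zero, cross .three .zero, cross .negThree .zero,
   cross .plain .zero, cross .plain .one, cross .plain .two, cross .plain .three,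
   cross .plain .plain, cross .zero .plain, cross .one .plain, cross .three .plain,
   cross .negThree .plain}

/-- The eighteen tiles for the rule with four children perpendicular to their parent. -/
def perpTiles : Set Cell := outwardTiles ∪
  {cross .one .one, cross .one .two, cross .one .three, cross .three .zero,
   cross .negThree .zero,
   cross .plain .zero, cross .plain .one, cross .plain .two, cross .plain .three,
   cross .plain .plain, cross .zero .plain, cross .one .plain, cross .three .plain,
   cross .negThree .plain}

/-- The twenty-six tiles for the asymmetric rules. -/
def asymTiles : Set Cell := tiles1 \ {cross .zero .two}

/-! ### Configurations and tilings by marked squares -/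

/-- A configuration of marked squares: a set of placed tiles `(p, c)`, where the marked square
`c` occupies the square of the lattice that is centred at `p`. -/
abbrev Config := Set ((ℤ × ℤ) × Cell)

/-- The four lattice squares around a vertex of the lattice. -/
def around (p : ℤ × ℤ) : Set (ℤ × ℤ) :=
  {p, (p.1 + 1, p.2), (p.1, p.2 + 1), (p.1 + 1, p.2 + 1)}

/-- `C` is a configuration admitted by the set `T` of tiles: every placed tile is congruent to a
tile in `T`, distinct tiles occupy distinct squares, edge markings match across common edges, and
no two cornered tiles meet at a vertex. -/
structure Admitted (T : Set Cell) (C : Config) : Prop where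
  congruent : ∀ x ∈ C, ∃ t ∈ T, ∃ f k, x.2 = Cell.move f k t
  unique : ∀ p c c', (p, c) ∈ C → (p, c') ∈ C → c = c'
  fits_e : ∀ (p : ℤ × ℤ) (c c' : Cell),
    (p, c) ∈ C → ((p.1 + 1, p.2), c') ∈ C → c.e.Fits c'.w
  fits_n : ∀ (p : ℤ × ℤ) (c c' : Cell),
    (p, c) ∈ C → ((p.1, p.2 + 1), c') ∈ C → c.n.Fits c'.s
  corners : ∀ p, ∀ x ∈ C, ∀ y ∈ C, x.1 ∈ around p → y.1 ∈ around p →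
    x.2.cornered = true → y.2.cornered = true → x = y

/-- `τ` is a tiling admitted by `T`: an admitted configuration that leaves no square and no
vertex uncovered, i.e. every square is occupied and every vertex meets a cornered tile. -/
structure IsTiling (T : Set Cell) (τ : Config) : Prop where
  admitted : Admitted T τ
  full : ∀ p, ∃ c, (p, c) ∈ τ
  vertices : ∀ p, ∃ x ∈ τ, x.1 ∈ around p ∧ x.2.cornered = true

/-- Invariance under a non-zero translation. -/
def Periodic (τ : Config) : Prop :=
  ∃ v : ℤ × ℤ, v ≠ 0 ∧ (fun x : (ℤ × ℤ) × Cell => (x.1 + v, x.2)) '' τ = τ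

/-- `T` admits a tiling, but no periodic one. -/
def Aperiodic (T : Set Cell) : Prop :=
  (∃ τ, IsTiling T τ) ∧ ∀ τ, IsTiling T τ → ¬ Periodic τ

/-! ### Dominoes in the Euclidean plane and their substitution systems -/

abbrev Plane := EuclideanSpace ℝ (Fin 2)

/-- Euclidean isometries. -/
abbrev Isom := Plane ≃ᵢ Plane

/-- The domino: a `2 × 1` rectangle centred at the origin. -/
def domino : Set Plane := {p | |p 0| ≤ 1 ∧ |p 1| ≤ 1 / 2}

/-- A configuration of dominoes: copies of the domino with disjoint interiors. -/
def IsDominoConfig (C : Set (Set Plane)) : Prop :=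
  (∀ t ∈ C, ∃ g : Isom, t = g '' domino) ∧
    C.Pairwise fun s t => Disjoint (interior s) (interior t)

/-- A tiling of the plane by dominoes. -/
def IsDominoTiling (C : Set (Set Plane)) : Prop :=
  IsDominoConfig C ∧ ⋃₀ C = Set.univ

/-- A tiling substitution rule on the domino, with inflation `x ↦ 2x`, is given by the isometries
that place the children in the inflated domino: the isometries themselves matter when the
rule is iterated, not only the dominoes that they produce. -/
abbrev Rule := Set Isom

/-- The dominoes placed by a set of isometries. -/
def placed (P : Set Isom) : Set (Set Plane) := (fun g : Isom => g '' domino) '' P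

/-- Conjugation `s g s⁻¹` of an isometry `g` by the inflation `s : x ↦ 2x`. -/
noncomputable def inflate (g : Isom) : Isom where
  toFun x := (2 : ℝ) • g ((2 : ℝ)⁻¹ • x)
  invFun x := (2 : ℝ) • g.symm ((2 : ℝ)⁻¹ • x)
  left_inv x := by simp
  right_inv x := by simp
  isometry_toFun := by
    refine Isometry.of_dist_eq fun x y => ?_
    simp only [dist_smul₀, g.dist_eq, norm_inv, Real.norm_ofNat]
    ring

/-- The `n`-level supertiles of a set `S` of rules, each as the set of isometries that place its
dominoes. In a substitution step every domino of the supertile is replaced according to a rule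
in `S`, chosen for it. -/
inductive IsSupertile (S : Set Rule) : ℕ → Set Isom → Prop
  | base : IsSupertile S 0 {1}
  | move {n : ℕ} {P : Set Isom} (g : Isom) (h : IsSupertile S n P) :
      IsSupertile S n ((fun x => g * x) '' P)
  | subst {n : ℕ} {P : Set Isom} (h : IsSupertile S n P) (σ : Isom → Rule)
      (hσ : ∀ g ∈ P, σ g ∈ S) :
      IsSupertile S (n + 1) (⋃ g ∈ P, (fun x => inflate g * x) '' σ g)

/-- Hierarchical tilings: every domino lies in an increasing sequence of supertiles of all
levels. -/
def IsHierarchical (S : Set Rule) (C : Set (Set Plane)) : Prop :=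
  IsDominoTiling C ∧ ∀ t ∈ C, ∃ P : ℕ → Set Isom, placed (P 0) = {t} ∧
    ∀ n, IsSupertile S n (P n) ∧ placed (P n) ⊆ placed (P (n + 1)) ∧ placed (P n) ⊆ C

/-- The horizontal and vertical dominoes with centre `(a, b)`. -/
def horiz (a b : ℝ) : Set Plane := {p | |p 0 - a| ≤ 1 ∧ |p 1 - b| ≤ 1 / 2}
def vert (a b : ℝ) : Set Plane := {p | |p 0 - a| ≤ 1 / 2 ∧ |p 1 - b| ≤ 1}

/-- All rules whose children form the configuration `D`: one isometry for each domino of `D`,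
chosen in any of the four ways that the symmetries of the domino allow. (If `D` has the symmetries
of the domino, the supertiles do not depend on the choice.) -/
def rulesOf (D : Set (Set Plane)) : Set Rule :=
  {σ | Set.BijOn (fun g : Isom => g '' domino) σ D}

/-- The table rule: an upright domino at either end, two horizontal ones stacked between. -/
def tableRule : Set Rule :=
  rulesOf {vert (-3 / 2) 0, horiz 0 (1 / 2), horiz 0 (-1 / 2), vert (3 / 2) 0}

/-- Four children parallel to their parent. -/
def parallelRule : Set Rule :=
  rulesOf {horiz (-1) (1 / 2), horiz 1 (1 / 2), horiz (-1) (-1 / 2), horiz 1 (-1 / 2)}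

/-- Four children perpendicular to their parent. -/
def perpRule : Set Rule :=
  rulesOf {vert (-3 / 2) 0, vert (-1 / 2) 0, vert (1 / 2) 0, vert (3 / 2) 0}

/-- The asymmetric rules: two parallel children in one half, two perpendicular ones in the
other. -/
def asymRules : Set Rule :=
  rulesOf {horiz (-1) (1 / 2), horiz (-1) (-1 / 2), vert (1 / 2) 0, vert (3 / 2) 0}

/-! ### Local derivations and enforcement -/

/-- A symmetry of the square lattice: an optional reflection, clockwise quarter turns about the
origin, and a translation. -/
structure LatticeIsom where
  flip : Bool
  turns : Fin 4
  shift : ℤ × ℤ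

namespace LatticeIsom

/-- The action on positions. -/
def pos (g : LatticeIsom) (p : ℤ × ℤ) : ℤ × ℤ :=
  (fun q : ℤ × ℤ => (q.2, -q.1))^[g.turns.val] (if g.flip then (-p.1, p.2) else p) + g.shift

/-- The action on configurations. -/
def config (g : LatticeIsom) (C : Config) : Config :=
  (fun x : (ℤ × ℤ) × Cell => (g.pos x.1, Cell.move g.flip g.turns x.2)) '' C

/-- The action on the plane, the marked squares having sides of length `1 / 4`. -/
noncomputable def plane (g : LatticeIsom) (p : Plane) : Plane :=
  (fun q : Plane => !₂[q 1, -q 0])^[g.turns.val] (if g.flip then !₂[-p 0, p 1] else p) +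
    !₂[(g.shift.1 : ℝ) / 4, (g.shift.2 : ℝ) / 4]

end LatticeIsom

/-- The result of applying to `τ` the local derivation given by the patterns in `pats` and their
images under `φ`. -/
def derive (pats : Set Config) (φ : Config → Set (Set Plane)) (τ : Config) : Set (Set Plane) :=
  {t | ∃ g : LatticeIsom, ∃ C ∈ pats, g.config C ⊆ τ ∧ ∃ s ∈ φ C, t = g.plane '' s}

/-- The eight cornered tiles that frame a horizontal block of `3 × 7` squares centred at the
origin; the two given ones are carried to the others by the symmetries of the rectangle. -/
def frame : Config :=
  {x | ∃ f : Bool, ∃ k ∈ ({0, 2} : Set (Fin 4)),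
    x ∈ LatticeIsom.config ⟨f, k, 0⟩
      {((-3, 1), Cell.move false 3 (tileA true)), ((-1, 1), Cell.move false 2 (tileB true))}}

/-- Erasing the markings: every framed block is replaced by a domino with the same centre and the
same long direction. -/
def erase (τ : Config) : Set (Set Plane) := derive {frame} (fun _ => {domino}) τ

/-- The set `T` of marked squares enforces the domino substitution system `S`: some local
derivation, given by finitely many finite configurations and their images, takes every tiling
admitted by `T` to a hierarchical tiling. -/
def Enforces (T : Set Cell) (S : Set Rule) : Prop :=
  ∃ (pats : Set Config) (φ : Config → Set (Set Plane)),
    pats.Finite ∧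
    (∀ C ∈ pats, C.Finite ∧ Admitted T C ∧ (φ C).Finite ∧ IsDominoConfig (φ C)) ∧
    ∀ τ, IsTiling T τ →
      (∀ x ∈ τ, ∃ g : LatticeIsom, ∃ C ∈ pats, g.config C ⊆ τ ∧ x ∈ g.config C) ∧
      IsHierarchical S (derive pats φ τ)

end DominoTiles

namespace DominoTiles
set_option linter.unusedSimpArgs false

/-! ### Edge markings and oriented tiles -/

/-! The markings force a hierarchy of square blocks. Outward markings send out arrows; where two
arrows meet head on there is a crossing tile, whose two paired markings correspond under
`Marking.mate` and which lets the perpendicular line pass. A level of size `s` (`Level`) is a set of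
outward tiles whose lines run unchanged through blocks of size `2 * s` that tile the plane. The
cornered tiles form the level of size `1`.

The signed edges in channels `0`, `1`, `2` join four blocks into a square of twice the size, a
half-block: two copies of `tileA` joined through channel `0`, each joined to a copy of `tileB`
through channels `1` and `2`. The obstacle is a fault, a line along which adjacent columns of blocks
are out of step. All tiles on a fault are crossing tiles, the arrows along it can only lead upward
below some point and downward above it, and the sidedness of a marking in channels `0`, `1`, `2`
restricts the direction of the arrow that crosses it. Following the markings from block to block
produces the opposite sidedness further down the fault, a contradiction
(`Level.aligned_of_tileA_south`, `Level.aligned_of_tileB_south`). The tile in the centre of a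
half-block is then forced to be outward, so the half-blocks form the next level (`Level.next`), and
there are levels of all sizes `2 ^ n` (`Tiled.level`). No non-zero translation preserves all of
them.

Edges in channel `3` lead from a half-block to its partner. Their sidedness says nothing about
arrows, so their alignment (`Tiled.aligned_of_chan_three`) uses the hierarchy: if a fault is shifted
by an odd multiple of `2 ^ m`, there is at level `m` a shift by exactly half a block, and then pairs
of lines in channel `3` of one level would have to match pairs of the next level, which are twice as
far apart. Hence half-blocks come in pairs, which are the dominoes (`Dom`).

Signed lines from the centre of a half-block that do not leave through its open side cross the lines
joining its four blocks, and they cross them in key tiles (`HalfBlock.centerCond`). For the four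
half-blocks in a larger one this leaves three roles (`Tiled.role`); comparing the two halves of a
domino gives the table, the parallel, the perpendicular and the mixed patterns (`Tiled.children`),
and the mixed ones need a tile of `mixTiles` (`Tiled.not_mixed`). Choosing a frame for each domino
of each level exhibits the supertiles (`isHierarchical_of_frames`).

When the remaining crossing tiles are added, mixed patterns can no longer be excluded for the
systems with rules `p, q` and `t, p, q`. There another derivation serves (`enforces_parallel_perp`):
it fills each half-block of level `2` with eight parallel dominoes, so that supertiles arise by
using `p` only, except for a choice between `p` and `q` in the last step. Enforcement passes to
smaller sets of tiles (`Enforces.anti_tiles`).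

Tilings exist because any outward tile can be surrounded by a half-block that opens in a suitable
direction (`Scheme`); this refinement yields arbitrarily large squares, and compactness does the
rest. The three small sets are minimal because half-blocks of the lowest levels around both kinds of
outward tiles already display every tile. -/

/-- The marking that fits a given one. -/
def Marking.opp (m : Marking) : Marking := ⟨!m.out, -m.side, m.chan⟩

/-- The marking of the outward tile at the other end of a line. -/
def Marking.mate (m : Marking) : Marking := ⟨m.out, -m.side, ![0, 2, 1, 3] m.chan⟩

theorem Marking.fits_iff {m m' : Marking} : m.Fits m' ↔ m' = m.opp := by
  cases m; cases m'; simp [Marking.Fits, Marking.opp]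

@[simp] theorem Marking.opp_opp (m : Marking) : m.opp.opp = m := by
  cases m; simp [Marking.opp]

@[simp] theorem Marking.opp_out (m : Marking) : m.opp.out = !m.out := rfl

@[simp] theorem Marking.reflect_reflect (m : Marking) : m.reflect.reflect = m := by
  cases m; simp [Marking.reflect]

@[simp] theorem Marking.reflect_out (m : Marking) : m.reflect.out = m.out := rfl

@[simp] theorem Cell.flip_flip (c : Cell) : c.flip.flip = c := by
  cases c; simp [Cell.flip]

/-- The marked squares congruent to a tile of `T`. -/
def oriented (T : Set Cell) : Set Cell := {c | ∃ t ∈ T, ∃ b k, c = Cell.move b k t}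

theorem oriented_mono {T T' : Set Cell} (h : T ⊆ T') : oriented T ⊆ oriented T' :=
  fun _ ⟨t, ht, b, k, e⟩ => ⟨t, h ht, b, k, e⟩

/-- All four markings are outward. -/
def Cell.IsOut (c : Cell) : Prop :=
  c.n.out = true ∧ c.e.out = true ∧ c.s.out = true ∧ c.w.out = true

instance (c : Cell) : Decidable c.IsOut := by unfold Cell.IsOut; infer_instance

/-- The twenty-seven tiles of `tiles1`, listed. -/
def tileList : List Cell :=
  [tileA false, tileA true, tileB false, tileB true] ++
    (([Hor.plain, .zero, .one, .three, .negThree].flatMap fun h =>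
      [Ver.plain, .zero, .one, .two, .three].map (cross h)).filter
        fun c => c ≠ cross .zero .zero ∧ c ≠ cross .zero .one)

/-- All congruent copies of a list of tiles. -/
def copies (l : List Cell) : List Cell :=
  l.flatMap fun t => [false, true].flatMap fun b => (List.finRange 4).map fun k => Cell.move b k t

theorem mem_copies {l : List Cell} {c : Cell} :
    c ∈ copies l ↔ ∃ t ∈ l, ∃ b k, c = Cell.move b k t := by
  simp only [copies, List.mem_flatMap, List.mem_map, List.mem_finRange, true_and]
  constructor
  · rintro ⟨t, ht, b, -, k, rfl⟩
    exact ⟨t, ht, b, k, rfl⟩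
  · rintro ⟨t, ht, b, k, rfl⟩
    exact ⟨t, ht, b, by cases b <;> simp, k, rfl⟩

theorem mem_tileList_of_mem {c : Cell} (h : c ∈ tiles1) : c ∈ tileList := by
  rcases h with (rfl | rfl | rfl | rfl) | ⟨⟨h, v, rfl⟩, hn⟩
  · decide
  · decide
  · decide
  · decide
  · revert hn
    cases h <;> cases v <;> first | (intro _; decide) | (intro hn; exact absurd (by simp) hn)

theorem mem_copies_of_oriented {c : Cell} (h : c ∈ oriented tiles1) : c ∈ copies tileList := by
  obtain ⟨t, ht, b, k, rfl⟩ := h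
  exact mem_copies.2 ⟨t, mem_tileList_of_mem ht, b, k, rfl⟩

/-- The inverse of `Cell.move`. -/
def Cell.unmove (b : Bool) (k : Fin 4) (c : Cell) : Cell :=
  if b then Cell.move true k c else Cell.turn^[4 - k.val] c

@[simp] theorem Cell.move_unmove (b : Bool) (k : Fin 4) (c : Cell) :
    Cell.move b k (Cell.unmove b k c) = c := by
  cases b <;> fin_cases k <;> cases c <;>
    simp [Cell.unmove, Cell.move, Cell.flip, Cell.turn, Nat.iterate]

@[simp] theorem Cell.unmove_move (b : Bool) (k : Fin 4) (c : Cell) :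
    Cell.unmove b k (Cell.move b k c) = c := by
  cases b <;> fin_cases k <;> cases c <;>
    simp [Cell.unmove, Cell.move, Cell.flip, Cell.turn, Nat.iterate]

theorem turn_mem_oriented {T : Set Cell} {c : Cell} (h : c ∈ oriented T) :
    c.turn ∈ oriented T := by
  obtain ⟨t, ht, b, k, rfl⟩ := h
  refine ⟨t, ht, b, k + 1, ?_⟩
  cases b <;> fin_cases k <;> rfl

theorem flip_mem_oriented {T : Set Cell} {c : Cell} (h : c ∈ oriented T) :
    c.flip ∈ oriented T := by
  obtain ⟨t, ht, b, k, rfl⟩ := h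
  refine ⟨t, ht, !b, ![0, 3, 2, 1] k, ?_⟩
  cases b <;> fin_cases k <;> cases t <;>
    simp [Cell.move, Cell.flip, Cell.turn, Nat.iterate]

/-! ### Views of a configuration -/

/-- A function on the lattice, seen in the frame of a lattice symmetry. -/
def view (g : LatticeIsom) (f : ℤ × ℤ → Cell) (p : ℤ × ℤ) : Cell :=
  Cell.unmove g.flip g.turns (f (g.pos p))

/-- Three turns, because positions are moved forward by the symmetry while tiles are moved back. -/
def turnView (f : ℤ × ℤ → Cell) (p : ℤ × ℤ) : Cell := (f (p.2, -p.1)).turn.turn.turn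
def flipView (f : ℤ × ℤ → Cell) (p : ℤ × ℤ) : Cell := (f (-p.1, p.2)).flip
def shiftView (v : ℤ × ℤ) (f : ℤ × ℤ → Cell) (p : ℤ × ℤ) : Cell := f (p + v)

/-- A property of pairs `(f, Q)` that is preserved by the generators is preserved by all views. -/
theorem view_induction {P : (ℤ × ℤ → Cell) → Set (ℤ × ℤ) → Prop}
    (ht : ∀ f Q, P f Q → P (turnView f) {p | (p.2, -p.1) ∈ Q})
    (hf : ∀ f Q, P f Q → P (flipView f) {p | (-p.1, p.2) ∈ Q})
    (hs : ∀ v f Q, P f Q → P (shiftView v f) {p | p + v ∈ Q})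
    (g : LatticeIsom) {f : ℤ × ℤ → Cell} {Q : Set (ℤ × ℤ)} (h : P f Q) :
    P (view g f) (g.pos ⁻¹' Q) := by
  obtain ⟨b, k, v⟩ := g
  have h0 := hs v f Q h
  have h1 := ht _ _ h0
  have h2 := ht _ _ h1
  have h3 := ht _ _ h2
  cases b <;> fin_cases k
  · convert h0 using 1 <;> ext p <;> simp [view, LatticeIsom.pos, turnView, shiftView,
      flipView, Cell.unmove, Cell.move, Cell.turn, Cell.flip, Nat.iterate]
  · convert h1 using 1 <;> ext p <;> simp [view, LatticeIsom.pos, turnView, shiftView,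
      flipView, Cell.unmove, Cell.move, Cell.turn, Cell.flip, Nat.iterate]
  · convert h2 using 1 <;> ext p <;> simp [view, LatticeIsom.pos, turnView, shiftView,
      flipView, Cell.unmove, Cell.move, Cell.turn, Cell.flip, Nat.iterate]
  · convert h3 using 1 <;> ext p <;> simp [view, LatticeIsom.pos, turnView, shiftView,
      flipView, Cell.unmove, Cell.move, Cell.turn, Cell.flip, Nat.iterate]
  · convert hf _ _ h0 using 1 <;> ext p <;> simp [view, LatticeIsom.pos, turnView, shiftView,
      flipView, Cell.unmove, Cell.move, Cell.turn, Cell.flip, Nat.iterate]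
  · convert hf _ _ h1 using 1 <;> ext p <;> simp [view, LatticeIsom.pos, turnView, shiftView,
      flipView, Cell.unmove, Cell.move, Cell.turn, Cell.flip, Nat.iterate]
  · convert hf _ _ h2 using 1 <;> ext p <;> simp [view, LatticeIsom.pos, turnView, shiftView,
      flipView, Cell.unmove, Cell.move, Cell.turn, Cell.flip, Nat.iterate]
  · convert hf _ _ h3 using 1 <;> ext p <;> simp [view, LatticeIsom.pos, turnView, shiftView,
      flipView, Cell.unmove, Cell.move, Cell.turn, Cell.flip, Nat.iterate]

/-! ### Markings that fit everywhere -/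

/-- Every square is occupied by a copy of a tile of `T`, and the markings match. -/
structure Valid (T : Set Cell) (f : ℤ × ℤ → Cell) : Prop where
  mem : ∀ p, f p ∈ oriented T
  fe : ∀ x y, (f (x + 1, y)).w = (f (x, y)).e.opp
  fn : ∀ x y, (f (x, y + 1)).s = (f (x, y)).n.opp

namespace Valid

variable {T : Set Cell} {f : ℤ × ℤ → Cell} (h : Valid T f)
include h

theorem we {x x' y : ℤ} (e : x' = x + 1) : (f (x', y)).w = (f (x, y)).e.opp := e ▸ h.fe x y

theorem ew {x x' y : ℤ} (e : x' = x + 1) : (f (x, y)).e = (f (x', y)).w.opp := by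
  rw [h.we e, Marking.opp_opp]

theorem sn {x y y' : ℤ} (e : y' = y + 1) : (f (x, y')).s = (f (x, y)).n.opp := e ▸ h.fn x y

theorem ns {x y y' : ℤ} (e : y' = y + 1) : (f (x, y)).n = (f (x, y')).s.opp := by
  rw [h.sn e, Marking.opp_opp]

protected theorem view (g : LatticeIsom) : Valid T (view g f) := by
  refine view_induction (P := fun f _ => Valid T f) (Q := ∅) ?_ ?_ ?_ g h
  · intro f _ h
    refine ⟨fun p => turn_mem_oriented (turn_mem_oriented (turn_mem_oriented (h.mem _))), ?_, ?_⟩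
    · intro x y
      exact h.ns (by ring)
    · intro x y
      exact h.we (by ring)
  · intro f _ h
    refine ⟨fun p => flip_mem_oriented (h.mem _), ?_, ?_⟩
    · intro x y
      exact congrArg Marking.reflect (h.ew (x := -(x + 1)) (x' := -x) (by ring))
    · intro x y
      exact congrArg Marking.reflect (h.sn rfl)
  · intro v f _ h
    refine ⟨fun p => h.mem _, ?_, ?_⟩
    · intro x y
      exact h.we (by simp; ring)
    · intro x y
      exact h.sn (by simp; ring)

end Valid

/-! ### Levels -/

/-- There is an outward tile at each point of `Q` whose markings are transmitted along the axes of
the block of size `2s` around it, and all markings at the boundary of the block are outward. -/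
structure Star (f : ℤ × ℤ → Cell) (s : ℤ) (Q : Set (ℤ × ℤ)) : Prop where
  out : ∀ x y, (x, y) ∈ Q → (f (x, y)).IsOut
  lineE : ∀ x y, (x, y) ∈ Q → ∀ i, 0 ≤ i → i < s → (f (x + i, y)).e = (f (x, y)).e
  lineW : ∀ x y, (x, y) ∈ Q → ∀ i, 0 ≤ i → i < s → (f (x - i, y)).w = (f (x, y)).w
  lineN : ∀ x y, (x, y) ∈ Q → ∀ i, 0 ≤ i → i < s → (f (x, y + i)).n = (f (x, y)).n
  lineS : ∀ x y, (x, y) ∈ Q → ∀ i, 0 ≤ i → i < s → (f (x, y - i)).s = (f (x, y)).s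
  sideE : ∀ x y, (x, y) ∈ Q → ∀ i, -s < i → i < s → (f (x + (s - 1), y + i)).e.out = true
  sideW : ∀ x y, (x, y) ∈ Q → ∀ i, -s < i → i < s → (f (x - (s - 1), y + i)).w.out = true
  sideN : ∀ x y, (x, y) ∈ Q → ∀ i, -s < i → i < s → (f (x + i, y + (s - 1))).n.out = true
  sideS : ∀ x y, (x, y) ∈ Q → ∀ i, -s < i → i < s → (f (x + i, y - (s - 1))).s.out = true

/-- The set `Q` consists of the centres of the blocks of size `2s`: their squares tile the plane. -/
structure Level (f : ℤ × ℤ → Cell) (s : ℤ) (Q : Set (ℤ × ℤ)) : Prop extends Star f s Q where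
  pos : 0 < s
  sep : ∀ x y x' y', (x, y) ∈ Q → (x', y') ∈ Q →
    x < x' + 2 * s → x' < x + 2 * s → y < y' + 2 * s → y' < y + 2 * s → x = x' ∧ y = y'
  cov : ∀ x y, ∃ x' y', (x', y') ∈ Q ∧ x' - s ≤ x ∧ x < x' + s ∧ y' - s ≤ y ∧ y < y' + s

protected theorem Star.view {f : ℤ × ℤ → Cell} {s : ℤ} {Q : Set (ℤ × ℤ)} (h : Star f s Q)
    (g : LatticeIsom) : Star (view g f) s (g.pos ⁻¹' Q) := by
  refine view_induction (P := fun f Q => Star f s Q) ?_ ?_ ?_ g h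
  · intro f Q h
    refine ⟨?_, ?_, ?_, ?_, ?_, ?_, ?_, ?_, ?_⟩
    · intro x y hq
      obtain ⟨a, b, c, d⟩ := h.out _ _ hq
      exact ⟨b, c, d, a⟩
    · intro x y hq i a b
      simpa [turnView, Cell.turn, sub_eq_add_neg, add_comm] using h.lineS _ _ hq i a b
    · intro x y hq i a b
      simpa [turnView, Cell.turn, sub_eq_add_neg, add_comm] using h.lineN _ _ hq i a b
    · intro x y hq i a b
      simpa [turnView, Cell.turn] using h.lineE _ _ hq i a b
    · intro x y hq i a b
      simpa [turnView, Cell.turn] using h.lineW _ _ hq i a b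
    · intro x y hq i a b
      have := h.sideS _ _ hq i a b
      simp only [turnView, Cell.turn]
      convert this using 5
      dsimp only
      ring
    · intro x y hq i a b
      have := h.sideN _ _ hq i a b
      simp only [turnView, Cell.turn]
      convert this using 5
      dsimp only
      ring
    · intro x y hq i a b
      have := h.sideE _ _ hq (-i) (by omega) (by omega)
      simp only [turnView, Cell.turn]
      convert this using 5
      dsimp only
      ring
    · intro x y hq i a b
      have := h.sideW _ _ hq (-i) (by omega) (by omega)
      simp only [turnView, Cell.turn]
      convert this using 5
      dsimp only
      ring
  · intro f Q h
    refine ⟨?_, ?_, ?_, ?_, ?_, ?_, ?_, ?_, ?_⟩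
    · intro x y hq
      obtain ⟨a, b, c, d⟩ := h.out _ _ hq
      exact ⟨a, d, c, b⟩
    · intro x y hq i a b
      have := h.lineW _ _ hq i a b
      simp only [flipView, Cell.flip]
      rw [← this]
      congr 4
      dsimp only
      ring
    · intro x y hq i a b
      have := h.lineE _ _ hq i a b
      simp only [flipView, Cell.flip]
      rw [← this]
      congr 4
      dsimp only
      ring
    · intro x y hq i a b
      exact congrArg Marking.reflect (h.lineN _ _ hq i a b)
    · intro x y hq i a b
      exact congrArg Marking.reflect (h.lineS _ _ hq i a b)
    · intro x y hq i a b
      have := h.sideW _ _ hq i a b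
      simp only [flipView, Cell.flip, Marking.reflect]
      convert this using 5
      dsimp only
      ring
    · intro x y hq i a b
      have := h.sideE _ _ hq i a b
      simp only [flipView, Cell.flip, Marking.reflect]
      convert this using 5
      dsimp only
      ring
    · intro x y hq i a b
      have := h.sideN _ _ hq (-i) (by omega) (by omega)
      simp only [flipView, Cell.flip, Marking.reflect]
      convert this using 5
      dsimp only
      ring
    · intro x y hq i a b
      have := h.sideS _ _ hq (-i) (by omega) (by omega)
      simp only [flipView, Cell.flip, Marking.reflect]
      convert this using 5
      dsimp only
      ring
  · intro v f Q h
    obtain ⟨u, v⟩ := v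
    refine ⟨?_, ?_, ?_, ?_, ?_, ?_, ?_, ?_, ?_⟩
    · intro x y hq
      exact h.out _ _ hq
    all_goals
      intro x y hq i a b
      first
        | have := h.lineE _ _ hq i a b
          simp only [shiftView, Prod.mk_add_mk] at this ⊢
          rw [← this]; congr 3; ring1
        | have := h.lineW _ _ hq i a b
          simp only [shiftView, Prod.mk_add_mk] at this ⊢
          rw [← this]; congr 3; ring1
        | have := h.lineN _ _ hq i a b
          simp only [shiftView, Prod.mk_add_mk] at this ⊢
          rw [← this]; congr 3; ring1
        | have := h.lineS _ _ hq i a b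
          simp only [shiftView, Prod.mk_add_mk] at this ⊢
          rw [← this]; congr 3; ring1
        | have := h.sideE _ _ hq i a b
          simp only [shiftView, Prod.mk_add_mk] at this ⊢
          rw [← this]; congr 4 <;> ring1
        | have := h.sideW _ _ hq i a b
          simp only [shiftView, Prod.mk_add_mk] at this ⊢
          rw [← this]; congr 4 <;> ring1
        | have := h.sideN _ _ hq i a b
          simp only [shiftView, Prod.mk_add_mk] at this ⊢
          rw [← this]; congr 4 <;> ring1
        | have := h.sideS _ _ hq i a b
          simp only [shiftView, Prod.mk_add_mk] at this ⊢
          rw [← this]; congr 4 <;> ring1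

protected theorem Level.view {f : ℤ × ℤ → Cell} {s : ℤ} {Q : Set (ℤ × ℤ)} (h : Level f s Q)
    (g : LatticeIsom) : Level (view g f) s (g.pos ⁻¹' Q) := by
  suffices (∀ x y x' y', (x, y) ∈ g.pos ⁻¹' Q → (x', y') ∈ g.pos ⁻¹' Q →
      x < x' + 2 * s → x' < x + 2 * s → y < y' + 2 * s → y' < y + 2 * s → x = x' ∧ y = y') ∧
      ∀ x y, ∃ x' y', (x', y') ∈ g.pos ⁻¹' Q ∧ x' - s ≤ x ∧ x < x' + s ∧ y' - s ≤ y ∧ y < y' + s from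
    ⟨h.toStar.view g, h.pos, this.1, this.2⟩
  refine view_induction (P := fun _ Q => (∀ x y x' y', (x, y) ∈ Q → (x', y') ∈ Q →
      x < x' + 2 * s → x' < x + 2 * s → y < y' + 2 * s → y' < y + 2 * s → x = x' ∧ y = y') ∧
      ∀ x y, ∃ x' y', (x', y') ∈ Q ∧ x' - s ≤ x ∧ x < x' + s ∧ y' - s ≤ y ∧ y < y' + s)
      ?_ ?_ ?_ g (f := f) ⟨h.sep, h.cov⟩
  · intro f Q h
    constructor
    · intro x y x' y' h1 h2 a b c d
      have := h.1 _ _ _ _ h1 h2 (by simpa using c) (by simpa using d) (by simp; omega)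
        (by simp; omega)
      simp only [neg_inj] at this
      exact this.symm
    · intro x y
      -- The covering intervals are half open, so a coordinate whose sign changes must also be
      -- shifted by one.
      obtain ⟨x', y', hq, a, b, c, d⟩ := h.2 y (-x - 1)
      exact ⟨-y', x', by simpa using hq, by omega, by omega, a, b⟩
  · intro f Q h
    constructor
    · intro x y x' y' h1 h2 a b c d
      have := h.1 _ _ _ _ h1 h2 (by simp; omega) (by simp; omega) (by simpa using c)
        (by simpa using d)
      simpa using this
    · intro x y
      obtain ⟨x', y', hq, a, b, c, d⟩ := h.2 (-x - 1) y
      exact ⟨-x', y', by simpa using hq, by omega, by omega, c, d⟩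
  · intro v f Q h
    obtain ⟨u, v⟩ := v
    constructor
    · intro x y x' y' h1 h2 a b c d
      have := h.1 _ _ _ _ h1 h2 (by simp; omega) (by simp; omega) (by simp; omega)
        (by simp; omega)
      simpa using this
    · intro x y
      obtain ⟨x', y', hq, a, b, c, d⟩ := h.2 (x + u) (y + v)
      exact ⟨x' - u, y' - v, by simpa using hq, by omega, by omega, by omega, by omega⟩

/-! ### Facts about single tiles -/

/-- With west and east both inward, the single outward edge of a crossing tile is the north or the
south one. So west and east carry the pair named by `h`, and the pair named by `v` runs through
vertically. This and the similar facts below are finite checks over all copies of the tiles. -/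
theorem Cell.through_ew : ∀ c ∈ copies tileList, c.w.out = false → c.e.out = false →
    c.e = c.w.mate ∧ c.s = c.n.opp := by decide +kernel

theorem Cell.through_ns : ∀ c ∈ copies tileList, c.n.out = false → c.s.out = false →
    c.s = c.n.mate ∧ c.e = c.w.opp := by decide +kernel

theorem Cell.isOut_of_ew : ∀ c ∈ copies tileList, c.w.out = true → c.e.out = true → c.IsOut := by
  decide +kernel

theorem Cell.in_of_n : ∀ c ∈ copies tileList, ¬ c.IsOut → c.n.out = true →
    c.s.out = false ∧ c.e.out = false ∧ c.w.out = false := by decide +kernel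

theorem Cell.in_of_s : ∀ c ∈ copies tileList, ¬ c.IsOut → c.s.out = true →
    c.n.out = false ∧ c.e.out = false ∧ c.w.out = false := by decide +kernel

/-- Except in channel `3`, where both `[3v]` and `[-3v]` exist, a signed marking shows by its
sidedness which way the arrow crossing it runs. The exclusion of faults rests on this. -/
theorem Cell.side_w_of_n : ∀ c ∈ copies tileList, ¬ c.IsOut → c.n.out = true → c.w.chan ≠ 3 →
    c.w.side ≠ 1 := by decide +kernel

theorem Cell.side_w_of_s : ∀ c ∈ copies tileList, ¬ c.IsOut → c.s.out = true → c.w.chan ≠ 3 →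
    c.w.side ≠ -1 := by decide +kernel

theorem Cell.cases_of_isOut : ∀ c ∈ copies tileList, c.IsOut →
    ∃ b, ∃ k, c = Cell.move b k (tileA c.cornered) ∨ c = Cell.move b k (tileB c.cornered) := by
  decide +kernel

/-- The markings of outward tiles with a marking in channel `0` or `1` on the east edge. -/
theorem Cell.tileA_east : ∀ c ∈ copies tileList, c.IsOut →
    (c.e = ⟨true, 1, 0⟩ → c.s = ⟨true, -1, 1⟩ ∧ c.n = plainOut ∧ c.w = plainOut) ∧
    (c.e = ⟨true, 1, 1⟩ → (c.s = ⟨true, -1, 0⟩ ∧ c.n = plainOut ∧ c.w = plainOut)) := by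
  decide +kernel

theorem Cell.tileA_north : ∀ c ∈ copies tileList, c.IsOut →
    (c.n = ⟨true, 1, 0⟩ → c.e = ⟨true, -1, 1⟩) ∧ (c.n = ⟨true, 1, 1⟩ → c.e = ⟨true, -1, 0⟩) := by
  decide +kernel

theorem Cell.tileB_north : ∀ c ∈ copies tileList, c.IsOut →
    (c.n = ⟨true, 1, 2⟩ → c.s = ⟨true, -1, 3⟩) ∧ (c.n = ⟨true, 1, 3⟩ → c.s = ⟨true, -1, 2⟩) := by
  decide +kernel

theorem Marking.mate_mate (m : Marking) : m.mate.mate = m := by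
  obtain ⟨o, s, c⟩ := m
  fin_cases c <;> simp [Marking.mate]

theorem Marking.opp_mate_opp (m : Marking) : m.opp.mate.opp = m.mate := by
  simp [Marking.opp, Marking.mate]

theorem Marking.opp_injective {m m' : Marking} (h : m.opp = m'.opp) : m = m' := by
  rw [← m.opp_opp, h, m'.opp_opp]

section
variable {f : ℤ × ℤ → Cell} {s : ℤ} {Q : Set (ℤ × ℤ)}

theorem Valid.mem_copies (hv : Valid tiles1 f) (p : ℤ × ℤ) : f p ∈ copies tileList :=
  mem_copies_of_oriented (hv.mem p)

/-! ### Links between aligned blocks -/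

namespace Level
variable (hv : Valid tiles1 f) (h : Level f s Q)
include hv h

/-- The markings at the end of the eastern line of a block. -/
theorem endE {x y : ℤ} (hq : (x, y) ∈ Q) : (f (x + s, y)).w = (f (x, y)).e.opp := by
  rw [hv.we (x := x + (s - 1)) (by ring), h.lineE x y hq (s - 1) (by have := h.pos; omega) (by omega)]

theorem endW {x y : ℤ} (hq : (x, y) ∈ Q) : (f (x - s, y)).e = (f (x, y)).w.opp := by
  rw [hv.ew (x' := x - (s - 1)) (by ring), h.lineW x y hq (s - 1) (by have := h.pos; omega) (by omega)]

theorem endN {x y : ℤ} (hq : (x, y) ∈ Q) : (f (x, y + s)).s = (f (x, y)).n.opp := by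
  rw [hv.sn (y := y + (s - 1)) (by ring), h.lineN x y hq (s - 1) (by have := h.pos; omega) (by omega)]

theorem endS {x y : ℤ} (hq : (x, y) ∈ Q) : (f (x, y - s)).n = (f (x, y)).s.opp := by
  rw [hv.ns (y' := y - (s - 1)) (by ring), h.lineS x y hq (s - 1) (by have := h.pos; omega) (by omega)]

/-- Markings that meet from west and east. -/
theorem meet_ew {x y x' : ℤ} (hq : (x, y) ∈ Q) (he : (f (x + s, y)).e = (f (x', y)).w.opp)
    (ho : (f (x', y)).w.out = true) : (f (x', y)).w = (f (x, y)).e.mate := by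
  have h1 := h.endE hv hq
  have := (Cell.through_ew _ (hv.mem_copies (x + s, y)) (by rw [h1]; simp [(h.out _ _ hq).2.1])
    (by rw [he]; simp [ho])).1
  rw [he, h1] at this
  rw [← Marking.opp_mate_opp, ← this, Marking.opp_opp]

/-- The lines of two aligned neighbours end at opposite edges of the same square, which must hold a
crossing tile. -/
theorem linkE {x x' y : ℤ} (hq : (x, y) ∈ Q) (hq' : (x', y) ∈ Q) (e : x' = x + 2 * s) :
    (f (x', y)).w = (f (x, y)).e.mate := by
  refine h.meet_ew hv hq ?_ (h.out _ _ hq').2.2.2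
  rw [← h.endW hv hq', e]
  congr 3
  ring

theorem linkS {x y y' : ℤ} (hq : (x, y) ∈ Q) (hq' : (x, y') ∈ Q) (e : y' = y - 2 * s) :
    (f (x, y')).n = (f (x, y)).s.mate := by
  have h1 := h.endS hv hq
  have h2 := h.endN hv hq'
  rw [show y' + s = y - s by omega] at h2
  have := (Cell.through_ns _ (hv.mem_copies (x, y - s)) (by rw [h1]; simp [(h.out _ _ hq).2.2.1])
    (by rw [h2]; simp [(h.out _ _ hq').1])).1
  rw [h1, h2] at this
  rw [← Marking.opp_mate_opp, ← this, Marking.opp_opp]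

end Level

/-! ### Faults -/

/-- The column of blocks through the origin is shifted by `a` against the column to the east. -/
structure Fault (f : ℤ × ℤ → Cell) (s : ℤ) (Q : Set (ℤ × ℤ)) (a : ℤ) : Prop where
  level : Level f s Q
  pos : 0 < a
  lt : a < 2 * s
  left : ∀ j, (0, 2 * s * j) ∈ Q
  right : ∀ j, (2 * s, a + 2 * s * j) ∈ Q

theorem exists_near {s : ℤ} (hs : 0 < s) (k : ℤ) : ∃ j i, k = 2 * s * j + i ∧ -s ≤ i ∧ i < s :=
  ⟨(k + s) / (2 * s), (k + s) % (2 * s) - s, by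
    have := Int.mul_ediv_add_emod (k + s) (2 * s); omega, by
    have := Int.emod_nonneg (k + s) (b := 2 * s) (by omega); omega, by
    have := Int.emod_lt_of_pos (k + s) (b := 2 * s) (by omega); omega⟩

/-- The block that covers the point just beyond the eastern side at height `k` would overlap the
given block if its centre were further west. -/
theorem Level.neighbour_east (h : Level f s Q) {x y : ℤ} (h0 : (x, y) ∈ Q) {k : ℤ} (h1 : y - s ≤ k)
    (h2 : k < y + s) : ∃ y', (x + 2 * s, y') ∈ Q ∧ y' - s ≤ k ∧ k < y' + s := by
  obtain ⟨x', y', hq, a, b, c, d⟩ := h.cov (x + s) k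
  rcases lt_or_ge x' (x + 2 * s) with hx | hx
  · have := h.sep _ _ _ _ h0 hq (by omega) (by omega) (by omega) (by omega)
    omega
  · obtain rfl : x' = x + 2 * s := by omega
    exact ⟨y', hq, c, d⟩

theorem Level.neighbour_north (h : Level f s Q) {x y : ℤ} (h0 : (x, y) ∈ Q) {k : ℤ} (h1 : x - s ≤ k)
    (h2 : k < x + s) : ∃ x', (x', y + 2 * s) ∈ Q ∧ x' - s ≤ k ∧ k < x' + s := by
  obtain ⟨x', y', hq, a, b, c, d⟩ := h.cov k (y + s)
  rcases lt_or_ge y' (y + 2 * s) with hx | hx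
  · have := h.sep _ _ _ _ h0 hq (by omega) (by omega) (by omega) (by omega)
    omega
  · obtain rfl : y' = y + 2 * s := by omega
    exact ⟨x', hq, a, b⟩

theorem Level.neighbour_south (h : Level f s Q) {x y : ℤ} (h0 : (x, y) ∈ Q) {k : ℤ} (h1 : x - s ≤ k)
    (h2 : k < x + s) : ∃ x', (x', y - 2 * s) ∈ Q ∧ x' - s ≤ k ∧ k < x' + s := by
  obtain ⟨x', y', hq, a, b, c, d⟩ := h.cov k (y - s - 1)
  rcases lt_or_ge (y - 2 * s) y' with hx | hx
  · have := h.sep _ _ _ _ h0 hq (by omega) (by omega) (by omega) (by omega)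
    omega
  · obtain rfl : y' = y - 2 * s := by omega
    exact ⟨x', hq, a, b⟩

/-- The two columns along a fault continue. -/
theorem Level.fault_step (h : Level f s Q) {x y a : ℤ} (h0 : (x, y) ∈ Q)
    (h1 : (x + 2 * s, y + a) ∈ Q) (ha : 0 < a) (ha' : a < 2 * s) :
    ((x, y + 2 * s) ∈ Q ∧ (x + 2 * s, y + a + 2 * s) ∈ Q) ∧
    ((x, y - 2 * s) ∈ Q ∧ (x + 2 * s, y + a - 2 * s) ∈ Q) := by
  have hs := h.pos
  constructor
  · have h2 : (x, y + 2 * s) ∈ Q := by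
      -- This is the last column before the fault: the block found cannot lie further west than `x`,
      -- and if it lay further east it would run into the eastern column.
      obtain ⟨x', hq, b, c⟩ := h.neighbour_north h0 (k := x + s - 1) (by omega) (by omega)
      rcases eq_or_ne x' x with rfl | hne
      · exact hq
      · have := h.sep _ _ _ _ h1 hq (by omega) (by omega) (by omega) (by omega)
        omega
    refine ⟨h2, ?_⟩
    obtain ⟨x', hq, b, c⟩ := h.neighbour_north h1 (k := x + s) (by omega) (by omega)
    rcases eq_or_ne x' (x + 2 * s) with rfl | hne
    · exact hq
    · have := h.sep _ _ _ _ h2 hq (by omega) (by omega) (by omega) (by omega)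
      omega
  · have h2 : (x + 2 * s, y + a - 2 * s) ∈ Q := by
      obtain ⟨x', hq, b, c⟩ := h.neighbour_south h1 (k := x + s) (by omega) (by omega)
      rcases eq_or_ne x' (x + 2 * s) with rfl | hne
      · exact hq
      · have := h.sep _ _ _ _ h0 hq (by omega) (by omega) (by omega) (by omega)
        omega
    refine ⟨?_, h2⟩
    obtain ⟨x', hq, b, c⟩ := h.neighbour_south h0 (k := x + s - 1) (by omega) (by omega)
    rcases eq_or_ne x' x with rfl | hne
    · exact hq
    · have := h.sep _ _ _ _ h2 hq (by omega) (by omega) (by omega) (by omega)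
      omega

theorem Level.fault_of_mem (h : Level f s Q) {a : ℤ} (h0 : (0, 0) ∈ Q) (h1 : (2 * s, a) ∈ Q)
    (ha : 0 < a) (ha' : a < 2 * s) : Fault f s Q a := by
  have key : ∀ j : ℤ, (0, 2 * s * j) ∈ Q ∧ (2 * s, a + 2 * s * j) ∈ Q := by
    intro j
    induction j using Int.induction_on with
    | zero => simpa using ⟨h0, h1⟩
    | succ i ih =>
      have := (h.fault_step (x := 0) (a := a) ih.1
        (by rw [zero_add, add_comm]; exact ih.2) ha ha').1
      constructor
      · convert this.1 using 2; ring
      · convert this.2 using 2 <;> ring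
    | pred i ih =>
      have := (h.fault_step (x := 0) (a := a) ih.1
        (by rw [zero_add, add_comm]; exact ih.2) ha ha').2
      constructor
      · convert this.1 using 2; ring
      · convert this.2 using 2 <;> ring
  exact ⟨h, ha, ha', fun j => (key j).1, fun j => (key j).2⟩

theorem Level.exists_fault (h : Level f s Q) (h0 : (0, 0) ∈ Q) (h1 : (2 * s, 0) ∉ Q) :
    ∃ a, Fault f s Q a := by
  have hs := h.pos
  -- Taking the topmost position on the side normalizes the shift to `0 ≤ a < 2 * s`.
  obtain ⟨a, hq, b, c⟩ := h.neighbour_east h0 (k := s - 1) (by omega) (by omega)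
  rw [zero_add] at hq
  have : a ≠ 0 := by rintro rfl; exact h1 hq
  exact ⟨a, h.fault_of_mem h0 hq (by omega) (by omega)⟩

namespace Fault
variable {a : ℤ} (hv : Valid tiles1 f) (h : Fault f s Q a)
include hv h

theorem w_in (j : ℤ) {i : ℤ} (h1 : -s < i) (h2 : i < s) :
    (f (s, 2 * s * j + i)).w.out = false := by
  have := h.level.sideE _ _ (h.left j) i h1 h2
  rw [hv.we (x := 0 + (s - 1)) (by ring)]
  simpa using this

theorem e_in (j : ℤ) {i : ℤ} (h1 : -s < i) (h2 : i < s) :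
    (f (s, a + 2 * s * j + i)).e.out = false := by
  have := h.level.sideW _ _ (h.right j) i h1 h2
  rw [hv.ew (x' := 2 * s - (s - 1)) (by ring)]
  simp [this]

/-- A square of the fault line escapes an inward marking only if it lies at a joint between blocks
on both sides; then `a` would be a multiple of `2 * s`. -/
theorem not_isOut (k : ℤ) : ¬ (f (s, k)).IsOut := by
  have hs := h.level.pos
  rintro ⟨-, he, -, hw⟩
  obtain ⟨j, i, hk, h1, h2⟩ := exists_near hs k
  obtain ⟨j', i', hk', h1', h2'⟩ := exists_near hs (k - a)
  rcases eq_or_lt_of_le h1 with rfl | h1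
  · rcases eq_or_lt_of_le h1' with rfl | h1'
    · have e : a = 2 * s * (j - j') := by linarith
      have := h.pos
      have := h.lt
      have h3 : 0 < j - j' := by
        by_contra hc
        nlinarith
      nlinarith
    · have := h.e_in hv j' h1' h2'
      rw [show a + 2 * s * j' + i' = k by omega, he] at this
      cases this
  · have := h.w_in hv j h1 h2
    rw [← hk, hw] at this
    cases this

/-- Above a square of the fault whose northern marking is inward, the line leads downward. -/
theorem down {k : ℤ} (hn : (f (s, k)).n.out = false) {k' : ℤ} (hk : k < k') :
    (f (s, k')).s.out = true ∧ (f (s, k')).n.out = false := by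
  induction k', Int.add_one_le_of_lt hk using Int.leInduction with
  | base =>
    have : (f (s, k + 1)).s.out = true := by rw [hv.fn]; simp [hn]
    exact ⟨this, (Cell.in_of_s _ (hv.mem_copies _) (h.not_isOut hv _) this).1⟩
  | succ m hm ih =>
    have : (f (s, m + 1)).s.out = true := by rw [hv.fn]; simp [(ih (by omega)).2]
    exact ⟨this, (Cell.in_of_s _ (hv.mem_copies _) (h.not_isOut hv _) this).1⟩

/-- By contraposition from `down`: a line leading downward below `k` would have to lead downward at
`k` as well. -/
theorem up {k : ℤ} (hn : (f (s, k)).s.out = false) {k' : ℤ} (hk : k' < k) :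
    (f (s, k')).n.out = true ∧ (f (s, k')).s.out = false := by
  by_contra hc
  have hn' : (f (s, k')).n.out = false := by
    by_contra hn'
    have hn' : (f (s, k')).n.out = true := by simpa using hn'
    exact hc ⟨hn', (Cell.in_of_n _ (hv.mem_copies _) (h.not_isOut hv _) hn').1⟩
  have := (h.down hv hn' hk).1
  rw [hn] at this
  cases this

/-- Either all arrows on the fault lead upward, or from some square on they lead downward. In both
cases the only outward edge of each crossing tile high up lies along the fault. -/
theorem exists_bound : ∃ K, ∀ k, K < k →
    (f (s, k)).w.out = false ∧ (f (s, k)).e.out = false := by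
  by_cases hx : ∃ k, (f (s, k)).n.out = false
  · obtain ⟨K, hK⟩ := hx
    refine ⟨K, fun k hk => ?_⟩
    have := Cell.in_of_s _ (hv.mem_copies _) (h.not_isOut hv k) (h.down hv hK hk).1
    exact ⟨this.2.2, this.2.1⟩
  · refine ⟨0, fun k _ => ?_⟩
    have h1 : (f (s, k)).n.out = true := by
      by_contra hc
      exact hx ⟨k, by simpa using hc⟩
    have := Cell.in_of_n _ (hv.mem_copies _) (h.not_isOut hv k) h1
    exact ⟨this.2.2, this.2.1⟩

/-- A marking in channels `0`, `1`, `2` that arrives at the fault from the west. -/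
theorem side_of_up {k : ℤ} (hn : (f (s, k)).n.out = true) {m : Marking} (hm : (f (s, k)).w = m.opp)
    (hc : m.chan ≠ 3) : m.side ≠ -1 := by
  have := Cell.side_w_of_n _ (hv.mem_copies _) (h.not_isOut hv k) hn (by rw [hm]; exact hc)
  rw [hm] at this
  intro e
  exact this (by simp [Marking.opp, e])

theorem side_of_down {k : ℤ} (hn : (f (s, k)).s.out = true) {m : Marking}
    (hm : (f (s, k)).w = m.opp) (hc : m.chan ≠ 3) : m.side ≠ 1 := by
  have := Cell.side_w_of_s _ (hv.mem_copies _) (h.not_isOut hv k) hn (by rw [hm]; exact hc)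
  rw [hm] at this
  intro e
  exact this (by simp [Marking.opp, e])

end Fault

/-- A signed edge of a tile with channels `0` and `1` does not lead to a fault. -/
theorem Level.aligned_of_tileA_south (hv : Valid tiles1 f) (h : Level f s Q) (h0 : (0, 0) ∈ Q)
    (he : (f (0, 0)).e = ⟨true, 1, 0⟩ ∨ (f (0, 0)).e = ⟨true, 1, 1⟩) : (2 * s, 0) ∈ Q := by
  by_contra hc
  obtain ⟨a, hf⟩ := h.exists_fault h0 hc
  have hs := h.pos
  have ho := h.out _ _ h0
  have hw : (f (s, 0)).w = (f (0, 0)).e.opp := by simpa using h.endE hv h0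
  have hsn : (f (s, 0)).s.out = false := by
    by_contra hcon
    refine hf.side_of_down hv (k := 0) (by simpa using hcon) hw ?_ ?_
    · rcases he with he | he <;> rw [he] <;> decide
    · rcases he with he | he <;> rw [he]
  have q : ∀ j : ℤ, (0, 2 * s * j) ∈ Q := hf.left
  have fin : ∀ j : ℤ, j < 0 → (f (0, 2 * s * j)).e = ⟨true, -1, 0⟩ ∨
      (f (0, 2 * s * j)).e = ⟨true, -1, 1⟩ → False := by
    intro j hj he'
    have hw : (f (s, 2 * s * j)).w = (f (0, 2 * s * j)).e.opp := by
      simpa using h.endE hv (q j)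
    have := (hf.up hv hsn (k' := 2 * s * j) (by nlinarith)).1
    refine hf.side_of_up hv this hw ?_ ?_
    · rcases he' with he | he <;> rw [he] <;> decide
    · rcases he' with he | he <;> rw [he]
  have l1 := h.linkS hv h0 (q (-1)) (by ring)
  have l2 := h.linkS hv (q (-1)) (q (-2)) (by ring)
  have l3 := h.linkS hv (q (-2)) (q (-3)) (by ring)
  have f0 := Cell.tileA_east _ (hv.mem_copies _) ho
  have o1 := h.out _ _ (q (-1))
  have o2 := h.out _ _ (q (-2))
  have o3 := h.out _ _ (q (-3))
  -- Going down the column, channel `0` leads through the tiles `A, B, B, A` and channel `1` through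
  -- `A, A`. Either way the last copy of `tileA` has an east marking of the opposite sign, which the
  -- upward arrow forbids.
  rcases he with he | he
  · rw [(f0.1 he).1] at l1
    rw [(Cell.tileB_north _ (hv.mem_copies _) o1).1 l1] at l2
    rw [(Cell.tileB_north _ (hv.mem_copies _) o2).2 l2] at l3
    exact fin (-3) (by norm_num) (Or.inl ((Cell.tileA_north _ (hv.mem_copies _) o3).2 l3))
  · rw [(f0.2 he).1] at l1
    exact fin (-1) (by norm_num) (Or.inr ((Cell.tileA_north _ (hv.mem_copies _) o1).1 l1))

end

section
variable {f : ℤ × ℤ → Cell} {s : ℤ} {Q : Set (ℤ × ℤ)}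

/-! ### Rows and columns that transmit markings -/

/-- Each tile in between has inward markings to the north and south, hence transmits the horizontal
marking by `Cell.through_ns`. -/
theorem Valid.row_const (hv : Valid tiles1 f) {x₀ x₁ k : ℤ} (hx : x₀ < x₁)
    (h : ∀ x, x₀ < x → x < x₁ → (f (x, k)).n.out = false ∧ (f (x, k)).s.out = false) :
    (f (x₀, k)).e = (f (x₁, k)).w.opp := by
  induction x₁, Int.add_one_le_of_lt hx using Int.leInduction with
  | base => exact hv.ew rfl
  | succ m hm ih =>
    rw [ih (by omega) fun x h1 h2 => h x h1 (by omega), ← hv.ew rfl]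
    have := h m (by omega) (by omega)
    rw [(Cell.through_ns _ (hv.mem_copies _) this.1 this.2).2]

theorem Valid.column_const (hv : Valid tiles1 f) {y₀ y₁ k : ℤ} (hy : y₀ < y₁)
    (h : ∀ y, y₀ < y → y < y₁ → (f (k, y)).w.out = false ∧ (f (k, y)).e.out = false) :
    (f (k, y₀)).n = (f (k, y₁)).s.opp := by
  induction y₁, Int.add_one_le_of_lt hy using Int.leInduction with
  | base => exact hv.ns rfl
  | succ m hm ih =>
    rw [ih (by omega) fun x h1 h2 => h x h1 (by omega), ← hv.ns rfl]
    have := h m (by omega) (by omega)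
    rw [(Cell.through_ew _ (hv.mem_copies _) this.1 this.2).2, Marking.opp_opp]

namespace Level

theorem between_ns (hv : Valid tiles1 f) (h : Level f s Q) {x y : ℤ} (h0 : (x, y) ∈ Q)
    (h1 : (x, y + 2 * s) ∈ Q) {i : ℤ} (hi : -s < i) (hi' : i < s) :
    (f (x + i, y + s)).n.out = false ∧ (f (x + i, y + s)).s.out = false := by
  have a := h.sideN _ _ h0 i hi hi'
  have b := h.sideS _ _ h1 i hi hi'
  rw [hv.ns (y := y + s) (y' := y + 2 * s - (s - 1)) (by ring),
    hv.sn (y' := y + s) (y := y + (s - 1)) (by ring)]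
  simp [a, b]

theorem between_ew (hv : Valid tiles1 f) (h : Level f s Q) {x y : ℤ} (h0 : (x, y) ∈ Q)
    (h1 : (x + 2 * s, y) ∈ Q) {i : ℤ} (hi : -s < i) (hi' : i < s) :
    (f (x + s, y + i)).w.out = false ∧ (f (x + s, y + i)).e.out = false := by
  have a := h.sideE _ _ h0 i hi hi'
  have b := h.sideW _ _ h1 i hi hi'
  rw [hv.ew (x' := x + 2 * s - (s - 1)) (by ring), hv.we (x := x + (s - 1)) (by ring)]
  simp [a, b]

theorem row_between (hv : Valid tiles1 f) (h : Level f s Q) {x y : ℤ} (h0 : (x, y) ∈ Q)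
    (h1 : (x, y + 2 * s) ∈ Q) : (f (x - s, y + s)).e = (f (x + s, y + s)).w.opp := by
  have := h.pos
  refine hv.row_const (by omega) fun x' a b => ?_
  have := h.between_ns hv h0 h1 (i := x' - x) (by omega) (by omega)
  simpa using this

theorem column_between (hv : Valid tiles1 f) (h : Level f s Q) {x y : ℤ} (h0 : (x, y) ∈ Q)
    (h1 : (x + 2 * s, y) ∈ Q) : (f (x + s, y - s)).n = (f (x + s, y + s)).s.opp := by
  have := h.pos
  refine hv.column_const (by omega) fun y' a b => ?_
  have := h.between_ew hv h0 h1 (i := y' - y) (by omega) (by omega)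
  simpa using this

/-- To the west of a straight column of blocks there is another one. -/
theorem column_west (h : Level f s Q) {x : ℤ} (h0 : ∀ j, (x, 2 * s * j) ∈ Q) :
    ∃ a, 0 ≤ a ∧ a < 2 * s ∧ ∀ j, (x - 2 * s, a + 2 * s * j) ∈ Q := by
  have hs := h.pos
  have west : ∀ k, ∃ y', (x - 2 * s, y') ∈ Q ∧ y' - s ≤ k ∧ k < y' + s := by
    intro k
    obtain ⟨x', y', hq, a, b, c, d⟩ := h.cov (x - s - 1) k
    obtain ⟨j, i, hk, h1, h2⟩ := exists_near hs k
    rcases lt_or_ge (x - 2 * s) x' with hx | hx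
    · have := h.sep _ _ _ _ (h0 j) hq (by omega) (by omega) (by omega) (by omega)
      omega
    · obtain rfl : x' = x - 2 * s := by omega
      exact ⟨y', hq, c, d⟩
  obtain ⟨a, ha, ha1, ha2⟩ := west (s - 1)
  have key : ∀ j : ℤ, (x - 2 * s, a + 2 * s * j) ∈ Q := by
    intro j
    induction j using Int.induction_on with
    | zero => simpa using ha
    | succ i ih =>
      obtain ⟨y, hy, h1, h2⟩ := west (a + 2 * s * i + s)
      obtain rfl : y = a + 2 * s * (i + 1) := by
        have e : a + 2 * s * (i + 1) = a + 2 * s * i + 2 * s := by ring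
        rw [e]
        by_contra hne
        have := h.sep _ _ _ _ ih hy (by omega) (by omega) (by omega) (by omega)
        omega
      exact hy
    | pred i ih =>
      obtain ⟨y, hy, h1, h2⟩ := west (a + 2 * s * (-i) - s - 1)
      obtain rfl : y = a + 2 * s * (-i - 1) := by
        have e : a + 2 * s * (-i - 1) = a + 2 * s * (-i) - 2 * s := by ring
        rw [e]
        by_contra hne
        have := h.sep _ _ _ _ ih hy (by omega) (by omega) (by omega) (by omega)
        omega
      exact hy
  exact ⟨a, by omega, by omega, key⟩

end Level

theorem view_mirrorX (u v x y : ℤ) : view ⟨true, 0, (u, v)⟩ f (x, y) = (f (-x + u, y + v)).flip := by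
  simp [view, LatticeIsom.pos, Cell.unmove, Cell.move]

theorem mem_mirrorX (u v x y : ℤ) :
    (x, y) ∈ (LatticeIsom.pos ⟨true, 0, (u, v)⟩) ⁻¹' Q ↔ (-x + u, y + v) ∈ Q := by
  simp [LatticeIsom.pos]

theorem exists_lt_mul {s : ℤ} (hs : 0 < s) (K : ℤ) : ∃ j, K < 2 * s * j :=
  ⟨|K| + 1, by nlinarith [le_abs_self K, abs_nonneg K]⟩

/-- Two faults are not next to each other, nor at distance `4s`. -/
theorem Fault.aligned_west (hv : Valid tiles1 f) {a : ℤ} (h : Fault f s Q a) :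
    (∀ j, (-2 * s, 2 * s * j) ∈ Q) ∧ ∀ j, (-4 * s, 2 * s * j) ∈ Q := by
  have hs := h.level.pos
  obtain ⟨K, hK⟩ := h.exists_bound hv
  -- High up the fault receives an arrow from the west at every joint of column `0`, and the row
  -- between two blocks carries it back to the column `-s`.
  have hE : ∀ j : ℤ, K < 2 * s * j → (f (-s, 2 * s * j + s)).e.out = true := by
    intro j hj
    have := h.level.row_between hv (h.left j) (by convert h.left (j + 1) using 2; ring)
    rw [zero_sub, zero_add] at this
    rw [this]
    simp [(hK (2 * s * j + s) (by omega)).1]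
  have h1 : ∀ j, (-2 * s, 2 * s * j) ∈ Q := by
    obtain ⟨b, hb, hb', hc⟩ := h.level.column_west h.left
    rcases eq_or_lt_of_le hb with rfl | hb
    · simpa using hc
    · exfalso
      -- If the blocks to the west were shifted, the line at `-s` would be a fault in the mirror
      -- image. High up it would receive arrows from the east, whereas by `hE` it sends them there.
      have hF : Fault (view ⟨true, 0, (0, 0)⟩ f) s ((LatticeIsom.pos ⟨true, 0, (0, 0)⟩) ⁻¹' Q) b :=
        ⟨h.level.view _, hb, hb', fun j => (mem_mirrorX ..).2 (by simpa using h.left j),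
          fun j => (mem_mirrorX ..).2 (by simpa using hc j)⟩
      obtain ⟨K', hK'⟩ := hF.exists_bound (hv.view _)
      obtain ⟨j, hj⟩ := exists_lt_mul hs (max K K')
      have e1 := hE j (lt_of_le_of_lt (le_max_left _ _) hj)
      have e2 := (hK' (2 * s * j + s) (by have := le_max_right K K'; omega)).1
      rw [view_mirrorX] at e2
      simp [Cell.flip, e1] at e2
  refine ⟨h1, ?_⟩
  obtain ⟨b, hb, hb', hc⟩ := h.level.column_west h1
  rcases eq_or_lt_of_le hb with rfl | hb
  · intro j
    convert hc j using 2 <;> ring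
  · exfalso
    -- A fault at `-3 * s` would likewise receive arrows from the east. Then the squares at the
    -- joints on column `-s` send arrows both ways and are outward tiles.
    have hF : Fault (view ⟨true, 0, (-2 * s, 0)⟩ f) s
        ((LatticeIsom.pos ⟨true, 0, (-2 * s, 0)⟩) ⁻¹' Q) b :=
      ⟨h.level.view _, hb, hb', fun j => (mem_mirrorX ..).2 (by simpa using h1 j),
        fun j => (mem_mirrorX ..).2 (by convert hc j using 2 <;> ring)⟩
    obtain ⟨K', hK'⟩ := hF.exists_bound (hv.view _)
    have hW : ∀ j : ℤ, K' < 2 * s * j → (f (-s, 2 * s * j + s)).w.out = true := by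
      intro j hj
      have := h.level.row_between hv (h1 j) (by convert h1 (j + 1) using 2; ring)
      have h2 := (hK' (2 * s * j + s) (by omega)).1
      rw [view_mirrorX] at h2
      rw [show -2 * s - s = -s + -2 * s by ring, show -2 * s + s = -s by ring] at this
      simp only [Cell.flip, Marking.reflect_out, add_zero] at h2
      rw [← Marking.opp_opp (f (-s, _)).w, ← this, Marking.opp_out, h2]
      rfl
    obtain ⟨j, hj⟩ := exists_lt_mul hs (max K K')
    have hK1 := lt_of_le_of_lt (le_max_left _ _) hj
    have hK2 := lt_of_le_of_lt (le_max_right _ _) hj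
    have hj' : 2 * s * (j + 1) = 2 * s * j + 2 * s := by ring
    have o1 := Cell.isOut_of_ew _ (hv.mem_copies (-s, 2 * s * j + s)) (hW j hK2) (hE j hK1)
    have o2 := Cell.isOut_of_ew _ (hv.mem_copies (-s, 2 * s * (j + 1) + s))
      (hW (j + 1) (by omega)) (hE (j + 1) (by omega))
    -- Two successive outward tiles on column `-s` send arrows against each other along a column
    -- that transmits its markings.
    have := h.level.column_between hv (h1 (j + 1)) (by convert h.left (j + 1) using 2; ring)
    rw [show -2 * s + s = -s by ring, show 2 * s * (j + 1) - s = 2 * s * j + s by omega] at this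
    have := congrArg Marking.out this
    rw [o1.1, Marking.opp_out, o2.2.2.1] at this
    cases this

/-! ### The edges in channel 2 -/

theorem Cell.tileB_east : ∀ c ∈ copies tileList, c.IsOut →
    (c.e = ⟨true, 1, 2⟩ → c.w = ⟨true, -1, 3⟩) ∧ (c.e = ⟨true, 1, 3⟩ → c.w = ⟨true, -1, 2⟩) ∧
    (c.w = ⟨true, 1, 2⟩ → c.e = ⟨true, -1, 3⟩) ∧ (c.w = ⟨true, 1, 3⟩ → c.e = ⟨true, -1, 2⟩) ∧
    (c.w = ⟨true, -1, 3⟩ → c.e = ⟨true, 1, 2⟩) := by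
  decide +kernel

theorem Marking.eq_mate {m m' : Marking} (h : m = m'.mate) : m' = m.mate := by
  rw [h, Marking.mate_mate]

/-- The edge in channel `2` does not lead to a fault. -/
theorem Level.aligned_of_tileB_south (hv : Valid tiles1 f) (h : Level f s Q) (h0 : (0, 0) ∈ Q)
    (he : (f (0, 0)).e = ⟨true, 1, 2⟩) : (2 * s, 0) ∈ Q := by
  by_contra hc
  obtain ⟨a, hf⟩ := h.exists_fault h0 hc
  have hs := h.pos
  obtain ⟨q1, q2⟩ := hf.aligned_west hv
  have q0 := hf.left
  have hsn : (f (s, 0)).s.out = false := by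
    by_contra hcon
    exact hf.side_of_down hv (k := 0) (by simpa using hcon) (by simpa using h.endE hv h0)
      (by rw [he]; decide) (by rw [he])
  have hup := (hf.up hv hsn (k' := 2 * s * (-1)) (by omega)).1
  have B := fun {p} (hp : p ∈ Q) => Cell.tileB_east _ (hv.mem_copies p) (h.out _ _ hp)
  have h00 : (0, 0) ∈ Q := h0
  -- Because the two columns to the west are aligned, the markings can be followed along the circuit
  -- of tiles `B, B, A, A, B, B`: west to `-4 * s`, down one block, and back east, where a negative
  -- sign arrives at the fault below the first one.
  have e1 : (f (-2 * s, 2 * s * 0)).e = ⟨true, 1, 3⟩ := by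
    have := h.linkE hv (q1 0) (q0 0) (by ring)
    rw [mul_zero] at this ⊢
    rw [(B h00).1 he] at this
    exact Marking.eq_mate this
  have e2 : (f (-4 * s, 2 * s * 0)).e = ⟨true, 1, 1⟩ := by
    have := h.linkE hv (q2 0) (q1 0) (by ring)
    rw [(B (q1 0)).2.1 e1] at this
    exact Marking.eq_mate this
  have e3 := h.linkS hv (q2 0) (q2 (-1)) (by ring)
  rw [((Cell.tileA_east _ (hv.mem_copies _) (h.out _ _ (q2 0))).2 e2).1] at e3
  have e4 := (Cell.tileA_north _ (hv.mem_copies _) (h.out _ _ (q2 (-1)))).1 e3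
  have e5 := h.linkE hv (q2 (-1)) (q1 (-1)) (by ring)
  rw [e4] at e5
  have e6 := h.linkE hv (q1 (-1)) (q0 (-1)) (by ring)
  rw [(B (q1 (-1))).2.2.1 e5] at e6
  have e7 := (B (q0 (-1))).2.2.2.1 e6
  refine hf.side_of_up hv hup (m := ⟨true, -1, 2⟩) ?_ (by decide) rfl
  have := h.endE hv (q0 (-1))
  rw [zero_add] at this
  rw [this, e7]

/-! ### Half-blocks -/

/-- Four blocks around the origin that form the northern half of an upright domino. -/
structure HalfBlock (f : ℤ × ℤ → Cell) (s : ℤ) (Q : Set (ℤ × ℤ)) : Prop where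
  ne : (s, s) ∈ Q ∧ ∃ c, f (s, s) = tileA c
  nw : (-s, s) ∈ Q ∧ ∃ c, f (-s, s) = (tileA c).flip
  se : (s, -s) ∈ Q ∧ ∃ c, f (s, -s) = Cell.move false 3 (tileB c)
  sw : (-s, -s) ∈ Q ∧ ∃ c, f (-s, -s) = (Cell.move false 3 (tileB c)).flip

theorem Cell.eq_flip_tileA : ∀ c ∈ copies tileList, c.IsOut → c.e = ⟨true, 1, 0⟩ →
    c = (tileA c.cornered).flip := by decide +kernel

theorem Cell.eq_turn_tileB : ∀ c ∈ copies tileList, c.IsOut → c.n = ⟨true, -1, 2⟩ →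
    c = Cell.move false 3 (tileB c.cornered) := by decide +kernel

theorem Cell.eq_flip_turn_tileB : ∀ c ∈ copies tileList, c.IsOut → c.n = ⟨true, 1, 2⟩ →
    c = (Cell.move false 3 (tileB c.cornered)).flip := by decide +kernel

/-- Both signed edges of `tileA` lead to aligned neighbours, and the links determine the tiles
there. The fourth block is reached from the mirror image of `tileA` in the north-west. -/
theorem Level.halfBlock (hv : Valid tiles1 f) (h : Level f s Q) (h0 : (s, s) ∈ Q) {c : Bool}
    (hc : f (s, s) = tileA c) : HalfBlock f s Q := by
  have q1 : (-s, s) ∈ Q := by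
    have := (h.view ⟨true, 0, (s, s)⟩).aligned_of_tileA_south (hv.view _)
      ((mem_mirrorX ..).2 (by simpa using h0)) (Or.inl (by rw [view_mirrorX]; simp [hc]; rfl))
    rw [mem_mirrorX] at this
    convert this using 2 <;> ring
  have q2 : (s, -s) ∈ Q := by
    have := (h.view ⟨false, 1, (s, s)⟩).aligned_of_tileA_south (hv.view _)
      (by simpa [LatticeIsom.pos] using h0)
      (Or.inr (by simp [view, LatticeIsom.pos, hc, Cell.unmove, Nat.iterate, Cell.turn, tileA]))
    simp only [LatticeIsom.pos, Set.mem_preimage] at this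
    convert this using 2 <;> simp; ring
  have e1 : (f (-s, s)).e = ⟨true, 1, 0⟩ := by
    have := h.linkE hv q1 h0 (by ring)
    rw [hc] at this
    exact Marking.eq_mate this
  have f1 := Cell.eq_flip_tileA _ (hv.mem_copies _) (h.out _ _ q1) e1
  have q3 : (-s, -s) ∈ Q := by
    have := (h.view ⟨true, 3, (-s, s)⟩).aligned_of_tileA_south (hv.view _)
      (by simpa [LatticeIsom.pos] using q1)
      (Or.inr (by
        simp only [view, LatticeIsom.pos]
        simp
        rw [f1]
        simp [Cell.unmove, Nat.iterate, Cell.turn, tileA, Cell.flip, Cell.move, Marking.reflect]))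
    simp only [LatticeIsom.pos, Set.mem_preimage] at this
    convert this using 2 <;> simp; ring
  have e2 := h.linkS hv h0 q2 (by ring)
  rw [hc] at e2
  have e3 := h.linkS hv q1 q3 (by ring)
  rw [f1] at e3
  exact ⟨⟨h0, c, hc⟩, ⟨q1, _, f1⟩,
    ⟨q2, _, Cell.eq_turn_tileB _ (hv.mem_copies _) (h.out _ _ q2) e2⟩,
    ⟨q3, _, Cell.eq_flip_turn_tileB _ (hv.mem_copies _) (h.out _ _ q3) e3⟩⟩

end

/-! ### Composition and inversion of lattice symmetries -/

namespace LatticeIsom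

/-- Composition of lattice symmetries. -/
def comp (g h : LatticeIsom) : LatticeIsom :=
  ⟨xor g.flip h.flip, if g.flip then g.turns + ![0, 3, 2, 1] h.turns else g.turns + h.turns, g.pos h.shift⟩

theorem pos_comp (g h : LatticeIsom) (p : ℤ × ℤ) : (g.comp h).pos p = g.pos (h.pos p) := by
  obtain ⟨b, k, u⟩ := g
  obtain ⟨b', k', u'⟩ := h
  cases b <;> cases b' <;> fin_cases k <;> fin_cases k' <;>
    simp [comp, pos, Nat.iterate, Prod.ext_iff] <;> (try constructor) <;> ring1

theorem unmove_comp (g h : LatticeIsom) (c : Cell) :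
    Cell.unmove (g.comp h).flip (g.comp h).turns c =
      Cell.unmove h.flip h.turns (Cell.unmove g.flip g.turns c) := by
  obtain ⟨b, k, u⟩ := g
  obtain ⟨b', k', u'⟩ := h
  obtain ⟨c, m1, m2, m3, m4⟩ := c
  cases b <;> cases b' <;> fin_cases k <;> fin_cases k' <;>
    simp [comp, Nat.iterate, Cell.unmove, Cell.move, Cell.turn, Cell.flip]

/-- The inverse of a lattice symmetry. -/
def inv (g : LatticeIsom) : LatticeIsom :=
  let h : LatticeIsom := ⟨g.flip, if g.flip then g.turns else ![0, 3, 2, 1] g.turns, 0⟩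
  ⟨h.flip, h.turns, -h.pos g.shift⟩

theorem pos_inv (g : LatticeIsom) (p : ℤ × ℤ) : g.pos (g.inv.pos p) = p := by
  obtain ⟨b, k, u⟩ := g
  cases b <;> fin_cases k <;>
    simp [inv, pos, Nat.iterate, Prod.ext_iff]

theorem inv_pos (g : LatticeIsom) (p : ℤ × ℤ) : g.inv.pos (g.pos p) = p := by
  obtain ⟨b, k, u⟩ := g
  cases b <;> fin_cases k <;>
    simp [inv, pos, Nat.iterate, Prod.ext_iff]

theorem unmove_inv (g : LatticeIsom) (c : Cell) :
    Cell.unmove g.inv.flip g.inv.turns (Cell.unmove g.flip g.turns c) = c := by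
  obtain ⟨b, k, u⟩ := g
  obtain ⟨c, m1, m2, m3, m4⟩ := c
  cases b <;> fin_cases k <;>
    simp [inv, Nat.iterate, Cell.unmove, Cell.move, Cell.turn, Cell.flip]

end LatticeIsom

theorem view_comp (g h : LatticeIsom) (f : ℤ × ℤ → Cell) : view (g.comp h) f = view h (view g f) := by
  funext p
  simp only [view, LatticeIsom.unmove_comp, LatticeIsom.pos_comp]

theorem view_inv (g : LatticeIsom) (f : ℤ × ℤ → Cell) : view g.inv (view g f) = f := by
  funext p
  simp only [view, LatticeIsom.unmove_inv, LatticeIsom.pos_inv]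

section
variable {f : ℤ × ℤ → Cell} {s : ℤ} {Q : Set (ℤ × ℤ)}

/-! ### Frames of half-blocks -/

/-- There is a half-block in the frame `g`. -/
def HB (f : ℤ × ℤ → Cell) (s : ℤ) (Q : Set (ℤ × ℤ)) (g : LatticeIsom) : Prop :=
  HalfBlock (view g f) s (g.pos ⁻¹' Q)

/-- The centres of the half-blocks. -/
def nextQ (f : ℤ × ℤ → Cell) (s : ℤ) (Q : Set (ℤ × ℤ)) : Set (ℤ × ℤ) :=
  {z | ∃ b k, HB f s Q ⟨b, k, z⟩}

theorem LatticeIsom.comp_pos_preimage (g h : LatticeIsom) (Q : Set (ℤ × ℤ)) :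
    (g.comp h).pos ⁻¹' Q = h.pos ⁻¹' (g.pos ⁻¹' Q) := by
  ext p; simp [LatticeIsom.pos_comp]

theorem HB_view {g h : LatticeIsom} : HB (view g f) s (g.pos ⁻¹' Q) h ↔ HB f s Q (g.comp h) := by
  rw [HB, HB, view_comp, LatticeIsom.comp_pos_preimage]

theorem HB.mem {g : LatticeIsom} (h : HB f s Q g) : g.shift ∈ nextQ f s Q := ⟨g.flip, g.turns, h⟩

theorem LatticeIsom.pos_zero (g : LatticeIsom) : g.pos 0 = g.shift := by
  obtain ⟨b, k, u⟩ := g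
  cases b <;> fin_cases k <;> simp [pos, Nat.iterate, Prod.ext_iff]

theorem LatticeIsom.inv_comp_view (g h : LatticeIsom) (f : ℤ × ℤ → Cell) :
    view (g.comp (g.inv.comp h)) f = view h f := by
  rw [view_comp, view_comp, view_inv]

theorem HB_inv_comp {g h : LatticeIsom} : HB f s Q (g.comp (g.inv.comp h)) ↔ HB f s Q h := by
  rw [HB, HB, LatticeIsom.inv_comp_view]
  have : (g.comp (g.inv.comp h)).pos = h.pos := by
    funext p
    rw [LatticeIsom.pos_comp, LatticeIsom.pos_comp, LatticeIsom.pos_inv]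
  rw [this]

theorem nextQ_view (g : LatticeIsom) : nextQ (view g f) s (g.pos ⁻¹' Q) = g.pos ⁻¹' nextQ f s Q := by
  ext p
  constructor
  · rintro ⟨b, k, h⟩
    rw [HB_view] at h
    exact h.mem
  · rintro ⟨b, k, h⟩
    rw [← HB_inv_comp (g := g), ← HB_view] at h
    have := h.mem
    convert this using 1
    change p = g.inv.pos (g.pos p)
    rw [LatticeIsom.inv_pos]

/-- The direction from an outward tile to the centre of its half-block. -/
def Cell.dir (c : Cell) : ℤ × ℤ :=
  let w (m : Marking) : ℤ := if m.chan = 1 ∨ m.chan = 2 then 1 else 0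
  (w c.n * c.n.side + w c.e - w c.s * c.s.side - w c.w,
   w c.n - w c.e * c.e.side - w c.s + w c.w * c.w.side)

theorem Cell.dir_unmove (b : Bool) (k : Fin 4) (c : Cell) :
    c.dir = (⟨b, k, 0⟩ : LatticeIsom).pos (Cell.unmove b k c).dir := by
  obtain ⟨c, m1, m2, m3, m4⟩ := c
  cases b <;> fin_cases k <;>
    simp [Cell.dir, LatticeIsom.pos, Cell.unmove, Cell.move, Cell.flip, Cell.turn, Nat.iterate,
      Marking.reflect] <;> constructor <;> ring1

theorem tileA_dir (c : Bool) : (tileA c).dir = (-1, -1) := by cases c <;> decide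
theorem tileA_flip_dir (c : Bool) : (tileA c).flip.dir = (1, -1) := by cases c <;> decide
theorem tileB_turn_dir (c : Bool) : (Cell.move false 3 (tileB c)).dir = (-1, 1) := by
  cases c <;> decide
theorem tileB_turn_flip_dir (c : Bool) : (Cell.move false 3 (tileB c)).flip.dir = (1, 1) := by
  cases c <;> decide

theorem HalfBlock.dir (h : HalfBlock f s Q) {a b : ℤ} (ha : a = 1 ∨ a = -1) (hb : b = 1 ∨ b = -1) :
    (a * s, b * s) ∈ Q ∧ (f (a * s, b * s)).dir = (-a, -b) := by
  obtain ⟨⟨h1, c1, e1⟩, ⟨h2, c2, e2⟩, ⟨h3, c3, e3⟩, ⟨h4, c4, e4⟩⟩ := h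
  rcases ha with rfl | rfl <;> rcases hb with rfl | rfl <;>
    simp [*, tileA_dir, tileA_flip_dir, tileB_turn_dir, tileB_turn_flip_dir]

/-- The four blocks in the block of size `4s` with centre `z`. -/
theorem block_of_mem_nextQ {x y : ℤ} (hz : (x, y) ∈ nextQ f s Q) {a b : ℤ} (ha : a = 1 ∨ a = -1)
    (hb : b = 1 ∨ b = -1) :
    (x + a * s, y + b * s) ∈ Q ∧ (f (x + a * s, y + b * s)).dir = (-a, -b) := by
  obtain ⟨c, k, h⟩ := hz
  have key : ∀ a' b' : ℤ, (a' = 1 ∨ a' = -1) → (b' = 1 ∨ b' = -1) →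
      (⟨c, k, 0⟩ : LatticeIsom).pos (a', b') = (a, b) →
      (x + a * s, y + b * s) ∈ Q ∧ (f (x + a * s, y + b * s)).dir = (-a, -b) := by
    intro a' b' ha' hb' e
    obtain ⟨h1, h2⟩ := h.dir ha' hb'
    have e' : (⟨c, k, (x, y)⟩ : LatticeIsom).pos (a' * s, b' * s) = (x + a * s, y + b * s) := by
      revert e
      cases c <;> fin_cases k <;> simp [LatticeIsom.pos, Nat.iterate] <;>
        rintro rfl rfl <;> constructor <;> ring1
    rw [Set.mem_preimage, e'] at h1
    refine ⟨h1, ?_⟩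
    simp only [view, e'] at h2
    rw [Cell.dir_unmove c k, h2]
    revert e
    cases c <;> fin_cases k <;> simp [LatticeIsom.pos, Nat.iterate] <;>
        rintro rfl rfl <;> constructor <;> ring1
  have key2 := LatticeIsom.pos_inv ⟨c, k, 0⟩ (a, b)
  refine key _ _ ?_ ?_ key2
  all_goals
    rcases ha with rfl | rfl <;> rcases hb with rfl | rfl <;> cases c <;> fin_cases k <;>
      simp [LatticeIsom.inv, LatticeIsom.pos, Nat.iterate]

/-- Two overlapping blocks of the larger size share a block of the smaller size, and that block
determines the centre of its half-block through `Cell.dir`. -/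
theorem nextQ_sep (h : Level f s Q) (x y x' y' : ℤ) (hz : (x, y) ∈ nextQ f s Q)
    (hz' : (x', y') ∈ nextQ f s Q) (h1 : x < x' + 2 * (2 * s)) (h2 : x' < x + 2 * (2 * s))
    (h3 : y < y' + 2 * (2 * s)) (h4 : y' < y + 2 * (2 * s)) : x = x' ∧ y = y' := by
  -- In each coordinate, take the halves of the two blocks that face each other, or equal halves if
  -- the centres agree.
  have key : ∀ x x' : ℤ, x < x' + 2 * (2 * s) → x' < x + 2 * (2 * s) → ∃ a a' : ℤ,
      (a = 1 ∨ a = -1) ∧ (a' = 1 ∨ a' = -1) ∧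
      x + a * s < x' + a' * s + 2 * s ∧ x' + a' * s < x + a * s + 2 * s := by
    intro x x' h1 h2
    rcases lt_trichotomy x x' with h | h | h
    · exact ⟨1, -1, by simp, by simp, by omega, by omega⟩
    · exact ⟨1, 1, by simp, by simp, by omega, by omega⟩
    · exact ⟨-1, 1, by simp, by simp, by omega, by omega⟩
  obtain ⟨a, a', ha, ha', l1, l2⟩ := key x x' h1 h2
  obtain ⟨b, b', hb, hb', l3, l4⟩ := key y y' h3 h4
  obtain ⟨m1, d1⟩ := block_of_mem_nextQ hz ha hb
  obtain ⟨m2, d2⟩ := block_of_mem_nextQ hz' ha' hb'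
  obtain ⟨e1, e2⟩ := h.sep _ _ _ _ m1 m2 l1 l2 l3 l4
  rw [e1, e2, d2] at d1
  simp only [Prod.mk.injEq, neg_inj] at d1
  rw [d1.1] at e1
  rw [d1.2] at e2
  exact ⟨by linarith, by linarith⟩

theorem Cell.unmove_tileB : ∀ c ∈ copies [tileB false, tileB true], ∃ b, ∃ k,
    Cell.unmove b k c = Cell.move false 3 (tileB c.cornered) := by decide +kernel

theorem Cell.eq_tileA : ∀ c ∈ copies tileList, c.IsOut → c.s = ⟨true, 1, 1⟩ →
    c = tileA c.cornered := by decide +kernel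

theorem LatticeIsom.exists_pos_eq (b : Bool) (k : Fin 4) (p q : ℤ × ℤ) :
    ∃ v, (⟨b, k, v⟩ : LatticeIsom).pos p = q :=
  ⟨q - (⟨b, k, 0⟩ : LatticeIsom).pos p, by simp [pos]⟩

/-- Only the edge in channel `2` is followed, to a copy of `tileA`; at this stage nothing is known
about the alignment of edges in channel `3`. -/
theorem Level.halfBlock_of_tileB (hv : Valid tiles1 f) (h : Level f s Q) (h0 : (s, -s) ∈ Q) {c : Bool}
    (hc : f (s, -s) = Cell.move false 3 (tileB c)) : HalfBlock f s Q := by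
  have q2 := (h.view ⟨true, 1, (s, -s)⟩).aligned_of_tileB_south (hv.view _)
    (by simpa [LatticeIsom.pos] using h0) (by
      simp only [view, LatticeIsom.pos]
      simp
      rw [hc]
      simp [Cell.unmove, Cell.move, Nat.iterate, Cell.turn, Cell.flip, Marking.reflect, tileB])
  have q2 : (s, s) ∈ Q := by
    simp [LatticeIsom.pos] at q2
    convert q2 using 2; ring
  have e2 : f (s, s) = tileA (f (s, s)).cornered := by
    refine Cell.eq_tileA _ (hv.mem_copies _) (h.out _ _ q2) ?_
    have := h.linkS hv q2 h0 (by ring)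
    rw [hc] at this
    exact Marking.eq_mate this
  exact h.halfBlock hv q2 e2

/-- Every block belongs to a half-block. -/
theorem Level.exists_halfBlock (hv : Valid tiles1 f) (h : Level f s Q) {q : ℤ × ℤ} (hq : q ∈ Q) :
    ∃ g : LatticeIsom, HB f s Q g ∧ (g.pos (s, s) = q ∨ g.pos (s, -s) = q) := by
  obtain ⟨b, k, hc | hc⟩ := Cell.cases_of_isOut _ (hv.mem_copies q) (h.out _ _ hq)
  · obtain ⟨v, e⟩ := LatticeIsom.exists_pos_eq b k (s, s) q
    refine ⟨⟨b, k, v⟩, (h.view _).halfBlock (hv.view _) (by rw [Set.mem_preimage, e]; exact hq)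
      (c := (f q).cornered) ?_, Or.inl e⟩
    simp only [view, e]
    rw [hc, Cell.unmove_move, ← hc]
  · obtain ⟨b, k, hc⟩ := Cell.unmove_tileB (f q) (mem_copies.2 ⟨tileB (f q).cornered, by
      cases (f q).cornered <;> simp, b, k, hc⟩)
    obtain ⟨v, e⟩ := LatticeIsom.exists_pos_eq b k (s, -s) q
    refine ⟨⟨b, k, v⟩, (h.view _).halfBlock_of_tileB (hv.view _)
      (by rw [Set.mem_preimage, e]; exact hq) (c := (f q).cornered) ?_, Or.inr e⟩
    simp only [view, e]
    exact hc

theorem nextQ_cov (hv : Valid tiles1 f) (h : Level f s Q) (x y : ℤ) : ∃ x' y',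
    (x', y') ∈ nextQ f s Q ∧ x' - 2 * s ≤ x ∧ x < x' + 2 * s ∧ y' - 2 * s ≤ y ∧ y < y' + 2 * s := by
  obtain ⟨x₁, y₁, hq, h1, h2, h3, h4⟩ := h.cov x y
  have := h.pos
  obtain ⟨⟨b, k, u, v⟩, hg, e⟩ := h.exists_halfBlock hv hq
  refine ⟨u, v, hg.mem, ?_⟩
  rcases e with e | e <;> revert e <;> cases b <;> fin_cases k <;>
    simp [LatticeIsom.pos, Nat.iterate] <;> intros <;> refine ⟨?_, ?_, ?_, ?_⟩ <;> omega

end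

/-! ### Half-blocks are the blocks of the next level -/

section
variable {f : ℤ × ℤ → Cell} {s : ℤ} {Q : Set (ℤ × ℤ)}

/-- The signs on the line from `tileA` to `tileB` direct the arrow that crosses it away from the
axis of the half-block. -/
theorem Cell.out_e_of_n : ∀ c ∈ copies tileList, c.n = ⟨false, -1, 1⟩ → c.s = ⟨false, 1, 2⟩ →
    c.e.out = true ∧ c.w.out = false := by decide +kernel

theorem Cell.out_w_of_n : ∀ c ∈ copies tileList, c.n = ⟨false, 1, 1⟩ → c.s = ⟨false, -1, 2⟩ →
    c.w.out = true ∧ c.e.out = false := by decide +kernel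

namespace HalfBlock
variable (hv : Valid tiles1 f) (h : Level f s Q) (hb : HalfBlock f s Q)
include hv h hb

/-- The markings on the axis of a half-block. -/
theorem east : (f (s, 0)).n = ⟨false, -1, 1⟩ ∧ (f (s, 0)).s = ⟨false, 1, 2⟩ := by
  obtain ⟨⟨h1, c1, e1⟩, -, ⟨h3, c3, e3⟩, -⟩ := hb
  have a := h.endS hv h1
  have b := h.endN hv h3
  rw [e1, sub_self] at a
  rw [e3, neg_add_cancel] at b
  exact ⟨a, b⟩

theorem west : (f (-s, 0)).n = ⟨false, 1, 1⟩ ∧ (f (-s, 0)).s = ⟨false, -1, 2⟩ := by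
  obtain ⟨-, ⟨h1, c1, e1⟩, -, ⟨h3, c3, e3⟩⟩ := hb
  have a := h.endS hv h1
  have b := h.endN hv h3
  rw [e1, sub_self] at a
  rw [e3, neg_add_cancel] at b
  exact ⟨a, b⟩

theorem row {x : ℤ} (h0 : x ≠ 0) (h1 : -(2 * s) < x) (h2 : x < 2 * s) :
    (f (x, 0)).n.out = false ∧ (f (x, 0)).s.out = false := by
  rcases lt_or_gt_of_ne h0 with h0 | h0
  · have := h.between_ns hv (i := x + s) hb.sw.1 (by convert hb.nw.1 using 2; ring) (by omega)
      (by omega)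
    convert this using 5 <;> ring_nf
  · have := h.between_ns hv (i := x - s) hb.se.1 (by convert hb.ne.1 using 2; ring) (by omega)
      (by omega)
    convert this using 5 <;> ring_nf

theorem column {y : ℤ} (h0 : y ≠ 0) (h1 : -(2 * s) < y) (h2 : y < 2 * s) :
    (f (0, y)).w.out = false ∧ (f (0, y)).e.out = false := by
  rcases lt_or_gt_of_ne h0 with h0 | h0
  · have := h.between_ew hv (i := y + s) hb.sw.1 (by convert hb.se.1 using 2; ring) (by omega)
      (by omega)
    convert this using 5 <;> ring_nf
  · have := h.between_ew hv (i := y - s) hb.nw.1 (by convert hb.ne.1 using 2; ring) (by omega)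
      (by omega)
    convert this using 5 <;> ring_nf

theorem row_eq {x x' : ℤ} (hx : x < x') (h1 : -(2 * s) < x) (h2 : x' < 2 * s)
    (h3 : 0 ≤ x ∨ x' ≤ 0) : (f (x, 0)).e = (f (x', 0)).w.opp :=
  hv.row_const hx fun y a b => hb.row hv h (by omega) (by omega) (by omega)

theorem column_eq {y y' : ℤ} (hy : y < y') (h1 : -(2 * s) < y) (h2 : y' < 2 * s)
    (h3 : 0 ≤ y ∨ y' ≤ 0) : (f (0, y)).n = (f (0, y')).s.opp :=
  hv.column_const hy fun x a b => hb.column hv h (by omega) (by omega) (by omega)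

/-- The arrows crossing the eastern and the western line of the half-block both lead away from the
axis, so the central square sends arrows to both sides, which no crossing tile does. -/
theorem center : (f (0, 0)).IsOut := by
  have := h.pos
  obtain ⟨a, b⟩ := hb.east hv h
  obtain ⟨c, d⟩ := hb.west hv h
  refine Cell.isOut_of_ew _ (hv.mem_copies _) ?_ ?_
  · have e := hb.row_eq hv h (x := -s) (x' := 0) (by omega) (by omega) (by omega) (by omega)
    have := (Cell.out_w_of_n _ (hv.mem_copies _) c d).2
    rw [e] at this
    simpa using this
  · have e := hb.row_eq hv h (x := 0) (x' := s) (by omega) (by omega) (by omega) (by omega)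
    have := (Cell.out_e_of_n _ (hv.mem_copies _) a b).2
    rw [e]
    simpa using this

theorem lineE {i : ℤ} (h0 : 0 ≤ i) (h1 : i < 2 * s) : (f (i, 0)).e = (f (0, 0)).e := by
  rcases h0.eq_or_lt with rfl | h0
  · rfl
  rw [hb.row_eq hv h h0 (by omega) h1 (by omega)]
  have := hb.row hv h (x := i) (by omega) (by omega) (by omega)
  exact (Cell.through_ns _ (hv.mem_copies _) this.1 this.2).2

theorem lineW {i : ℤ} (h0 : 0 ≤ i) (h1 : i < 2 * s) : (f (-i, 0)).w = (f (0, 0)).w := by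
  rcases h0.eq_or_lt with rfl | h0
  · rfl
  have := hb.row hv h (x := -i) (by omega) (by omega) (by omega)
  have := (Cell.through_ns _ (hv.mem_copies _) this.1 this.2).2
  rw [hb.row_eq hv h (x' := 0) (by omega) (by omega) (by omega) (by omega)] at this
  exact (Marking.opp_injective this).symm

theorem lineN {i : ℤ} (h0 : 0 ≤ i) (h1 : i < 2 * s) : (f (0, i)).n = (f (0, 0)).n := by
  rcases h0.eq_or_lt with rfl | h0
  · rfl
  have := hb.column hv h (y := i) (by omega) (by omega) (by omega)
  have := (Cell.through_ew _ (hv.mem_copies _) this.1 this.2).2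
  rw [hb.column_eq hv h h0 (by omega) h1 (by omega), this, Marking.opp_opp]

theorem lineS {i : ℤ} (h0 : 0 ≤ i) (h1 : i < 2 * s) : (f (0, -i)).s = (f (0, 0)).s := by
  rcases h0.eq_or_lt with rfl | h0
  · rfl
  have := hb.column hv h (y := -i) (by omega) (by omega) (by omega)
  have := (Cell.through_ew _ (hv.mem_copies _) this.1 this.2).2
  rw [this, hb.column_eq hv h (y' := 0) (by omega) (by omega) (by omega) (by omega), Marking.opp_opp]

/-- The boundary of the square consists of sides of the four blocks, apart from the four ends of the
axes, where the outward markings of the centre arrive. -/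
theorem star : Star f (2 * s) {(0, 0)} := by
  have hs := h.pos
  have hc := hb.center hv h
  refine ⟨?_, ?_, ?_, ?_, ?_, ?_, ?_, ?_, ?_⟩ <;> rintro x y ⟨⟩
  · exact hc
  · intro i h0 h1
    rw [zero_add]; exact hb.lineE hv h h0 h1
  · intro i h0 h1
    rw [zero_sub]; exact hb.lineW hv h h0 h1
  · intro i h0 h1
    rw [zero_add]; exact hb.lineN hv h h0 h1
  · intro i h0 h1
    rw [zero_sub]; exact hb.lineS hv h h0 h1
  · intro i h0 h1
    rw [zero_add, zero_add]
    rcases lt_trichotomy i 0 with hi | rfl | hi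
    · have := h.sideE _ _ hb.se.1 (i + s) (by omega) (by omega)
      convert this using 5 <;> ring
    · rw [hb.lineE hv h (by omega) (by omega)]; exact hc.2.1
    · have := h.sideE _ _ hb.ne.1 (i - s) (by omega) (by omega)
      convert this using 5 <;> ring
  · intro i h0 h1
    rw [zero_sub, zero_add]
    rcases lt_trichotomy i 0 with hi | rfl | hi
    · have := h.sideW _ _ hb.sw.1 (i + s) (by omega) (by omega)
      convert this using 5 <;> ring
    · rw [hb.lineW hv h (by omega) (by omega)]; exact hc.2.2.2
    · have := h.sideW _ _ hb.nw.1 (i - s) (by omega) (by omega)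
      convert this using 5 <;> ring
  · intro i h0 h1
    rw [zero_add, zero_add]
    rcases lt_trichotomy i 0 with hi | rfl | hi
    · have := h.sideN _ _ hb.nw.1 (i + s) (by omega) (by omega)
      convert this using 5 <;> ring
    · rw [hb.lineN hv h (by omega) (by omega)]; exact hc.1
    · have := h.sideN _ _ hb.ne.1 (i - s) (by omega) (by omega)
      convert this using 5 <;> ring
  · intro i h0 h1
    rw [zero_sub, zero_add]
    rcases lt_trichotomy i 0 with hi | rfl | hi
    · have := h.sideS _ _ hb.sw.1 (i + s) (by omega) (by omega)
      convert this using 5 <;> ring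
    · rw [hb.lineS hv h (by omega) (by omega)]; exact hc.2.2.1
    · have := h.sideS _ _ hb.se.1 (i - s) (by omega) (by omega)
      convert this using 5 <;> ring

end HalfBlock

theorem Star.of_view {g : LatticeIsom} (h : Star (view g f) s {(0, 0)}) : Star f s {g.shift} := by
  have := h.view g.inv
  rw [view_inv] at this
  convert this using 1
  ext p
  simp only [Set.mem_singleton_iff, Set.mem_preimage]
  constructor
  · rintro rfl
    rw [← LatticeIsom.pos_zero, LatticeIsom.inv_pos]; rfl
  · intro e
    rw [← LatticeIsom.pos_zero, ← LatticeIsom.pos_inv g p, e]; rfl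

/-- The half-blocks form the next level. -/
theorem Level.next (hv : Valid tiles1 f) (h : Level f s Q) : Level f (2 * s) (nextQ f s Q) := by
  have key : ∀ {x y}, (x, y) ∈ nextQ f s Q → Star f (2 * s) {(x, y)} := by
    rintro x y ⟨b, k, hb⟩
    exact (hb.star (hv.view _) (h.view _)).of_view
  refine ⟨⟨?_, ?_, ?_, ?_, ?_, ?_, ?_, ?_, ?_⟩, by have := h.pos; omega, nextQ_sep h,
    nextQ_cov hv h⟩ <;> intro x y hz
  · exact (key hz).out x y rfl
  · exact (key hz).lineE x y rfl
  · exact (key hz).lineW x y rfl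
  · exact (key hz).lineN x y rfl
  · exact (key hz).lineS x y rfl
  · exact (key hz).sideE x y rfl
  · exact (key hz).sideW x y rfl
  · exact (key hz).sideN x y rfl
  · exact (key hz).sideS x y rfl

end

/-! ### The hierarchy of a tiling -/

/-- A tiling as a function. -/
structure Tiled (T : Set Cell) (f : ℤ × ℤ → Cell) : Prop extends Valid T f where
  sep : ∀ x y x' y', (f (x, y)).cornered = true → (f (x', y')).cornered = true →
    x ≤ x' + 1 → x' ≤ x + 1 → y ≤ y' + 1 → y' ≤ y + 1 → x = x' ∧ y = y'
  cov : ∀ x y, ∃ x' y', (f (x', y')).cornered = true ∧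
    x' - 1 ≤ x ∧ x < x' + 1 ∧ y' - 1 ≤ y ∧ y < y' + 1

/-- The centres of the blocks of size `2 ^ (n + 1)`. -/
def levelQ (f : ℤ × ℤ → Cell) : ℕ → Set (ℤ × ℤ)
  | 0 => {p | (f p).cornered = true}
  | n + 1 => nextQ f (2 ^ n) (levelQ f n)

theorem Cell.isOut_of_cornered : ∀ c ∈ copies tileList, c.cornered = true → c.IsOut := by
  decide +kernel

theorem Valid.mono {T T' : Set Cell} (hT : T ⊆ T') {f : ℤ × ℤ → Cell} (h : Valid T f) : Valid T' f :=
  ⟨fun p => oriented_mono hT (h.mem p), h.fe, h.fn⟩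

theorem Tiled.mono {T T' : Set Cell} (hT : T ⊆ T') {f : ℤ × ℤ → Cell} (h : Tiled T f) : Tiled T' f :=
  ⟨h.toValid.mono hT, h.sep, h.cov⟩

theorem Tiled.level {f : ℤ × ℤ → Cell} (h : Tiled tiles1 f) : ∀ n, Level f (2 ^ n) (levelQ f n)
  | 0 => by
    have o : ∀ x y, (x, y) ∈ levelQ f 0 → (f (x, y)).IsOut := fun x y hq =>
      Cell.isOut_of_cornered _ (h.mem_copies _) hq
    rw [pow_zero]
    refine ⟨⟨o, ?_, ?_, ?_, ?_, ?_, ?_, ?_, ?_⟩, by omega, ?_, h.cov⟩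
    rotate_right
    · intro x y x' y' h1 h2 _ _ _ _
      exact h.sep x y x' y' h1 h2 (by omega) (by omega) (by omega) (by omega)
    all_goals
      intro x y hq i h1 h2
      obtain rfl : i = 0 := by omega
      simp [o _ _ hq, (o _ _ hq).1, (o _ _ hq).2.1, (o _ _ hq).2.2.1, (o _ _ hq).2.2.2]
  | n + 1 => by
    rw [pow_succ']
    exact (h.level n).next h.toValid

theorem levelQ_view (f : ℤ × ℤ → Cell) (g : LatticeIsom) :
    ∀ n, levelQ (view g f) n = g.pos ⁻¹' levelQ f n
  | 0 => by
    ext p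
    simp only [levelQ, view, Set.mem_ofPred_eq, Set.mem_preimage]
    obtain ⟨b, k, v⟩ := g
    cases b <;> fin_cases k <;>
      simp [Cell.unmove, Cell.move, Cell.turn, Cell.flip, Nat.iterate]
  | n + 1 => by rw [levelQ, levelQ_view f g n, nextQ_view, levelQ]

theorem IsTiling.exists_tiled {T : Set Cell} {τ : Config} (h : IsTiling T τ) :
    ∃ f, Tiled T f ∧ ∀ p c, (p, c) ∈ τ ↔ c = f p := by
  choose f hf using h.full
  have hu : ∀ p c, (p, c) ∈ τ ↔ c = f p := fun p c =>
    ⟨fun hc => h.admitted.unique _ _ _ hc (hf p), fun e => e ▸ hf p⟩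
  refine ⟨f, ⟨⟨?_, ?_, ?_⟩, ?_, ?_⟩, hu⟩
  · intro p
    obtain ⟨t, ht, b, k, e⟩ := h.admitted.congruent _ (hf p)
    exact ⟨t, ht, b, k, e⟩
  · intro x y
    exact Marking.fits_iff.1 (h.admitted.fits_e (x, y) _ _ (hf _) (hf _))
  · intro x y
    exact Marking.fits_iff.1 (h.admitted.fits_n (x, y) _ _ (hf _) (hf _))
  · intro x y x' y' h1 h2 a b c d
    have := h.admitted.corners (min x x', min y y') _ (hf (x, y)) _ (hf (x', y'))
      (by simp [around]; omega) (by simp [around]; omega) h1 h2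
    simpa using congrArg Prod.fst this
  · intro x y
    obtain ⟨⟨⟨x', y'⟩, c⟩, h1, h2, h3⟩ := h.vertices (x, y)
    rw [hu] at h1
    subst h1
    simp [around] at h2
    exact ⟨x', y', h3, by omega, by omega, by omega, by omega⟩

/-- A function on the lattice as a configuration. -/
def graph (f : ℤ × ℤ → Cell) : Config := {x | x.2 = f x.1}

theorem mem_graph {f : ℤ × ℤ → Cell} {p : ℤ × ℤ} {c : Cell} : (p, c) ∈ graph f ↔ c = f p := Iff.rfl

theorem Tiled.isTiling {T : Set Cell} {f : ℤ × ℤ → Cell} (h : Tiled T f) : IsTiling T (graph f) := by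
  refine ⟨⟨?_, ?_, ?_, ?_, ?_⟩, fun p => ⟨f p, rfl⟩, ?_⟩
  · rintro ⟨p, c⟩ (rfl : c = f p)
    obtain ⟨t, ht, b, k, e⟩ := h.mem p
    exact ⟨t, ht, b, k, e⟩
  · rintro p c c' (rfl : c = f p) (rfl : c' = f p)
    rfl
  · rintro ⟨x, y⟩ c c' (rfl : c = f (x, y)) (rfl : c' = f (x + 1, y))
    exact Marking.fits_iff.2 (h.fe x y)
  · rintro ⟨x, y⟩ c c' (rfl : c = f (x, y)) (rfl : c' = f (x, y + 1))
    exact Marking.fits_iff.2 (h.fn x y)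
  · rintro ⟨u, v⟩ ⟨⟨x, y⟩, c⟩ (rfl : c = f (x, y)) ⟨⟨x', y'⟩, c'⟩ (rfl : c' = f (x', y')) h1 h2 h3 h4
    simp [around] at h1 h2
    obtain ⟨rfl, rfl⟩ := h.sep x y x' y' h3 h4 (by omega) (by omega) (by omega) (by omega)
    rfl
  · rintro ⟨x, y⟩
    obtain ⟨x', y', h0, h1, h2, h3, h4⟩ := h.cov x y
    exact ⟨((x', y'), f (x', y')), mem_graph.2 rfl, by simp [around]; omega, h0⟩

/-! ### Tilings are not periodic -/

/-- A period maps every level to itself, but the blocks of a high level are too large to be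
separated from their translates by a fixed vector. -/
theorem Tiled.not_periodic {f : ℤ × ℤ → Cell} (h : Tiled tiles1 f) {v : ℤ × ℤ} (hv : v ≠ 0)
    (hf : ∀ p, f (p + v) = f p) : False := by
  have e : view ⟨false, 0, v⟩ f = f := by
    funext p
    simp [view, LatticeIsom.pos, Cell.unmove, hf, Nat.iterate, Cell.turn]
  obtain ⟨u, w⟩ := v
  obtain ⟨n, hn⟩ : ∃ n : ℕ, |u| + |w| < 2 ^ n := by
    obtain ⟨n, hn⟩ := pow_unbounded_of_one_lt (|u| + |w|) (by norm_num : (1 : ℤ) < 2)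
    exact ⟨n, hn⟩
  obtain ⟨x, y, hq, -⟩ := (h.level n).cov 0 0
  have hq' : (x + u, y + w) ∈ levelQ f n := by
    have := levelQ_view f ⟨false, 0, (u, w)⟩ n
    rw [e] at this
    rw [this] at hq
    simpa [LatticeIsom.pos] using hq
  have a1 := abs_le.1 (le_refl |u|)
  have a2 := abs_le.1 (le_refl |w|)
  have a3 := abs_nonneg u
  have a4 := abs_nonneg w
  have := (h.level n).sep _ _ _ _ hq hq' (by omega) (by omega) (by omega) (by omega)
  exact hv (by simp; omega)

/-! ### The edges in channel 3 -/

theorem Cell.tileB_dir : ∀ c ∈ copies tileList, c.IsOut →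
    (c.e = ⟨true, 1, 3⟩ → c.dir = (-1, -1) ∧ c.s = plainOut) ∧
    (c.e = ⟨true, -1, 3⟩ → c.dir = (-1, 1) ∧ c.n = plainOut) ∧
    (c.w = ⟨true, -1, 3⟩ → c.dir = (1, -1) ∧ c.s = plainOut) ∧
    (c.dir = (-1, 1) → c.n = plainOut → c.e = ⟨true, -1, 3⟩) ∧
    (c.dir = (-1, -1) → c.s = plainOut → c.e = ⟨true, 1, 3⟩) ∧
    (c.dir = (1, 1) → c.n = plainOut → c.w = ⟨true, 1, 3⟩) := by decide +kernel

section
variable {f : ℤ × ℤ → Cell} {s : ℤ} {Q : Set (ℤ × ℤ)}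

theorem Level.exists_nextQ (hv : Valid tiles1 f) (h : Level f s Q) {x y : ℤ} (hq : (x, y) ∈ Q) :
    ∃ a b : ℤ, (f (x, y)).dir = (a, b) ∧ (a = 1 ∨ a = -1) ∧ (b = 1 ∨ b = -1) ∧
      (x + a * s, y + b * s) ∈ nextQ f s Q := by
  obtain ⟨⟨c, k, u, v⟩, hg, e⟩ := h.exists_halfBlock hv hq
  have : ∃ a b : ℤ, (a = 1 ∨ a = -1) ∧ (b = 1 ∨ b = -1) ∧ x + a * s = u ∧ y + b * s = v := by
    rcases e with e | e <;> revert e <;> cases c <;> fin_cases k <;>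
      simp [LatticeIsom.pos, Nat.iterate] <;> rintro rfl rfl
    all_goals omega
  obtain ⟨a, b, ha, hb, h1, h2⟩ := this
  have hz := hg.mem
  refine ⟨a, b, ?_, ha, hb, by rw [h1, h2]; exact hz⟩
  have := (block_of_mem_nextQ hz (a := -a) (b := -b) (by omega) (by omega)).2
  rw [neg_neg, neg_neg] at this
  rw [← this]
  congr 3 <;> simp only [neg_mul] <;> omega

/-- The two copies of `tileB` in a half-block are mirror images of each other, so their edges in
channel `3` leave in the same direction with opposite signs. -/
theorem Level.partner (hv : Valid tiles1 f) (h : Level f s Q) {x y : ℤ} (hq : (x, y) ∈ Q) :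
    ((f (x, y)).e = ⟨true, 1, 3⟩ → (x, y - 2 * s) ∈ Q ∧ (f (x, y - 2 * s)).e = ⟨true, -1, 3⟩) ∧
    ((f (x, y)).e = ⟨true, -1, 3⟩ → (x, y + 2 * s) ∈ Q ∧ (f (x, y + 2 * s)).e = ⟨true, 1, 3⟩) ∧
    ((f (x, y)).w = ⟨true, -1, 3⟩ → (x, y - 2 * s) ∈ Q ∧ (f (x, y - 2 * s)).w = ⟨true, 1, 3⟩) := by
  have B := Cell.tileB_dir _ (hv.mem_copies (x, y)) (h.out _ _ hq)
  obtain ⟨a, b, d, -, -, hz⟩ := h.exists_nextQ hv hq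
  refine ⟨fun e => ?_, fun e => ?_, fun e => ?_⟩
  · obtain ⟨d', e'⟩ := B.1 e
    rw [d, Prod.mk.injEq] at d'
    obtain ⟨rfl, rfl⟩ := d'
    obtain ⟨h1, h2⟩ := block_of_mem_nextQ hz (a := 1) (b := -1) (by simp) (by simp)
    rw [show x + -1 * s + 1 * s = x by ring, show y + -1 * s + -1 * s = y - 2 * s by ring] at h1 h2
    refine ⟨h1, (Cell.tileB_dir _ (hv.mem_copies _) (h.out _ _ h1)).2.2.2.1 h2 ?_⟩
    rw [h.linkS hv hq h1 rfl, e']; rfl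
  · obtain ⟨d', e'⟩ := B.2.1 e
    rw [d, Prod.mk.injEq] at d'
    obtain ⟨rfl, rfl⟩ := d'
    obtain ⟨h1, h2⟩ := block_of_mem_nextQ hz (a := 1) (b := 1) (by simp) (by simp)
    rw [show x + -1 * s + 1 * s = x by ring, show y + 1 * s + 1 * s = y + 2 * s by ring] at h1 h2
    refine ⟨h1, (Cell.tileB_dir _ (hv.mem_copies _) (h.out _ _ h1)).2.2.2.2.1 h2 ?_⟩
    have := h.linkS hv h1 hq (by ring)
    rw [e'] at this
    exact Marking.eq_mate this
  · obtain ⟨d', e'⟩ := B.2.2.1 e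
    rw [d, Prod.mk.injEq] at d'
    obtain ⟨rfl, rfl⟩ := d'
    obtain ⟨h1, h2⟩ := block_of_mem_nextQ hz (a := -1) (b := -1) (by simp) (by simp)
    rw [show x + 1 * s + -1 * s = x by ring, show y + -1 * s + -1 * s = y - 2 * s by ring] at h1 h2
    refine ⟨h1, (Cell.tileB_dir _ (hv.mem_copies _) (h.out _ _ h1)).2.2.2.2.2 h2 ?_⟩
    rw [h.linkS hv hq h1 rfl, e']; rfl

/-- Two half-blocks facing a column of half-blocks that is shifted by half of their size. -/
theorem Level.no_half_fault_aux (hv : Valid tiles1 f) (h : Level f s Q) (h0 : (0, 0) ∈ Q)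
    (he : (f (0, 0)).e = ⟨true, 1, 3⟩) (h1 : (3 * s, 0) ∈ nextQ f s Q) : False := by
  have hs := h.pos
  have h' := h.next hv
  have q1 : (2 * s, s) ∈ Q := by
    convert (block_of_mem_nextQ h1 (a := -1) (b := 1) (by simp) (by simp)).1 using 2 <;> ring
  have q := (h.fault_of_mem h0 q1 hs (by omega)).left
  have m := fun {y : ℤ} (hy : (0, y) ∈ Q) (hy' : (3 * s, y) ∈ nextQ f s Q) =>
    h.meet_ew hv hy (x' := 3 * s)
      (by
        have := h'.endW hv hy'
        rw [zero_add, ← this]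
        congr 3; ring) (h'.out _ _ hy').2.2.2
  -- Lines in channel `3` leave the small blocks in pairs at distance `2 * s` and arrive from the
  -- large blocks in pairs at distance `4 * s`. Matching both kinds gives the small block at height
  -- `-2 * s` two different signs.
  have w1 := m h0 h1
  rw [he] at w1
  obtain ⟨h2, w2⟩ := (h'.partner hv h1).2.2 w1
  have q2 : (0, 0 - 2 * (2 * s)) ∈ Q := by
    convert q (-2) using 2; ring
  have w3 := m q2 h2
  rw [w2] at w3
  have w4 := Marking.eq_mate w3
  have w5 := ((h.partner hv q2).2.1 w4).2
  have w6 := ((h.partner hv h0).1 he).2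
  rw [show (0 : ℤ) - 2 * (2 * s) + 2 * s = 0 - 2 * s by ring, w6] at w5
  cases w5

/-- The half-block of the eastern block at height `-s` has its centre level with the origin or with
the other copy of `tileB` below it; a reflection exchanges the two cases. -/
theorem Level.no_half_fault (hv : Valid tiles1 f) (h : Level f s Q) (h0 : (0, 0) ∈ Q)
    (he : (f (0, 0)).e = ⟨true, 1, 3⟩) (h1 : (2 * s, s) ∈ Q) : False := by
  have hs := h.pos
  have hf := h.fault_of_mem h0 h1 hs (by omega)
  have q1 : (2 * s, -s) ∈ Q := by convert hf.right (-1) using 2; ring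
  obtain ⟨a, b, -, ha, hb, hz⟩ := h.exists_nextQ hv q1
  -- The half-block cannot extend to the west across the fault, where the block at the origin is in
  -- the way.
  obtain rfl : a = 1 := by
    by_contra ha'
    obtain rfl : a = -1 := by tauto
    have := (block_of_mem_nextQ hz (a := -1) (b := -b) (by simp) (by omega)).1
    have := h.sep _ _ _ _ h0 this
    rw [show -s + b * s + -b * s = -s by ring] at this
    have := this (by omega) (by omega) (by omega) (by omega)
    omega
  rcases hb with rfl | rfl
  · refine h.no_half_fault_aux hv h0 he ?_
    convert hz using 2 <;> ring
  · obtain ⟨q2, e2⟩ := (h.partner hv h0).1 he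
    refine (h.view ⟨true, 2, (0, -2 * s)⟩).no_half_fault_aux (hv.view _) ?_ ?_ ?_
    · simp [LatticeIsom.pos]
      simpa using q2
    · simp only [view, LatticeIsom.pos]
      rw [zero_sub] at e2
      simp [Cell.unmove, Cell.move, Nat.iterate, Cell.turn, Cell.flip, Marking.reflect, e2]
    · rw [nextQ_view]
      simp [LatticeIsom.pos]
      convert hz using 2 <;> ring

theorem Level.no_half_fault' (hv : Valid tiles1 f) (h : Level f s Q) (h0 : (0, 0) ∈ Q)
    (he : (f (0, 0)).e = ⟨true, -1, 3⟩) (h1 : (2 * s, s) ∈ Q) : False := by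
  have hs := h.pos
  have hf := h.fault_of_mem h0 h1 hs (by omega)
  have q1 : (2 * s, -s) ∈ Q := by convert hf.right (-1) using 2; ring
  refine (h.view ⟨true, 2, (0, 0)⟩).no_half_fault (hv.view _) ?_ ?_ ?_
  · simpa [LatticeIsom.pos] using h0
  · simp [view, LatticeIsom.pos, Cell.unmove, Cell.move, Nat.iterate, Cell.turn, Cell.flip,
      Marking.reflect, he]
  · simpa [LatticeIsom.pos] using q1

end

/-- A block of level `m + d` is a square array of `2 ^ d` by `2 ^ d` blocks of level `m`, as one
sees by quartering. This locates small blocks along the sides of a large one. -/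
theorem levelQ_sub {f : ℤ × ℤ → Cell} (m d : ℕ) : ∀ x y : ℤ, (x, y) ∈ levelQ f (m + d) →
    ∀ a b : ℤ, 0 ≤ a → a < 2 ^ d → 0 ≤ b → b < 2 ^ d →
      (x + 2 ^ m * (2 * a + 1 - 2 ^ d), y + 2 ^ m * (2 * b + 1 - 2 ^ d)) ∈ levelQ f m := by
  induction d with
  | zero =>
    intro x y h a b h1 h2 h3 h4
    rw [pow_zero] at *
    obtain rfl : a = 0 := by omega
    obtain rfl : b = 0 := by omega
    simpa using h
  | succ d ih =>
    intro x y h a b h1 h2 h3 h4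
    have key : ∀ a : ℤ, 0 ≤ a → a < 2 ^ (d + 1) → ∃ i a' : ℤ, (i = 1 ∨ i = -1) ∧ 0 ≤ a' ∧
        a' < 2 ^ d ∧ i * 2 ^ (m + d) + 2 ^ m * (2 * a' + 1 - 2 ^ d) =
          2 ^ m * (2 * a + 1 - 2 ^ (d + 1)) := by
      intro a h1 h2
      rw [pow_succ] at h2
      rcases lt_or_ge a (2 ^ d) with h | h
      · exact ⟨-1, a, by simp, h1, h, by ring⟩
      · exact ⟨1, a - 2 ^ d, by simp, by omega, by omega, by ring⟩
    obtain ⟨i, a', hi, h1, h2, e1⟩ := key a h1 h2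
    obtain ⟨j, b', hj, h3, h4, e2⟩ := key b h3 h4
    have := ih _ _ (block_of_mem_nextQ (s := 2 ^ (m + d)) h hi hj).1 a' b' h1 h2 h3 h4
    rw [← e1, ← e2]
    convert this using 2 <;> ring

theorem Int.exists_eq_two_pow_mul {a : ℤ} (ha : 0 < a) : ∃ (m : ℕ) (k : ℤ),
    0 ≤ k ∧ a = 2 ^ m * (2 * k + 1) := by
  obtain ⟨m, r, ⟨k, rfl⟩, e⟩ := Nat.exists_eq_two_pow_mul_odd (n := a.toNat) (by omega)
  refine ⟨m, k, by omega, ?_⟩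
  have : (a.toNat : ℤ) = a := by omega
  rw [← this, e]
  push_cast
  ring

/-- The edge in channel `3` does not lead to a fault. -/
theorem Tiled.aligned_of_chan_three {f : ℤ × ℤ → Cell} (h : Tiled tiles1 f) {n : ℕ}
    (h0 : (0, 0) ∈ levelQ f n) (he : (f (0, 0)).e = ⟨true, 1, 3⟩ ∨ (f (0, 0)).e = ⟨true, -1, 3⟩) :
    (2 * 2 ^ n, 0) ∈ levelQ f n := by
  have hv := h.toValid
  have hl := h.level n
  by_contra hc
  obtain ⟨a, hf⟩ := hl.exists_fault h0 hc
  -- The exponent `m` is the level at which the shift becomes half a block; the odd factor only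
  -- counts further half-blocks.
  obtain ⟨m, k, hk, e⟩ := Int.exists_eq_two_pow_mul hf.pos
  have h2 := hf.lt
  have hmn : m ≤ n := by
    by_contra hmn
    have : (2 : ℤ) ^ (n + 1) ≤ 2 ^ m := pow_le_pow_right₀ (by norm_num) (by omega)
    rw [pow_succ] at this
    have h3 : (2 : ℤ) ^ m * 1 ≤ 2 ^ m * (2 * k + 1) := by gcongr; omega
    omega
  obtain ⟨d, rfl⟩ := Nat.exists_eq_add_of_le hmn
  have pm : (0 : ℤ) < 2 ^ m := by positivity
  have pd : (1 : ℤ) ≤ 2 ^ d := one_le_pow₀ (by norm_num)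
  rw [pow_add, e] at h2
  have hk2 : 2 * k + 1 < 2 * 2 ^ d := by nlinarith
  rcases Nat.eq_zero_or_pos d with rfl | hd
  · obtain rfl : k = 0 := by omega
    have := hf.right 0
    rw [e] at this
    simp only [mul_zero, zero_add, mul_one, add_zero] at this
    rcases he with he | he
    · exact hl.no_half_fault hv h0 he this
    · exact hl.no_half_fault' hv h0 he this
  have h2d : ∃ w : ℤ, (2 : ℤ) ^ d = 2 * w := by
    obtain ⟨d, rfl⟩ := Nat.exists_eq_add_of_lt hd
    exact ⟨2 ^ (0 + d), by ring⟩
  obtain ⟨w, hw⟩ := h2d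
  -- For `m < n` the small blocks along the western side have their centres at odd multiples of `2 ^
  -- m`, while those on the eastern side are shifted by an odd multiple and include one at height
  -- `0`.
  have left : (2 ^ (m + d) - 2 ^ m, 2 ^ m) ∈ levelQ f m := by
    have := levelQ_sub m d _ _ h0 (2 ^ d - 1) w (by omega) (by omega) (by omega) (by omega)
    convert this using 2
    · ring
    · rw [hw]; ring
  have right : (2 ^ (m + d) + 2 ^ m, 0) ∈ levelQ f m := by
    rcases lt_or_ge k w with hkw | hkw
    · have := levelQ_sub m d _ _ (hf.right 0) 0 (w - k - 1) (by omega) (by omega) (by omega) (by omega)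
      convert this using 2
      · ring
      · rw [e, hw]; ring
    · have := levelQ_sub m d _ _ (hf.right (-1)) 0 (w - k - 1 + 2 * w) (by omega) (by omega) (by omega)
        (by omega)
      convert this using 2
      · ring
      · rw [e, pow_add, hw]; ring
  have hm := h.level m
  -- The line of the large block at the origin meets the line of this small block, which therefore
  -- carries channel `3` too. In the mirror image it faces blocks of its own level shifted by half a
  -- block.
  have w1 : (f (2 ^ (m + d) + 2 ^ m, 0)).w = (f (0, 0)).e.mate := by
    refine hl.meet_ew hv h0 ?_ (hm.out _ _ right).2.2.2
    rw [← hm.endW hv right]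
    congr 3; ring
  have hm' := hm.view ⟨true, 0, (2 ^ (m + d) + 2 ^ m, 0)⟩
  have r1 : (0, 0) ∈ (⟨true, 0, (2 ^ (m + d) + 2 ^ m, 0)⟩ : LatticeIsom).pos ⁻¹' levelQ f m := by
    rw [mem_mirrorX]; simpa using right
  have r2 : (2 * 2 ^ m, 2 ^ m) ∈
      (⟨true, 0, (2 ^ (m + d) + 2 ^ m, 0)⟩ : LatticeIsom).pos ⁻¹' levelQ f m := by
    rw [mem_mirrorX]; convert left using 2 <;> ring
  rcases he with he | he
  · refine hm'.no_half_fault (hv.view _) r1 ?_ r2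
    rw [view_mirrorX]
    simp only [neg_zero, zero_add, Cell.flip]
    rw [w1, he]; rfl
  · refine hm'.no_half_fault' (hv.view _) r1 ?_ r2
    rw [view_mirrorX]
    simp only [neg_zero, zero_add, Cell.flip]
    rw [w1, he]; rfl

/-! ### Half-blocks of a level and their directions -/

/-- There is a half-block of level `n` in the frame `g`. -/
def H (f : ℤ × ℤ → Cell) (n : ℕ) (g : LatticeIsom) : Prop := HB f (2 ^ n) (levelQ f n) g

/-- The linear part of a lattice symmetry. -/
def LatticeIsom.lin (g : LatticeIsom) (d : ℤ × ℤ) : ℤ × ℤ := (⟨g.flip, g.turns, 0⟩ : LatticeIsom).pos d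

theorem LatticeIsom.pos_eq_lin (g : LatticeIsom) (p : ℤ × ℤ) : g.pos p = g.lin p + g.shift := by
  simp [lin, pos]

theorem LatticeIsom.lin_add (g : LatticeIsom) (p q : ℤ × ℤ) : g.lin (p + q) = g.lin p + g.lin q := by
  obtain ⟨b, k, u⟩ := g
  cases b <;> fin_cases k <;> simp [lin, pos, Nat.iterate, Prod.ext_iff] <;> (first | ring1 | (constructor <;> ring1))

theorem LatticeIsom.lin_smul (g : LatticeIsom) (r : ℤ) (p : ℤ × ℤ) : g.lin (r • p) = r • g.lin p := by
  obtain ⟨b, k, u⟩ := g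
  cases b <;> fin_cases k <;> simp [lin, pos, Nat.iterate, Prod.ext_iff]

theorem LatticeIsom.lin_comp (g h : LatticeIsom) (d : ℤ × ℤ) : (g.comp h).lin d = g.lin (h.lin d) := by
  have h1 := g.pos_comp h d
  rw [pos_eq_lin, pos_eq_lin g, pos_eq_lin h, lin_add, add_assoc] at h1
  have : (g.comp h).shift = g.lin h.shift + g.shift := by rw [← pos_eq_lin]; rfl
  rw [this] at h1
  exact add_right_cancel h1

theorem H_view {f : ℤ × ℤ → Cell} {n : ℕ} {g h : LatticeIsom} :
    H (view g f) n h ↔ H f n (g.comp h) := by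
  rw [H, H, levelQ_view, HB_view]

theorem view_id (f : ℤ × ℤ → Cell) : view ⟨false, 0, 0⟩ f = f := by
  funext p
  simp [view, LatticeIsom.pos, Cell.unmove, Nat.iterate, Cell.turn]

theorem H_id {f : ℤ × ℤ → Cell} {n : ℕ} :
    H f n ⟨false, 0, 0⟩ ↔ HalfBlock f (2 ^ n) (levelQ f n) := by
  have : (⟨false, 0, 0⟩ : LatticeIsom).pos = id := by
    funext p; simp [LatticeIsom.pos]
  rw [H, HB, view_id, this, Set.preimage_id]

theorem LatticeIsom.comp_id (g : LatticeIsom) : g.comp ⟨false, 0, 0⟩ = g := by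
  obtain ⟨b, k, u⟩ := g
  cases b <;> fin_cases k <;> simp [comp, pos, Nat.iterate]

theorem H_iff {f : ℤ × ℤ → Cell} {n : ℕ} {g : LatticeIsom} :
    H f n g ↔ HalfBlock (view g f) (2 ^ n) (levelQ (view g f) n) := by
  rw [← H_id, H_view, LatticeIsom.comp_id]

/-- A half-block is symmetric about its axis. Hence it has two frames, with the same centre and the
same direction. -/
theorem HalfBlock.flip {f : ℤ × ℤ → Cell} {s : ℤ} {Q : Set (ℤ × ℤ)} (h : HalfBlock f s Q) :
    HB f s Q ⟨true, 0, 0⟩ := by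
  obtain ⟨⟨h1, c1, e1⟩, ⟨h2, c2, e2⟩, ⟨h3, c3, e3⟩, ⟨h4, c4, e4⟩⟩ := h
  refine ⟨⟨?_, c2, ?_⟩, ⟨?_, c1, ?_⟩, ⟨?_, c4, ?_⟩, ⟨?_, c3, ?_⟩⟩
  all_goals
    first
      | simpa [LatticeIsom.pos, Nat.iterate]
      | simp [LatticeIsom.pos, Nat.iterate, view, Cell.unmove, Cell.move, *]

theorem H.flip {f : ℤ × ℤ → Cell} {n : ℕ} {g : LatticeIsom} (h : H f n g) :
    H f n (g.comp ⟨true, 0, 0⟩) := by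
  rw [← H_view]
  exact (H_iff.1 h).flip

theorem Cell.eq_tileB_of_e : ∀ c ∈ copies tileList, c.IsOut → c.n = ⟨true, 1, 3⟩ →
    Cell.unmove false 2 c = Cell.move false 3 (tileB c.cornered) := by decide +kernel

theorem Tiled.view {T : Set Cell} {f : ℤ × ℤ → Cell} (h : Tiled T f) (g : LatticeIsom) :
    Tiled T (view g f) := by
  have key : ∀ p, (DominoTiles.view g f p).cornered = (f (g.pos p)).cornered := by
    intro p
    obtain ⟨b, k, v⟩ := g
    cases b <;> fin_cases k <;>
      simp [DominoTiles.view, Cell.unmove, Cell.move, Cell.turn, Cell.flip, Nat.iterate]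
  refine ⟨h.toValid.view g, ?_, ?_⟩
  · intro x y x' y' h1 h2
    rw [key] at h1 h2
    revert h1 h2
    obtain ⟨b, k, u, v⟩ := g
    cases b <;> fin_cases k <;> simp [LatticeIsom.pos, Nat.iterate] <;> intro h1 h2 a b c d <;>
      have := h.sep _ _ _ _ h1 h2 (by omega) (by omega) (by omega) (by omega) <;> omega
  · intro x y
    -- Here `(x, y)` stands for the vertex north-east of that square, so a coordinate that changes
    -- sign is also shifted by one.
    have key2 : ∃ X Y : ℤ, ∀ x' y' : ℤ, x' - 1 ≤ X → X < x' + 1 → y' - 1 ≤ Y → Y < y' + 1 →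
        (g.inv.pos (x', y')).1 - 1 ≤ x ∧ x < (g.inv.pos (x', y')).1 + 1 ∧
        (g.inv.pos (x', y')).2 - 1 ≤ y ∧ y < (g.inv.pos (x', y')).2 + 1 := by
      obtain ⟨b, k, u, v⟩ := g
      cases b <;> fin_cases k <;> simp [LatticeIsom.inv, LatticeIsom.pos, Nat.iterate]
      · exact ⟨x + u, y + v, fun x' y' a b c d => by omega⟩
      · exact ⟨y + u, -x - 1 + v, fun x' y' a b c d => by omega⟩
      · exact ⟨-x - 1 + u, -y - 1 + v, fun x' y' a b c d => by omega⟩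
      · exact ⟨-y - 1 + u, x + v, fun x' y' a b c d => by omega⟩
      · exact ⟨-x - 1 + u, y + v, fun x' y' a b c d => by omega⟩
      · exact ⟨y + u, x + v, fun x' y' a b c d => by omega⟩
      · exact ⟨x + u, -y - 1 + v, fun x' y' a b c d => by omega⟩
      · exact ⟨-y - 1 + u, -x - 1 + v, fun x' y' a b c d => by omega⟩
    obtain ⟨X, Y, hXY⟩ := key2
    obtain ⟨x', y', h0, h1, h2, h3, h4⟩ := h.cov X Y
    refine ⟨(g.inv.pos (x', y')).1, (g.inv.pos (x', y')).2, ?_, hXY x' y' h1 h2 h3 h4⟩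
    rw [key, Prod.mk.eta, LatticeIsom.pos_inv]
    exact h0

/-- One edge in channel `3` is enough: it leads to a copy of `tileB`, which determines its
half-block, seen after a half turn. -/
theorem Tiled.partner_aux {f : ℤ × ℤ → Cell} (h : Tiled tiles1 f) {n : ℕ}
    (hb : HalfBlock f (2 ^ n) (levelQ f n)) : H f n ⟨false, 2, (0, -4 * 2 ^ n)⟩ := by
  obtain ⟨-, -, -, ⟨h4, c4, e4⟩⟩ := hb
  have hl := h.level n
  have q : (-2 ^ n, -3 * 2 ^ n) ∈ levelQ f n := by
    have := (h.view ⟨false, 1, (-2 ^ n, -2 ^ n)⟩).aligned_of_chan_three (n := n)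
      (by rw [levelQ_view]; simpa [LatticeIsom.pos] using h4)
      (Or.inr (by
        simp [DominoTiles.view, LatticeIsom.pos, e4, Cell.unmove, Nat.iterate, Cell.turn, tileB,
          Cell.flip, Marking.reflect, Cell.move]))
    rw [levelQ_view] at this
    simp [LatticeIsom.pos] at this
    convert this using 2; ring
  rw [H_iff]
  have h' := h.view ⟨false, 2, (0, -4 * 2 ^ n)⟩
  refine (h'.level n).halfBlock_of_tileB h'.toValid ?_ (c := (f (-2 ^ n, -3 * 2 ^ n)).cornered) ?_
  · rw [levelQ_view]
    simp [LatticeIsom.pos]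
    convert q using 2; ring
  · have e : (⟨false, 2, (0, -4 * 2 ^ n)⟩ : LatticeIsom).pos (2 ^ n, -2 ^ n) = (-2 ^ n, -3 * 2 ^ n) := by
      simp [LatticeIsom.pos]; ring
    simp only [DominoTiles.view, e]
    refine Cell.eq_tileB_of_e _ (h.mem_copies _) (hl.out _ _ q) ?_
    have := hl.linkS h.toValid h4 q (by ring)
    rw [e4] at this
    exact this

theorem Tiled.partner {f : ℤ × ℤ → Cell} (h : Tiled tiles1 f) {n : ℕ} {g : LatticeIsom}
    (hb : H f n g) : H f n (g.comp ⟨false, 2, (0, -4 * 2 ^ n)⟩) := by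
  rw [← H_view]
  exact (h.view g).partner_aux (H_iff.1 hb)

/-- The tile has an edge in channel `3`. -/
def Cell.HasThree (c : Cell) : Prop := c.n.chan = 3 ∨ c.e.chan = 3 ∨ c.s.chan = 3 ∨ c.w.chan = 3

theorem Cell.unmove_hasThree (b : Bool) (k : Fin 4) (c : Cell) :
    (Cell.unmove b k c).HasThree ↔ c.HasThree := by
  obtain ⟨c, m1, m2, m3, m4⟩ := c
  cases b <;> fin_cases k <;>
    simp [Cell.unmove, Cell.HasThree, Cell.move, Cell.flip, Cell.turn, Nat.iterate, Marking.reflect] <;>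
    tauto

/-- Among the four tiles of a half-block, exactly the two on the open side have an edge in channel
`3`. -/
theorem HalfBlock.dir_unique {f : ℤ × ℤ → Cell} {s : ℤ} {Q : Set (ℤ × ℤ)} (h : HalfBlock f s Q)
    {b : Bool} {k : Fin 4} (h' : HB f s Q ⟨b, k, 0⟩) :
    (⟨b, k, 0⟩ : LatticeIsom).pos (0, -1) = (0, -1) := by
  obtain ⟨-, -, ⟨-, c3, e3⟩, ⟨-, c4, e4⟩⟩ := h'
  obtain ⟨⟨-, c1, e1⟩, ⟨-, c2, e2⟩, -, -⟩ := h
  have t3 : (f ((⟨b, k, 0⟩ : LatticeIsom).pos (s, -s))).HasThree := by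
    rw [← Cell.unmove_hasThree b k]
    change (view ⟨b, k, 0⟩ f (s, -s)).HasThree
    rw [e3]; simp [Cell.HasThree, tileB, Cell.move, Nat.iterate, Cell.turn]
  have t4 : (f ((⟨b, k, 0⟩ : LatticeIsom).pos (-s, -s))).HasThree := by
    rw [← Cell.unmove_hasThree b k]
    change (view ⟨b, k, 0⟩ f (-s, -s)).HasThree
    rw [e4]; simp [Cell.HasThree, tileB, Cell.move, Nat.iterate, Cell.turn, Cell.flip, Marking.reflect]
  have t1 : ¬ (f (s, s)).HasThree := by rw [e1]; simp [Cell.HasThree, tileA, plainOut]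
  have t2 : ¬ (f (-s, s)).HasThree := by
    rw [e2]; simp [Cell.HasThree, tileA, plainOut, Cell.flip, Marking.reflect]
  revert t3 t4
  cases b <;> fin_cases k <;> simp [LatticeIsom.pos, Nat.iterate, t1, t2]

theorem H.dir_unique {f : ℤ × ℤ → Cell} {n : ℕ} {g g' : LatticeIsom} (h : H f n g) (h' : H f n g')
    (e : g.shift = g'.shift) : g.lin (0, -1) = g'.lin (0, -1) := by
  have e0 : (g.inv.comp g').shift = 0 := by
    change g.inv.pos g'.shift = 0
    rw [← e, ← g.pos_zero, g.inv_pos]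
  have e1 : g.pos ((g.inv.comp g').pos (0, -1)) = g'.pos (0, -1) := by
    rw [LatticeIsom.pos_comp, LatticeIsom.pos_inv]
  have e2 : (g.inv.comp g').pos (0, -1) = (0, -1) := by
    have h2 : H f n (g.comp (g.inv.comp g')) := HB_inv_comp.2 h'
    rw [← H_view] at h2
    generalize g.inv.comp g' = k at *
    obtain ⟨b, k, v⟩ := k
    subst e0
    exact (H_iff.1 h).dir_unique h2
  rw [e2, g.pos_eq_lin, g'.pos_eq_lin, e] at e1
  exact add_right_cancel e1

/-- There is a half-block of level `n` with centre `q`, whose partner is in direction `d`. -/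
def Pt (f : ℤ × ℤ → Cell) (n : ℕ) (q d : ℤ × ℤ) : Prop :=
  ∃ g : LatticeIsom, H f n g ∧ g.shift = q ∧ g.lin (0, -1) = d

section
variable {f : ℤ × ℤ → Cell} {n : ℕ} {q d : ℤ × ℤ}

theorem exists_pt (hq : q ∈ levelQ f (n + 1)) :
    ∃ g : LatticeIsom, H f n g ∧ g.shift = q := by
  obtain ⟨b, k, h⟩ := hq
  exact ⟨_, h, rfl⟩

theorem Pt.mem (h : Pt f n q d) : q ∈ levelQ f (n + 1) := by
  obtain ⟨g, h1, rfl, -⟩ := h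
  exact h1.mem

theorem Pt.unique {d' : ℤ × ℤ} (h : Pt f n q d) (h' : Pt f n q d') : d = d' := by
  obtain ⟨g, h1, h2, rfl⟩ := h
  obtain ⟨g', h1', h2', rfl⟩ := h'
  exact h1.dir_unique h1' (h2.trans h2'.symm)

/-- The shift and the image of one direction determine a lattice symmetry up to the reflection in
`H.flip`, so every frame that points the right way is a frame of the half-block. -/
theorem Pt.frame (h : Pt f n q d) {g : LatticeIsom} (hq : g.shift = q) (hd : g.lin (0, -1) = d) :
    H f n g := by
  obtain ⟨g', h1, h2, h3⟩ := h
  have h4 := h1.flip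
  obtain ⟨b, k, u⟩ := g
  obtain ⟨b', k', u'⟩ := g'
  obtain rfl : u = u' := hq.trans h2.symm
  subst hd
  revert h3 h1 h4
  cases b <;> cases b' <;> fin_cases k <;> fin_cases k' <;>
    simp [LatticeIsom.lin, LatticeIsom.pos, Nat.iterate, LatticeIsom.comp] <;>
    (try simp only [Prod.mk_zero_zero, zero_add]) <;> tauto

theorem pt_view {g : LatticeIsom} : Pt (view g f) n q d ↔ Pt f n (g.pos q) (g.lin d) := by
  constructor
  · rintro ⟨h, h1, rfl, rfl⟩
    rw [H_view] at h1
    exact ⟨_, h1, rfl, LatticeIsom.lin_comp _ _ _⟩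
  · rintro ⟨h, h1, h2, h3⟩
    have h4 : H f n (g.comp (g.inv.comp h)) := HB_inv_comp.2 h1
    rw [← H_view] at h4
    refine ⟨_, h4, ?_, ?_⟩
    · change g.inv.pos h.shift = q
      rw [h2, LatticeIsom.inv_pos]
    · have : g.lin ((g.inv.comp h).lin (0, -1)) = g.lin d := by
        rw [← h3, LatticeIsom.lin_comp]
        have := g.pos_inv (h.lin (0, -1) + g.shift)
        rw [LatticeIsom.pos_eq_lin] at this
        have e : g.inv.pos (h.lin (0, -1) + g.shift) = g.inv.lin (h.lin (0, -1)) := by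
          rw [LatticeIsom.pos_eq_lin, LatticeIsom.lin_add, add_assoc, ← LatticeIsom.pos_eq_lin,
            ← g.pos_zero, LatticeIsom.inv_pos, add_zero]
        rw [e] at this
        exact add_right_cancel this
      have := congrArg (fun p => g.inv.pos (p + g.shift)) this
      simpa only [← LatticeIsom.pos_eq_lin, LatticeIsom.inv_pos] using this

theorem Tiled.pt_partner (hf : Tiled tiles1 f) (h : Pt f n q d) : Pt f n (q + (4 * 2 ^ n : ℤ) • d) (-d) := by
  obtain ⟨g, h1, rfl, rfl⟩ := h
  refine ⟨_, hf.partner h1, ?_, ?_⟩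
  · change g.pos (0, -4 * 2 ^ n) = _
    rw [LatticeIsom.pos_eq_lin, ← LatticeIsom.lin_smul, add_comm]
    simp
  · have e : (⟨false, 2, (0, -4 * 2 ^ n)⟩ : LatticeIsom).lin (0, -1) = (-1 : ℤ) • (0, -1) := by
      simp [LatticeIsom.lin, LatticeIsom.pos]
    rw [LatticeIsom.lin_comp, e, LatticeIsom.lin_smul, neg_one_smul]

end

/-! ### Key tiles and the roles of half-blocks -/

/-- The channels of vertical markings that cross horizontal markings in channel `0`. -/
def keyN (T : Set Cell) (c : Fin 4) : Prop :=
  c = 2 ∧ cross .zero .two ∈ T ∨ c = 3 ∧ cross .zero .three ∈ T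

/-- The channels of vertical markings that cross horizontal markings in channels `1` and `2`. -/
def keyE (T : Set Cell) (c : Fin 4) : Prop :=
  c = 0 ∧ cross .one .zero ∈ T ∨ c = 1 ∧ cross .one .one ∈ T ∨ c = 2 ∧ cross .one .two ∈ T ∨
    c = 3 ∧ cross .one .three ∈ T

/-- Since `[00]` and `[01]` are not among the tiles, a signed arrow crosses channel `0` in channel
`2` or `3` only. In `key_one` all four channels are possible, but the sign of the passing marking is
prescribed. -/
theorem key_zero : ∀ t ∈ tileList, ∀ b k, (Cell.move b k t).w = ⟨false, -1, 0⟩ →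
    (Cell.move b k t).e = ⟨false, 1, 0⟩ → (Cell.move b k t).s.out = false →
    (Cell.move b k t).s.side = 0 ∨ (Cell.move b k t).s.chan = 2 ∧ t = cross .zero .two ∨
      (Cell.move b k t).s.chan = 3 ∧ t = cross .zero .three := by decide +kernel

theorem key_one : ∀ t ∈ tileList, ∀ b k, (Cell.move b k t).n = ⟨false, -1, 1⟩ →
    (Cell.move b k t).s = ⟨false, 1, 2⟩ →
    (Cell.move b k t).w.side = 0 ∨ (Cell.move b k t).w.side = -1 ∧
      ((Cell.move b k t).w.chan = 0 ∧ t = cross .one .zero ∨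
      (Cell.move b k t).w.chan = 1 ∧ t = cross .one .one ∨
      (Cell.move b k t).w.chan = 2 ∧ t = cross .one .two ∨
      (Cell.move b k t).w.chan = 3 ∧ t = cross .one .three) := by decide +kernel

/-- The conditions on the outward tile in the centre of a half-block. -/
structure CenterCond (T : Set Cell) (c : Cell) : Prop where
  n : c.n.side = 0 ∨ keyN T c.n.chan
  e : c.e.side = 0 ∨ c.e.side = 1 ∧ keyE T c.e.chan
  w : c.w.side = 0 ∨ c.w.side = -1 ∧ keyE T c.w.chan

section
variable {T : Set Cell} {f : ℤ × ℤ → Cell} {s : ℤ} {Q : Set (ℤ × ℤ)}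

theorem HalfBlock.north_cell (hv : Valid tiles1 f) (h : Level f s Q) (hb : HalfBlock f s Q) :
    (f (0, s)).w = ⟨false, -1, 0⟩ ∧ (f (0, s)).e = ⟨false, 1, 0⟩ ∧ (f (0, s)).s = (f (0, 0)).n.opp := by
  have hs := h.pos
  have := hb.column_eq hv h (y := 0) (y' := s) hs (by omega) (by omega) (by omega)
  obtain ⟨⟨h1, c1, e1⟩, ⟨h2, c2, e2⟩, -, -⟩ := hb
  have a := h.endE hv h2
  have b := h.endW hv h1
  rw [e2, neg_add_cancel] at a
  rw [e1, sub_self] at b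
  exact ⟨a, b, by rw [this, Marking.opp_opp]⟩

theorem HalfBlock.east_cell (hv : Valid tiles1 f) (h : Level f s Q) (hb : HalfBlock f s Q) :
    (f (s, 0)).n = ⟨false, -1, 1⟩ ∧ (f (s, 0)).s = ⟨false, 1, 2⟩ ∧ (f (s, 0)).w = (f (0, 0)).e.opp := by
  have hs := h.pos
  obtain ⟨a, b⟩ := hb.east hv h
  refine ⟨a, b, ?_⟩
  rw [hb.row_eq hv h (x := 0) (x' := s) hs (by omega) (by omega) (by omega), Marking.opp_opp]

theorem HalfBlock.west_cell (hv : Valid tiles1 f) (h : Level f s Q) (hb : HalfBlock f s Q) :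
    (f (-s, 0)).n = ⟨false, 1, 1⟩ ∧ (f (-s, 0)).s = ⟨false, -1, 2⟩ ∧
      (f (-s, 0)).e = (f (0, 0)).w.opp := by
  have hs := h.pos
  obtain ⟨a, b⟩ := hb.west hv h
  exact ⟨a, b, hb.row_eq hv h (x := -s) (x' := 0) (by omega) (by omega) (by omega) (by omega)⟩

theorem SignType.neg_eq_iff (a b : SignType) : -a = b ↔ a = -b := by
  revert a b; decide

/-- The lines from the centre to the north, east and west each cross a line joining two of the four
blocks, and the square of the crossing holds a tile of `T`. The south is open and imposes nothing.
-/
theorem HalfBlock.centerCond (hT : T ⊆ tiles1) (hv' : Valid T f) (h : Level f s Q)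
    (hb : HalfBlock f s Q) : CenterCond T (f (0, 0)) := by
  have hv := hv'.mono hT
  have ho := hb.center hv h
  refine ⟨?_, ?_, ?_⟩
  · obtain ⟨a, b, c⟩ := hb.north_cell hv h
    obtain ⟨t, ht, fl, k, e⟩ := hv'.mem (0, s)
    rw [e] at a b c
    have := key_zero t (mem_tileList_of_mem (hT ht)) fl k a b (by rw [c]; simp [ho.1])
    rw [c] at this
    simp only [Marking.opp, SignType.neg_eq_iff] at this
    rcases this with h1 | ⟨h1, rfl⟩ | ⟨h1, rfl⟩
    · exact Or.inl (by simpa using h1)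
    · exact Or.inr (Or.inl ⟨h1, ht⟩)
    · exact Or.inr (Or.inr ⟨h1, ht⟩)
  · obtain ⟨a, b, c⟩ := hb.east_cell hv h
    obtain ⟨t, ht, fl, k, e⟩ := hv'.mem (s, 0)
    rw [e] at a b c
    have := key_one t (mem_tileList_of_mem (hT ht)) fl k a b
    rw [c] at this
    simp only [Marking.opp, SignType.neg_eq_iff] at this
    rcases this with h1 | ⟨h0, h1⟩
    · exact Or.inl (by simpa using h1)
    · refine Or.inr ⟨by simpa using h0, ?_⟩
      rcases h1 with ⟨h1, rfl⟩ | ⟨h1, rfl⟩ | ⟨h1, rfl⟩ | ⟨h1, rfl⟩ <;> simp [keyE, h1, ht]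
  · obtain ⟨a, b, c⟩ := hb.west_cell hv h
    -- `key_one` describes the eastern line of a half-block; the western one is its mirror image.
    obtain ⟨t, ht, e⟩ := flip_mem_oriented (hv'.mem (-s, 0))
    obtain ⟨fl, k, e⟩ := e
    have := key_one t (mem_tileList_of_mem (hT ht)) fl k (by rw [← e]; simp [Cell.flip, a]; rfl)
      (by rw [← e]; simp [Cell.flip, b]; rfl)
    rw [← e] at this
    simp only [Cell.flip, c, Marking.opp, Marking.reflect, neg_neg] at this
    rcases this with h1 | ⟨h0, h1⟩
    · exact Or.inl (by simpa using h1)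
    · refine Or.inr ⟨by simpa using h0, ?_⟩
      rcases h1 with ⟨h1, rfl⟩ | ⟨h1, rfl⟩ | ⟨h1, rfl⟩ | ⟨h1, rfl⟩ <;> simp [keyE, h1, ht]

end

/-- The tile is in the north-eastern position of a larger half-block, with signed edges to the west
and the south. Of the orientations of the smaller half-block around it, only those remain that let
one of these edges out through the open side, and the other edge then needs its key tile. -/
theorem CenterCond.tileA {T : Set Cell} (g : LatticeIsom) {c : Bool}
    (h : CenterCond T (Cell.unmove g.flip g.turns (tileA c))) :
    g.lin (0, -1) = (0, -1) ∧ keyE T 0 ∨ g.lin (0, -1) = (-1, 0) ∧ keyE T 1 := by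
  obtain ⟨h1, h2, h3⟩ := h
  obtain ⟨b, k, u⟩ := g
  revert h1 h2 h3
  cases b <;> fin_cases k <;>
    simp [LatticeIsom.lin, LatticeIsom.pos, Nat.iterate, Cell.unmove, Cell.move, Cell.turn, Cell.flip,
      DominoTiles.tileA, keyN, plainOut, Marking.reflect]

theorem CenterCond.tileA_flip {T : Set Cell} (g : LatticeIsom) {c : Bool}
    (h : CenterCond T (Cell.unmove g.flip g.turns (DominoTiles.tileA c).flip)) :
    g.lin (0, -1) = (0, -1) ∧ keyE T 0 ∨ g.lin (0, -1) = (1, 0) ∧ keyE T 1 := by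
  obtain ⟨h1, h2, h3⟩ := h
  obtain ⟨b, k, u⟩ := g
  revert h1 h2 h3
  cases b <;> fin_cases k <;>
    simp [LatticeIsom.lin, LatticeIsom.pos, Nat.iterate, Cell.unmove, Cell.move, Cell.turn, Cell.flip,
      DominoTiles.tileA, keyN, plainOut, Marking.reflect]

/-- The signed edges are opposite to each other here. Either one of them leaves through the open
side and the other crosses channel `0`, or the half-block opens sideways and both cross lateral
lines; then the signs decide between the two lateral directions. -/
theorem CenterCond.tileB {T : Set Cell} (g : LatticeIsom) {c : Bool}
    (h : CenterCond T (Cell.unmove g.flip g.turns (Cell.move false 3 (tileB c)))) :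
    g.lin (0, -1) = (0, 1) ∧ keyN T 3 ∨ g.lin (0, -1) = (0, -1) ∧ keyN T 2 ∨
      g.lin (0, -1) = (-1, 0) ∧ keyE T 2 ∧ keyE T 3 := by
  obtain ⟨h1, h2, h3⟩ := h
  obtain ⟨b, k, u⟩ := g
  revert h1 h2 h3
  cases b <;> fin_cases k <;>
    simp [LatticeIsom.lin, LatticeIsom.pos, Nat.iterate, Cell.unmove, Cell.move, Cell.turn, Cell.flip,
      DominoTiles.tileB, plainOut, Marking.reflect] <;> tauto

theorem CenterCond.tileB_flip {T : Set Cell} (g : LatticeIsom) {c : Bool}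
    (h : CenterCond T (Cell.unmove g.flip g.turns (Cell.move false 3 (DominoTiles.tileB c)).flip)) :
    g.lin (0, -1) = (0, 1) ∧ keyN T 3 ∨ g.lin (0, -1) = (0, -1) ∧ keyN T 2 ∨
      g.lin (0, -1) = (1, 0) ∧ keyE T 2 ∧ keyE T 3 := by
  obtain ⟨h1, h2, h3⟩ := h
  obtain ⟨b, k, u⟩ := g
  revert h1 h2 h3
  cases b <;> fin_cases k <;>
    simp [LatticeIsom.lin, LatticeIsom.pos, Nat.iterate, Cell.unmove, Cell.move, Cell.turn, Cell.flip,
      DominoTiles.tileB, plainOut, Marking.reflect] <;> tauto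

section
variable {T : Set Cell} {f : ℤ × ℤ → Cell} {n : ℕ}

/-- In the square around the origin, two children point to the south. -/
def RoleP (f : ℤ × ℤ → Cell) (n : ℕ) : Prop :=
  let s : ℤ := 2 ^ (n + 1)
  Pt f n (s, s) (0, -1) ∧ Pt f n (-s, s) (0, -1) ∧ Pt f n (s, -s) (0, 1) ∧ Pt f n (-s, -s) (0, 1)

/-- In the square around the origin, two children point to the east. -/
def RoleU (f : ℤ × ℤ → Cell) (n : ℕ) : Prop :=
  let s : ℤ := 2 ^ (n + 1)
  Pt f n (s, s) (-1, 0) ∧ Pt f n (-s, s) (1, 0) ∧ Pt f n (s, -s) (-1, 0) ∧ Pt f n (-s, -s) (1, 0)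

/-- In the square around the origin, one child points to the east and two are shared with the
square to the south. -/
def RoleM (f : ℤ × ℤ → Cell) (n : ℕ) : Prop :=
  let s : ℤ := 2 ^ (n + 1)
  Pt f n (s, s) (-1, 0) ∧ Pt f n (-s, s) (1, 0) ∧ Pt f n (s, -s) (0, -1) ∧ Pt f n (-s, -s) (0, -1)

theorem Tiled.view_zero_cond (hT : T ⊆ tiles1) (hf : Tiled T f) {g : LatticeIsom} (h : H f n g) :
    CenterCond T (Cell.unmove g.flip g.turns (f g.shift)) := by
  have := (H_iff.1 h).centerCond hT (hf.toValid.view g) (((hf.mono hT).view g).level n)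
  rw [← g.pos_zero]
  exact this

/-- A child that opens towards another child of the same square is the partner of that child, so the
latter opens back. This leaves three of the combinations that `CenterCond` allows. -/
theorem Tiled.role (hT : T ⊆ tiles1) (hf : Tiled T f)
    (hb : HalfBlock f (2 ^ (n + 1)) (levelQ f (n + 1))) :
    RoleP f n ∧ keyE T 0 ∧ keyN T 3 ∨ RoleU f n ∧ keyE T 1 ∧ keyE T 2 ∧ keyE T 3 ∨
      RoleM f n ∧ keyE T 1 ∧ keyN T 2 := by
  have ht := hf.mono hT
  obtain ⟨⟨h1, c1, e1⟩, ⟨h2, c2, e2⟩, ⟨h3, c3, e3⟩, ⟨h4, c4, e4⟩⟩ := hb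
  obtain ⟨g1, p1, s1⟩ := exists_pt h1
  obtain ⟨g2, p2, s2⟩ := exists_pt h2
  obtain ⟨g3, p3, s3⟩ := exists_pt h3
  obtain ⟨g4, p4, s4⟩ := exists_pt h4
  have d1 := hf.view_zero_cond hT p1
  have d2 := hf.view_zero_cond hT p2
  have d3 := hf.view_zero_cond hT p3
  have d4 := hf.view_zero_cond hT p4
  rw [s1, e1] at d1
  rw [s2, e2] at d2
  rw [s3, e3] at d3
  rw [s4, e4] at d4
  replace d1 := d1.tileA
  replace d2 := d2.tileA_flip
  replace d3 := d3.tileB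
  replace d4 := d4.tileB_flip
  have P1 : Pt f n _ _ := ⟨g1, p1, s1, rfl⟩
  have P2 : Pt f n _ _ := ⟨g2, p2, s2, rfl⟩
  have P3 : Pt f n _ _ := ⟨g3, p3, s3, rfl⟩
  have P4 : Pt f n _ _ := ⟨g4, p4, s4, rfl⟩
  generalize g1.lin (0, -1) = D1 at *
  generalize g2.lin (0, -1) = D2 at *
  generalize g3.lin (0, -1) = D3 at *
  generalize g4.lin (0, -1) = D4 at *
  have R1 := ht.pt_partner P1
  have R2 := ht.pt_partner P2
  have R3 := ht.pt_partner P3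
  have R4 := ht.pt_partner P4
  have u1 : D1 = (-1, 0) → D2 = (1, 0) := by
    rintro rfl
    refine P2.unique ?_
    convert R1 using 1 <;> simp; ring
  have u2 : D2 = (1, 0) → D1 = (-1, 0) := by
    rintro rfl
    refine P1.unique ?_
    convert R2 using 1 <;> simp; ring
  have u3 : D1 = (0, -1) → D3 = (0, 1) := by
    rintro rfl
    refine P3.unique ?_
    convert R1 using 1 <;> simp; ring
  have u4 : D3 = (0, 1) → D1 = (0, -1) := by
    rintro rfl
    refine P1.unique ?_
    convert R3 using 1 <;> simp; ring
  have u5 : D2 = (0, -1) → D4 = (0, 1) := by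
    rintro rfl
    refine P4.unique ?_
    convert R2 using 1 <;> simp; ring
  have u6 : D4 = (0, 1) → D2 = (0, -1) := by
    rintro rfl
    refine P2.unique ?_
    convert R4 using 1 <;> simp; ring
  have u7 : D3 = (-1, 0) → D4 = (1, 0) := by
    rintro rfl
    refine P4.unique ?_
    convert R3 using 1 <;> simp; ring
  have u8 : D4 = (1, 0) → D3 = (-1, 0) := by
    rintro rfl
    refine P3.unique ?_
    convert R4 using 1 <;> simp; ring
  rcases d1 with ⟨e1, k1⟩ | ⟨e1, k1⟩
  · rcases d2 with ⟨e2, k2⟩ | ⟨e2, k2⟩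
    · have e3 := u3 e1
      have e4 := u5 e2
      rw [e3] at d3
      subst e1 e2 e3 e4
      refine Or.inl ⟨⟨P1, P2, P3, P4⟩, k1, ?_⟩
      simpa using d3
    · have := e1.symm.trans (u2 e2)
      simp at this
  · have e2 := u1 e1
    rcases d3 with ⟨e3, k3⟩ | ⟨e3, k3⟩ | ⟨e3, k3, k3'⟩
    · have := e1.symm.trans (u4 e3)
      simp at this
    · rcases d4 with ⟨e4, k4⟩ | ⟨e4, k4⟩ | ⟨e4, k4, k4'⟩
      · have := e2.symm.trans (u6 e4)
        simp at this
      · subst e1 e2 e3 e4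
        exact Or.inr (Or.inr ⟨⟨P1, P2, P3, P4⟩, k1, k3⟩)
      · have := e3.symm.trans (u8 e4)
        simp at this
    · have e4 := u7 e3
      subst e1 e2 e3 e4
      exact Or.inr (Or.inl ⟨⟨P1, P2, P3, P4⟩, k1, k3, k3'⟩)

/-! ### Dominoes of a level and their children -/

/-- There is a domino of level `n` with centre `c` and long direction `a`. -/
def Dom (f : ℤ × ℤ → Cell) (n : ℕ) (c a : ℤ × ℤ) : Prop := Pt f n (c - (2 ^ (n + 1) : ℤ) • a) a

theorem dom_view {g : LatticeIsom} {c a : ℤ × ℤ} :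
    Dom (view g f) n c a ↔ Dom f n (g.pos c) (g.lin a) := by
  rw [Dom, Dom, pt_view]
  have : g.pos (c - (2 ^ (n + 1) : ℤ) • a) = g.pos c - (2 ^ (n + 1) : ℤ) • g.lin a := by
    rw [g.pos_eq_lin, sub_eq_add_neg, ← neg_smul, g.lin_add, g.lin_smul, g.pos_eq_lin]
    simp only [neg_smul]; abel
  rw [this]

theorem Tiled.dom_iff (hf : Tiled tiles1 f) {c a : ℤ × ℤ} :
    Dom f n c a ↔ Pt f n (c + (2 ^ (n + 1) : ℤ) • a) (-a) := by
  have e : (4 * 2 ^ n : ℤ) = 2 ^ (n + 1) + 2 ^ (n + 1) := by ring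
  constructor
  · intro h
    have := hf.pt_partner h
    rw [e] at this
    convert this using 1
    rw [add_smul]; abel
  · intro h
    have := hf.pt_partner h
    rw [e, neg_neg] at this
    rw [Dom]
    convert this using 1
    rw [add_smul, smul_neg]; abel

theorem Tiled.dom_neg (hf : Tiled tiles1 f) {c a : ℤ × ℤ} : Dom f n c (-a) ↔ Dom f n c a := by
  rw [hf.dom_iff (c := c) (a := a), Dom]
  simp

/-- Centres and directions of the children of a horizontal domino, in units of half of the width
of a child. -/
def tablePat : List ((ℤ × ℤ) × (ℤ × ℤ)) :=
  [((-3, 0), (0, 1)), ((0, 1), (1, 0)), ((0, -1), (1, 0)), ((3, 0), (0, 1))]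
def parallelPat : List ((ℤ × ℤ) × (ℤ × ℤ)) :=
  [((-2, 1), (1, 0)), ((2, 1), (1, 0)), ((-2, -1), (1, 0)), ((2, -1), (1, 0))]
def perpPat : List ((ℤ × ℤ) × (ℤ × ℤ)) :=
  [((-3, 0), (0, 1)), ((-1, 0), (0, 1)), ((1, 0), (0, 1)), ((3, 0), (0, 1))]
def asymPat : List ((ℤ × ℤ) × (ℤ × ℤ)) :=
  [((-2, 1), (1, 0)), ((-2, -1), (1, 0)), ((1, 0), (0, 1)), ((3, 0), (0, 1))]

/-- The horizontal domino of level `n + 1` at the origin has the given children. -/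
def Children (f : ℤ × ℤ → Cell) (n : ℕ) (K : List ((ℤ × ℤ) × (ℤ × ℤ))) : Prop :=
  ∀ x ∈ K, Dom f n ((2 ^ (n + 1) : ℤ) • x.1) x.2

theorem pt_congr {q q' d d' : ℤ × ℤ} (h : Pt f n q d) (hq : q = q') (hd : d = d') : Pt f n q' d' :=
  hq ▸ hd ▸ h

/-- The patterns of the children of a domino. -/
theorem Tiled.children (hT : T ⊆ tiles1) (hf : Tiled T f) (hd : Dom f (n + 1) (0, 0) (1, 0)) :
    Children f n tablePat ∧ keyE T 1 ∧ keyN T 2 ∨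
    Children f n parallelPat ∧ keyE T 0 ∧ keyN T 3 ∨
    Children f n perpPat ∧ keyE T 1 ∧ keyE T 2 ∧ keyE T 3 ∨
    (RoleP (DominoTiles.view ⟨false, 3, (-2 * 2 ^ (n + 1), 0)⟩ f) n ∧
      RoleU (DominoTiles.view ⟨false, 1, (2 * 2 ^ (n + 1), 0)⟩ f) n ∨
     RoleU (DominoTiles.view ⟨false, 3, (-2 * 2 ^ (n + 1), 0)⟩ f) n ∧
      RoleP (DominoTiles.view ⟨false, 1, (2 * 2 ^ (n + 1), 0)⟩ f) n) ∧
     keyE T 0 ∧ keyE T 1 ∧ keyE T 2 ∧ keyE T 3 ∧ keyN T 3 := by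
  have ht := hf.mono hT
  have hE := (ht.dom_iff.1 hd).frame (g := ⟨false, 1, (2 * 2 ^ (n + 1), 0)⟩)
    (by simp; ring) (by simp [LatticeIsom.lin, LatticeIsom.pos])
  have hW := Pt.frame hd (g := ⟨false, 3, (-2 * 2 ^ (n + 1), 0)⟩)
    (by simp; ring) (by simp [LatticeIsom.lin, LatticeIsom.pos])
  have rE := (hf.view _).role hT (H_iff.1 hE)
  have rW := (hf.view _).role hT (H_iff.1 hW)
  have dom : ∀ {q d c a : ℤ × ℤ}, Pt f n q d → (d = a ∧ q = c - (2 ^ (n + 1) : ℤ) • a) ∨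
      (d = -a ∧ q = c + (2 ^ (n + 1) : ℤ) • a) → Dom f n c a := by
    rintro q d c a h (⟨rfl, rfl⟩ | ⟨rfl, rfl⟩)
    · exact h
    · exact ht.dom_iff.2 h
  -- In the role `RoleM` two children seek their partners in the other half of the domino, so the
  -- other half must contain children that look back.
  have clash : ∀ {q d q' d' : ℤ × ℤ}, Pt f n q d → Pt f n q' d' →
      (q' = q + (2 * 2 ^ (n + 1) : ℤ) • d ∧ -d ≠ d') → False := by
    rintro q d q' d' h h' ⟨rfl, h2⟩
    refine h2 (Pt.unique ?_ h')
    have := ht.pt_partner h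
    convert this using 2
    ring_nf
  have ch : ∀ K, (∀ x ∈ K, Dom f n ((2 ^ (n + 1) : ℤ) • x.1) x.2) → Children f n K := fun K h => h
  simp only [RoleP, RoleU, RoleM, pt_view, LatticeIsom.lin, LatticeIsom.pos] at rE rW ⊢
  have e2 : (2 : ℤ) ^ (n + 1) = 2 ^ n * 2 := pow_succ _ _
  generalize (2 : ℤ) ^ (n + 1) = s at *
  simp [Nat.iterate] at rE rW ⊢
  rcases rW with ⟨⟨w1, w2, w3, w4⟩, kW⟩ | ⟨⟨w1, w2, w3, w4⟩, kW⟩ | ⟨⟨w1, w2, w3, w4⟩, kW⟩ <;>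
    rcases rE with ⟨⟨r1, r2, r3, r4⟩, kE⟩ | ⟨⟨r1, r2, r3, r4⟩, kE⟩ | ⟨⟨r1, r2, r3, r4⟩, kE⟩
  · refine Or.inr (Or.inl ⟨ch _ ?_, kW⟩)
    simp only [parallelPat, List.forall_mem_cons]
    exact ⟨dom w1 (by simp; ring), dom r2 (by simp; ring), dom w2 (by simp; ring),
      dom r1 (by simp; ring), by simp⟩
  · exact Or.inr (Or.inr (Or.inr ⟨Or.inl ⟨⟨w1, w2, w3, w4⟩, r1, r2, r3, r4⟩, kW.1, kE.1, kE.2.1,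
      kE.2.2, kW.2⟩))
  · exact (clash r3 w4 (by simp; ring)).elim
  · exact Or.inr (Or.inr (Or.inr ⟨Or.inr ⟨⟨w1, w2, w3, w4⟩, r1, r2, r3, r4⟩, kE.1, kW.1, kW.2.1,
      kW.2.2, kE.2⟩))
  · refine Or.inr (Or.inr (Or.inl ⟨ch _ ?_, kW⟩))
    simp only [perpPat, List.forall_mem_cons]
    exact ⟨dom w1 (by simp; ring), dom w3 (by simp; ring), dom r3 (by simp; ring),
      dom r1 (by simp; ring), by simp⟩
  · exact (clash r3 w4 (by simp; ring)).elim
  · exact (clash w4 r3 (by simp; ring)).elim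
  · exact (clash w4 r3 (by simp; ring)).elim
  · refine Or.inl ⟨ch _ ?_, kW⟩
    simp only [tablePat, List.forall_mem_cons]
    exact ⟨dom w1 (by simp; ring), dom w3 (by simp; ring), dom w4 (by simp; ring),
      dom r1 (by simp; ring), by simp⟩
end

/-! ### Mixed dominoes -/

/-- The crossing tiles that only occur next to mixed dominoes. -/
def mixTiles : Set Cell :=
  {cross .three .one, cross .negThree .one, cross .three .three, cross .negThree .three}

/-- Lines in channel `3` are the pairs of `[3v]` and `[-3v]`; without the four mixed tiles, `v` is
plain, `0` or `2`. -/
theorem three_cross : ∀ t ∈ tileList, ∀ b k, (Cell.move b k t).n.out = false →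
    (Cell.move b k t).n.chan = 3 → (Cell.move b k t).s.out = false →
    (((Cell.move b k t).e.side = 0 ∨ (Cell.move b k t).e.chan = 0 ∨ (Cell.move b k t).e.chan = 2) ∧
    ((Cell.move b k t).w.side = 0 ∨ (Cell.move b k t).w.chan = 0 ∨ (Cell.move b k t).w.chan = 2)) ∨
    (t = cross .three .one ∨ t = cross .negThree .one ∨ t = cross .three .three ∨
      t = cross .negThree .three) := by decide +kernel

/-- This check and the next distinguish two roles by the southern edge of the centre, where plain
markings count as channel `0`. The two halves of a domino agree in whether this channel is `0`. -/
theorem south_of_perp : ∀ c ∈ copies tileList, c.IsOut →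
    (c.n.side = 0 ∨ c.n.chan = 2 ∨ c.n.chan = 3) → (c.e.side = 0 ∨ c.e.side = 1) →
    (c.w.side = 0 ∨ c.w.side = -1) → (c.n.side = 0 ∨ c.n.chan = 0 ∨ c.n.chan = 2) →
    (c.s.side = 0 ∨ c.s.chan = 0 ∨ c.s.chan = 2) → c.s.chan = 0 := by decide +kernel

theorem south_of_parallel : ∀ c ∈ copies tileList, c.IsOut →
    (c.n.side = 0 ∨ c.n.chan = 2 ∨ c.n.chan = 3) → (c.e.side = 0 ∨ c.e.side = 1) →
    (c.w.side = 0 ∨ c.w.side = -1) → (c.e.side = 0 ∨ c.e.chan = 0 ∨ c.e.chan = 2) →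
    (c.w.side = 0 ∨ c.w.chan = 0 ∨ c.w.chan = 2) → c.s.chan ≠ 0 := by decide +kernel

section
variable {T : Set Cell} {f : ℤ × ℤ → Cell} {n : ℕ}

/-- The cells where the edges in channel `3` of a domino meet. -/
theorem Tiled.three_cell (h : Tiled tiles1 f) (hb : HalfBlock f (2 ^ n) (levelQ f n)) :
    ((f (2 ^ n, -(2 * 2 ^ n))).n = ⟨false, -1, 3⟩ ∧ (f (2 ^ n, -(2 * 2 ^ n))).s = ⟨false, 1, 3⟩) ∧
    ((f (-2 ^ n, -(2 * 2 ^ n))).n = ⟨false, 1, 3⟩ ∧ (f (-2 ^ n, -(2 * 2 ^ n))).s = ⟨false, -1, 3⟩) := by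
  have hl := h.level n
  have hp := h.partner_aux hb
  obtain ⟨-, -, ⟨h3, c3, e3⟩, ⟨h4, c4, e4⟩⟩ := hb
  obtain ⟨-, -, ⟨p3, -, -⟩, ⟨p4, -, -⟩⟩ := hp
  simp only [LatticeIsom.pos, Set.mem_preimage] at p3 p4
  simp at p3 p4
  constructor
  · have a := hl.endS h.toValid h3
    have b := hl.endN h.toValid p4
    have c := hl.linkS h.toValid h3 p4 (by ring)
    rw [c, e3] at b
    rw [e3] at a
    change _ = (⟨false, -1, 3⟩ : Marking) at a
    change _ = (⟨false, 1, 3⟩ : Marking) at b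
    rw [← a, ← b]
    constructor <;> congr 3 <;> ring
  · have a := hl.endS h.toValid h4
    have b := hl.endN h.toValid p3
    have c := hl.linkS h.toValid h4 p3 (by ring)
    rw [c, e4] at b
    rw [e4] at a
    change _ = (⟨false, 1, 3⟩ : Marking) at a
    change _ = (⟨false, -1, 3⟩ : Marking) at b
    rw [← a, ← b]
    constructor <;> congr 3 <;> ring

/-- A marking that crosses the edges in channel `3`. -/
def CrossThree (m : Marking) : Prop := m.side = 0 ∨ m.chan = 0 ∨ m.chan = 2

theorem Tiled.cross_three (hT : T ⊆ tiles1) (hm : Disjoint T mixTiles) (hf : Tiled T f)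
    (hb : HalfBlock f (2 ^ n) (levelQ f n)) :
    (CrossThree (f (2 ^ n, -(2 * 2 ^ n))).e ∧ CrossThree (f (2 ^ n, -(2 * 2 ^ n))).w) ∧
    (CrossThree (f (-2 ^ n, -(2 * 2 ^ n))).e ∧ CrossThree (f (-2 ^ n, -(2 * 2 ^ n))).w) := by
  have key : ∀ p, (f p).n.out = false → (f p).n.chan = 3 → (f p).s.out = false →
      CrossThree (f p).e ∧ CrossThree (f p).w := by
    intro p h1 h2 h3
    obtain ⟨t, ht, b, k, e⟩ := hf.mem p
    rw [e] at h1 h2 h3 ⊢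
    rcases three_cross t (mem_tileList_of_mem (hT ht)) b k h1 h2 h3 with h | h
    · exact h
    · exact (Set.disjoint_left.1 hm ht (by simpa [mixTiles] using h)).elim
  obtain ⟨⟨a, b⟩, c, d⟩ := (hf.mono hT).three_cell hb
  exact ⟨key _ (by rw [a]) (by rw [a]) (by rw [b]), key _ (by rw [c]) (by rw [c]) (by rw [d])⟩

theorem Tiled.centerCond_zero (hT : T ⊆ tiles1) (hf : Tiled T f)
    (hb : HalfBlock f (2 ^ n) (levelQ f n)) :
    (f (0, 0)).IsOut ∧
    ((f (0, 0)).n.side = 0 ∨ (f (0, 0)).n.chan = 2 ∨ (f (0, 0)).n.chan = 3) ∧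
    ((f (0, 0)).e.side = 0 ∨ (f (0, 0)).e.side = 1) ∧
    ((f (0, 0)).w.side = 0 ∨ (f (0, 0)).w.side = -1) := by
  have hv := (hf.mono hT).toValid
  have hl := (hf.mono hT).level n
  obtain ⟨h1, h2, h3⟩ := hb.centerCond hT hf.toValid hl
  refine ⟨hb.center hv hl, ?_, ?_, ?_⟩
  · simp only [keyN] at h1; tauto
  · tauto
  · tauto

/-- The children are paired from east to west, so their edges in channel `3` meet on the vertical
axis of the square. There they are crossed by the northern and southern lines of its centre. -/
theorem Tiled.south_of_roleU (hT : T ⊆ tiles1) (hm : Disjoint T mixTiles) (hf : Tiled T f)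
    (hb : HalfBlock f (2 ^ (n + 1)) (levelQ f (n + 1))) (hr : RoleU f n) :
    (f (0, 0)).s.chan = 0 := by
  have hv := (hf.mono hT).toValid
  have hl := (hf.mono hT).level (n + 1)
  obtain ⟨h0, h1, h2, h3⟩ := hf.centerCond_zero hT hb
  obtain ⟨r1, -, r3, -⟩ := hr
  have g1 := r1.frame (g := ⟨false, 1, (2 ^ (n + 1), 2 ^ (n + 1))⟩) rfl
    (by simp [LatticeIsom.lin, LatticeIsom.pos])
  have g3 := r3.frame (g := ⟨false, 1, (2 ^ (n + 1), -2 ^ (n + 1))⟩) rfl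
    (by simp [LatticeIsom.lin, LatticeIsom.pos])
  have a := ((hf.view _).cross_three hT hm (H_iff.1 g1)).1.2
  have b := ((hf.view _).cross_three hT hm (H_iff.1 g3)).2.1
  have p1 : (⟨false, 1, (2 ^ (n + 1), 2 ^ (n + 1))⟩ : LatticeIsom).pos (2 ^ n, -(2 * 2 ^ n)) =
      (0, 2 ^ n) := by simp [LatticeIsom.pos]; constructor <;> ring
  have p3 : (⟨false, 1, (2 ^ (n + 1), -2 ^ (n + 1))⟩ : LatticeIsom).pos (-2 ^ n, -(2 * 2 ^ n)) =
      (0, -2 ^ n) := by simp [LatticeIsom.pos]; constructor <;> ring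
  simp only [DominoTiles.view, p1, p3, Cell.unmove, Cell.turn, Nat.iterate] at a b
  simp [Nat.iterate] at a b
  change CrossThree (f (0, 2 ^ n)).n at a
  change CrossThree (f (0, -2 ^ n)).s at b
  have hp : (0 : ℤ) < 2 ^ n := by positivity
  have e : (2 : ℤ) * 2 ^ (n + 1) = 4 * 2 ^ n := by ring
  rw [hb.lineN hv hl (by omega) (by omega)] at a
  rw [hb.lineS hv hl (by omega) (by omega)] at b
  exact south_of_perp _ (hv.mem_copies _) h0 h1 h2 h3 a b

/-- Now the edges of the children in channel `3` meet on the horizontal axis and are crossed by the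
eastern and western lines of the centre. -/
theorem Tiled.south_of_roleP (hT : T ⊆ tiles1) (hm : Disjoint T mixTiles) (hf : Tiled T f)
    (hb : HalfBlock f (2 ^ (n + 1)) (levelQ f (n + 1))) (hr : RoleP f n) :
    (f (0, 0)).s.chan ≠ 0 := by
  have hv := (hf.mono hT).toValid
  have hl := (hf.mono hT).level (n + 1)
  obtain ⟨h0, h1, h2, h3⟩ := hf.centerCond_zero hT hb
  obtain ⟨-, -, r1, r3⟩ := hr
  have g1 := r1.frame (g := ⟨false, 2, (2 ^ (n + 1), -2 ^ (n + 1))⟩) rfl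
    (by simp [LatticeIsom.lin, LatticeIsom.pos])
  have g3 := r3.frame (g := ⟨false, 2, (-2 ^ (n + 1), -2 ^ (n + 1))⟩) rfl
    (by simp [LatticeIsom.lin, LatticeIsom.pos])
  have a := ((hf.view _).cross_three hT hm (H_iff.1 g1)).1.2
  have b := ((hf.view _).cross_three hT hm (H_iff.1 g3)).2.1
  have p1 : (⟨false, 2, (2 ^ (n + 1), -2 ^ (n + 1))⟩ : LatticeIsom).pos (2 ^ n, -(2 * 2 ^ n)) =
      (2 ^ n, 0) := by simp [LatticeIsom.pos]; constructor <;> ring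
  have p3 : (⟨false, 2, (-2 ^ (n + 1), -2 ^ (n + 1))⟩ : LatticeIsom).pos (-2 ^ n, -(2 * 2 ^ n)) =
      (-2 ^ n, 0) := by simp [LatticeIsom.pos]; constructor <;> ring
  simp only [DominoTiles.view, p1, p3, Cell.unmove, Cell.turn, Nat.iterate] at a b
  simp [Nat.iterate] at a b
  change CrossThree (f (2 ^ n, 0)).e at a
  change CrossThree (f (-2 ^ n, 0)).w at b
  have hp : (0 : ℤ) < 2 ^ n := by positivity
  have e : (2 : ℤ) * 2 ^ (n + 1) = 4 * 2 ^ n := by ring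
  rw [hb.lineE hv hl (by omega) (by omega)] at a
  rw [hb.lineW hv hl (by omega) (by omega)] at b
  exact south_of_parallel _ (hv.mem_copies _) h0 h1 h2 h3 a b

theorem Marking.mate_chan (m : Marking) : m.mate.chan = 0 ↔ m.chan = 0 := by
  obtain ⟨o, s, c⟩ := m
  fin_cases c <;> simp [Marking.mate]

/-- If the mixed crossing tiles are missing, the two halves of a domino have the same role. -/
theorem Tiled.not_mixed (hT : T ⊆ tiles1) (hm : Disjoint T mixTiles) (hf : Tiled T f)
    (hb : HalfBlock f (2 ^ (n + 1)) (levelQ f (n + 1)))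
    (h : RoleP f n ∧ RoleU (DominoTiles.view ⟨false, 2, (0, -4 * 2 ^ (n + 1))⟩ f) n ∨
      RoleU f n ∧ RoleP (DominoTiles.view ⟨false, 2, (0, -4 * 2 ^ (n + 1))⟩ f) n) : False := by
  have ht := hf.mono hT
  have hp := ht.partner_aux hb
  have hl := ht.level (n + 1 + 1)
  have h0 : (0, 0) ∈ levelQ f (n + 1 + 1) := (H_id.2 hb).mem
  have h1 : (0, -4 * 2 ^ (n + 1)) ∈ levelQ f (n + 1 + 1) := hp.mem
  have link := congrArg Marking.chan (hl.linkS ht.toValid h0 h1 (by ring))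
  have e : ((DominoTiles.view ⟨false, 2, (0, -4 * 2 ^ (n + 1))⟩ f) (0, 0)).s =
      (f (0, -4 * 2 ^ (n + 1))).n := by
    simp [DominoTiles.view, LatticeIsom.pos, Cell.unmove, Cell.turn, Nat.iterate]
  rw [← e] at link
  have link2 := (Marking.mate_chan (f (0, 0)).s)
  rw [← link] at link2
  rcases h with ⟨r1, r2⟩ | ⟨r1, r2⟩
  · exact hf.south_of_roleP hT hm hb r1
      (link2.1 ((hf.view _).south_of_roleU hT hm (H_iff.1 hp) r2))
  · exact (hf.view _).south_of_roleP hT hm (H_iff.1 hp) r2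
      (link2.2 (hf.south_of_roleU hT hm hb r1))

/-- The patterns of the children of a domino, up to a reflection. -/
theorem Tiled.exists_children (hT : T ⊆ tiles1) (hf : Tiled T f)
    (hd : Dom f (n + 1) (0, 0) (1, 0)) :
    ∃ b : Bool, (Children (DominoTiles.view ⟨b, 0, 0⟩ f) n tablePat ∧ keyE T 1 ∧ keyN T 2) ∨
    (Children (DominoTiles.view ⟨b, 0, 0⟩ f) n parallelPat ∧ keyE T 0 ∧ keyN T 3) ∨
    (Children (DominoTiles.view ⟨b, 0, 0⟩ f) n perpPat ∧ keyE T 1 ∧ keyE T 2 ∧ keyE T 3) ∨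
    (Children (DominoTiles.view ⟨b, 0, 0⟩ f) n asymPat ∧ ¬ Disjoint T mixTiles ∧
     keyE T 0 ∧ keyE T 1 ∧ keyE T 2 ∧ keyE T 3 ∧ keyN T 3) := by
  have ht := hf.mono hT
  have dom : ∀ {q d c a : ℤ × ℤ}, Pt f n q d → (d = a ∧ q = c - (2 ^ (n + 1) : ℤ) • a) ∨
      (d = -a ∧ q = c + (2 ^ (n + 1) : ℤ) • a) → Dom f n c a := by
    rintro q d c a h (⟨rfl, rfl⟩ | ⟨rfl, rfl⟩)
    · exact h
    · exact ht.dom_iff.2 h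
  rcases hf.children hT hd with h | h | h | ⟨h, k⟩
  · exact ⟨false, Or.inl (by rwa [view_id])⟩
  · exact ⟨false, Or.inr (Or.inl (by rwa [view_id]))⟩
  · exact ⟨false, Or.inr (Or.inr (Or.inl (by rwa [view_id])))⟩
  · have hmix : ¬ Disjoint T mixTiles := by
      intro hm
      have hE := (ht.dom_iff.1 hd).frame (g := ⟨false, 1, (2 * 2 ^ (n + 1), 0)⟩)
        (by simp; ring) (by simp [LatticeIsom.lin, LatticeIsom.pos])
      refine (hf.view _).not_mixed (n := n) hT hm (H_iff.1 hE) ?_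
      rw [← view_comp]
      have : (⟨false, 1, (2 * 2 ^ (n + 1), 0)⟩ : LatticeIsom).comp
          ⟨false, 2, (0, -4 * 2 ^ (n + 1))⟩ = ⟨false, 3, (-2 * 2 ^ (n + 1), 0)⟩ := by
        simp [LatticeIsom.comp, LatticeIsom.pos]; ring
      rw [this]
      tauto
    have ch : ∀ K b, (∀ x ∈ K, Dom (DominoTiles.view ⟨b, 0, 0⟩ f) n ((2 ^ (n + 1) : ℤ) • x.1) x.2) →
      Children (DominoTiles.view ⟨b, 0, 0⟩ f) n K := fun K b h => h
    rcases h with ⟨h1, h2⟩ | ⟨h1, h2⟩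
    · refine ⟨false, Or.inr (Or.inr (Or.inr ⟨?_, hmix, k⟩))⟩
      refine ch _ _ ?_
      rw [view_id]
      simp only [asymPat, List.forall_mem_cons]
      simp only [RoleP, RoleU, pt_view, LatticeIsom.lin, LatticeIsom.pos] at h1 h2
      generalize (2 : ℤ) ^ (n + 1) = s at *
      simp [Nat.iterate] at h1 h2
      obtain ⟨w1, w2, w3, w4⟩ := h1
      obtain ⟨r1, r2, r3, r4⟩ := h2
      exact ⟨dom w1 (by simp; ring), dom w2 (by simp; ring), dom r3 (by simp; ring),
        dom r1 (by simp; ring), by simp⟩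
    · refine ⟨true, Or.inr (Or.inr (Or.inr ⟨?_, hmix, k⟩))⟩
      refine ch _ _ ?_
      simp only [asymPat, List.forall_mem_cons, dom_view]
      simp only [RoleP, RoleU, pt_view, LatticeIsom.lin, LatticeIsom.pos] at h1 h2 ⊢
      generalize (2 : ℤ) ^ (n + 1) = s at *
      simp [Nat.iterate] at h1 h2 ⊢
      obtain ⟨w1, w2, w3, w4⟩ := h1
      obtain ⟨r1, r2, r3, r4⟩ := h2
      exact ⟨dom r2 (by simp; ring), dom r1 (by simp; ring), dom w4 (by simp; ring),
        dom w2 (by simp; ring)⟩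

end

/-! ### Lattice symmetries acting on the plane -/

/-- The quarter turn, clockwise. -/
noncomputable def turnIsom : Isom where
  toFun q := !₂[q 1, -q 0]
  invFun q := !₂[-q 1, q 0]
  left_inv q := by ext i; fin_cases i <;> simp
  right_inv q := by ext i; fin_cases i <;> simp
  isometry_toFun := by
    refine Isometry.of_dist_eq fun x y => ?_
    simp only [EuclideanSpace.dist_eq, Fin.sum_univ_two, Real.dist_eq, sq_abs]
    congr 1
    simp; ring

/-- The reflection exchanging east and west. -/
noncomputable def flipIsom : Isom where
  toFun q := !₂[-q 0, q 1]
  invFun q := !₂[-q 0, q 1]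
  left_inv q := by ext i; fin_cases i <;> simp
  right_inv q := by ext i; fin_cases i <;> simp
  isometry_toFun := by
    refine Isometry.of_dist_eq fun x y => ?_
    simp only [EuclideanSpace.dist_eq, Fin.sum_univ_two, Real.dist_eq, sq_abs]
    congr 1
    simp; ring

/-- The action of a lattice symmetry on the plane, with squares of side `r`. -/
noncomputable def LatticeIsom.isom (g : LatticeIsom) (r : ℝ) : Isom :=
  IsometryEquiv.addRight !₂[r * (g.shift.1 : ℝ), r * (g.shift.2 : ℝ)] *
    turnIsom ^ g.turns.val * (if g.flip then flipIsom else 1)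

theorem turnIsom_apply (q : Plane) : turnIsom q = !₂[q 1, -q 0] := rfl
theorem flipIsom_apply (q : Plane) : flipIsom q = !₂[-q 0, q 1] := rfl

namespace LatticeIsom

theorem isom_apply (g : LatticeIsom) (r : ℝ) (p : Plane) : g.isom r p =
    (fun q : Plane => !₂[q 1, -q 0])^[g.turns.val] (if g.flip then !₂[-p 0, p 1] else p) +
      !₂[r * (g.shift.1 : ℝ), r * (g.shift.2 : ℝ)] := by
  obtain ⟨b, k, u⟩ := g
  cases b <;> fin_cases k <;>
    simp [isom, Nat.iterate, IsometryEquiv.mul_apply, pow_succ, turnIsom_apply, flipIsom_apply]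

theorem plane_eq (g : LatticeIsom) : g.plane = g.isom (1 / 4) := by
  funext p
  have e1 : (g.shift.1 : ℝ) / 4 = 1 / 4 * g.shift.1 := by ring
  have e2 : (g.shift.2 : ℝ) / 4 = 1 / 4 * g.shift.2 := by ring
  rw [isom_apply, plane, e1, e2]

theorem isom_comp (g h : LatticeIsom) (r : ℝ) : (g.comp h).isom r = g.isom r * h.isom r := by
  ext p i
  rw [IsometryEquiv.mul_apply]
  simp only [isom_apply]
  obtain ⟨b, k, u⟩ := g
  obtain ⟨b', k', u'⟩ := h
  cases b <;> cases b' <;> fin_cases k <;> fin_cases k' <;> fin_cases i <;>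
    simp [comp, pos, Nat.iterate] <;> ring1

theorem inflate_isom (g : LatticeIsom) (r : ℝ) : inflate (g.isom r) = g.isom (2 * r) := by
  ext p i
  change ((2 : ℝ) • g.isom r ((2 : ℝ)⁻¹ • p)) i = _
  simp only [isom_apply]
  obtain ⟨b, k, u⟩ := g
  cases b <;> fin_cases k <;> fin_cases i <;> simp [Nat.iterate] <;> ring

end LatticeIsom

/-! ### Dominoes with given centre and direction -/

/-- The domino with centre `r d.1`, upright or horizontal. -/
def rect (r : ℝ) (d : (ℤ × ℤ) × Bool) : Set Plane :=
  if d.2 then vert (r * d.1.1) (r * d.1.2) else horiz (r * d.1.1) (r * d.1.2)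

/-- The centre and the direction of the image of the standard domino. -/
def LatticeIsom.key (g : LatticeIsom) : (ℤ × ℤ) × Bool := (g.shift, g.turns = 1 ∨ g.turns = 3)

theorem LatticeIsom.isom_image_domino (g : LatticeIsom) (r : ℝ) :
    g.isom r '' domino = rect r g.key := by
  ext p
  have : p ∈ g.isom r '' domino ↔ (g.isom r).symm p ∈ domino := by
    constructor
    · rintro ⟨q, hq, rfl⟩; simpa using hq
    · intro h; exact ⟨_, h, by simp⟩
  rw [this]
  obtain ⟨q, rfl⟩ := (g.isom r).surjective p
  rw [IsometryEquiv.symm_apply_apply]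
  obtain ⟨b, k, u⟩ := g
  rw [isom_apply]
  have neg (x c : ℝ) : |-x| ≤ c ↔ |x| ≤ c := by rw [abs_neg]
  cases b <;> fin_cases k <;>
    simp [domino, rect, key, Nat.iterate, horiz, vert, neg] <;> tauto

theorem horiz_bounds {a b a' b' : ℝ} (h : horiz a b = horiz a' b') : a = a' ∧ b = b' := by
  have h1 : !₂[a + 1, b + 1 / 2] ∈ horiz a' b' := h ▸ (by simp [horiz])
  have h2 : !₂[a - 1, b - 1 / 2] ∈ horiz a' b' := h ▸ (by simp [horiz])
  simp only [horiz, Set.mem_ofPred_eq, abs_le] at h1 h2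
  simp at h1 h2
  constructor <;> linarith

theorem vert_bounds {a b a' b' : ℝ} (h : vert a b = vert a' b') : a = a' ∧ b = b' := by
  have h1 : !₂[a + 1 / 2, b + 1] ∈ vert a' b' := h ▸ (by simp [vert])
  have h2 : !₂[a - 1 / 2, b - 1] ∈ vert a' b' := h ▸ (by simp [vert])
  simp only [vert, Set.mem_ofPred_eq, abs_le] at h1 h2
  simp at h1 h2
  constructor <;> linarith

theorem horiz_ne_vert {a b a' b' : ℝ} (h : horiz a b = vert a' b') : False := by
  have h1 : !₂[a + 1, b + 1 / 2] ∈ vert a' b' := h ▸ (by simp [horiz])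
  have h2 : !₂[a - 1, b - 1 / 2] ∈ vert a' b' := h ▸ (by simp [horiz])
  simp only [vert, Set.mem_ofPred_eq, abs_le] at h1 h2
  simp at h1 h2
  linarith

theorem rect_injective {r : ℝ} (hr : 0 < r) : Function.Injective (rect r) := by
  rintro ⟨⟨a, b⟩, c⟩ ⟨⟨a', b'⟩, c'⟩ h
  cases c <;> cases c' <;> simp only [rect, Bool.false_eq_true, if_true, if_false] at h
  · have := horiz_bounds h
    simpa [hr.ne'] using this
  · exact (horiz_ne_vert h).elim
  · exact (horiz_ne_vert h.symm).elim
  · have := vert_bounds h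
    simpa [hr.ne'] using this

/-- The part of the plane where a coordinate has a given value has no interior. -/
theorem interior_coord_eq (i : Fin 2) (c : ℝ) : interior {p : Plane | p i = c} = ∅ := by
  have ho : IsOpenMap (EuclideanSpace.proj i : Plane →L[ℝ] ℝ) := by
    refine ContinuousLinearMap.isOpenMap _ fun y => ⟨!₂[y, y], ?_⟩
    fin_cases i <;> simp
  have hc : Continuous (EuclideanSpace.proj i : Plane →L[ℝ] ℝ) := ContinuousLinearMap.continuous _
  have := ho.preimage_interior_eq_interior_preimage hc {c}
  rw [interior_singleton, Set.preimage_empty] at this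
  rw [this]
  rfl

theorem disjoint_interior {s t : Set Plane} (i : Fin 2) (c : ℝ) (h : ∀ p ∈ s, p ∈ t → p i = c) :
    Disjoint (interior s) (interior t) := by
  rw [Set.disjoint_iff_inter_eq_empty, ← interior_inter, ← Set.subset_empty_iff,
    ← interior_coord_eq i c]
  exact interior_mono fun p hp => h p hp.1 hp.2

theorem rect_isDomino (r : ℝ) (d : (ℤ × ℤ) × Bool) : ∃ g : Isom, rect r d = g '' domino := by
  obtain ⟨c, b⟩ := d
  refine ⟨(⟨false, if b then 1 else 0, c⟩ : LatticeIsom).isom r, ?_⟩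
  rw [LatticeIsom.isom_image_domino]
  cases b <;> simp [LatticeIsom.key]

/-! ### Hierarchical tilings from canonical frames -/

/-- Frames for the supertiles of all levels, each scaled to a domino, with the rules that place
the children. -/
theorem isHierarchical_of_frames {S : Set Rule} (X : ℕ → Set Isom) (ρ : ℕ → Isom → Rule)
    (ht : IsDominoTiling (placed (X 0)))
    (hρ : ∀ n, ∀ γ ∈ X (n + 1), ρ n γ ∈ S ∧ ∀ x ∈ ρ n γ, inflate γ * x ∈ X n)
    (hp : ∀ n, ∀ γ' ∈ X n, ∃ γ ∈ X (n + 1), ∃ x ∈ ρ n γ, γ' = inflate γ * x) :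
    IsHierarchical S (placed (X 0)) := by
  refine ⟨ht, ?_⟩
  let E : ℕ → Set Isom → Set Isom := fun n P => ⋃ g ∈ P, (fun x => inflate g * x) '' ρ n g
  have hE : ∀ n P, P ⊆ X (n + 1) → E n P ⊆ X n := by
    intro n P hP x hx
    simp only [E, Set.mem_iUnion, Set.mem_image] at hx
    obtain ⟨g, hg, y, hy, rfl⟩ := hx
    exact (hρ n g (hP hg)).2 y hy
  have mono : ∀ n P P', P ⊆ P' → E n P ⊆ E n P' := fun n P P' h =>
    Set.biUnion_subset_biUnion_left h
  have sup : ∀ n k P, IsSupertile S k P → P ⊆ X (n + 1) → IsSupertile S (k + 1) (E n P) := by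
    intro n k P hP hX
    have : E n P = ⋃ g ∈ P, (fun x => inflate g * x) '' (open Classical in
        if g ∈ X (n + 1) then ρ n g else ρ n (Classical.epsilon (· ∈ P))) := by
      refine Set.iUnion₂_congr fun g hg => ?_
      rw [if_pos (hX hg)]
    rw [this]
    refine hP.subst _ fun g hg => ?_
    rw [if_pos (hX hg)]
    exact (hρ n g (hX hg)).1
  -- `F n` takes frames of level `n` down to level `0` by applying `E` from the top level downward;
  -- each application is one substitution step.
  let F : ℕ → Set Isom → Set Isom := fun n => n.rec (fun P => P) fun k ih P => ih (E k P)
  have F0 : ∀ P, F 0 P = P := fun _ => rfl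
  have Fs : ∀ n P, F (n + 1) P = F n (E n P) := fun _ _ => rfl
  have Fmono : ∀ n P P', P ⊆ P' → F n P ⊆ F n P' := by
    intro n
    induction n with
    | zero => exact fun P P' h => h
    | succ n ih => exact fun P P' h => ih _ _ (mono n P P' h)
  have FX : ∀ n P, P ⊆ X n → F n P ⊆ X 0 := by
    intro n
    induction n with
    | zero => exact fun P h => h
    | succ n ih => exact fun P h => ih _ (hE n P h)
  have Fsup : ∀ n k P, IsSupertile S k P → P ⊆ X n → IsSupertile S (k + n) (F n P) := by
    intro n
    induction n with
    | zero => exact fun k P h _ => h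
    | succ n ih =>
      intro k P h hX
      have := ih (k + 1) _ (sup n k P h hX) (hE n P hX)
      rwa [show k + 1 + n = k + (n + 1) by ring] at this
  rintro _ ⟨γ₀, hγ₀, rfl⟩
  choose! par hpar using hp
  -- These are the successive ancestors of the given domino; the supertile of level `n` consists of
  -- all descendants of the `n`-th one.
  let Γ : ℕ → Isom := fun n => n.rec γ₀ fun k γ => par k γ
  have Γs : ∀ n, Γ (n + 1) = par n (Γ n) := fun _ => rfl
  have hΓ : ∀ n, Γ n ∈ X n := by
    intro n
    induction n with
    | zero => exact hγ₀
    | succ n ih => exact (hpar n _ ih).1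
  have single : ∀ g : Isom, IsSupertile S 0 {g} := by
    intro g
    have := (IsSupertile.base (S := S)).move g
    simpa using this
  refine ⟨fun n => F n {Γ n}, ?_, fun n => ⟨?_, ?_, ?_⟩⟩
  · simp [F0, placed, Γ]
  · have := Fsup n 0 _ (single (Γ n)) (by simpa using hΓ n)
    rwa [zero_add] at this
  · refine Set.image_mono ?_
    change F n _ ⊆ F (n + 1) _
    rw [Fs]
    refine Fmono _ _ _ ?_
    rw [Set.singleton_subset_iff]
    obtain ⟨x, hx, e⟩ := (hpar n _ (hΓ n)).2
    simp only [E, Γs, Set.mem_iUnion, Set.mem_image, Set.mem_singleton_iff]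
    exact ⟨_, rfl, x, hx, e.symm⟩
  · exact Set.image_mono (FX n _ (by simpa using hΓ n))

/-- The rule with a given choice of an isometry for each child. -/
theorem image_mem_rulesOf {D : Set (Set Plane)} (x : Set Plane → Isom)
    (hx : ∀ p ∈ D, x p '' domino = p) : x '' D ∈ rulesOf D := by
  refine ⟨?_, ?_, ?_⟩
  · rintro _ ⟨p, hp, rfl⟩
    simpa only [hx p hp] using hp
  · rintro _ ⟨p, hp, rfl⟩ _ ⟨p', hp', rfl⟩ h
    simp only [hx p hp, hx p' hp'] at h
    rw [h]
  · rintro p hp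
    exact ⟨x p, ⟨p, hp, rfl⟩, hx p hp⟩

/-! ### The dominoes of all levels -/

/-- The long direction of a domino. -/
def axis (v : Bool) : ℤ × ℤ := if v then (0, 1) else (1, 0)

/-- The dominoes of level `n`. -/
def dominoSet (f : ℤ × ℤ → Cell) (n : ℕ) : Set ((ℤ × ℤ) × Bool) := {d | Dom f n d.1 (axis d.2)}

/-- The scale at which the dominoes of level `n` become dominoes. -/
noncomputable def scale (n : ℕ) : ℝ := 1 / (4 * 2 ^ n)

theorem scale_pos (n : ℕ) : 0 < scale n := by unfold scale; positivity

theorem two_mul_scale (n : ℕ) : 2 * scale (n + 1) = scale n := by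
  unfold scale; rw [pow_succ]; field_simp

theorem scale_mul (n : ℕ) : scale n * 2 ^ (n + 1) = 1 / 2 := by
  unfold scale; rw [pow_succ]; field_simp; norm_num

/-- The position of a child in the parent domino, as a domino in the plane. -/
def piece (x : (ℤ × ℤ) × (ℤ × ℤ)) : Set Plane := rect (1 / 2) (x.1, x.2.1 = 0)

/-- The configuration given by a pattern. -/
def pieces (K : List ((ℤ × ℤ) × (ℤ × ℤ))) : Set (Set Plane) := {p | ∃ x ∈ K, p = piece x}

theorem tableRule_eq : tableRule = rulesOf (pieces tablePat) := by
  rw [tableRule]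
  congr 1
  ext p
  simp [pieces, tablePat, piece, rect]
  norm_num

theorem parallelRule_eq : parallelRule = rulesOf (pieces parallelPat) := by
  rw [parallelRule]
  congr 1
  ext p
  simp [pieces, parallelPat, piece, rect]
  norm_num

theorem perpRule_eq : perpRule = rulesOf (pieces perpPat) := by
  rw [perpRule]
  congr 1
  ext p
  simp [pieces, perpPat, piece, rect]
  norm_num

theorem asymRules_eq : asymRules = rulesOf (pieces asymPat) := by
  rw [asymRules]
  congr 1
  ext p
  simp [pieces, asymPat, piece, rect]
  norm_num

/-- The patterns of the children. -/
def pats4 : List (List ((ℤ × ℤ) × (ℤ × ℤ))) := [tablePat, parallelPat, perpPat, asymPat]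

theorem pats4_unit : ∀ K ∈ pats4, ∀ x ∈ K, x.2 = axis (x.2.1 = 0) := by decide

/-- The points `(i, j)` are the centres of the eight squares that make up a domino, and the ends of
a child are `x.1 ± x.2`. Each square is an end of a child in every pattern, so a parent can be found
without knowing which pattern occurs. -/
theorem pats4_cover : ∀ K ∈ pats4, ∀ i ∈ [(3 : ℤ), 1, -1, -3], ∀ j ∈ [(1 : ℤ), -1],
    ∃ x ∈ K, (i, j) = x.1 - x.2 ∨ (i, j) = x.1 + x.2 := by decide

theorem LatticeIsom.key_comp (g : LatticeIsom) (c : ℤ × ℤ) (v : Bool) :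
    (g.comp ⟨false, if v then 1 else 0, c⟩).key = (g.pos c, decide ((g.lin (axis v)).1 = 0)) := by
  obtain ⟨b, k, u⟩ := g
  cases b <;> cases v <;> fin_cases k <;>
    simp [key, comp, axis, lin, pos, Nat.iterate]

theorem LatticeIsom.image_rect (g : LatticeIsom) (r : ℝ) (c : ℤ × ℤ) (v : Bool) :
    g.isom r '' rect r (c, v) = rect r (g.pos c, decide ((g.lin (axis v)).1 = 0)) := by
  have : rect r (c, v) = (⟨false, if v then 1 else 0, c⟩ : LatticeIsom).isom r '' domino := by
    rw [LatticeIsom.isom_image_domino]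
    cases v <;> simp [LatticeIsom.key]
  rw [this, ← Set.image_comp, ← LatticeIsom.key_comp, ← LatticeIsom.isom_image_domino,
    LatticeIsom.isom_comp]
  rfl

theorem LatticeIsom.image_piece (g : LatticeIsom) (n : ℕ) {x : (ℤ × ℤ) × (ℤ × ℤ)}
    (hx : x.2 = axis (x.2.1 = 0)) : g.isom (scale n) '' piece x =
      rect (scale n) (g.pos ((2 ^ (n + 1) : ℤ) • x.1), decide ((g.lin x.2).1 = 0)) := by
  have : piece x = rect (scale n) ((2 ^ (n + 1) : ℤ) • x.1, x.2.1 = 0) := by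
    have e : ∀ z : ℤ, scale n * ((2 ^ (n + 1) * z : ℤ) : ℝ) = 1 / 2 * z := by
      intro z
      rw [← scale_mul n]
      push_cast
      ring
    simp only [piece, rect, Prod.smul_fst, Prod.smul_snd, smul_eq_mul, e]
  rw [this, LatticeIsom.image_rect, ← hx]

section
variable {T : Set Cell} {f : ℤ × ℤ → Cell} {n : ℕ}

theorem LatticeIsom.lin_axis (g : LatticeIsom) (v : Bool) :
    g.lin (axis v) = axis ((g.lin (axis v)).1 = 0) ∨ g.lin (axis v) = -axis ((g.lin (axis v)).1 = 0) := by
  obtain ⟨b, k, u⟩ := g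
  cases b <;> cases v <;> fin_cases k <;> simp [axis, lin, pos, Nat.iterate]

theorem LatticeIsom.lin_south (g : LatticeIsom) :
    g.lin (0, -1) = axis ((g.lin (0, -1)).1 = 0) ∨ g.lin (0, -1) = -axis ((g.lin (0, -1)).1 = 0) := by
  obtain ⟨b, k, u⟩ := g
  cases b <;> fin_cases k <;> simp [axis, lin, pos, Nat.iterate]

theorem Tiled.mem_dominoSet (ht : Tiled tiles1 f) {c a : ℤ × ℤ} {v : Bool} (h : Dom f n c a)
    (ha : a = axis v ∨ a = -axis v) : (c, v) ∈ dominoSet f n := by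
  rcases ha with rfl | rfl
  · exact h
  · exact ht.dom_neg.1 h

theorem Tiled.child_mem (ht : Tiled tiles1 f) {g : LatticeIsom} {x : (ℤ × ℤ) × (ℤ × ℤ)}
    (hx : x.2 = axis (x.2.1 = 0)) (h : Dom (DominoTiles.view g f) n ((2 ^ (n + 1) : ℤ) • x.1) x.2) :
    (g.pos ((2 ^ (n + 1) : ℤ) • x.1), decide ((g.lin x.2).1 = 0)) ∈ dominoSet f n := by
  rw [dom_view] at h
  refine ht.mem_dominoSet h ?_
  rw [hx]
  exact g.lin_axis _

/-- In all frames of `d`, the domino `d'` is among the children of `d`. -/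
def Parent (f : ℤ × ℤ → Cell) (n : ℕ) (d' d : (ℤ × ℤ) × Bool) : Prop :=
  ∀ g : LatticeIsom, g.key = d → ∀ K ∈ pats4, Children (view g f) n K →
    ∃ x ∈ K, d' = (g.pos ((2 ^ (n + 1) : ℤ) • x.1), decide ((g.lin x.2).1 = 0))

/-- The offset from a small block to the centre of its half-block is `(α, β)`, and from there to the
centre of the domino it is two further units along the axis. In any frame of that domino this gives
one of the eight squares of `pats4_cover`. -/
theorem quarter_position : ∀ b : Bool, ∀ k : Fin 4, ∀ b' : Bool, ∀ k' : Fin 4,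
    ∀ α ∈ [(1 : ℤ), -1], ∀ β ∈ [(1 : ℤ), -1],
    (k = 1 ∨ k = 3 ↔ ((⟨b', k', 0⟩ : LatticeIsom).lin (0, -1)).1 = 0) →
    ∃ i ∈ [(3 : ℤ), 1, -1, -3], ∃ j ∈ [(1 : ℤ), -1],
    (⟨b, k, 0⟩ : LatticeIsom).lin (i, j) =
      -(2 : ℤ) • (⟨b', k', 0⟩ : LatticeIsom).lin (0, -1) - (α, β) := by
  decide +kernel

/-- One half of the given domino lies in a half-block of the next level, hence in a domino of that
level. Whichever pattern the children of the latter form, some child covers the same square, and a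
half-block has only one direction. -/
theorem Tiled.exists_parent (ht : Tiled tiles1 f) {d' : (ℤ × ℤ) × Bool} (hd : d' ∈ dominoSet f n) :
    ∃ d ∈ dominoSet f (n + 1), Parent f n d' d := by
  obtain ⟨c, v⟩ := d'
  have hP : Pt f n _ _ := hd
  have hl := ht.level (n + 1)
  obtain ⟨α, β, -, hα, hβ, hz⟩ := hl.exists_nextQ ht.toValid hP.mem
  obtain ⟨⟨b', k', z⟩, hg, hgz⟩ := exists_pt hz
  have P2 : Pt f (n + 1) _ _ := ⟨_, hg, hgz, rfl⟩
  subst hgz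
  set a := axis v with ha
  set d0 := (⟨b', k', (_, _)⟩ : LatticeIsom).lin (0, -1) with hd0
  have hD : Dom f (n + 1) ((c - (2 ^ (n + 1) : ℤ) • a + (2 ^ (n + 1) : ℤ) • (α, β)) +
      (2 ^ (n + 1 + 1) : ℤ) • d0) d0 := by
    refine pt_congr P2 ?_ rfl
    rw [add_sub_cancel_right]
    ext <;> simp [mul_comm]
  refine ⟨_, ht.mem_dominoSet hD (LatticeIsom.lin_south _), ?_⟩
  rintro ⟨b, k, C⟩ hkey K hK hc
  simp only [LatticeIsom.key, Prod.mk.injEq, decide_eq_decide] at hkey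
  obtain ⟨rfl, hk⟩ := hkey
  obtain ⟨i, hi, j, hj, e⟩ := quarter_position b k b' k' α (by simpa using hα) β (by simpa using hβ) hk
  obtain ⟨x, hx, hij⟩ := pats4_cover K hK i hi j hj
  refine ⟨x, hx, ?_⟩
  have hxD := hc x hx
  rw [dom_view] at hxD
  set g : LatticeIsom := ⟨b, k, _⟩ with hg
  change g.lin (i, j) = -(2 : ℤ) • d0 - (α, β) at e
  have hq : g.lin ((2 ^ (n + 1) : ℤ) • (i, j)) + g.shift = c - (2 ^ (n + 1) : ℤ) • a := by
    rw [LatticeIsom.lin_smul, e, hg]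
    simp only [pow_succ (2 : ℤ) (n + 1), smul_sub, mul_smul, neg_smul, smul_neg]
    abel
  have sub : ∀ p q : ℤ × ℤ, g.lin (p - q) = g.lin p - g.lin q := by
    intro p q
    rw [eq_sub_iff_add_eq, ← LatticeIsom.lin_add, sub_add_cancel]
  rcases hij with hij | hij
  · rw [hij, smul_sub, sub, LatticeIsom.lin_smul g _ x.2, sub_add_eq_add_sub,
      ← LatticeIsom.pos_eq_lin] at hq
    have hu : g.lin x.2 = a := Pt.unique (pt_congr hxD hq rfl) hP
    rw [hu] at hq ⊢
    ext
    · exact congrArg Prod.fst (sub_left_inj.1 hq).symm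
    · exact congrArg Prod.snd (sub_left_inj.1 hq).symm
    · rw [ha]; cases v <;> simp [axis]
  · rw [hij, smul_add, LatticeIsom.lin_add, LatticeIsom.lin_smul g _ x.2, add_right_comm,
      ← LatticeIsom.pos_eq_lin] at hq
    have hu : -g.lin x.2 = a := Pt.unique (pt_congr (ht.dom_iff.1 hxD) hq rfl) hP
    have hu' : g.lin x.2 = -a := by rw [← hu, neg_neg]
    rw [hu', smul_neg, ← sub_eq_add_neg] at hq
    rw [hu']
    ext
    · exact congrArg Prod.fst (sub_left_inj.1 hq).symm
    · exact congrArg Prod.snd (sub_left_inj.1 hq).symm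
    · rw [ha]; cases v <;> simp [axis]

/-- The tiling by dominoes. -/
def dominoTiling (f : ℤ × ℤ → Cell) : Set (Set Plane) := rect (1 / 4) '' dominoSet f 0

theorem Tiled.half_unique (ht : Tiled tiles1 f) {c c' : ℤ × ℤ} {v v' : Bool} {ε ε' : ℤ}
    (h : (c, v) ∈ dominoSet f n) (h' : (c', v') ∈ dominoSet f n) (hε : ε = 1 ∨ ε = -1)
    (hε' : ε' = 1 ∨ ε' = -1)
    (e : c + (ε * 2 ^ (n + 1)) • axis v = c' + (ε' * 2 ^ (n + 1)) • axis v') : c = c' ∧ v = v' := by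
  have key : ∀ {c v ε}, (c, v) ∈ dominoSet f n → (ε = 1 ∨ ε = -1) →
      Pt f n (c + (ε * 2 ^ (n + 1) : ℤ) • axis v) (-ε • axis v) := by
    rintro c v ε h (rfl | rfl)
    · rw [one_mul, neg_one_smul]
      exact ht.dom_iff.1 h
    · refine pt_congr h ?_ ?_
      · rw [sub_eq_add_neg]; simp
      · simp
  have k1 := key h hε
  have k2 := key h' hε'
  rw [e] at k1
  have := k1.unique k2
  have hv : v = v' := by
    rcases hε with rfl | rfl <;> rcases hε' with rfl | rfl <;> cases v <;> cases v' <;>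
      simp [axis] at this ⊢
  subst hv
  have hε : ε = ε' := by
    rcases hε with rfl | rfl <;> rcases hε' with rfl | rfl <;> cases v <;>
      simp [axis] at this ⊢
  subst hε
  exact ⟨by simpa using e, rfl⟩

theorem Tiled.half_mem (ht : Tiled tiles1 f) {c : ℤ × ℤ} {v : Bool} {ε : ℤ}
    (h : (c, v) ∈ dominoSet f n) (hε : ε = 1 ∨ ε = -1) :
    c + (ε * 2 ^ (n + 1)) • axis v ∈ levelQ f (n + 1) := by
  rcases hε with rfl | rfl
  · rw [one_mul]
    exact (ht.dom_iff.1 h).mem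
  · have : Pt f n _ _ := h
    have := this.mem
    rw [sub_eq_add_neg] at this
    simpa using this

/-- Half of the width and half of the height of a domino, in units of a quarter. -/
def halfWidth (v : Bool) : ℤ := if v then 2 else 4
def halfHeight (v : Bool) : ℤ := if v then 4 else 2

/-- A criterion for dominoes at integral positions to form a tiling. -/
theorem isDominoTiling_image_rect {E : Set ((ℤ × ℤ) × Bool)}
    (h : ∀ x y v x' y' v', ((x, y), v) ∈ E → ((x', y'), v') ∈ E → ¬ (x = x' ∧ y = y' ∧ v = v') →
      x' - x ≥ halfWidth v + halfWidth v' ∨ x - x' ≥ halfWidth v + halfWidth v' ∨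
      y' - y ≥ halfHeight v + halfHeight v' ∨ y - y' ≥ halfHeight v + halfHeight v')
    (hc : ∀ i j : ℤ, ∃ x y v, ((x, y), v) ∈ E ∧ x - halfWidth v ≤ i ∧ i + 1 ≤ x + halfWidth v ∧
      y - halfHeight v ≤ j ∧ j + 1 ≤ y + halfHeight v) :
    IsDominoTiling (rect (1 / 4) '' E) := by
  have mem : ∀ {x y : ℤ} {v : Bool} {p : Plane}, p ∈ rect (1 / 4) ((x, y), v) ↔
      (-(halfWidth v : ℝ) ≤ 4 * p 0 - x ∧ 4 * p 0 - x ≤ halfWidth v) ∧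
      (-(halfHeight v : ℝ) ≤ 4 * p 1 - y ∧ 4 * p 1 - y ≤ halfHeight v) := by
    intro x y v p
    cases v <;> simp only [rect, horiz, vert, Bool.false_eq_true, if_false, if_true,
      Set.mem_ofPred_eq, abs_le, halfWidth, halfHeight] <;> push_cast <;> constructor <;> intro hp <;>
      refine ⟨⟨?_, ?_⟩, ?_, ?_⟩ <;> linarith [hp.1.1, hp.1.2, hp.2.1, hp.2.2]
  refine ⟨⟨?_, ?_⟩, ?_⟩
  · rintro _ ⟨d, -, rfl⟩
    exact rect_isDomino _ d
  · rintro _ ⟨⟨⟨x, y⟩, v⟩, hd, rfl⟩ _ ⟨⟨⟨x', y'⟩, v'⟩, hd', rfl⟩ hne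
    have hne' : ¬ (x = x' ∧ y = y' ∧ v = v') := by
      rintro ⟨rfl, rfl, rfl⟩; exact hne rfl
    rcases h x y v x' y' v' hd hd' hne' with h | h | h | h
    · refine disjoint_interior 0 ((x + halfWidth v) / 4) fun p hp hp' => ?_
      have h' : (x' : ℝ) - x ≥ halfWidth v + halfWidth v' := by exact_mod_cast h
      linarith [(mem.1 hp).1.2, (mem.1 hp').1.1]
    · refine disjoint_interior 0 ((x - halfWidth v) / 4) fun p hp hp' => ?_
      have h' : (x : ℝ) - x' ≥ halfWidth v + halfWidth v' := by exact_mod_cast h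
      linarith [(mem.1 hp).1.1, (mem.1 hp').1.2]
    · refine disjoint_interior 1 ((y + halfHeight v) / 4) fun p hp hp' => ?_
      have h' : (y' : ℝ) - y ≥ halfHeight v + halfHeight v' := by exact_mod_cast h
      linarith [(mem.1 hp).2.2, (mem.1 hp').2.1]
    · refine disjoint_interior 1 ((y - halfHeight v) / 4) fun p hp hp' => ?_
      have h' : (y : ℝ) - y' ≥ halfHeight v + halfHeight v' := by exact_mod_cast h
      linarith [(mem.1 hp).2.1, (mem.1 hp').2.2]
  · rw [Set.eq_univ_iff_forall]
    intro p
    obtain ⟨x, y, v, hE, h1, h2, h3, h4⟩ := hc ⌊4 * p 0⌋ ⌊4 * p 1⌋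
    have a1 := Int.floor_le (4 * p 0)
    have a2 := Int.lt_floor_add_one (4 * p 0)
    have b1 := Int.floor_le (4 * p 1)
    have b2 := Int.lt_floor_add_one (4 * p 1)
    have h1' : (x : ℝ) - halfWidth v ≤ ⌊4 * p 0⌋ := by exact_mod_cast h1
    have h2' : (⌊4 * p 0⌋ : ℝ) + 1 ≤ x + halfWidth v := by exact_mod_cast h2
    have h3' : (y : ℝ) - halfHeight v ≤ ⌊4 * p 1⌋ := by exact_mod_cast h3
    have h4' : (⌊4 * p 1⌋ : ℝ) + 1 ≤ y + halfHeight v := by exact_mod_cast h4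
    refine ⟨_, ⟨_, hE, rfl⟩, mem.2 ⟨⟨?_, ?_⟩, ?_, ?_⟩⟩ <;> linarith

/-- Each domino consists of two blocks of level `1`, these blocks tile the plane, and by
`half_unique` no block belongs to two dominoes. -/
theorem Tiled.dominoTiling_isDominoTiling (ht : Tiled tiles1 f) :
    IsDominoTiling (dominoTiling f) := by
  refine isDominoTiling_image_rect ?_ ?_
  · intro x y v x' y' v' hd hd' hne
    have far : ∀ ε ε' : ℤ, (ε = 1 ∨ ε = -1) → (ε' = 1 ∨ ε' = -1) →
        ¬ ((x + ε * 2 * (axis v).1 < x' + ε' * 2 * (axis v').1 + 4 ∧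
          x' + ε' * 2 * (axis v').1 < x + ε * 2 * (axis v).1 + 4) ∧
          y + ε * 2 * (axis v).2 < y' + ε' * 2 * (axis v').2 + 4 ∧
          y' + ε' * 2 * (axis v').2 < y + ε * 2 * (axis v).2 + 4) := by
      intro ε ε' hε hε' ⟨⟨h1, h2⟩, h3, h4⟩
      have m1 := ht.half_mem hd hε
      have m2 := ht.half_mem hd' hε'
      have := (ht.level 1).sep _ _ _ _ m1 m2 (by simpa using h1) (by simpa using h2)
        (by simpa using h3) (by simpa using h4)
      have := ht.half_unique hd hd' hε hε' (Prod.ext this.1 this.2)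
      simp only [Prod.mk.injEq] at this
      exact hne ⟨this.1.1, this.1.2, this.2⟩
    have f1 := far 1 1 (by simp) (by simp)
    have f2 := far 1 (-1) (by simp) (by simp)
    have f3 := far (-1) 1 (by simp) (by simp)
    have f4 := far (-1) (-1) (by simp) (by simp)
    cases v <;> cases v' <;> simp [axis] at f1 f2 f3 f4 <;> simp [halfWidth, halfHeight] <;> omega
  · intro i j
    obtain ⟨x, y, hq, h1, h2, h3, h4⟩ := (ht.level 1).cov i j
    obtain ⟨g, hg, e⟩ := exists_pt hq
    have P : Pt f 0 (x, y) (g.lin (0, -1)) := ⟨g, hg, e, rfl⟩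
    have hD : Dom f 0 ((x, y) + (2 : ℤ) • g.lin (0, -1)) (g.lin (0, -1)) := by
      refine pt_congr P ?_ rfl
      simp
    refine ⟨_, _, _, ht.mem_dominoSet hD g.lin_south, ?_⟩
    have : g.lin (0, -1) = (1, 0) ∨ g.lin (0, -1) = (-1, 0) ∨ g.lin (0, -1) = (0, 1) ∨
        g.lin (0, -1) = (0, -1) := by
      obtain ⟨b, k, u⟩ := g
      cases b <;> fin_cases k <;> simp [LatticeIsom.lin, LatticeIsom.pos, Nat.iterate]
    rcases this with h | h | h | h <;> rw [h] <;> simp [halfWidth, halfHeight] <;> omega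

end

/-! ### The hierarchical tiling by dominoes -/

/-- The rules that correspond to the crossings of key tiles in `T` belong to `S`. -/
structure RulesFor (T : Set Cell) (S : Set Rule) : Prop where
  table : keyE T 1 → keyN T 2 → tableRule ⊆ S
  parallel : keyE T 0 → keyN T 3 → parallelRule ⊆ S
  perp : keyE T 1 → keyE T 2 → keyE T 3 → perpRule ⊆ S
  asym : ¬ Disjoint T mixTiles → keyE T 0 → keyE T 1 → keyE T 2 → keyE T 3 → keyN T 3 → asymRules ⊆ S

section
variable {T : Set Cell} {f : ℤ × ℤ → Cell} {n : ℕ}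

/-- A frame of a domino in which its children form one of the patterns of the rules in `S`. -/
def GoodFrame (S : Set Rule) (f : ℤ × ℤ → Cell) : ℕ → (ℤ × ℤ) × Bool → LatticeIsom → Prop
  | 0, d, g => g.key = d
  | n + 1, d, g => g.key = d ∧ ∃ K ∈ pats4, Children (view g f) n K ∧ rulesOf (pieces K) ⊆ S

theorem GoodFrame.key {S : Set Rule} {d : (ℤ × ℤ) × Bool} {g : LatticeIsom}
    (h : GoodFrame S f n d g) : g.key = d := by
  cases n with
  | zero => exact h
  | succ n => exact h.1

theorem Tiled.exists_goodFrame (hT : T ⊆ tiles1) (hf : Tiled T f) {S : Set Rule} (hS : RulesFor T S)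
    {d : (ℤ × ℤ) × Bool} (hd : d ∈ dominoSet f n) : ∃ g, GoodFrame S f n d g := by
  obtain ⟨c, v⟩ := d
  cases n with
  | zero => exact ⟨⟨false, if v then 3 else 0, c⟩, by cases v <;> simp [GoodFrame, LatticeIsom.key]⟩
  | succ n =>
    -- Three clockwise quarter turns carry `(1, 0)` to `axis true`; a single one would give its
    -- opposite.
    have h0 : Dom (DominoTiles.view ⟨false, if v then 3 else 0, c⟩ f) (n + 1) (0, 0) (1, 0) := by
      rw [dom_view]
      have h1 := (⟨false, if v then 3 else 0, c⟩ : LatticeIsom).pos_zero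
      have h2 : (⟨false, if v then 3 else 0, c⟩ : LatticeIsom).lin (1, 0) = axis v := by
        cases v <;> simp [LatticeIsom.lin, LatticeIsom.pos, Nat.iterate, axis]
      rw [h2]
      change Dom f (n + 1) (LatticeIsom.pos _ 0) _
      rw [h1]
      exact hd
    obtain ⟨b, h⟩ := (hf.view _).exists_children hT h0
    have hk : ((⟨false, if v then 3 else 0, c⟩ : LatticeIsom).comp ⟨b, 0, 0⟩).key = (c, v) := by
      cases v <;> cases b <;> simp [LatticeIsom.key, LatticeIsom.comp, LatticeIsom.pos, Nat.iterate]
    refine ⟨_, hk, ?_⟩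
    rw [view_comp]
    rcases h with ⟨h, k⟩ | ⟨h, k⟩ | ⟨h, k⟩ | ⟨h, k⟩
    · exact ⟨_, by simp [pats4], h, by rw [← tableRule_eq]; exact hS.table k.1 k.2⟩
    · exact ⟨_, by simp [pats4], h, by rw [← parallelRule_eq]; exact hS.parallel k.1 k.2⟩
    · exact ⟨_, by simp [pats4], h, by rw [← perpRule_eq]; exact hS.perp k.1 k.2.1 k.2.2⟩
    · exact ⟨_, by simp [pats4], h, by
        rw [← asymRules_eq]; exact hS.asym k.1 k.2.1 k.2.2.1 k.2.2.2.1 k.2.2.2.2.1 k.2.2.2.2.2⟩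

/-- Each domino of each level receives a frame in which its children form a pattern of `S`. These
frames are chosen independently, so the rule applied to a parent has to place every child by the
child's own frame; this is possible because `rulesOf` contains all choices of isometries. -/
theorem Tiled.isHierarchical (hT : T ⊆ tiles1) (hf : Tiled T f) {S : Set Rule} (hS : RulesFor T S) :
    IsHierarchical S (dominoTiling f) := by
  have ht := hf.mono hT
  have hex : ∀ n, ∀ d ∈ dominoSet f n, ∃ g, GoodFrame S f n d g :=
    fun n d hd => hf.exists_goodFrame hT hS hd
  have hne : Nonempty LatticeIsom := ⟨⟨false, 0, 0⟩⟩
  choose! G hG using hex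
  let γ : ℕ → (ℤ × ℤ) × Bool → Isom := fun n d => (G n d).isom (scale n)
  have hγ : ∀ n, ∀ d ∈ dominoSet f n, γ n d '' domino = rect (scale n) d := by
    intro n d hd
    rw [LatticeIsom.isom_image_domino, (hG n d hd).key]
  have hex : ∀ n, ∀ d ∈ dominoSet f (n + 1), ∃ ρ ∈ S,
      (∀ x ∈ ρ, inflate (γ (n + 1) d) * x ∈ γ n '' dominoSet f n) ∧
      ∀ d' ∈ dominoSet f n, Parent f n d' d → ∃ x ∈ ρ, γ n d' = inflate (γ (n + 1) d) * x := by
    intro n d hd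
    obtain ⟨hk, K, hK, hc, hKS⟩ := hG (n + 1) d hd
    have hi : inflate (γ (n + 1) d) = (G (n + 1) d).isom (scale n) := by
      rw [LatticeIsom.inflate_isom, two_mul_scale]
    rw [hi]
    set g := G (n + 1) d with hg
    have hch : ∀ x ∈ K, g.isom (scale n) '' piece x =
        rect (scale n) (g.pos ((2 ^ (n + 1) : ℤ) • x.1), decide ((g.lin x.2).1 = 0)) :=
      fun x hx => g.image_piece n (pats4_unit K hK x hx)
    have hex : ∀ p ∈ pieces K, ∃ d' ∈ dominoSet f n, g.isom (scale n) '' p = rect (scale n) d' := by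
      rintro _ ⟨x, hx, rfl⟩
      exact ⟨_, ht.child_mem (pats4_unit K hK x hx) (hc x hx), hch x hx⟩
    choose! D hD hD' using hex
    -- After multiplication by the frame of the parent, this isometry becomes exactly the frame
    -- chosen for the child.
    refine ⟨_, hKS (image_mem_rulesOf (fun p => (g.isom (scale n))⁻¹ * γ n (D p)) ?_), ?_, ?_⟩
    · intro p hp
      have : ((g.isom (scale n))⁻¹ * γ n (D p) : Isom) '' domino =
          ((g.isom (scale n))⁻¹ : Isom) '' (γ n (D p) '' domino) := by
        rw [← Set.image_comp]; rfl
      rw [this, hγ n _ (hD p hp), ← hD' p hp, ← Set.image_comp]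
      have e : ((g.isom (scale n))⁻¹ : Isom) ∘ (g.isom (scale n)) = id := by
        funext q; exact (g.isom (scale n)).symm_apply_apply q
      rw [e, Set.image_id]
    · rintro _ ⟨p, hp, rfl⟩
      rw [mul_inv_cancel_left]
      exact ⟨D p, hD p hp, rfl⟩
    · intro d' hd' hpar
      obtain ⟨x, hx, e⟩ := hpar g hk K hK hc
      have hp : piece x ∈ pieces K := ⟨x, hx, rfl⟩
      refine ⟨_, ⟨piece x, hp, rfl⟩, ?_⟩
      rw [mul_inv_cancel_left]
      have := hD' _ hp
      rw [hch x hx, ← e] at this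
      rw [rect_injective (scale_pos n) this]
  choose! R hRS hRX hRP using hex
  -- Rules are assigned to isometries, so the domino has to be recovered from its frame; its image
  -- as a set suffices.
  let δ : ℕ → Isom → (ℤ × ℤ) × Bool := fun n x =>
    Classical.epsilon fun d => rect (scale n) d = x '' domino
  have hδ : ∀ n, ∀ d ∈ dominoSet f n, δ n (γ n d) = d := by
    intro n d hd
    refine rect_injective (scale_pos n) ?_
    rw [← hγ n d hd]
    exact Classical.epsilon_spec (p := fun d' => rect (scale n) d' = γ n d '' domino) ⟨d, (hγ n d hd).symm⟩
  have h0 : placed (γ 0 '' dominoSet f 0) = dominoTiling f := by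
    rw [placed, Set.image_image, dominoTiling]
    refine Set.image_congr fun d hd => ?_
    rw [hγ 0 d hd]
    norm_num [scale]
  rw [← h0]
  refine isHierarchical_of_frames (fun n => γ n '' dominoSet f n) (fun n x => R n (δ (n + 1) x)) ?_ ?_ ?_
  · rw [h0]; exact ht.dominoTiling_isDominoTiling
  · rintro n _ ⟨d, hd, rfl⟩
    rw [hδ _ d hd]
    exact ⟨hRS n d hd, hRX n d hd⟩
  · rintro n _ ⟨d', hd', rfl⟩
    obtain ⟨d, hd, hp⟩ := ht.exists_parent hd'
    refine ⟨_, ⟨d, hd, rfl⟩, ?_⟩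
    rw [hδ _ d hd]
    exact hRP n d hd d' hd' hp

/-! ### Framed blocks -/

theorem config_subset_graph {g : LatticeIsom} {C : Config} :
    g.config C ⊆ graph f ↔ ∀ x ∈ C, view g f x.1 = x.2 := by
  constructor
  · intro h x hx
    have := h ⟨x, hx, rfl⟩
    have e : Cell.move g.flip g.turns x.2 = f (g.pos x.1) := this
    rw [view, ← e, Cell.unmove_move]
  · rintro h _ ⟨x, hx, rfl⟩
    change Cell.move g.flip g.turns x.2 = f (g.pos x.1)
    rw [← h x hx, view, Cell.move_unmove]

/-- The eight tiles are grouped as the two facing half-blocks of a domino, each written as a turned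
copy of the standard one. -/
theorem frame_eq : frame = {((3, -1), Cell.move false 1 (tileA true)),
    ((3, 1), Cell.move false 1 (tileA true).flip),
    ((1, -1), Cell.move false 1 (Cell.move false 3 (tileB true))),
    ((1, 1), Cell.move false 1 (Cell.move false 3 (tileB true)).flip),
    ((-3, 1), Cell.move false 3 (tileA true)),
    ((-3, -1), Cell.move false 3 (tileA true).flip),
    ((-1, 1), Cell.move false 3 (Cell.move false 3 (tileB true))),
    ((-1, -1), Cell.move false 3 (Cell.move false 3 (tileB true)).flip)} := by
  ext x
  constructor
  · rintro ⟨b, k, hk, y, hy, rfl⟩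
    rcases hy with rfl | rfl <;> cases b <;> rcases hk with rfl | rfl <;> decide
  · intro h
    simp only [Set.mem_insert_iff, Set.mem_singleton_iff] at h
    have key : ∀ b k, (k = 0 ∨ k = 2) → ∀ y : (ℤ × ℤ) × Cell,
        (y = ((-3, 1), Cell.move false 3 (tileA true)) ∨ y = ((-1, 1), Cell.move false 2 (tileB true))) →
        (((⟨b, k, 0⟩ : LatticeIsom).pos y.1, Cell.move b k y.2) : (ℤ × ℤ) × Cell) = x → x ∈ frame := by
      rintro b k hk y hy rfl
      exact ⟨b, k, by simpa using hk, y, by simpa using hy, rfl⟩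
    rcases h with rfl | rfl | rfl | rfl | rfl | rfl | rfl | rfl
    · exact key false 2 (by simp) _ (Or.inl rfl) (by decide)
    · exact key true 0 (by simp) _ (Or.inl rfl) (by decide)
    · exact key false 2 (by simp) _ (Or.inr rfl) (by decide)
    · exact key true 0 (by simp) _ (Or.inr rfl) (by decide)
    · exact key false 0 (by simp) _ (Or.inl rfl) (by decide)
    · exact key true 2 (by simp) _ (Or.inl rfl) (by decide)
    · exact key false 0 (by simp) _ (Or.inr rfl) (by decide)
    · exact key true 2 (by simp) _ (Or.inr rfl) (by decide)

theorem LatticeIsom.key_axis (g : LatticeIsom) :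
    g.lin (1, 0) = axis g.key.2 ∨ g.lin (1, 0) = -axis g.key.2 := by
  obtain ⟨b, k, u⟩ := g
  cases b <;> fin_cases k <;> simp [axis, lin, pos, Nat.iterate, key]

theorem Tiled.dom_key_iff (ht : Tiled tiles1 f) {g : LatticeIsom} :
    g.key ∈ dominoSet f n ↔ Dom (DominoTiles.view g f) n (0, 0) (1, 0) := by
  rw [dom_view]
  change Dom f n g.key.1 _ ↔ Dom f n (g.pos 0) _
  rw [g.pos_zero]
  rcases g.key_axis with h | h
  · rw [h]; rfl
  · rw [h, ht.dom_neg]; rfl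

/-- The eight tiles are those of two half-blocks of level `0` facing each other. Conversely, four of
them already give one half-block, and its partner is forced. -/
theorem Tiled.frame_iff (ht : Tiled tiles1 f) {g : LatticeIsom} :
    g.config frame ⊆ graph f ↔ g.key ∈ dominoSet f 0 := by
  rw [ht.dom_key_iff, config_subset_graph, frame_eq]
  have ht' := ht.view g
  generalize DominoTiles.view g f = F at *
  have e1 : (⟨false, 1, (2, 0)⟩ : LatticeIsom).lin (0, -1) = (-1, 0) := by decide
  have e3 : (⟨false, 3, (-2, 0)⟩ : LatticeIsom).lin (0, -1) = (1, 0) := by decide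
  have hHB : ∀ {F}, HalfBlock F (2 ^ 0) (levelQ F 0) → F (1, 1) = tileA true ∧
      F (-1, 1) = (tileA true).flip ∧ F (1, -1) = Cell.move false 3 (tileB true) ∧
      F (-1, -1) = (Cell.move false 3 (tileB true)).flip := by
    rintro F ⟨⟨h1, c1, e1⟩, ⟨h2, c2, e2⟩, ⟨h3, c3, e3⟩, ⟨h4, c4, e4⟩⟩
    simp only [pow_zero] at *
    have k1 : (F (1, 1)).cornered = true := h1
    have k2 : (F (-1, 1)).cornered = true := h2
    have k3 : (F (1, -1)).cornered = true := h3
    have k4 : (F (-1, -1)).cornered = true := h4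
    rw [e1] at k1 ⊢
    rw [e2] at k2 ⊢
    rw [e3] at k3 ⊢
    rw [e4] at k4 ⊢
    obtain rfl : c1 = true := k1
    obtain rfl : c2 = true := k2
    obtain rfl : c3 = true := k3
    obtain rfl : c4 = true := k4
    exact ⟨rfl, rfl, rfl, rfl⟩
  have hun : ∀ {k : Fin 4} {c c' : Cell}, Cell.unmove false k c = c' → c = Cell.move false k c' := by
    rintro k c _ rfl; rw [Cell.move_unmove]
  constructor
  · intro h
    simp only [Set.mem_insert_iff, Set.mem_singleton_iff, forall_eq_or_imp, forall_eq] at h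
    obtain ⟨h1, h2, h3, h4, -, -, -, -⟩ := h
    rw [ht'.dom_iff]
    refine ⟨⟨false, 1, (2, 0)⟩, ?_, by simp, e1⟩
    rw [H_iff]
    have cor : ∀ p, (F p).cornered = true → p ∈ levelQ F 0 := fun p h => h
    have v : ∀ x y, DominoTiles.view ⟨false, 1, (2, 0)⟩ F (x, y) =
        Cell.unmove false 1 (F (y + 2, -x)) := by
      intro x y; simp [DominoTiles.view, LatticeIsom.pos]
    have w1 : DominoTiles.view ⟨false, 1, (2, 0)⟩ F (1, 1) = tileA true := by
      rw [v]; norm_num [h1]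
    have w2 : DominoTiles.view ⟨false, 1, (2, 0)⟩ F (-1, 1) = (tileA true).flip := by
      rw [v]; norm_num [h2]
    have w3 : DominoTiles.view ⟨false, 1, (2, 0)⟩ F (1, -1) = Cell.move false 3 (tileB true) := by
      rw [v]; norm_num [h3]
    have w4 : DominoTiles.view ⟨false, 1, (2, 0)⟩ F (-1, -1) =
        (Cell.move false 3 (tileB true)).flip := by
      rw [v]; norm_num [h4]
    rw [pow_zero]
    refine ⟨⟨?_, true, w1⟩, ⟨?_, true, w2⟩, ⟨?_, true, w3⟩, ⟨?_, true, w4⟩⟩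
    · change Cell.cornered _ = true
      rw [w1]; rfl
    · change Cell.cornered _ = true
      rw [w2]; rfl
    · change Cell.cornered _ = true
      rw [w3]; rfl
    · change Cell.cornered _ = true
      rw [w4]; rfl
  · intro h
    have a := hHB (H_iff.1 ((ht'.dom_iff.1 h).frame (g := ⟨false, 1, (2, 0)⟩) (by simp) e1))
    have b := hHB (H_iff.1 (Pt.frame h (g := ⟨false, 3, (-2, 0)⟩) (by simp) e3))
    simp only [DominoTiles.view, LatticeIsom.pos] at a b
    simp [Nat.iterate] at a b
    obtain ⟨a1, a2, a3, a4⟩ := a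
    obtain ⟨b1, b2, b3, b4⟩ := b
    simp only [Set.mem_insert_iff, Set.mem_singleton_iff, forall_eq_or_imp, forall_eq]
    exact ⟨hun a1, hun a2, hun a3, hun a4, hun b1, hun b2, hun b3, hun b4⟩

theorem Tiled.erase_eq (ht : Tiled tiles1 f) : erase (graph f) = dominoTiling f := by
  ext t
  simp only [erase, derive, dominoTiling, Set.mem_singleton_iff, exists_eq_left]
  constructor
  · rintro ⟨g, hg, rfl⟩
    exact ⟨_, ht.frame_iff.1 hg, by rw [LatticeIsom.plane_eq, LatticeIsom.isom_image_domino]⟩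
  · rintro ⟨⟨c, v⟩, hd, rfl⟩
    have hk : (⟨false, if v then 1 else 0, c⟩ : LatticeIsom).key = (c, v) := by
      cases v <;> simp [LatticeIsom.key]
    refine ⟨⟨false, if v then 1 else 0, c⟩, ht.frame_iff.2 (by rw [hk]; exact hd), ?_⟩
    rw [LatticeIsom.plane_eq, LatticeIsom.isom_image_domino, hk]

end

theorem IsTiling.erase_isHierarchical {T : Set Cell} (hT : T ⊆ tiles1) {S : Set Rule}
    (hS : RulesFor T S) {τ : Config} (h : IsTiling T τ) : IsHierarchical S (erase τ) := by
  obtain ⟨f, hf, e⟩ := h.exists_tiled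
  have : τ = graph f := by
    ext ⟨p, c⟩
    exact e p c
  rw [this, (hf.mono hT).erase_eq]
  exact hf.isHierarchical hT hS

/-! ### Enforcement -/

theorem IsSupertile.mono {S S' : Set Rule} (hS : S ⊆ S') {n : ℕ} {P : Set Isom}
    (h : IsSupertile S n P) : IsSupertile S' n P := by
  induction h with
  | base => exact .base
  | move g _ ih => exact ih.move g
  | subst _ σ hσ ih => exact ih.subst σ fun g hg => hS (hσ g hg)

theorem IsHierarchical.mono {S S' : Set Rule} (hS : S ⊆ S') {C : Set (Set Plane)}
    (h : IsHierarchical S C) : IsHierarchical S' C := by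
  refine ⟨h.1, fun t ht => ?_⟩
  obtain ⟨P, h0, h1⟩ := h.2 t ht
  exact ⟨P, h0, fun n => ⟨(h1 n).1.mono hS, (h1 n).2⟩⟩

theorem Enforces.mono_rules {T : Set Cell} {S S' : Set Rule} (hS : S ⊆ S') (h : Enforces T S) :
    Enforces T S' := by
  obtain ⟨pats, φ, h1, h2, h3⟩ := h
  exact ⟨pats, φ, h1, h2, fun τ hτ => ⟨(h3 τ hτ).1, (h3 τ hτ).2.mono hS⟩⟩

theorem Admitted.mono {T T' : Set Cell} (hT : T ⊆ T') {C : Config} (h : Admitted T C) :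
    Admitted T' C :=
  ⟨fun x hx => let ⟨t, ht, e⟩ := h.congruent x hx; ⟨t, hT ht, e⟩, h.unique, h.fits_e, h.fits_n,
    h.corners⟩

theorem Admitted.subset {T : Set Cell} {C C' : Config} (hC : C' ⊆ C) (h : Admitted T C) :
    Admitted T C' :=
  ⟨fun x hx => h.congruent x (hC hx), fun p c c' h1 h2 => h.unique p c c' (hC h1) (hC h2),
    fun p c c' h1 h2 => h.fits_e p c c' (hC h1) (hC h2),
    fun p c c' h1 h2 => h.fits_n p c c' (hC h1) (hC h2),
    fun p x hx y hy => h.corners p x (hC hx) y (hC hy)⟩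

theorem IsTiling.mono {T T' : Set Cell} (hT : T ⊆ T') {τ : Config} (h : IsTiling T τ) :
    IsTiling T' τ := ⟨h.admitted.mono hT, h.full, h.vertices⟩

theorem IsTiling.exists_graph {T : Set Cell} {τ : Config} (h : IsTiling T τ) :
    ∃ f, Tiled T f ∧ τ = graph f := by
  obtain ⟨f, hf, e⟩ := h.exists_tiled
  refine ⟨f, hf, ?_⟩
  ext ⟨p, c⟩
  exact e p c

/-- A configuration in a tiling is admitted. -/
theorem IsTiling.admitted_of_config {T : Set Cell} {τ : Config} (h : IsTiling T τ)
    {g : LatticeIsom} {C : Config} (hC : g.config C ⊆ τ) : Admitted T C := by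
  obtain ⟨f, hf, rfl⟩ := h.exists_graph
  rw [config_subset_graph] at hC
  exact (hf.view g).isTiling.admitted.subset fun x hx => (hC x hx).symm

/-- Patterns not admitted by the smaller set are discarded. They do not occur in its tilings, so the
derivation has the same result. -/
theorem Enforces.anti_tiles {T T' : Set Cell} {S : Set Rule} (hT : T ⊆ T') (h : Enforces T' S) :
    Enforces T S := by
  obtain ⟨pats, φ, h1, h2, h3⟩ := h
  refine ⟨{C ∈ pats | Admitted T C}, φ, h1.subset (Set.sep_subset _ _), ?_, ?_⟩
  · rintro C ⟨hC, hA⟩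
    exact ⟨(h2 C hC).1, hA, (h2 C hC).2.2⟩
  · intro τ hτ
    obtain ⟨h4, h5⟩ := h3 τ (hτ.mono hT)
    have e : derive {C ∈ pats | Admitted T C} φ τ = derive pats φ τ := by
      ext t
      constructor
      · rintro ⟨g, C, ⟨hC, -⟩, h⟩
        exact ⟨g, C, hC, h⟩
      · rintro ⟨g, C, hC, h, h'⟩
        exact ⟨g, C, ⟨hC, hτ.admitted_of_config h⟩, h, h'⟩
    rw [e]
    refine ⟨fun x hx => ?_, h5⟩
    obtain ⟨g, C, hC, h, h'⟩ := h4 x hx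
    exact ⟨g, C, ⟨hC, hτ.admitted_of_config h⟩, h, h'⟩

theorem tiles1_finite : tiles1.Finite :=
  (List.finite_toSet tileList).subset fun _ h => mem_tileList_of_mem h

theorem admitted_singleton {T : Set Cell} {t : Cell} (ht : t ∈ T) : Admitted T {(0, t)} := by
  refine ⟨?_, ?_, ?_, ?_, ?_⟩
  · rintro _ rfl
    exact ⟨t, ht, false, 0, rfl⟩
  · intro p c c' h h'
    simp only [Set.mem_singleton_iff, Prod.mk.injEq] at h h'
    rw [h.2, h'.2]
  · intro p c c' h h'
    simp only [Set.mem_singleton_iff, Prod.mk.injEq, Prod.ext_iff, Prod.fst_zero, Prod.snd_zero] at h h'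
    omega
  · intro p c c' h h'
    simp only [Set.mem_singleton_iff, Prod.mk.injEq, Prod.ext_iff, Prod.fst_zero, Prod.snd_zero] at h h'
    omega
  · rintro p _ rfl _ rfl _ _ _ _
    rfl

theorem admitted_frame {T : Set Cell} (hA : tileA true ∈ T) (hB : tileB true ∈ T) :
    Admitted T frame := by
  have hne : ∀ x ∈ frame, ∀ y ∈ frame, x = y ∨ x.1.1 - y.1.1 ≥ 2 ∨ y.1.1 - x.1.1 ≥ 2 ∨
      x.1.2 - y.1.2 ≥ 2 ∨ y.1.2 - x.1.2 ≥ 2 := by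
    rw [frame_eq]
    rintro x (rfl | rfl | rfl | rfl | rfl | rfl | rfl | rfl) y
      (rfl | rfl | rfl | rfl | rfl | rfl | rfl | rfl) <;> first | exact Or.inl rfl | (right; decide)
  refine ⟨?_, ?_, ?_, ?_, ?_⟩
  · rintro _ ⟨b, k, -, y, hy, rfl⟩
    have : y.2 ∈ oriented T := by
      rcases hy with rfl | rfl
      · exact ⟨_, hA, _, _, rfl⟩
      · exact ⟨_, hB, _, _, rfl⟩
    have h2 : ∀ n c, c ∈ oriented T → Cell.turn^[n] c ∈ oriented T := by
      intro n
      induction n with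
      | zero => exact fun c h => h
      | succ n ih => exact fun c h => ih _ (turn_mem_oriented h)
    have h3 : Cell.move b k y.2 ∈ oriented T := by
      refine h2 _ _ ?_
      split_ifs
      · exact flip_mem_oriented this
      · exact this
    obtain ⟨t, ht, b', k', e⟩ := h3
    exact ⟨t, ht, b', k', e⟩
  · intro p c c' h h'
    rcases hne _ h _ h' with e | e
    · exact congrArg Prod.snd e
    · simp at e
  · intro p c c' h h'
    rcases hne _ h _ h' with e | e
    · have := congrArg (fun x => x.1.1) e
      simp at this
    · simp at e
  · intro p c c' h h'
    rcases hne _ h _ h' with e | e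
    · have := congrArg (fun x => x.1.2) e
      simp at this
    · simp at e
  · rintro ⟨u, v⟩ ⟨⟨x, y⟩, c⟩ hx ⟨⟨x', y'⟩, c'⟩ hy h1 h2 - -
    rcases hne _ hx _ hy with e | e
    · exact e
    · simp [around] at h1 h2 e
      omega

theorem frame_finite : frame.Finite := by
  rw [frame_eq]
  exact Set.toFinite _

theorem isDominoConfig_domino : IsDominoConfig {domino} := by
  refine ⟨?_, Set.pairwise_singleton _ _⟩
  rintro _ rfl
  exact ⟨1, by simp⟩

theorem isDominoConfig_empty : IsDominoConfig ∅ := ⟨by simp, Set.pairwise_empty _⟩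

theorem singleton_cover {T : Set Cell} {τ : Config} (h : IsTiling T τ) {x : (ℤ × ℤ) × Cell}
    (hx : x ∈ τ) : ∃ g : LatticeIsom, ∃ t ∈ T, g.config {(0, t)} ⊆ τ ∧ x ∈ g.config {(0, t)} := by
  obtain ⟨p, c⟩ := x
  obtain ⟨t, ht, b, k, e⟩ := h.admitted.congruent _ hx
  have e' : c = Cell.move b k t := e
  have : (⟨b, k, p⟩ : LatticeIsom).config {(0, t)} = {(p, c)} := by
    simp only [LatticeIsom.config, Set.image_singleton, LatticeIsom.pos_zero, e']
  exact ⟨⟨b, k, p⟩, t, ht, by simpa [this] using hx, by simp [this]⟩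

/-- Erasing the markings is a local derivation. -/
theorem enforces_of_erase {T : Set Cell} (ho : outwardTiles ⊆ T) (hT : T ⊆ tiles1) {S : Set Rule}
    (h : ∀ τ, IsTiling T τ → IsHierarchical S (erase τ)) : Enforces T S := by
  classical
  -- Single tiles with empty image are added because the patterns have to cover every tiling.
  refine ⟨{frame} ∪ (fun t => {(0, t)}) '' T, fun C => if C = frame then {domino} else ∅, ?_, ?_, ?_⟩
  · exact (Set.finite_singleton _).union ((tiles1_finite.subset hT).image _)
  · rintro C (rfl | ⟨t, ht, rfl⟩)
    · simp only [if_true]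
      exact ⟨frame_finite, admitted_frame (ho (by simp [outwardTiles])) (ho (by simp [outwardTiles])),
        Set.finite_singleton _, isDominoConfig_domino⟩
    · refine ⟨Set.finite_singleton _, admitted_singleton ht, ?_⟩
      dsimp only
      split_ifs
      · exact ⟨Set.finite_singleton _, isDominoConfig_domino⟩
      · exact ⟨Set.finite_empty, isDominoConfig_empty⟩
  · intro τ hτ
    constructor
    · intro x hx
      obtain ⟨g, t, ht, h⟩ := singleton_cover hτ hx
      exact ⟨g, _, Or.inr ⟨t, ht, rfl⟩, h⟩
    · convert h τ hτ using 1
      ext t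
      simp only [derive, erase, Set.mem_ofPred_eq]
      refine exists_congr fun g => ⟨?_, ?_⟩
      · rintro ⟨C, -, hC, s, hs, e⟩
        split_ifs at hs with hc
        · exact ⟨frame, rfl, hc ▸ hC, s, hs, e⟩
        · exact hs.elim
      · rintro ⟨C, rfl, hC, s, hs, e⟩
        exact ⟨frame, Or.inl rfl, hC, s, by simpa using hs, e⟩

/-! ### The nine sets of tiles -/

@[simp] theorem cross_inj {h h' : Hor} {v v' : Ver} : cross h v = cross h' v' ↔ h = h' ∧ v = v' := by
  constructor
  · revert h h' v v'
    intro h h' v v'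
    cases h <;> cases h' <;> cases v <;> cases v' <;> decide
  · rintro ⟨rfl, rfl⟩; rfl

@[simp] theorem cross_mem_outwardTiles {h : Hor} {v : Ver} : ¬ cross h v ∈ outwardTiles := by
  simp [outwardTiles, cross, tileA, tileB, plainOut]
  cases h <;> cases v <;> decide

@[simp] theorem cross_mem_crossingTiles {h : Hor} {v : Ver} :
    cross h v ∈ crossingTiles ↔ ¬ (h = .zero ∧ v = .zero) ∧ ¬ (h = .zero ∧ v = .one) := by
  have : ∃ h' v', h = h' ∧ v = v' := ⟨h, v, rfl, rfl⟩
  simp [crossingTiles]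

@[simp] theorem cross_mem_tiles1 {h : Hor} {v : Ver} : cross h v ∈ tiles1 ↔ cross h v ∈ crossingTiles := by
  simp [tiles1]

@[simp] theorem cross_mem_restTiles1 {h : Hor} {v : Ver} :
    cross h v ∈ restTiles1 ↔ h ≠ .zero ∧ h ≠ .one ∨ v = .plain := by
  simp only [restTiles1, keyTiles1, Set.mem_sdiff, Set.mem_inter_iff, Set.mem_ofPred_eq, cross_inj,
    cross_mem_crossingTiles]
  cases h <;> cases v <;> simp

theorem cross_mem_tableTiles {h : Hor} {v : Ver} : cross h v ∈ tableTiles ↔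
    h = .zero ∧ v = .two ∨ h = .one ∧ v = .one ∨ h = .three ∧ v = .two ∨ h = .negThree ∧ v = .two ∨
    h = .plain ∧ v ≠ .two ∨ v = .plain := by
  simp only [tableTiles, Set.mem_union, cross_mem_outwardTiles, false_or, Set.mem_insert_iff,
    Set.mem_singleton_iff, cross_inj]
  cases h <;> cases v <;> simp

theorem cross_mem_parallelTiles {h : Hor} {v : Ver} : cross h v ∈ parallelTiles ↔
    h = .zero ∧ v = .three ∨ h = .one ∧ v = .zero ∨ h = .three ∧ v = .zero ∨
    h = .negThree ∧ v = .zero ∨ h = .plain ∨ v = .plain := by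
  simp only [parallelTiles, Set.mem_union, cross_mem_outwardTiles, false_or, Set.mem_insert_iff,
    Set.mem_singleton_iff, cross_inj]
  cases h <;> cases v <;> simp

theorem cross_mem_perpTiles {h : Hor} {v : Ver} : cross h v ∈ perpTiles ↔
    h = .one ∧ v ≠ .zero ∨ h = .three ∧ v = .zero ∨ h = .negThree ∧ v = .zero ∨ h = .plain ∨
    v = .plain := by
  simp only [perpTiles, Set.mem_union, cross_mem_outwardTiles, false_or, Set.mem_insert_iff,
    Set.mem_singleton_iff, cross_inj]
  cases h <;> cases v <;> simp

theorem cross_mem_asymTiles {h : Hor} {v : Ver} : cross h v ∈ asymTiles ↔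
    ¬ (h = .zero ∧ v = .zero) ∧ ¬ (h = .zero ∧ v = .one) ∧ ¬ (h = .zero ∧ v = .two) := by
  simp only [asymTiles, Set.mem_sdiff, cross_mem_tiles1, cross_mem_crossingTiles,
    Set.mem_singleton_iff, cross_inj, and_assoc]

/-- The first two components of a row of the table of substitution systems. -/
def rows : List (Set Cell × Set Rule) :=
  [(tableTiles, tableRule), (parallelTiles, parallelRule), (perpTiles, perpRule),
   (asymTiles, parallelRule ∪ perpRule ∪ asymRules),
   (tableTiles ∪ parallelTiles, tableRule ∪ parallelRule),
   (tableTiles ∪ perpTiles, tableRule ∪ perpRule),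
   (parallelTiles ∪ perpTiles, parallelRule ∪ perpRule),
   (tableTiles ∪ parallelTiles ∪ perpTiles, tableRule ∪ parallelRule ∪ perpRule),
   (tiles1, tableRule ∪ parallelRule ∪ perpRule ∪ asymRules)]

/-- It only remains to read off which key tiles and which mixed tiles each set contains. -/
theorem rulesFor_rows : ∀ row ∈ rows, RulesFor row.1 row.2 := by
  simp only [rows, List.forall_mem_cons]
  refine ⟨?_, ?_, ?_, ?_, ?_, ?_, ?_, ?_, ?_, by simp⟩ <;> constructor <;>
    simp [keyN, keyE, mixTiles, Set.disjoint_right, cross_mem_tableTiles, cross_mem_parallelTiles,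
      cross_mem_perpTiles, cross_mem_asymTiles, Set.subset_def] <;> tauto

/-- The rows in which the set of tiles admits no tiling with new rules when all tiles without
crossing signed markings are added, and the other two. -/
theorem rulesFor_rows_union : ∀ row ∈ rows, RulesFor (row.1 ∪ restTiles1) row.2 ∨
    row.2 = parallelRule ∪ perpRule ∨ row.2 = tableRule ∪ parallelRule ∪ perpRule := by
  simp only [rows, List.forall_mem_cons]
  refine ⟨.inl ?_, .inl ?_, .inl ?_, .inl ?_, .inl ?_, .inl ?_, by simp, by simp, .inl ?_, by simp⟩ <;>
    constructor <;>
    simp [keyN, keyE, mixTiles, Set.disjoint_right, cross_mem_tableTiles, cross_mem_parallelTiles,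
      cross_mem_perpTiles, cross_mem_asymTiles, Set.subset_def] <;> tauto

theorem outwardTiles_subset_rows : ∀ row ∈ rows, outwardTiles ⊆ row.1 := by
  have h1 : outwardTiles ⊆ tiles1 := Set.subset_union_left
  have h2 : outwardTiles ⊆ asymTiles := fun c hc => ⟨h1 hc, by
    rintro rfl
    exact cross_mem_outwardTiles hc⟩
  have h3 : outwardTiles ⊆ tableTiles := Set.subset_union_left
  have h4 : outwardTiles ⊆ parallelTiles := Set.subset_union_left
  have h5 : outwardTiles ⊆ perpTiles := Set.subset_union_left
  simp only [rows, List.forall_mem_cons]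
  refine ⟨h3, h4, h5, h2, ?_, ?_, ?_, ?_, h1, by simp⟩ <;> intro c hc <;> simp [h3 hc, h4 hc]

theorem tableTiles_subset : tableTiles ⊆ tiles1 := by
  rintro c (h | h)
  · exact .inl h
  · right
    rcases h with rfl | rfl | rfl | rfl | rfl | rfl | rfl | rfl | rfl | rfl | rfl | rfl <;> simp

theorem parallelTiles_subset : parallelTiles ⊆ tiles1 := by
  rintro c (h | h)
  · exact .inl h
  · right
    rcases h with rfl | rfl | rfl | rfl | rfl | rfl | rfl | rfl | rfl | rfl | rfl | rfl | rfl <;> simp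

theorem perpTiles_subset : perpTiles ⊆ tiles1 := by
  rintro c (h | h)
  · exact .inl h
  · right
    rcases h with rfl | rfl | rfl | rfl | rfl | rfl | rfl | rfl | rfl | rfl | rfl | rfl | rfl | rfl <;>
      simp

theorem rows_subset : ∀ row ∈ rows, row.1 ⊆ tiles1 := by
  have h3 := tableTiles_subset
  have h4 := parallelTiles_subset
  have h5 := perpTiles_subset
  simp only [rows, List.forall_mem_cons]
  refine ⟨h3, h4, h5, Set.sdiff_subset, Set.union_subset h3 h4, Set.union_subset h3 h5,
    Set.union_subset h4 h5, Set.union_subset (Set.union_subset h3 h4) h5, subset_rfl, by simp⟩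

theorem restTiles1_subset : restTiles1 ⊆ tiles1 :=
  Set.sdiff_subset.trans Set.subset_union_right

theorem RulesFor.enforces {T : Set Cell} {S : Set Rule} (h : RulesFor T S)
    (ho : outwardTiles ⊆ T) (hT : T ⊆ tiles1) : Enforces T S :=
  enforces_of_erase ho hT fun _ => IsTiling.erase_isHierarchical hT h

/-! ### Existence of tilings -/

/-- The cornered outward tiles, in all orientations. -/
def outs : List Cell := copies [tileA true, tileB true]

/-- The cornered tiles of a half-block that is open to the south, clockwise from the north-east. -/
def southBlock (k : Fin 4) : Cell :=
  ![tileA true, Cell.move false 3 (tileB true), (Cell.move false 3 (tileB true)).flip,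
    (tileA true).flip] k

/-- The half-block that is open in the direction `d` (clockwise from the north). -/
def blockCell (d k : Fin 4) : Cell := Cell.move false (d + 2) (southBlock (k + 2 - d))

/-- The crossing cell between cornered cells to its north and south, with passing marking `μ`. -/
def midV (N S : Cell) (μ : Marking) : Cell := ⟨false, N.s.opp, μ, S.n.opp, μ.opp⟩

/-- The crossing cell between cornered cells to its west and east, with passing marking `μ`. -/
def midH (W E : Cell) (μ : Marking) : Cell := ⟨false, μ, E.w.opp, μ.opp, W.e.opp⟩

/-- A recipe for refining tilings: the direction in which the half-block around an outward tile is
open, and the markings that may pass between adjacent half-blocks, according to whether they are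
open to each other. -/
structure Scheme where
  tiles : List Cell
  dir : Cell → Fin 4
  ok : Bool → Marking → Bool

namespace Scheme

variable (S : Scheme)

/-- The markings that may pass between vertically adjacent cornered tiles. -/
abbrev LinkV (c : Cell) (μ : Marking) (c' : Cell) : Prop :=
  (S.dir c = 0 ↔ S.dir c' = 2) ∧ S.ok (decide (S.dir c = 0)) μ = true

/-- The markings that may pass between horizontally adjacent cornered tiles. -/
abbrev LinkH (c : Cell) (μ : Marking) (c' : Cell) : Prop :=
  (S.dir c = 1 ↔ S.dir c' = 3) ∧ S.ok (decide (S.dir c = 1)) μ = true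

abbrev FitV (c : Cell) (μ : Marking) (c' : Cell) : Prop :=
  midV c' c μ ∈ copies S.tiles ∧ S.LinkV c μ c'

abbrev FitH (c : Cell) (μ : Marking) (c' : Cell) : Prop :=
  midH c c' μ ∈ copies S.tiles ∧ S.LinkH c μ c'

/-- Finitely many conditions on one half-block and on pairs of adjacent ones. `FitV` and `FitH`
contain the hypotheses of `outsideV` and `outsideH`, so the conditions reproduce themselves under
refinement. -/
structure Sound : Prop where
  tiles : ∀ b, tileA b ∈ S.tiles ∧ tileB b ∈ S.tiles
  inside : ∀ c ∈ outs,
    S.FitV (blockCell (S.dir c) 1) c.e (blockCell (S.dir c) 0) ∧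
    S.FitV (blockCell (S.dir c) 2) c.w.opp (blockCell (S.dir c) 3) ∧
    S.FitH (blockCell (S.dir c) 3) c.n (blockCell (S.dir c) 0) ∧
    S.FitH (blockCell (S.dir c) 2) c.s.opp (blockCell (S.dir c) 1)
  outsideV : ∀ d d' : Fin 4, (d = 0 ↔ d' = 2) → ∀ b s k, S.ok (decide (d = 0)) ⟨b, s, k⟩ = true →
    S.FitV (blockCell d 0) ⟨b, s, k⟩ (blockCell d' 1) ∧
    S.FitV (blockCell d 3) ⟨b, s, k⟩ (blockCell d' 2)
  outsideH : ∀ d d' : Fin 4, (d = 1 ↔ d' = 3) → ∀ b s k, S.ok (decide (d = 1)) ⟨b, s, k⟩ = true →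
    S.FitH (blockCell d 0) ⟨b, s, k⟩ (blockCell d' 3) ∧
    S.FitH (blockCell d 1) ⟨b, s, k⟩ (blockCell d' 2)

end Scheme

/-- The first direction in which a property of the four edges (clockwise) holds. -/
def findDir (p : Marking → Marking → Marking → Bool) (c : Cell) : Fin 4 :=
  if p c.n c.e c.w then 0 else if p c.e c.s c.n then 1 else if p c.s c.w c.e then 2 else 3

/-- The half-block opens towards the signed edge in channel `0` or `3`, so that the other edge, in
channel `1` or `2`, crosses at a key tile of the table set. For `parallelScheme` the two kinds of
edges are exchanged. -/
def tableScheme : Scheme where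
  tiles := [tileA false, tileA true, tileB false, tileB true,
    cross .zero .two, cross .one .one, cross .three .two, cross .negThree .two,
    cross .plain .zero, cross .plain .one, cross .plain .three,
    cross .plain .plain, cross .zero .plain, cross .one .plain, cross .three .plain,
    cross .negThree .plain]
  dir := findDir fun m _ _ => m.side ≠ 0 && (m.chan = 0 || m.chan = 3)
  ok o m := m.side = 0 && m.chan = 0 || m.side ≠ 0 && (if o then m.chan = 2 else m.chan ≠ 2)

def parallelScheme : Scheme where
  tiles := [tileA false, tileA true, tileB false, tileB true,
    cross .zero .three, cross .one .zero, cross .three .zero, cross .negThree .zero,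
    cross .plain .zero, cross .plain .one, cross .plain .two, cross .plain .three,
    cross .plain .plain, cross .zero .plain, cross .one .plain, cross .three .plain,
    cross .negThree .plain]
  dir := findDir fun m _ _ => m.side ≠ 0 && (m.chan = 1 || m.chan = 2)
  ok o m := m.side = 0 && m.chan = 0 || m.side ≠ 0 && (!o || m.chan = 0)

/-- Around `tileA` the half-block opens towards channel `0`. Around `tileB` it opens at right angles
to both signed edges, on the side that their signs select. -/
def perpScheme : Scheme where
  tiles := [tileA false, tileA true, tileB false, tileB true,
    cross .one .one, cross .one .two, cross .one .three, cross .three .zero,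
    cross .negThree .zero,
    cross .plain .zero, cross .plain .one, cross .plain .two, cross .plain .three,
    cross .plain .plain, cross .zero .plain, cross .one .plain, cross .three .plain,
    cross .negThree .plain]
  dir := findDir fun m r l => m.side ≠ 0 && m.chan = 0 || r.side = -1 && l.side = 1
  ok o m := m.side = 0 && m.chan = 0 || m.side ≠ 0 && (!o || m.chan = 0)

theorem tableScheme_sound : tableScheme.Sound := by
  constructor <;> decide +kernel
theorem parallelScheme_sound : parallelScheme.Sound := by
  constructor <;> decide +kernel
theorem perpScheme_sound : perpScheme.Sound := by
  constructor <;> decide +kernel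

/-! ### Refinement of tilings -/

/-- The configuration with the cells `b` at odd positions and `e` at even positions, and the
crossing cells between them that fit. -/
def fill (b e : ℤ × ℤ → Cell) (p : ℤ × ℤ) : Cell :=
  if p.1 % 2 = 0 then
    if p.2 % 2 = 0 then e p
    else ⟨false, (e (p.1, p.2 + 1)).s.opp, (b (p.1 + 1, p.2)).w.opp, (e (p.1, p.2 - 1)).n.opp,
      (b (p.1 - 1, p.2)).e.opp⟩
  else if p.2 % 2 = 0 then
    ⟨false, (b (p.1, p.2 + 1)).s.opp, (e (p.1 + 1, p.2)).w.opp, (b (p.1, p.2 - 1)).n.opp,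
      (e (p.1 - 1, p.2)).e.opp⟩
  else b p

theorem fill_fe (b e : ℤ × ℤ → Cell) (x y : ℤ) :
    (fill b e (x + 1, y)).w = (fill b e (x, y)).e.opp := by
  rcases Int.emod_two_eq_zero_or_one x with hx | hx <;>
    rcases Int.emod_two_eq_zero_or_one y with hy | hy
  · have : (x + 1) % 2 ≠ 0 := by omega
    simp [fill, hx, hy, this]
  · have : (x + 1) % 2 ≠ 0 := by omega
    simp [fill, hx, hy, this]
  · have : (x + 1) % 2 = 0 := by omega
    simp [fill, hx, hy, this]
  · have : (x + 1) % 2 = 0 := by omega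
    simp [fill, hx, hy, this]

theorem fill_fn (b e : ℤ × ℤ → Cell) (x y : ℤ) :
    (fill b e (x, y + 1)).s = (fill b e (x, y)).n.opp := by
  rcases Int.emod_two_eq_zero_or_one x with hx | hx <;>
    rcases Int.emod_two_eq_zero_or_one y with hy | hy
  · have : (y + 1) % 2 ≠ 0 := by omega
    simp [fill, hx, hy, this]
  · have : (y + 1) % 2 = 0 := by omega
    simp [fill, hx, hy, this]
  · have : (y + 1) % 2 ≠ 0 := by omega
    simp [fill, hx, hy, this]
  · have : (y + 1) % 2 = 0 := by omega
    simp [fill, hx, hy, this]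

/-- The same tile without its corner. -/
def Cell.uncorner (c : Cell) : Cell := { c with cornered := false }

namespace Scheme

variable (S : Scheme)

/-- Every cornered tile is surrounded by a half-block. -/
def block (f : ℤ × ℤ → Cell) (p : ℤ × ℤ) : Cell :=
  blockCell (S.dir (f (2 * (p.1 / 4) + 1, 2 * (p.2 / 4) + 1)))
    (if p.1 % 4 = 3 then if p.2 % 4 = 3 then 0 else 1 else if p.2 % 4 = 3 then 3 else 2)

/-- The refinement of a tiling. -/
def refine (f : ℤ × ℤ → Cell) : ℤ × ℤ → Cell :=
  fill (S.block f) fun p => (f (p.1 / 2, p.2 / 2)).uncorner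

/-- A configuration that fits everywhere and has copies of the tiles in a large square. -/
structure Good (M : ℤ) (f : ℤ × ℤ → Cell) : Prop where
  fe : ∀ x y, (f (x + 1, y)).w = (f (x, y)).e.opp
  fn : ∀ x y, (f (x, y + 1)).s = (f (x, y)).n.opp
  corner : ∀ x y, (f (x, y)).cornered = true ↔ x % 2 = 1 ∧ y % 2 = 1
  out : ∀ x y, x % 2 = 1 → y % 2 = 1 → f (x, y) ∈ outs
  mem : ∀ x y, 1 ≤ x → x ≤ M → 1 ≤ y → y ≤ M → f (x, y) ∈ copies S.tiles
  linkV : ∀ x y, x % 2 = 1 → y % 2 = 1 → 1 ≤ x → x ≤ M → 1 ≤ y → y + 2 ≤ M →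
    ∃ μ, S.LinkV (f (x, y)) μ (f (x, y + 2)) ∧ (f (x, y + 1)).e = μ ∧ (f (x, y + 1)).w = μ.opp
  linkH : ∀ x y, x % 2 = 1 → y % 2 = 1 → 1 ≤ y → y ≤ M → 1 ≤ x → x + 2 ≤ M →
    ∃ μ, S.LinkH (f (x, y)) μ (f (x + 2, y)) ∧ (f (x + 1, y)).n = μ ∧ (f (x + 1, y)).s = μ.opp

variable {S} {M : ℤ} {f : ℤ × ℤ → Cell}

theorem blockCell_mem_outs : ∀ d k, blockCell d k ∈ outs := by decide +kernel

theorem refine_block (f : ℤ × ℤ → Cell) {i j : ℤ} :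
    S.refine f (4 * i + 3, 4 * j + 3) = blockCell (S.dir (f (2 * i + 1, 2 * j + 1))) 0 ∧
    S.refine f (4 * i + 3, 4 * j + 1) = blockCell (S.dir (f (2 * i + 1, 2 * j + 1))) 1 ∧
    S.refine f (4 * i + 1, 4 * j + 1) = blockCell (S.dir (f (2 * i + 1, 2 * j + 1))) 2 ∧
    S.refine f (4 * i + 1, 4 * j + 3) = blockCell (S.dir (f (2 * i + 1, 2 * j + 1))) 3 := by
  have h1 : ∀ i : ℤ, (4 * i + 3) % 2 = 1 := by omega
  have h2 : ∀ i : ℤ, (4 * i + 1) % 2 = 1 := by omega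
  have h3 : ∀ i : ℤ, (4 * i + 3) / 4 = i := by omega
  have h4 : ∀ i : ℤ, (4 * i + 1) / 4 = i := by omega
  have h5 : ∀ i : ℤ, (4 * i + 3) % 4 = 3 := by omega
  have h6 : ∀ i : ℤ, (4 * i + 1) % 4 = 1 := by omega
  simp [refine, fill, block, h1, h2, h3, h4, h5, h6]

theorem refine_even (f : ℤ × ℤ → Cell) (x y : ℤ) :
    S.refine f (2 * x, 2 * y) = (f (x, y)).uncorner := by
  simp [refine, fill]

/-- The crossing cells of the refinement. -/
theorem refine_midV (hf : ∀ x y, (f (x + 1, y)).w = (f (x, y)).e.opp) (x y : ℤ) :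
    S.refine f (2 * x + 1, 2 * y) =
      midV (S.refine f (2 * x + 1, 2 * y + 1)) (S.refine f (2 * x + 1, 2 * y - 1)) (f (x, y)).e := by
  have h1 : (2 * x + 1) % 2 = 1 := by omega
  have h2 : (2 * y + 1) % 2 = 1 := by omega
  have h3 : (2 * y - 1) % 2 = 1 := by omega
  have h4 : (2 * x + 1 + 1) / 2 = x + 1 := by omega
  simp [refine, fill, midV, h1, h2, h3, h4, Cell.uncorner, hf]

theorem refine_midH (hf : ∀ x y, (f (x, y + 1)).s = (f (x, y)).n.opp) (x y : ℤ) :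
    S.refine f (2 * x, 2 * y + 1) =
      midH (S.refine f (2 * x - 1, 2 * y + 1)) (S.refine f (2 * x + 1, 2 * y + 1)) (f (x, y)).n := by
  have h1 : (2 * x + 1) % 2 = 1 := by omega
  have h2 : (2 * y + 1) % 2 = 1 := by omega
  have h3 : (2 * x - 1) % 2 = 1 := by omega
  have h4 : (2 * y + 1 + 1) / 2 = y + 1 := by omega
  simp [refine, fill, midH, h1, h2, h3, h4, Cell.uncorner, hf]

theorem uncorner_outs : ∀ c ∈ outs, c.uncorner ∈ copies [tileA false, tileB false] := by
  decide +kernel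

theorem copies_mono {l l' : List Cell} (h : ∀ c ∈ l, c ∈ l') {c : Cell} (hc : c ∈ copies l) :
    c ∈ copies l' := by
  rw [mem_copies] at hc ⊢
  obtain ⟨t, ht, b, k, e⟩ := hc
  exact ⟨t, h t ht, b, k, e⟩

/-- For odd `y` the square lies inside the half-block around a single old tile, and `inside`
applies. For even `y` it lies between two half-blocks, and the links of the old configuration
provide the hypotheses of `outsideV`. -/
theorem Sound.fitV (hS : S.Sound) (hf : S.Good M f) {x y : ℤ} (hx : x % 2 = 1) (hx1 : 1 ≤ x)
    (hxM : x ≤ 2 * M + 1) (hy1 : 1 ≤ y) (hyM : y ≤ M) (hM : M % 2 = 1) :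
    ∃ μ, S.refine f (x, 2 * y) =
        midV (S.refine f (x, 2 * y + 1)) (S.refine f (x, 2 * y - 1)) μ ∧
      S.FitV (S.refine f (x, 2 * y - 1)) μ (S.refine f (x, 2 * y + 1)) := by
  obtain ⟨i, hi | hi⟩ : ∃ i : ℤ, x = 4 * i + 3 ∨ x = 4 * i + 1 := ⟨x / 4, by omega⟩
  · subst hi
    have e1 : 4 * i + 3 = 2 * (2 * i + 1) + 1 := by ring
    refine ⟨(f (2 * i + 1, y)).e, by rw [e1]; exact refine_midV hf.fe _ _, ?_⟩
    rcases Int.emod_two_eq_zero_or_one y with hy | hy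
    · obtain ⟨j, rfl⟩ : ∃ j, y = 2 * j := ⟨y / 2, by omega⟩
      obtain ⟨μ, ⟨h1, h2⟩, h3, -⟩ := hf.linkV (2 * i + 1) (2 * (j - 1) + 1) (by omega) (by omega)
        (by omega) (by omega) (by omega) (by omega)
      have := (hS.outsideV _ _ h1 _ _ _ h2).1
      rw [show 2 * (j - 1) + 1 + 1 = 2 * j by ring] at h3
      rw [show 2 * (j - 1) + 1 + 2 = 2 * j + 1 by ring] at this
      rw [h3, show 2 * (2 * j) - 1 = 4 * (j - 1) + 3 by ring, show 2 * (2 * j) + 1 = 4 * j + 1 by ring,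
        (refine_block f).1, (refine_block f).2.1]
      exact this
    · obtain ⟨j, rfl⟩ : ∃ j, y = 2 * j + 1 := ⟨y / 2, by omega⟩
      have := (hS.inside _ (hf.out (2 * i + 1) (2 * j + 1) (by omega) (by omega))).1
      rw [show 2 * (2 * j + 1) - 1 = 4 * j + 1 by ring, show 2 * (2 * j + 1) + 1 = 4 * j + 3 by ring,
        (refine_block f).1, (refine_block f).2.1]
      exact this
  · subst hi
    have e1 : 4 * i + 1 = 2 * (2 * i) + 1 := by ring
    have e2 : (f (2 * i, y)).e = (f (2 * i + 1, y)).w.opp := by rw [hf.fe, Marking.opp_opp]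
    refine ⟨(f (2 * i, y)).e, by rw [e1]; exact refine_midV hf.fe _ _, ?_⟩
    rw [e2]
    rcases Int.emod_two_eq_zero_or_one y with hy | hy
    · obtain ⟨j, rfl⟩ : ∃ j, y = 2 * j := ⟨y / 2, by omega⟩
      obtain ⟨μ, ⟨h1, h2⟩, -, h3⟩ := hf.linkV (2 * i + 1) (2 * (j - 1) + 1) (by omega) (by omega)
        (by omega) (by omega) (by omega) (by omega)
      have := (hS.outsideV _ _ h1 _ _ _ h2).2
      rw [show 2 * (j - 1) + 1 + 1 = 2 * j by ring] at h3
      rw [show 2 * (j - 1) + 1 + 2 = 2 * j + 1 by ring] at this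
      rw [h3, Marking.opp_opp, show 2 * (2 * j) - 1 = 4 * (j - 1) + 3 by ring,
        show 2 * (2 * j) + 1 = 4 * j + 1 by ring,
        (refine_block f).2.2.2, (refine_block f).2.2.1]
      exact this
    · obtain ⟨j, rfl⟩ : ∃ j, y = 2 * j + 1 := ⟨y / 2, by omega⟩
      have := (hS.inside _ (hf.out (2 * i + 1) (2 * j + 1) (by omega) (by omega))).2.1
      rw [show 2 * (2 * j + 1) - 1 = 4 * j + 1 by ring, show 2 * (2 * j + 1) + 1 = 4 * j + 3 by ring,
        (refine_block f).2.2.2, (refine_block f).2.2.1]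
      exact this

theorem Sound.fitH (hS : S.Sound) (hf : S.Good M f) {x y : ℤ} (hy : y % 2 = 1) (hy1 : 1 ≤ y)
    (hyM : y ≤ 2 * M + 1) (hx1 : 1 ≤ x) (hxM : x ≤ M) (hM : M % 2 = 1) :
    ∃ μ, S.refine f (2 * x, y) =
        midH (S.refine f (2 * x - 1, y)) (S.refine f (2 * x + 1, y)) μ ∧
      S.FitH (S.refine f (2 * x - 1, y)) μ (S.refine f (2 * x + 1, y)) := by
  obtain ⟨j, hj | hj⟩ : ∃ j : ℤ, y = 4 * j + 3 ∨ y = 4 * j + 1 := ⟨y / 4, by omega⟩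
  · subst hj
    have e1 : 4 * j + 3 = 2 * (2 * j + 1) + 1 := by ring
    refine ⟨(f (x, 2 * j + 1)).n, by rw [e1]; exact refine_midH hf.fn _ _, ?_⟩
    rcases Int.emod_two_eq_zero_or_one x with hx | hx
    · obtain ⟨i, rfl⟩ : ∃ i, x = 2 * i := ⟨x / 2, by omega⟩
      obtain ⟨μ, ⟨h1, h2⟩, h3, -⟩ := hf.linkH (2 * (i - 1) + 1) (2 * j + 1) (by omega) (by omega)
        (by omega) (by omega) (by omega) (by omega)
      have := (hS.outsideH _ _ h1 _ _ _ h2).1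
      rw [show 2 * (i - 1) + 1 + 1 = 2 * i by ring] at h3
      rw [show 2 * (i - 1) + 1 + 2 = 2 * i + 1 by ring] at this
      rw [h3, show 2 * (2 * i) - 1 = 4 * (i - 1) + 3 by ring, show 2 * (2 * i) + 1 = 4 * i + 1 by ring,
        (refine_block f).1, (refine_block f).2.2.2]
      exact this
    · obtain ⟨i, rfl⟩ : ∃ i, x = 2 * i + 1 := ⟨x / 2, by omega⟩
      have := (hS.inside _ (hf.out (2 * i + 1) (2 * j + 1) (by omega) (by omega))).2.2.1
      rw [show 2 * (2 * i + 1) - 1 = 4 * i + 1 by ring, show 2 * (2 * i + 1) + 1 = 4 * i + 3 by ring,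
        (refine_block f).1, (refine_block f).2.2.2]
      exact this
  · subst hj
    have e1 : 4 * j + 1 = 2 * (2 * j) + 1 := by ring
    have e2 : (f (x, 2 * j)).n = (f (x, 2 * j + 1)).s.opp := by rw [hf.fn, Marking.opp_opp]
    refine ⟨(f (x, 2 * j)).n, by rw [e1]; exact refine_midH hf.fn _ _, ?_⟩
    rw [e2]
    rcases Int.emod_two_eq_zero_or_one x with hx | hx
    · obtain ⟨i, rfl⟩ : ∃ i, x = 2 * i := ⟨x / 2, by omega⟩
      obtain ⟨μ, ⟨h1, h2⟩, -, h3⟩ := hf.linkH (2 * (i - 1) + 1) (2 * j + 1) (by omega) (by omega)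
        (by omega) (by omega) (by omega) (by omega)
      have := (hS.outsideH _ _ h1 _ _ _ h2).2
      rw [show 2 * (i - 1) + 1 + 1 = 2 * i by ring] at h3
      rw [show 2 * (i - 1) + 1 + 2 = 2 * i + 1 by ring] at this
      rw [h3, Marking.opp_opp, show 2 * (2 * i) - 1 = 4 * (i - 1) + 3 by ring,
        show 2 * (2 * i) + 1 = 4 * i + 1 by ring,
        (refine_block f).2.1, (refine_block f).2.2.1]
      exact this
    · obtain ⟨i, rfl⟩ : ∃ i, x = 2 * i + 1 := ⟨x / 2, by omega⟩
      have := (hS.inside _ (hf.out (2 * i + 1) (2 * j + 1) (by omega) (by omega))).2.2.2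
      rw [show 2 * (2 * i + 1) - 1 = 4 * i + 1 by ring, show 2 * (2 * i + 1) + 1 = 4 * i + 3 by ring,
        (refine_block f).2.1, (refine_block f).2.2.1]
      exact this

theorem fill_cornered {b e : ℤ × ℤ → Cell} (hb : ∀ p, b p ∈ outs) (he : ∀ p, (e p).cornered = false)
    (x y : ℤ) : (fill b e (x, y)).cornered = true ↔ x % 2 = 1 ∧ y % 2 = 1 := by
  have h : ∀ c ∈ outs, c.cornered = true := by decide +kernel
  rcases Int.emod_two_eq_zero_or_one x with hx | hx <;>
    rcases Int.emod_two_eq_zero_or_one y with hy | hy <;> simp [fill, hx, hy, he, h _ (hb _)]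

theorem Sound.outs_subset (hS : S.Sound) {c : Cell} (hc : c ∈ outs) : c ∈ copies S.tiles :=
  copies_mono (by simp [(hS.tiles true).1, (hS.tiles true).2]) hc

theorem Sound.uncorner (hS : S.Sound) {c : Cell} (hc : c ∈ copies S.tiles)
    (h : c.cornered = true → c ∈ outs) : c.uncorner ∈ copies S.tiles := by
  cases hcc : c.cornered
  · have : c.uncorner = c := by
      cases c; simp_all [Cell.uncorner]
    rwa [this]
  · exact copies_mono (by simp [(hS.tiles false).1, (hS.tiles false).2]) (uncorner_outs _ (h hcc))

/-- At positions with both coordinates even there are old tiles without their corners, with both odd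
the tiles of the new half-blocks, and the others are crossing squares governed by `fitV` and `fitH`.
-/
theorem Sound.refine (hS : S.Sound) (hM : M % 2 = 1) (hf : S.Good M f) :
    S.Good (2 * M + 1) (S.refine f) := by
  have hb : ∀ p, S.block f p ∈ outs := fun p => blockCell_mem_outs _ _
  have hout : ∀ x y, x % 2 = 1 → y % 2 = 1 → S.refine f (x, y) ∈ outs := by
    intro x y hx hy
    simp only [Scheme.refine, fill, hx, hy]
    exact hb _
  refine ⟨fill_fe _ _, fill_fn _ _, fill_cornered hb fun _ => rfl, hout, ?_, ?_, ?_⟩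
  · intro x y hx1 hxM hy1 hyM
    rcases Int.emod_two_eq_zero_or_one x with hx | hx <;>
      rcases Int.emod_two_eq_zero_or_one y with hy | hy
    · obtain ⟨i, rfl⟩ : ∃ i, x = 2 * i := ⟨x / 2, by omega⟩
      obtain ⟨j, rfl⟩ : ∃ j, y = 2 * j := ⟨y / 2, by omega⟩
      rw [refine_even]
      refine hS.uncorner (hf.mem _ _ (by omega) (by omega) (by omega) (by omega)) fun h => ?_
      rw [hf.corner] at h
      exact hf.out _ _ h.1 h.2
    · obtain ⟨i, rfl⟩ : ∃ i, x = 2 * i := ⟨x / 2, by omega⟩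
      obtain ⟨μ, h1, h2, -⟩ := hS.fitH hf hy hy1 hyM (x := i) (by omega) (by omega) hM
      rwa [h1]
    · obtain ⟨j, rfl⟩ : ∃ j, y = 2 * j := ⟨y / 2, by omega⟩
      obtain ⟨μ, h1, h2, -⟩ := hS.fitV hf hx hx1 hxM (y := j) (by omega) (by omega) hM
      rwa [h1]
    · exact hS.outs_subset (hout x y hx hy)
  · intro x y hx hy hx1 hxM hy1 hyM
    obtain ⟨j, rfl⟩ : ∃ j, y = 2 * j - 1 := ⟨(y + 1) / 2, by omega⟩
    obtain ⟨μ, h1, -, h2⟩ := hS.fitV hf hx hx1 hxM (y := j) (by omega) (by omega) hM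
    rw [show 2 * j - 1 + 2 = 2 * j + 1 by ring, show 2 * j - 1 + 1 = 2 * j by ring]
    exact ⟨μ, h2, by rw [h1]; rfl, by rw [h1]; rfl⟩
  · intro x y hx hy hy1 hyM hx1 hxM
    obtain ⟨i, rfl⟩ : ∃ i, x = 2 * i - 1 := ⟨(x + 1) / 2, by omega⟩
    obtain ⟨μ, h1, -, h2⟩ := hS.fitH hf hy hy1 hyM (x := i) (by omega) (by omega) hM
    rw [show 2 * i - 1 + 2 = 2 * i + 1 by ring, show 2 * i - 1 + 1 = 2 * i by ring]
    exact ⟨μ, h2, by rw [h1]; rfl, by rw [h1]; rfl⟩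

/-- Tilings of arbitrarily large squares. -/
theorem Sound.exists_good (hS : S.Sound) (n : ℕ) : ∃ f, ∃ M : ℤ, n < M ∧ M % 2 = 1 ∧ S.Good M f := by
  induction n with
  | zero =>
    have hA : tileA true ∈ outs := by decide +kernel
    have h : ∀ x y : ℤ, x % 2 = 1 → y % 2 = 1 →
        fill (fun _ => tileA true) (fun _ => tileA false) (x, y) ∈ outs := by
      intro x y hx hy
      simp only [fill, hx, hy]
      exact hA
    -- At the start only the square `(1, 1)` has to carry a proper tile; elsewhere it is enough that
    -- markings fit.
    refine ⟨fill (fun _ => tileA true) fun _ => tileA false, 1, by norm_num, by norm_num,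
      fill_fe _ _, fill_fn _ _, fill_cornered (fun _ => hA) fun _ => rfl, h, ?_, ?_, ?_⟩
    · intro x y h1 h2 h3 h4
      exact hS.outs_subset (h _ _ (by omega) (by omega))
    · intros; omega
    · intros; omega
  | succ n ih =>
    obtain ⟨f, M, h1, h2, h3⟩ := ih
    exact ⟨_, 2 * M + 1, by push_cast; omega, by omega, hS.refine h2 h3⟩

/-- Compactness. -/
theorem Sound.exists_tiled (hS : S.Sound) : ∃ f, Tiled {c | c ∈ S.tiles} f := by
  have key : ∀ n : ℕ, ∃ g : ℤ × ℤ → Cell,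
      (∀ x y, (g (x + 1, y)).w = (g (x, y)).e.opp) ∧ (∀ x y, (g (x, y + 1)).s = (g (x, y)).n.opp) ∧
      (∀ x y, (g (x, y)).cornered = true ↔ x % 2 = n % 2 ∧ y % 2 = n % 2) ∧
      ∀ x y : ℤ, |x| ≤ n → |y| ≤ n → g (x, y) ∈ copies S.tiles := by
    intro n
    obtain ⟨f, M, h1, h2, h3⟩ := hS.exists_good (2 * n)
    -- The window of radius `n` is centred at `(n + 1, n + 1)`, so its coordinates run from `1` to
    -- `2 * n + 1 ≤ M`.
    refine ⟨fun p => f (p.1 + (n + 1), p.2 + (n + 1)), ?_, ?_, ?_, ?_⟩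
    · intro x y
      dsimp only
      rw [show x + 1 + ((n : ℤ) + 1) = x + (n + 1) + 1 by ring]
      exact h3.fe _ _
    · intro x y
      dsimp only
      rw [show y + 1 + ((n : ℤ) + 1) = y + (n + 1) + 1 by ring]
      exact h3.fn _ _
    · intro x y
      rw [h3.corner]
      dsimp only
      omega
    · intro x y hx hy
      rw [abs_le] at hx hy
      push_cast at h1
      exact h3.mem _ _ (by dsimp only; omega) (by dsimp only; omega) (by dsimp only; omega)
        (by dsimp only; omega)
  choose g g1 g2 hr g4 using key
  -- Along an ultrafilter each position settles on one of finitely many tiles, and any finite set of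
  -- positions attains its limits at a common index. All conditions to be checked involve finitely
  -- many positions.
  let U : Ultrafilter ℕ := Filter.hyperfilter ℕ
  have hU : ∀ m : ℕ, ∀ᶠ n in (U : Filter ℕ), m ≤ n := fun m =>
    Nat.hyperfilter_le_atTop (Filter.eventually_ge_atTop m)
  have lim : ∀ p : ℤ × ℤ, ∃ c ∈ copies S.tiles, ∀ᶠ n in (U : Filter ℕ), g n p = c := by
    rintro ⟨x, y⟩
    have h : ∀ᶠ n in (U : Filter ℕ), ∃ c ∈ {c | c ∈ copies S.tiles}, g n (x, y) = c := by
      filter_upwards [hU (max x.natAbs y.natAbs)] with n hn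
      exact ⟨_, g4 n x y (by rw [Int.abs_eq_natAbs]; omega) (by rw [Int.abs_eq_natAbs]; omega), rfl⟩
    rwa [Ultrafilter.eventually_exists_mem_iff (List.finite_toSet _)] at h
  choose f hf1 hf2 using lim
  refine ⟨f, ⟨?_, ?_, ?_⟩, ?_, ?_⟩
  · intro p
    exact mem_copies.1 (hf1 p)
  · intro x y
    obtain ⟨n, h1, h2⟩ := ((hf2 (x + 1, y)).and (hf2 (x, y))).exists
    rw [← h1, ← h2, g1]
  · intro x y
    obtain ⟨n, h1, h2⟩ := ((hf2 (x, y + 1)).and (hf2 (x, y))).exists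
    rw [← h1, ← h2, g2]
  · intro x y x' y' h h' _ _ _ _
    obtain ⟨n, h1, h2⟩ := ((hf2 (x, y)).and (hf2 (x', y'))).exists
    rw [← h1, hr] at h
    rw [← h2, hr] at h'
    omega
  · intro x y
    obtain ⟨n, h1, h2, h3, h4⟩ := ((hf2 (x, y)).and ((hf2 (x + 1, y)).and ((hf2 (x, y + 1)).and
      (hf2 (x + 1, y + 1))))).exists
    have h0 := hr n
    rcases Int.emod_two_eq_zero_or_one (x - n) with hx | hx <;>
      rcases Int.emod_two_eq_zero_or_one (y - n) with hy | hy
    · exact ⟨x, y, by rw [← h1, h0]; omega, by omega, by omega, by omega, by omega⟩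
    · exact ⟨x, y + 1, by rw [← h3, h0]; omega, by omega, by omega, by omega, by omega⟩
    · exact ⟨x + 1, y, by rw [← h2, h0]; omega, by omega, by omega, by omega, by omega⟩
    · exact ⟨x + 1, y + 1, by rw [← h4, h0]; omega, by omega, by omega, by omega, by omega⟩

end Scheme

theorem Scheme.Sound.exists_isTiling {S : Scheme} (hS : S.Sound) {T : Set Cell}
    (hT : ∀ c ∈ S.tiles, c ∈ T) : ∃ τ, IsTiling T τ :=
  let ⟨f, hf⟩ := hS.exists_tiled
  ⟨graph f, (hf.mono hT).isTiling⟩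

theorem exists_isTiling_tableTiles : ∃ τ, IsTiling tableTiles τ :=
  tableScheme_sound.exists_isTiling (by
    simp [tableScheme, cross_mem_tableTiles]; simp [tableTiles, outwardTiles])

theorem exists_isTiling_parallelTiles : ∃ τ, IsTiling parallelTiles τ :=
  parallelScheme_sound.exists_isTiling (by
    simp [parallelScheme, cross_mem_parallelTiles]; simp [parallelTiles, outwardTiles])

theorem exists_isTiling_perpTiles : ∃ τ, IsTiling perpTiles τ :=
  perpScheme_sound.exists_isTiling (by
    simp [perpScheme, cross_mem_perpTiles]; simp [perpTiles, outwardTiles])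

theorem IsTiling.not_periodic {τ : Config} (h : IsTiling tiles1 τ) : ¬ Periodic τ := by
  rintro ⟨v, hv, e⟩
  obtain ⟨f, hf, rfl⟩ := h.exists_graph
  refine hf.not_periodic hv fun p => ?_
  have : (p + v, f p) ∈ (fun x : (ℤ × ℤ) × Cell => (x.1 + v, x.2)) '' graph f := ⟨(p, f p), rfl, rfl⟩
  rw [e] at this
  exact (mem_graph.1 this).symm

theorem aperiodic_rows : ∀ row ∈ rows, Aperiodic row.1 := by
  have h : ∀ row ∈ rows, ∃ τ, IsTiling row.1 τ := by
    obtain ⟨τ, h1⟩ := exists_isTiling_tableTiles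
    obtain ⟨τ', h2⟩ := exists_isTiling_parallelTiles
    obtain ⟨τ'', h3⟩ := exists_isTiling_perpTiles
    have h4 : parallelTiles ⊆ asymTiles := fun c hc => ⟨parallelTiles_subset hc, by
      rintro rfl
      simp [cross_mem_parallelTiles] at hc⟩
    simp only [rows, List.forall_mem_cons]
    exact ⟨⟨_, h1⟩, ⟨_, h2⟩, ⟨_, h3⟩, ⟨_, h2.mono h4⟩, ⟨_, h1.mono Set.subset_union_left⟩,
      ⟨_, h1.mono Set.subset_union_left⟩, ⟨_, h2.mono Set.subset_union_left⟩,
      ⟨_, h3.mono Set.subset_union_right⟩, ⟨_, h1.mono tableTiles_subset⟩, by simp⟩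
  exact fun row hr => ⟨h row hr, fun τ hτ => (hτ.mono (rows_subset row hr)).not_periodic⟩

/-! ### Tiles that occur in every tiling -/

theorem move_mem_oriented {T : Set Cell} {c : Cell} (b : Bool) (k : Fin 4) (h : c ∈ oriented T) :
    Cell.move b k c ∈ oriented T := by
  have h2 : ∀ n c, c ∈ oriented T → Cell.turn^[n] c ∈ oriented T := by
    intro n
    induction n with
    | zero => exact fun c h => h
    | succ n ih => exact fun c h => ih _ (turn_mem_oriented h)
  refine h2 _ _ ?_
  split_ifs
  · exact flip_mem_oriented h
  · exact h

/-- A copy of the tile occurs. -/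
def Occurs (f : ℤ × ℤ → Cell) (t : Cell) : Prop := ∃ p, f p ∈ copies [t]

theorem Occurs.of_view {f : ℤ × ℤ → Cell} {t : Cell} {g : LatticeIsom} (h : Occurs (view g f) t) :
    Occurs f t := by
  obtain ⟨p, h⟩ := h
  refine ⟨g.pos p, ?_⟩
  have h1 : view g f p ∈ oriented {t} := by simpa [mem_copies, oriented] using h
  have := move_mem_oriented g.flip g.turns h1
  rw [view, Cell.move_unmove] at this
  simpa [mem_copies, oriented] using this

theorem disjoint_copies : ∀ t ∈ tileList, ∀ t' ∈ tileList, t ≠ t' → ∀ b k,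
    ∀ c ∈ copies [t'], Cell.move b k t ≠ c := by decide +kernel

theorem eq_of_mem_copies {t t' c : Cell} (ht : t ∈ tileList) (ht' : t' ∈ tileList)
    (h : c ∈ copies [t]) (h' : c ∈ copies [t']) : t = t' := by
  by_contra hn
  simp only [mem_copies, List.mem_singleton, exists_eq_left] at h
  obtain ⟨b, k, rfl⟩ := h
  exact disjoint_copies _ ht _ ht' hn b k _ h' rfl

/-- A tiling by a proper subset is also a tiling by `T`, so it would contain the missing tile;
copies of different tiles are different. -/
theorem no_tiling_of_ssubset {T : Set Cell} (hT : T ⊆ tiles1)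
    (h : ∀ f, Tiled T f → ∀ t ∈ T, Occurs f t) : ∀ T' ⊂ T, ¬ ∃ τ, IsTiling T' τ := by
  rintro T' hT' ⟨τ, hτ⟩
  obtain ⟨f, hf, -⟩ := hτ.exists_graph
  obtain ⟨t, ht, ht'⟩ := Set.exists_of_ssubset hT'
  obtain ⟨p, hp⟩ := h f (hf.mono hT'.subset) t ht
  obtain ⟨t', h1, b, k, e⟩ := hf.mem p
  have := eq_of_mem_copies (mem_tileList_of_mem (hT ht)) (mem_tileList_of_mem (hT (hT'.subset h1)))
    hp (mem_copies.2 ⟨t', by simp, b, k, e⟩)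
  exact ht' (this ▸ h1)

section
variable {f : ℤ × ℤ → Cell} {s : ℤ} {Q : Set (ℤ × ℤ)}

theorem Cell.not_cornered : ∀ c ∈ copies tileList,
    (c.n.out = false ∨ c.e.out = false ∨ c.s.out = false ∨ c.w.out = false) → c.cornered = false := by
  decide +kernel

namespace HalfBlock

variable (hv : Valid tiles1 f) (h : Level f s Q) (hb : HalfBlock f s Q)
include hv h hb

/-- Along the axes of a half-block the marking of the centre is transmitted, so the tile there is
determined by it and by the two lateral neighbours. -/
theorem north_eq (j : ℤ) (h0 : 0 < j) (h1 : j < 2 * s) :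
    f (0, j) = midH (f (-1, j)) (f (1, j)) (f (0, 0)).n := by
  have e1 := hb.lineN hv h h0.le h1
  have e2 : (f (0, j)).s = (f (0, 0)).n.opp := by
    rw [← hb.lineN hv h (i := j - 1) (by omega) (by omega)]
    exact hv.sn (by ring)
  refine Cell.ext ?_ e1 (hv.ew (by ring)) e2 (hv.we (by ring))
  exact Cell.not_cornered _ (hv.mem_copies _) (by rw [e2]; simp [(hb.center hv h).1])

theorem south_eq (j : ℤ) (h0 : 0 < j) (h1 : j < 2 * s) :
    f (0, -j) = midH (f (-1, -j)) (f (1, -j)) (f (0, 0)).s.opp := by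
  have e1 := hb.lineS hv h h0.le h1
  have e2 : (f (0, -j)).n = (f (0, 0)).s.opp := by
    rw [← hb.lineS hv h (i := j - 1) (by omega) (by omega)]
    exact hv.ns (by ring)
  refine Cell.ext ?_ e2 (hv.ew (by ring)) (by rw [e1]; simp [midH]) (hv.we (by ring))
  exact Cell.not_cornered _ (hv.mem_copies _) (by rw [e2]; simp [(hb.center hv h).2.2.1])

theorem east_eq (j : ℤ) (h0 : 0 < j) (h1 : j < 2 * s) :
    f (j, 0) = midV (f (j, 1)) (f (j, -1)) (f (0, 0)).e := by
  have e1 := hb.lineE hv h h0.le h1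
  have e2 : (f (j, 0)).w = (f (0, 0)).e.opp := by
    rw [← hb.lineE hv h (i := j - 1) (by omega) (by omega)]
    exact hv.we (by ring)
  refine Cell.ext ?_ (hv.ns (by ring)) e1 (hv.sn (by ring)) e2
  exact Cell.not_cornered _ (hv.mem_copies _) (by rw [e2]; simp [(hb.center hv h).2.1])

theorem west_eq (j : ℤ) (h0 : 0 < j) (h1 : j < 2 * s) :
    f (-j, 0) = midV (f (-j, 1)) (f (-j, -1)) (f (0, 0)).w.opp := by
  have e1 := hb.lineW hv h h0.le h1
  have e2 : (f (-j, 0)).e = (f (0, 0)).w.opp := by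
    rw [← hb.lineW hv h (i := j - 1) (by omega) (by omega)]
    exact hv.ew (by ring)
  refine Cell.ext ?_ (hv.ns (by ring)) e2 (hv.sn (by ring)) (by rw [e1]; simp [midV])
  exact Cell.not_cornered _ (hv.mem_copies _) (by rw [e2]; simp [(hb.center hv h).2.2.2])

end HalfBlock

/-- The four directions, clockwise from the north. -/
def dirVec (d : Fin 4) : ℤ × ℤ := ![(0, 1), (1, 0), (0, -1), (-1, 0)] d

/-- The cornered tiles of a half-block. -/
theorem Pt.cells {x y : ℤ} {d : Fin 4} (h : Pt f 0 (x, y) (dirVec d)) :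
    f (x + 1, y + 1) = blockCell d 0 ∧ f (x + 1, y - 1) = blockCell d 1 ∧
      f (x - 1, y - 1) = blockCell d 2 ∧ f (x - 1, y + 1) = blockCell d 3 := by
  have hl : ∀ d : Fin 4, (⟨false, d + 2, (0, 0)⟩ : LatticeIsom).lin (0, -1) = dirVec d := by decide
  have h1 := h.frame (g := ⟨false, d + 2, (x, y)⟩) rfl (hl d)
  have hc : ∀ c : Cell, ∀ b k, (Cell.unmove b k c).cornered = c.cornered := by
    intro c b k
    cases b <;> fin_cases k <;> rfl
  have key : ∀ {p : ℤ × ℤ} {t : Bool → Cell}, (∃ b, DominoTiles.view ⟨false, d + 2, (x, y)⟩ f p = t b) →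
      (⟨false, d + 2, (x, y)⟩ : LatticeIsom).pos p ∈ levelQ f 0 → (∀ b, (t b).cornered = b) →
      f ((⟨false, d + 2, (x, y)⟩ : LatticeIsom).pos p) = Cell.move false (d + 2) (t true) := by
    rintro p t ⟨b, e⟩ (hm : (f _).cornered = true) ht
    have e1 := congrArg Cell.cornered e
    rw [DominoTiles.view, hc, hm, ht] at e1
    subst e1
    rw [← e, DominoTiles.view, Cell.move_unmove]
  obtain ⟨⟨m1, e1⟩, ⟨m2, e2⟩, ⟨m3, e3⟩, ⟨m4, e4⟩⟩ := h1
  have k1 := key e1 m1 fun _ => rfl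
  have k2 := key e2 m2 fun _ => rfl
  have k3 := key e3 m3 fun _ => rfl
  have k4 := key e4 m4 fun _ => rfl
  clear e1 e2 e3 e4 m1 m2 m3 m4 key
  fin_cases d <;> simp [LatticeIsom.pos, Nat.iterate] at k1 k2 k3 k4 <;>
    simp only [add_comm (1 : ℤ), neg_add_eq_sub] at k1 k2 k3 k4 <;>
    simp only [k1, k2, k3, k4] <;> decide

theorem Tiled.exists_H (hf : Tiled tiles1 f) (n : ℕ) : ∃ g, H f n g := by
  obtain ⟨x, y, h, -⟩ := (hf.level n).cov 0 0
  obtain ⟨g, h, -⟩ := (hf.level n).exists_halfBlock hf.toValid h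
  exact ⟨g, h⟩

theorem unmove_mem_copies {l : List Cell} {c : Cell} (b : Bool) (k : Fin 4) (h : c ∈ copies l) :
    Cell.unmove b k c ∈ copies l := by
  have h' : c ∈ oriented {t | t ∈ l} := mem_copies.1 h
  refine mem_copies.2 (?_ : Cell.unmove b k c ∈ oriented {t | t ∈ l})
  cases b
  · have := move_mem_oriented false (-k) h'
    convert this using 1
    fin_cases k <;> rfl
  · exact move_mem_oriented true k h'

/-- There are half-blocks of all levels around both kinds of outward tiles. -/
theorem Tiled.exists_centers {T : Set Cell} (hT : T ⊆ tiles1) (hf : Tiled T f) (n : ℕ) :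
    (∃ g, H f n g ∧ CenterCond T (DominoTiles.view g f (0, 0)) ∧
      DominoTiles.view g f (0, 0) ∈ copies [tileA false, tileA true]) ∧
    ∃ g, H f n g ∧ CenterCond T (DominoTiles.view g f (0, 0)) ∧
      DominoTiles.view g f (0, 0) ∈ copies [tileB false, tileB true] := by
  have ht := hf.mono hT
  obtain ⟨g, hg⟩ := ht.exists_H (n + 1)
  have key : ∀ {p : ℤ × ℤ} {t : Bool → Cell} {l : List Cell}, p ∈ levelQ (DominoTiles.view g f) (n + 1) ∧
      (∃ b, DominoTiles.view g f p = t b) → (∀ b, t b ∈ copies l) →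
      ∃ g, H f n g ∧ CenterCond T (DominoTiles.view g f (0, 0)) ∧
        DominoTiles.view g f (0, 0) ∈ copies l := by
    rintro p t l ⟨h1, b, e⟩ hl
    obtain ⟨g', h2, h3⟩ := exists_pt h1
    rw [H_view] at h2
    refine ⟨_, h2, (H_iff.1 h2).centerCond hT (hf.toValid.view _) ((ht.view _).level n), ?_⟩
    rw [view_comp, DominoTiles.view]
    refine unmove_mem_copies _ _ ?_
    rw [show (0, 0) = (0 : ℤ × ℤ) from rfl, g'.pos_zero, h3, e]
    exact hl b
  obtain ⟨h1, -, h3, -⟩ := H_iff.1 hg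
  exact ⟨key h1 fun b => by cases b <;> decide, key h3 fun b => by cases b <;> decide⟩

/-- One of two mirror images may be chosen. -/
theorem exists_frame {g : LatticeIsom} {n : ℕ} {c : Cell} (h : H f n g)
    (hc : view g f (0, 0) = c ∨ view g f (0, 0) = c.flip) : ∃ g, H f n g ∧ view g f (0, 0) = c := by
  rcases hc with hc | hc
  · exact ⟨g, h, hc⟩
  · refine ⟨_, h.flip, ?_⟩
    rw [view_comp, view]
    simpa [LatticeIsom.pos, Nat.iterate, Cell.unmove, Cell.move] using congrArg Cell.flip hc

/-- The crossing cells of a half-block. -/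
theorem Tiled.zero_cells (hf : Tiled tiles1 f) (hb : HalfBlock f (2 ^ 0) (levelQ f 0)) :
    f (0, 1) = midH (blockCell 2 3) (blockCell 2 0) (f (0, 0)).n ∧
    f (1, 0) = midV (blockCell 2 0) (blockCell 2 1) (f (0, 0)).e ∧
    f (0, -1) = midH (blockCell 2 2) (blockCell 2 1) (f (0, 0)).s.opp ∧
    f (-1, 0) = midV (blockCell 2 3) (blockCell 2 2) (f (0, 0)).w.opp := by
  have hl := hf.level 0
  have hv := hf.toValid
  obtain ⟨h1, h2, h3, h4⟩ := Pt.cells (f := f) (x := 0) (y := 0) (d := 2)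
    ⟨⟨false, 0, (0, 0)⟩, H_id.2 hb, rfl, by decide⟩
  norm_num at h1 h2 h3 h4
  rw [hb.north_eq hv hl 1 (by norm_num) (by norm_num), hb.east_eq hv hl 1 (by norm_num) (by norm_num),
    hb.south_eq hv hl 1 (by norm_num) (by norm_num), hb.west_eq hv hl 1 (by norm_num) (by norm_num),
    h1, h2, h3, h4]
  simp

/-- The crossing cells along the axes of a half-block of the next level. -/
theorem Tiled.one_cells (hf : Tiled tiles1 f) (hb : HalfBlock f (2 ^ 1) (levelQ f 1))
    {a b c d : Fin 4} (ha : Pt f 0 (2, 2) (dirVec a)) (hb' : Pt f 0 (2, -2) (dirVec b))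
    (hc : Pt f 0 (-2, -2) (dirVec c)) (hd : Pt f 0 (-2, 2) (dirVec d)) :
    f (0, 1) = midH (blockCell d 1) (blockCell a 2) (f (0, 0)).n ∧
    f (0, 3) = midH (blockCell d 0) (blockCell a 3) (f (0, 0)).n ∧
    f (1, 0) = midV (blockCell a 2) (blockCell b 3) (f (0, 0)).e ∧
    f (3, 0) = midV (blockCell a 1) (blockCell b 0) (f (0, 0)).e ∧
    f (0, -1) = midH (blockCell c 0) (blockCell b 3) (f (0, 0)).s.opp ∧
    f (0, -3) = midH (blockCell c 1) (blockCell b 2) (f (0, 0)).s.opp ∧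
    f (-1, 0) = midV (blockCell d 1) (blockCell c 0) (f (0, 0)).w.opp ∧
    f (-3, 0) = midV (blockCell d 2) (blockCell c 3) (f (0, 0)).w.opp := by
  have hl := hf.level 1
  have hv := hf.toValid
  have a' := ha.cells
  have b' := hb'.cells
  have c' := hc.cells
  have d' := hd.cells
  norm_num at a' b' c' d'
  refine ⟨?_, ?_, ?_, ?_, ?_, ?_, ?_, ?_⟩
  · rw [hb.north_eq hv hl 1 (by norm_num) (by norm_num), d'.2.1, a'.2.2.1]
  · rw [hb.north_eq hv hl 3 (by norm_num) (by norm_num), d'.1, a'.2.2.2]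
  · rw [hb.east_eq hv hl 1 (by norm_num) (by norm_num), a'.2.2.1, b'.2.2.2]
  · rw [hb.east_eq hv hl 3 (by norm_num) (by norm_num), a'.2.1, b'.1]
  · rw [hb.south_eq hv hl 1 (by norm_num) (by norm_num), c'.1, b'.2.2.2]
  · rw [hb.south_eq hv hl 3 (by norm_num) (by norm_num), c'.2.1, b'.2.2.1]
  · rw [hb.west_eq hv hl 1 (by norm_num) (by norm_num), d'.2.1, c'.1]
  · rw [hb.west_eq hv hl 3 (by norm_num) (by norm_num), d'.2.2.1, c'.2.2.2]

end

section
variable {f : ℤ × ℤ → Cell} {T : Set Cell}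

/-- Uncornered tiles occur in the centres of half-blocks of level `0`, where a corner would be too
close to those around it. The cornered ones are at the corners of these half-blocks. -/
theorem Tiled.occurs_outward (hT : T ⊆ tiles1) (hf : Tiled T f) :
    ∀ t ∈ outwardTiles, Occurs f t := by
  have ht := hf.mono hT
  have center : ∀ {g : LatticeIsom} {t : Bool → Cell}, H f 0 g → (∀ b, (t b).cornered = b) →
      DominoTiles.view g f (0, 0) ∈ copies [t false, t true] → Occurs f (t false) := by
    intro g t h hc h0
    refine Occurs.of_view (g := g) ⟨(0, 0), ?_⟩
    simp only [mem_copies, List.mem_cons, List.not_mem_nil, or_false] at h0 ⊢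
    obtain ⟨t', rfl | rfl, b, k, e⟩ := h0
    · exact ⟨_, rfl, b, k, e⟩
    · exfalso
      have e1 : (DominoTiles.view g f (0, 0)).cornered = true := by
        rw [e]
        refine Eq.trans ?_ (hc true)
        cases b <;> fin_cases k <;> rfl
      have e2 : (1, 1) ∈ levelQ (DominoTiles.view g f) 0 := (H_iff.1 h).ne.1
      have := (ht.view g).sep 0 0 1 1 e1 e2 (by norm_num) (by norm_num) (by norm_num) (by norm_num)
      omega
  obtain ⟨⟨g, h1, -, h2⟩, ⟨g', h1', -, h2'⟩⟩ := hf.exists_centers hT 0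
  have h3 := Pt.cells (f := DominoTiles.view g f) (x := 0) (y := 0) (d := 2)
    ⟨⟨false, 0, (0, 0)⟩, H_id.2 (H_iff.1 h1), rfl, by decide⟩
  rintro t (rfl | rfl | rfl | rfl)
  · exact center h1 (fun _ => rfl) h2
  · exact Occurs.of_view (g := g) ⟨_, by rw [h3.1]; decide⟩
  · exact center h1' (fun _ => rfl) h2'
  · exact Occurs.of_view (g := g) ⟨_, by rw [h3.2.1]; decide⟩

/-- The tiles that occur because a half-block is centred at `c`. -/
def around0 (c : Cell) : List Cell :=
  [midH (blockCell 2 3) (blockCell 2 0) c.n, midV (blockCell 2 0) (blockCell 2 1) c.e,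
    midH (blockCell 2 2) (blockCell 2 1) c.s.opp, midV (blockCell 2 3) (blockCell 2 2) c.w.opp]

/-- The tiles that occur because a half-block of the next level is centred at `x`, its corners
being open in the directions `a`, `b`, `c`, `d`. -/
def around1 (a b c d : Fin 4) (x : Cell) : List Cell :=
  [midH (blockCell d 1) (blockCell a 2) x.n, midH (blockCell d 0) (blockCell a 3) x.n,
    midV (blockCell a 2) (blockCell b 3) x.e, midV (blockCell a 1) (blockCell b 0) x.e,
    midH (blockCell c 0) (blockCell b 3) x.s.opp, midH (blockCell c 1) (blockCell b 2) x.s.opp,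
    midV (blockCell d 1) (blockCell c 0) x.w.opp, midV (blockCell d 2) (blockCell c 3) x.w.opp]

theorem occurs_of_mem {l : List Cell} (h : ∀ c ∈ l, ∃ p, f p = c) {t : Cell}
    (ht : ∃ c ∈ l, c ∈ copies [t]) : Occurs f t := by
  obtain ⟨c, h1, h2⟩ := ht
  obtain ⟨p, rfl⟩ := h c h1
  exact ⟨p, h2⟩

theorem Tiled.around0 (hf : Tiled tiles1 f) {g : LatticeIsom} (h : H f 0 g) {c : Cell}
    (hc : DominoTiles.view g f (0, 0) = c) {t : Cell}
    (ht : ∃ c' ∈ DominoTiles.around0 c, c' ∈ copies [t]) : Occurs f t := by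
  subst hc
  obtain ⟨h1, h2, h3, h4⟩ := (hf.view g).zero_cells (H_iff.1 h)
  refine Occurs.of_view (g := g) (occurs_of_mem ?_ ht)
  simp only [DominoTiles.around0, List.forall_mem_cons]
  exact ⟨⟨_, h1⟩, ⟨_, h2⟩, ⟨_, h3⟩, ⟨_, h4⟩, by simp⟩

theorem Tiled.around1 (hf : Tiled tiles1 f) {g : LatticeIsom} (h : H f 1 g) {x : Cell}
    (hx : DominoTiles.view g f (0, 0) = x) {a b c d : Fin 4}
    (h1 : Pt (DominoTiles.view g f) 0 (2, 2) (dirVec a))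
    (h2 : Pt (DominoTiles.view g f) 0 (2, -2) (dirVec b))
    (h3 : Pt (DominoTiles.view g f) 0 (-2, -2) (dirVec c))
    (h4 : Pt (DominoTiles.view g f) 0 (-2, 2) (dirVec d)) {t : Cell}
    (ht : ∃ c' ∈ DominoTiles.around1 a b c d x, c' ∈ copies [t]) : Occurs f t := by
  subst hx
  obtain ⟨e1, e2, e3, e4, e5, e6, e7, e8⟩ := (hf.view g).one_cells (H_iff.1 h) h1 h2 h3 h4
  refine Occurs.of_view (g := g) (occurs_of_mem ?_ ht)
  simp only [DominoTiles.around1, List.forall_mem_cons]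
  exact ⟨⟨_, e1⟩, ⟨_, e2⟩, ⟨_, e3⟩, ⟨_, e4⟩, ⟨_, e5⟩, ⟨_, e6⟩, ⟨_, e7⟩, ⟨_, e8⟩, by simp⟩

/-- The orientation of the outward tile in the centre of a half-block. -/
theorem Tiled.exists_center_eq (hT : T ⊆ tiles1) (hf : Tiled T f) (n : ℕ) {kA kB : Fin 4}
    (hA : ∀ c ∈ copies [tileA false, tileA true], CenterCond T c →
      c = Cell.move false kA (tileA c.cornered) ∨ c = (Cell.move false kA (tileA c.cornered)).flip)
    (hB : ∀ c ∈ copies [tileB false, tileB true], CenterCond T c →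
      c = Cell.move false kB (tileB c.cornered) ∨ c = (Cell.move false kB (tileB c.cornered)).flip) :
    (∃ g b, H f n g ∧ DominoTiles.view g f (0, 0) = Cell.move false kA (tileA b)) ∧
    ∃ g b, H f n g ∧ DominoTiles.view g f (0, 0) = Cell.move false kB (tileB b) := by
  obtain ⟨⟨g, h1, h2, h3⟩, ⟨g', h1', h2', h3'⟩⟩ := hf.exists_centers hT n
  obtain ⟨g1, h4⟩ := exists_frame h1 (hA _ h3 h2)
  obtain ⟨g2, h5⟩ := exists_frame h1' (hB _ h3' h2')
  exact ⟨⟨g1, _, h4⟩, ⟨g2, _, h5⟩⟩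

end

/-! ### Minimality of the three small sets -/

/-- This replaces the membership conditions of `keyN` and `keyE` by decidable conditions on
channels, so that the possible centres can be enumerated. -/
theorem CenterCond.sides {T : Set Cell} {c : Cell} (h : CenterCond T c) {pN pE : Fin 4 → Prop}
    (hN : ∀ k, keyN T k → pN k) (hE : ∀ k, keyE T k → pE k) :
    (c.n.side = 0 ∨ pN c.n.chan) ∧ (c.e.side = 0 ∨ c.e.side = 1 ∧ pE c.e.chan) ∧
      (c.w.side = 0 ∨ c.w.side = -1 ∧ pE c.w.chan) :=
  ⟨h.n.imp_right (hN _), h.e.imp_right (And.imp_right (hE _)), h.w.imp_right (And.imp_right (hE _))⟩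

theorem keyN_tableTiles : ∀ k, keyN tableTiles k → k = 2 := by
  simp [keyN, cross_mem_tableTiles]
theorem keyE_tableTiles : ∀ k, keyE tableTiles k → k = 1 := by
  simp [keyE, cross_mem_tableTiles]
theorem keyN_parallelTiles : ∀ k, keyN parallelTiles k → k = 3 := by
  simp [keyN, cross_mem_parallelTiles]
theorem keyE_parallelTiles : ∀ k, keyE parallelTiles k → k = 0 := by
  simp [keyE, cross_mem_parallelTiles]
theorem keyN_perpTiles : ∀ k, keyN perpTiles k → False := by
  simp [keyN, cross_mem_perpTiles]
theorem keyE_perpTiles : ∀ k, keyE perpTiles k → k ≠ 0 := by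
  rintro k (⟨rfl, h⟩ | ⟨rfl, -⟩ | ⟨rfl, -⟩ | ⟨rfl, -⟩)
  · simp [cross_mem_perpTiles] at h
  all_goals decide

/-- The key tiles of the set leave one orientation of the centre up to the symmetry of the
half-block, and likewise in the five checks that follow. -/
theorem center_tableTiles_tileA : ∀ c ∈ copies [tileA false, tileA true],
    (c.n.side = 0 ∨ c.n.chan = 2) ∧ (c.e.side = 0 ∨ c.e.side = 1 ∧ c.e.chan = 1) ∧
      (c.w.side = 0 ∨ c.w.side = -1 ∧ c.w.chan = 1) →
    c = Cell.move false 3 (tileA c.cornered) ∨ c = (Cell.move false 3 (tileA c.cornered)).flip := by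
  decide +kernel
theorem center_tableTiles_tileB : ∀ c ∈ copies [tileB false, tileB true],
    (c.n.side = 0 ∨ c.n.chan = 2) ∧ (c.e.side = 0 ∨ c.e.side = 1 ∧ c.e.chan = 1) ∧
      (c.w.side = 0 ∨ c.w.side = -1 ∧ c.w.chan = 1) →
    c = Cell.move false 3 (tileB c.cornered) ∨ c = (Cell.move false 3 (tileB c.cornered)).flip := by
  decide +kernel
theorem center_parallelTiles_tileA : ∀ c ∈ copies [tileA false, tileA true],
    (c.n.side = 0 ∨ c.n.chan = 3) ∧ (c.e.side = 0 ∨ c.e.side = 1 ∧ c.e.chan = 0) ∧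
      (c.w.side = 0 ∨ c.w.side = -1 ∧ c.w.chan = 0) →
    c = Cell.move false 0 (tileA c.cornered) ∨ c = (Cell.move false 0 (tileA c.cornered)).flip := by
  decide +kernel
theorem center_parallelTiles_tileB : ∀ c ∈ copies [tileB false, tileB true],
    (c.n.side = 0 ∨ c.n.chan = 3) ∧ (c.e.side = 0 ∨ c.e.side = 1 ∧ c.e.chan = 0) ∧
      (c.w.side = 0 ∨ c.w.side = -1 ∧ c.w.chan = 0) →
    c = Cell.move false 1 (tileB c.cornered) ∨ c = (Cell.move false 1 (tileB c.cornered)).flip := by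
  decide +kernel
theorem center_perpTiles_tileA : ∀ c ∈ copies [tileA false, tileA true],
    (c.n.side = 0 ∨ False) ∧ (c.e.side = 0 ∨ c.e.side = 1 ∧ c.e.chan ≠ 0) ∧
      (c.w.side = 0 ∨ c.w.side = -1 ∧ c.w.chan ≠ 0) →
    c = Cell.move false 3 (tileA c.cornered) ∨ c = (Cell.move false 3 (tileA c.cornered)).flip := by
  decide +kernel
theorem center_perpTiles_tileB : ∀ c ∈ copies [tileB false, tileB true],
    (c.n.side = 0 ∨ False) ∧ (c.e.side = 0 ∨ c.e.side = 1 ∧ c.e.chan ≠ 0) ∧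
      (c.w.side = 0 ∨ c.w.side = -1 ∧ c.w.chan ≠ 0) →
    c = Cell.move false 2 (tileB c.cornered) ∨ c = (Cell.move false 2 (tileB c.cornered)).flip := by
  decide +kernel

/-- Half-blocks of levels `0` and `1` exist around both kinds of outward tiles; the orientation of
the centre and the role of the square are forced, so the tiles on their axes can be computed. -/
theorem occurs_tableTiles (f : ℤ × ℤ → Cell) (hf : Tiled tableTiles f) :
    ∀ t ∈ tableTiles, Occurs f t := by
  have ht := hf.mono tableTiles_subset
  have centers := fun n => hf.exists_center_eq tableTiles_subset n
    (fun c hc h => center_tableTiles_tileA c hc (h.sides keyN_tableTiles keyE_tableTiles))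
    (fun c hc h => center_tableTiles_tileB c hc (h.sides keyN_tableTiles keyE_tableTiles))
  have role : ∀ g, H f 1 g → RoleM (view g f) 0 := by
    intro g h
    rcases (hf.view g).role tableTiles_subset (H_iff.1 h) with ⟨-, h, -⟩ | ⟨-, -, h, -⟩ | ⟨h, -⟩
    · exact absurd (keyE_tableTiles _ h) (by decide)
    · exact absurd (keyE_tableTiles _ h) (by decide)
    · exact h
  obtain ⟨⟨g, b, h1, h2⟩, ⟨g', b', h1', h2'⟩⟩ := centers 0
  obtain ⟨⟨i, c, h3, h4⟩, ⟨i', c', h3', h4'⟩⟩ := centers 1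
  obtain ⟨r1, r2, r3, r4⟩ := role _ h3
  obtain ⟨r1', r2', r3', r4'⟩ := role _ h3'
  have A0 := fun t => ht.around0 h1 h2 (t := t)
  have B0 := fun t => ht.around0 h1' h2' (t := t)
  have A1 := fun t => ht.around1 h3 h4 (a := 3) (b := 2) (c := 2) (d := 1) r1 r3 r4 r2 (t := t)
  have B1 := fun t => ht.around1 h3' h4' (a := 3) (b := 2) (c := 2) (d := 1) r1' r3' r4' r2' (t := t)
  rintro t (h | h)
  · exact hf.occurs_outward tableTiles_subset t h
  rcases h with rfl | rfl | rfl | rfl | rfl | rfl | rfl | rfl | rfl | rfl | rfl | rfl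
  · exact B0 _ (by clear * -; revert b'; decide +kernel)
  · exact A0 _ (by clear * -; revert b; decide +kernel)
  · exact B1 _ (by clear * -; revert c'; decide +kernel)
  · exact B1 _ (by clear * -; revert c'; decide +kernel)
  · exact A0 _ (by clear * -; revert b; decide +kernel)
  · exact A1 _ (by clear * -; revert c; decide +kernel)
  · exact B0 _ (by clear * -; revert b'; decide +kernel)
  · exact A1 _ (by clear * -; revert c; decide +kernel)
  · exact A0 _ (by clear * -; revert b; decide +kernel)
  · exact A0 _ (by clear * -; revert b; decide +kernel)
  · exact A1 _ (by clear * -; revert c; decide +kernel)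
  · exact A1 _ (by clear * -; revert c; decide +kernel)

theorem occurs_perpTiles (f : ℤ × ℤ → Cell) (hf : Tiled perpTiles f) :
    ∀ t ∈ perpTiles, Occurs f t := by
  have ht := hf.mono perpTiles_subset
  have centers := fun n => hf.exists_center_eq perpTiles_subset n
    (fun c hc h => center_perpTiles_tileA c hc (h.sides keyN_perpTiles keyE_perpTiles))
    (fun c hc h => center_perpTiles_tileB c hc (h.sides keyN_perpTiles keyE_perpTiles))
  have role : ∀ g, H f 1 g → RoleU (view g f) 0 := by
    intro g h
    rcases (hf.view g).role perpTiles_subset (H_iff.1 h) with ⟨-, h, -⟩ | ⟨h, -⟩ | ⟨-, -, h⟩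
    · exact absurd rfl (keyE_perpTiles _ h)
    · exact h
    · exact (keyN_perpTiles _ h).elim
  obtain ⟨⟨g, b, h1, h2⟩, ⟨g', b', h1', h2'⟩⟩ := centers 0
  obtain ⟨⟨i, c, h3, h4⟩, ⟨i', c', h3', h4'⟩⟩ := centers 1
  obtain ⟨r1, r2, r3, r4⟩ := role _ h3
  obtain ⟨r1', r2', r3', r4'⟩ := role _ h3'
  have A0 := fun t => ht.around0 h1 h2 (t := t)
  have B0 := fun t => ht.around0 h1' h2' (t := t)
  have A1 := fun t => ht.around1 h3 h4 (a := 3) (b := 3) (c := 1) (d := 1) r1 r3 r4 r2 (t := t)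
  have B1 := fun t => ht.around1 h3' h4' (a := 3) (b := 3) (c := 1) (d := 1) r1' r3' r4' r2' (t := t)
  rintro t (h | h)
  · exact hf.occurs_outward perpTiles_subset t h
  rcases h with rfl | rfl | rfl | rfl | rfl | rfl | rfl | rfl | rfl | rfl | rfl | rfl | rfl | rfl
  · exact A0 _ (by clear * -; revert b; decide +kernel)
  · exact B0 _ (by clear * -; revert b'; decide +kernel)
  · exact B0 _ (by clear * -; revert b'; decide +kernel)
  · exact A1 _ (by clear * -; revert c; decide +kernel)
  · exact A1 _ (by clear * -; revert c; decide +kernel)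
  · exact A0 _ (by clear * -; revert b; decide +kernel)
  · exact A1 _ (by clear * -; revert c; decide +kernel)
  · exact B1 _ (by clear * -; revert c'; decide +kernel)
  · exact B1 _ (by clear * -; revert c'; decide +kernel)
  · exact B0 _ (by clear * -; revert b'; decide +kernel)
  · exact A0 _ (by clear * -; revert b; decide +kernel)
  · exact A0 _ (by clear * -; revert b; decide +kernel)
  · exact A1 _ (by clear * -; revert c; decide +kernel)
  · exact A1 _ (by clear * -; revert c; decide +kernel)

theorem occurs_parallelTiles (f : ℤ × ℤ → Cell) (hf : Tiled parallelTiles f) :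
    ∀ t ∈ parallelTiles, Occurs f t := by
  have ht := hf.mono parallelTiles_subset
  have centers := fun n => hf.exists_center_eq parallelTiles_subset n
    (fun c hc h => center_parallelTiles_tileA c hc (h.sides keyN_parallelTiles keyE_parallelTiles))
    (fun c hc h => center_parallelTiles_tileB c hc (h.sides keyN_parallelTiles keyE_parallelTiles))
  have role : ∀ n g, H f (n + 1) g → RoleP (view g f) n := by
    intro n g h
    rcases (hf.view g).role parallelTiles_subset (H_iff.1 h) with ⟨h, -⟩ | ⟨-, h, -⟩ | ⟨-, h, -⟩
    · exact h
    · exact absurd (keyE_parallelTiles _ h) (by decide)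
    · exact absurd (keyE_parallelTiles _ h) (by decide)
  obtain ⟨⟨g, b, h1, h2⟩, ⟨g', b', h1', h2'⟩⟩ := centers 0
  obtain ⟨⟨i, c, h3, h4⟩, ⟨i', c', h3', h4'⟩⟩ := centers 1
  obtain ⟨r1, r2, r3, r4⟩ := role 0 _ h3
  obtain ⟨r1', r2', r3', r4'⟩ := role 0 _ h3'
  have A0 := fun t => ht.around0 h1 h2 (t := t)
  have B0 := fun t => ht.around0 h1' h2' (t := t)
  have A1 := fun t => ht.around1 h3 h4 (a := 2) (b := 0) (c := 0) (d := 2) r1 r3 r4 r2 (t := t)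
  have B1 := fun t => ht.around1 h3' h4' (a := 2) (b := 0) (c := 0) (d := 2) r1' r3' r4' r2' (t := t)
  -- This tile is found one level higher: it lies next to the centre on the western axis of a
  -- half-block of level `2` around `tileA`, between two grandchildren of the square.
  have A2 : Occurs f (cross .plain .zero) := by
    obtain ⟨⟨j, e, h5, h6⟩, -⟩ := centers 2
    obtain ⟨-, r2, -, r4⟩ := role 1 _ h5
    have hv := ht.view j
    have w := (H_iff.1 h5).west_eq hv.toValid (hv.level 2) 1 (by norm_num) (by norm_num)
    have f2 := r2.frame (g := ⟨false, 0, (-4, 4)⟩) (by norm_num) (by decide)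
    have f4 := r4.frame (g := ⟨false, 2, (-4, -4)⟩) (by norm_num) (by decide)
    rw [H_view] at f2 f4
    have s2 := (role 0 _ f2).2.2.1
    have s4 := (role 0 _ f4).2.2.2
    rw [view_comp, pt_view] at s2 s4
    have c2 := Pt.cells (x := -2) (y := 2) (d := 0) s2
    have c4 := Pt.cells (x := -2) (y := -2) (d := 2) s4
    norm_num at c2 c4 w
    refine Occurs.of_view (g := j) ⟨(-1, 0), ?_⟩
    rw [w, c2.2.1, c4.1, show view j f (0, 0) = _ from h6]
    clear * -; revert e; decide +kernel
  rintro t (h | h)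
  · exact hf.occurs_outward parallelTiles_subset t h
  rcases h with rfl | rfl | rfl | rfl | rfl | rfl | rfl | rfl | rfl | rfl | rfl | rfl | rfl
  · exact B0 _ (by clear * -; revert b'; decide +kernel)
  · exact A0 _ (by clear * -; revert b; decide +kernel)
  · exact A1 _ (by clear * -; revert c; decide +kernel)
  · exact A1 _ (by clear * -; revert c; decide +kernel)
  · exact A2
  · exact A0 _ (by clear * -; revert b; decide +kernel)
  · exact B0 _ (by clear * -; revert b'; decide +kernel)
  · exact B1 _ (by clear * -; revert c'; decide +kernel)
  · exact A1 _ (by clear * -; revert c; decide +kernel)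
  · exact A0 _ (by clear * -; revert b; decide +kernel)
  · exact A0 _ (by clear * -; revert b; decide +kernel)
  · exact A1 _ (by clear * -; revert c; decide +kernel)
  · exact A1 _ (by clear * -; revert c; decide +kernel)

/-! ### Refining a tiling to one with parallel dominoes in large squares -/

section
variable {f : ℤ × ℤ → Cell} {n : ℕ}

/-- The half-block of level `2` that is centred at `z` points along an axis. -/
def Along (f : ℤ × ℤ → Cell) (z : ℤ × ℤ) (u : Bool) : Prop := Pt f 2 z (axis u) ∨ Pt f 2 z (-axis u)

/-- The centres of eight parallel dominoes that fill a square. -/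
def fillCells (u : Bool) : List (ℤ × ℤ) :=
  if u then [(-6, -4), (-6, 4), (-2, -4), (-2, 4), (2, -4), (2, 4), (6, -4), (6, 4)]
  else [(-4, -6), (4, -6), (-4, -2), (4, -2), (-4, 2), (4, 2), (-4, 6), (4, 6)]

/-- The dominoes that fill the blocks of level `2`, parallel to the half-blocks. -/
def fineSet (f : ℤ × ℤ → Cell) : Set ((ℤ × ℤ) × Bool) :=
  {d | ∃ z, Along f z d.2 ∧ d.1 - z ∈ fillCells d.2}

theorem Along.mem {z : ℤ × ℤ} {u : Bool} (h : Along f z u) : z ∈ levelQ f 3 :=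
  h.elim Pt.mem Pt.mem

theorem Along.unique {z : ℤ × ℤ} {u u' : Bool} (h : Along f z u) (h' : Along f z u') : u = u' := by
  rcases h with h | h <;> rcases h' with h' | h' <;> have := h.unique h' <;>
    cases u <;> cases u' <;> simp [axis] at this ⊢

theorem exists_along {z : ℤ × ℤ} (h : z ∈ levelQ f 3) : ∃ u, Along f z u := by
  obtain ⟨g, hg, e⟩ := exists_pt h
  rcases g.lin_south with h | h
  · exact ⟨_, .inl ⟨g, hg, e, h⟩⟩
  · exact ⟨_, .inr ⟨g, hg, e, h⟩⟩

theorem fillCells_mem {u : Bool} {p : ℤ × ℤ} : p ∈ fillCells u ↔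
    u = true ∧ (p.1 = -6 ∨ p.1 = -2 ∨ p.1 = 2 ∨ p.1 = 6) ∧ (p.2 = -4 ∨ p.2 = 4) ∨
    u = false ∧ (p.2 = -6 ∨ p.2 = -2 ∨ p.2 = 2 ∨ p.2 = 6) ∧ (p.1 = -4 ∨ p.1 = 4) := by
  obtain ⟨x, y⟩ := p
  cases u <;> simp [fillCells] <;> omega

/-- The blocks of size `16` tile the plane, and each is filled by four rows of two dominoes or by
the same array turned. -/
theorem Tiled.fine_isDominoTiling (ht : Tiled tiles1 f) :
    IsDominoTiling (rect (1 / 4) '' fineSet f) := by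
  have hl := ht.level 3
  norm_num at hl
  refine isDominoTiling_image_rect ?_ ?_
  · rintro x y v x' y' v' ⟨⟨zx, zy⟩, h1, h2⟩ ⟨⟨zx', zy'⟩, h1', h2'⟩ hne
    dsimp only at h1 h1' h2 h2'
    rw [fillCells_mem] at h2 h2'
    simp only [Prod.fst_sub, Prod.snd_sub] at h2 h2'
    by_cases hz : zx = zx' ∧ zy = zy'
    · obtain ⟨rfl, rfl⟩ := hz
      obtain rfl := h1.unique h1'
      cases v <;> simp [halfWidth, halfHeight] at h2 h2' hne ⊢ <;> omega
    · have : ¬ (zx < zx' + 16 ∧ zx' < zx + 16 ∧ zy < zy' + 16 ∧ zy' < zy + 16) := fun h =>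
        hz (hl.sep _ _ _ _ h1.mem h1'.mem (by omega) (by omega) (by omega) (by omega))
      cases v <;> cases v' <;> simp [halfWidth, halfHeight] at h2 h2' ⊢ <;> omega
  · intro i j
    obtain ⟨zx, zy, hq, h1, h2, h3, h4⟩ := hl.cov i j
    obtain ⟨u, hu⟩ := exists_along hq
    cases u
    · obtain ⟨a, ha, ha'⟩ : ∃ a, (a = -4 ∨ a = 4) ∧ zx + a - 4 ≤ i ∧ i + 1 ≤ zx + a + 4 := by
        by_cases i < zx
        · exact ⟨-4, by simp, by omega, by omega⟩
        · exact ⟨4, by simp, by omega, by omega⟩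
      obtain ⟨b, hb, hb'⟩ : ∃ b, (b = -6 ∨ b = -2 ∨ b = 2 ∨ b = 6) ∧ zy + b - 2 ≤ j ∧
          j + 1 ≤ zy + b + 2 :=
        ⟨4 * ((j - zy) / 4) + 2, by omega, by omega, by omega⟩
      exact ⟨zx + a, zy + b, false, ⟨(zx, zy), hu, fillCells_mem.2 (by simp; omega)⟩,
        by simp [halfWidth, halfHeight]; omega⟩
    · obtain ⟨a, ha, ha'⟩ : ∃ a, (a = -4 ∨ a = 4) ∧ zy + a - 4 ≤ j ∧ j + 1 ≤ zy + a + 4 := by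
        by_cases j < zy
        · exact ⟨-4, by simp, by omega, by omega⟩
        · exact ⟨4, by simp, by omega, by omega⟩
      obtain ⟨b, hb, hb'⟩ : ∃ b, (b = -6 ∨ b = -2 ∨ b = 2 ∨ b = 6) ∧ zx + b - 2 ≤ i ∧
          i + 1 ≤ zx + b + 2 :=
        ⟨4 * ((i - zx) / 4) + 2, by omega, by omega, by omega⟩
      exact ⟨zx + b, zy + a, true, ⟨(zx, zy), hu, fillCells_mem.2 (by simp; omega)⟩,
        by simp [halfWidth, halfHeight]; omega⟩

/-! ### The blocks in a domino -/

/-- The numbers of absolute value less than `2 ^ k` that have the parity of `2 ^ k - 1`. -/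
def Grid (k : ℕ) (a : ℤ) : Prop := -2 ^ k < a ∧ a < 2 ^ k ∧ (a + 2 ^ k) % 2 = 1

theorem grid_zero {a : ℤ} : Grid 0 a ↔ a = 0 := by
  simp [Grid]; omega

/-- This splits off the last binary digit, as a substitution step does; `Grid.split` splits off the
first one, as in passing from a block to its quarters. -/
theorem grid_succ {k : ℕ} {a : ℤ} :
    Grid (k + 1) a ↔ ∃ b e, Grid k b ∧ (e = 1 ∨ e = -1) ∧ a = 2 * b + e := by
  have hN : (0 : ℤ) < 2 ^ k := by positivity
  simp only [Grid, pow_succ]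
  generalize (2 : ℤ) ^ k = N at hN
  constructor
  · intro h
    by_cases h' : ((a - 1) / 2 + N) % 2 = 1
    · exact ⟨(a - 1) / 2, 1, by omega, by simp, by omega⟩
    · exact ⟨(a + 1) / 2, -1, by omega, by simp, by omega⟩
  · rintro ⟨b, e, h, he, rfl⟩
    omega

theorem grid_unique {k : ℕ} {b b' e e' : ℤ} (h : Grid k b) (h' : Grid k b') (he : e = 1 ∨ e = -1)
    (he' : e' = 1 ∨ e' = -1) (hb : 2 * b + e = 2 * b' + e') : b = b' ∧ e = e' := by
  have := h.2.2
  have := h'.2.2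
  omega

theorem Grid.split {k : ℕ} {a : ℤ} (h : Grid (k + 1) a) :
    ∃ b e, Grid k b ∧ (e = 1 ∨ e = -1) ∧ a = e * 2 ^ k + b := by
  have hN : (0 : ℤ) < 2 ^ k := by positivity
  simp only [Grid, pow_succ] at h ⊢
  generalize (2 : ℤ) ^ k = N at hN h
  by_cases h' : 0 < a
  · exact ⟨a - N, 1, by omega, by simp, by ring⟩
  · exact ⟨a + N, -1, by omega, by simp, by ring⟩

theorem levelQ_corner {z : ℤ × ℤ} (h : z ∈ levelQ f (n + 1)) {e e' : ℤ} (he : e = 1 ∨ e = -1)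
    (he' : e' = 1 ∨ e' = -1) : (z.1 + e * 2 ^ n, z.2 + e' * 2 ^ n) ∈ levelQ f n := by
  obtain ⟨⟨b, k, u⟩, ⟨⟨h1, -⟩, ⟨h2, -⟩, ⟨h3, -⟩, ⟨h4, -⟩⟩, rfl⟩ := exists_pt h
  rw [Set.mem_preimage] at h1 h2 h3 h4
  obtain ⟨x, y⟩ := u
  generalize (2 : ℤ) ^ n = N at *
  rcases he with rfl | rfl <;> rcases he' with rfl | rfl <;> cases b <;> fin_cases k <;>
    simp [LatticeIsom.pos, Nat.iterate, add_comm] at h1 h2 h3 h4 ⊢ <;> assumption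

theorem levelQ_grid {m : ℕ} : ∀ {z : ℤ × ℤ}, z ∈ levelQ f (m + 3) → ∀ {a b : ℤ}, Grid m a → Grid m b →
    (z.1 + 8 * a, z.2 + 8 * b) ∈ levelQ f 3 := by
  induction m with
  | zero =>
    intro z h a b ha hb
    rw [grid_zero] at ha hb
    subst ha hb
    simpa using h
  | succ m ih =>
    intro z h a b ha hb
    obtain ⟨a', e, ha', he, rfl⟩ := ha.split
    obtain ⟨b', e', hb', he', rfl⟩ := hb.split
    have := ih (levelQ_corner (n := m + 3) (by rwa [show m + 3 + 1 = m + 1 + 3 by ring]) he he') ha' hb'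
    convert this using 2 <;> rw [pow_add] <;> ring

/-- The square with centre `z` is contained in the domino `d` of level `n`. -/
def Inside (n : ℕ) (d : (ℤ × ℤ) × Bool) (z : ℤ × ℤ) : Prop :=
  |z.1 - d.1.1| < halfWidth d.2 * 2 ^ n ∧ |z.2 - d.1.2| < halfHeight d.2 * 2 ^ n

/-- The frame of a domino. -/
def frameOf (d : (ℤ × ℤ) × Bool) : LatticeIsom := ⟨false, if d.2 then 1 else 0, d.1⟩

theorem frameOf_pos (d : (ℤ × ℤ) × Bool) (x y : ℤ) : (frameOf d).pos (x, y) =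
    if d.2 then (d.1.1 + y, d.1.2 - x) else (d.1.1 + x, d.1.2 + y) := by
  obtain ⟨⟨a, b⟩, v⟩ := d
  cases v <;> simp [frameOf, LatticeIsom.pos, Nat.iterate] <;> constructor <;> ring

theorem Grid.neg {k : ℕ} {a : ℤ} (h : Grid k a) : Grid k (-a) := by
  unfold Grid at *; omega

theorem Tiled.frameOf_mem (ht : Tiled tiles1 f) {m : ℕ} {d : (ℤ × ℤ) × Bool}
    (hd : d ∈ dominoSet f (m + 2)) {a b : ℤ} (ha : Grid (m + 1) a) (hb : Grid m b) :
    (frameOf d).pos (8 * a, 8 * b) ∈ levelQ f 3 := by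
  obtain ⟨⟨x, y⟩, v⟩ := d
  rw [frameOf_pos]
  cases v
  · obtain ⟨a', e, ha', he, rfl⟩ := ha.split
    have := levelQ_grid (ht.half_mem hd he) ha' hb
    simp [axis] at this ⊢
    convert this using 2
    rw [pow_add]; ring
  · obtain ⟨a', e, ha', he, e1⟩ := ha.neg.split
    have := levelQ_grid (ht.half_mem hd he) hb ha'
    simp [axis] at this ⊢
    convert this using 2
    rw [sub_eq_add_neg, ← mul_neg, e1, pow_add]; ring

theorem exists_grid {k : ℕ} {t : ℤ} (h : |t| < 8 * 2 ^ k) : ∃ a, Grid k a ∧ -8 ≤ t - 8 * a ∧ t - 8 * a < 8 := by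
  rw [abs_lt] at h
  simp only [Grid]
  generalize (2 : ℤ) ^ k = N at *
  exact ⟨2 * ((t + 8 * N) / 16) + 1 - N, by omega, by omega, by omega⟩

/-- The points on the right are the centres of an array of blocks that fills the domino; a centre
inside the domino lies within such a block and equals its centre by separation. -/
theorem Tiled.inside_iff (ht : Tiled tiles1 f) {m : ℕ} {d : (ℤ × ℤ) × Bool}
    (hd : d ∈ dominoSet f (m + 2)) {z : ℤ × ℤ} :
    z ∈ levelQ f 3 ∧ Inside (m + 2) d z ↔
      ∃ a b, Grid (m + 1) a ∧ Grid m b ∧ z = (frameOf d).pos (8 * a, 8 * b) := by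
  have hl := ht.level 3
  norm_num at hl
  have hN : (0 : ℤ) < 2 ^ m := by positivity
  constructor
  · rintro ⟨hz, h1, h2⟩
    have key : ∃ a b, Grid (m + 1) a ∧ Grid m b ∧ |z.1 - ((frameOf d).pos (8 * a, 8 * b)).1| ≤ 8 ∧
        |z.2 - ((frameOf d).pos (8 * a, 8 * b)).2| ≤ 8 := by
      obtain ⟨⟨x, y⟩, v⟩ := d
      simp only [frameOf_pos]
      cases v
      · obtain ⟨a, ha, ha'⟩ := exists_grid (k := m + 1) (t := z.1 - x) (by
          simp [halfWidth] at h1; rw [pow_succ] at h1 ⊢; rw [pow_succ] at h1; linarith)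
        obtain ⟨b, hb, hb'⟩ := exists_grid (k := m) (t := z.2 - y) (by
          simp [halfHeight] at h2; rw [pow_succ, pow_succ] at h2; linarith)
        exact ⟨a, b, ha, hb, by simp [abs_le]; omega, by simp [abs_le]; omega⟩
      · obtain ⟨a, ha, ha'⟩ := exists_grid (k := m + 1) (t := z.2 - y) (by
          simp [halfHeight] at h2; rw [pow_succ] at h2 ⊢; rw [pow_succ] at h2; linarith)
        obtain ⟨b, hb, hb'⟩ := exists_grid (k := m) (t := z.1 - x) (by
          simp [halfWidth] at h1; rw [pow_succ, pow_succ] at h1; linarith)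
        exact ⟨-a, b, ha.neg, hb, by simp [abs_le]; omega, by simp [abs_le]; omega⟩
    obtain ⟨a, b, ha, hb, h3, h4⟩ := key
    refine ⟨a, b, ha, hb, ?_⟩
    rw [abs_le] at h3 h4
    have hq := ht.frameOf_mem hd ha hb
    generalize (frameOf d).pos (8 * a, 8 * b) = q at *
    obtain ⟨qx, qy⟩ := q
    obtain ⟨zx, zy⟩ := z
    dsimp only at h3 h4
    have := hl.sep _ _ _ _ hz hq (by omega) (by omega) (by omega) (by omega)
    exact Prod.ext this.1 this.2
  · rintro ⟨a, b, ha, hb, rfl⟩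
    refine ⟨ht.frameOf_mem hd ha hb, ?_⟩
    rw [frameOf_pos]
    obtain ⟨⟨x, y⟩, v⟩ := d
    simp only [Grid, pow_succ] at ha hb
    cases v <;> simp only [Inside, halfWidth, halfHeight, pow_succ, abs_lt, if_true,
      Bool.false_eq_true, if_false] <;> omega

/-- A domino contains the blocks of its children. -/
theorem pats4_inside : ∀ K ∈ pats4, ∀ x ∈ K,
    |x.1.1| * 2 + halfWidth (decide (x.2.1 = 0)) ≤ 8 ∧
      |x.1.2| * 2 + halfHeight (decide (x.2.1 = 0)) ≤ 4 := by
  decide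

theorem Tiled.exists_parent_inside (ht : Tiled tiles1 f) {d' : (ℤ × ℤ) × Bool}
    (hd : d' ∈ dominoSet f n) :
    ∃ d ∈ dominoSet f (n + 1), ∀ z, Inside n d' z → Inside (n + 1) d z := by
  obtain ⟨d, hd, hp⟩ := ht.exists_parent hd
  refine ⟨d, hd, ?_⟩
  -- Only the geometry of the four patterns is needed, so all rules are permitted.
  obtain ⟨g, hk, K, hK, hc, -⟩ := ht.exists_goodFrame subset_rfl (S := Set.univ)
    ⟨fun _ _ => Set.subset_univ _, fun _ _ => Set.subset_univ _, fun _ _ _ => Set.subset_univ _,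
      fun _ _ _ _ _ _ => Set.subset_univ _⟩ hd
  obtain ⟨x, hx, rfl⟩ := hp g hk K hK hc
  subst hk
  obtain ⟨h1, h2⟩ := pats4_inside K hK x hx
  have hu := pats4_unit K hK x hx
  rintro ⟨zx, zy⟩ ⟨h3, h4⟩
  have hN : (0 : ℤ) < 2 ^ n := by positivity
  obtain ⟨⟨x1, x2⟩, x3⟩ := x
  dsimp only at h1 h2 hu h3 h4
  rw [hu] at h3 h4
  generalize decide (x3.1 = 0) = v at *
  have h1' : |2 ^ (n + 1) * x1| + halfWidth v * 2 ^ n ≤ 8 * 2 ^ n := by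
    rw [abs_mul, abs_of_pos (by positivity), pow_succ]
    nlinarith
  have h2' : |2 ^ (n + 1) * x2| + halfHeight v * 2 ^ n ≤ 4 * 2 ^ n := by
    rw [abs_mul, abs_of_pos (by positivity), pow_succ]
    nlinarith
  obtain ⟨b, k, ⟨gx, gy⟩⟩ := g
  simp only [Inside, pow_succ (2 : ℤ) n]
  clear hp hc hd hx
  simp only [Prod.smul_mk, smul_eq_mul] at h3 h4
  generalize (2 : ℤ) ^ (n + 1) * x1 = X at *
  generalize (2 : ℤ) ^ (n + 1) * x2 = Y at *
  generalize (2 : ℤ) ^ n = N at *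
  cases v <;> cases b <;> fin_cases k <;>
    simp [LatticeIsom.pos, LatticeIsom.lin, LatticeIsom.key, Nat.iterate, axis, halfWidth, halfHeight,
      abs_lt, ← le_sub_iff_add_le, abs_le] at h1' h2' h3 h4 ⊢ <;>
    omega

end

/-! ### Supertiles filled with parallel dominoes -/

/-- A translation of the plane by an integral vector, in units of a half. -/
noncomputable def shiftBy (x y : ℤ) : Isom := (⟨false, 0, (x, y)⟩ : LatticeIsom).isom (1 / 2)

/-- The rule with a standard isometry for each child. -/
def stdRule (K : List ((ℤ × ℤ) × (ℤ × ℤ))) : Rule :=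
  {γ | ∃ x ∈ K, γ = (⟨false, if x.2.1 = 0 then 1 else 0, x.1⟩ : LatticeIsom).isom (1 / 2)}

theorem stdRule_mem (K : List ((ℤ × ℤ) × (ℤ × ℤ))) : stdRule K ∈ rulesOf (pieces K) := by
  have key : ∀ x : (ℤ × ℤ) × (ℤ × ℤ),
      (⟨false, if x.2.1 = 0 then 1 else 0, x.1⟩ : LatticeIsom).isom (1 / 2) '' domino = piece x := by
    intro x
    rw [LatticeIsom.isom_image_domino, piece]
    congr 1
    by_cases h : x.2.1 = 0 <;> simp [LatticeIsom.key, h]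
  refine ⟨?_, ?_, ?_⟩
  · rintro _ ⟨x, hx, rfl⟩
    exact ⟨x, hx, key x⟩
  · rintro _ ⟨x, hx, rfl⟩ _ ⟨x', hx', rfl⟩ h
    simp only [key, piece] at h
    have h := rect_injective (by norm_num) h
    simp only [Prod.mk.injEq, decide_eq_decide] at h
    rw [h.1]
    simp only [h.2]
  · rintro _ ⟨x, hx, rfl⟩
    exact ⟨_, ⟨x, hx, rfl⟩, key x⟩

theorem inflate_shiftBy (x y : ℤ) : inflate (shiftBy x y) = shiftBy (2 * x) (2 * y) := by
  rw [shiftBy, LatticeIsom.inflate_isom]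
  ext p i
  simp only [LatticeIsom.isom_apply, shiftBy]
  fin_cases i <;> simp [Nat.iterate]

theorem shiftBy_mul (x y x' y' : ℤ) : shiftBy x y * shiftBy x' y' = shiftBy (x + x') (y + y') := by
  rw [shiftBy, shiftBy, ← LatticeIsom.isom_comp]
  simp [LatticeIsom.comp, LatticeIsom.pos, Nat.iterate, shiftBy, add_comm]

theorem shiftBy_injective {x y x' y' : ℤ} (h : shiftBy x y = shiftBy x' y') : x = x' ∧ y = y' := by
  have h1 := congrArg (fun g : Isom => g 0) h
  simp only [shiftBy, LatticeIsom.isom_apply] at h1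
  have h2 := congrArg (fun p : Plane => p 0) h1
  have h3 := congrArg (fun p : Plane => p 1) h1
  simp [Nat.iterate] at h2 h3
  exact ⟨h2, h3⟩

/-- The supertile with all dominoes parallel to it. -/
def gridTile (k : ℕ) : Set Isom := {γ | ∃ x y, Grid k x ∧ Grid k y ∧ γ = shiftBy (2 * x) y}

theorem mem_stdRule_parallel {γ : Isom} : γ ∈ stdRule parallelPat ↔
    ∃ e e' : ℤ, (e = 1 ∨ e = -1) ∧ (e' = 1 ∨ e' = -1) ∧ γ = shiftBy (2 * e) e' := by
  simp only [stdRule, parallelPat, shiftBy, Set.mem_ofPred_eq]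
  constructor
  · rintro ⟨x, hx, rfl⟩
    simp only [List.mem_cons, List.not_mem_nil, or_false] at hx
    rcases hx with rfl | rfl | rfl | rfl
    · exact ⟨-1, 1, by simp, by simp, by simp⟩
    · exact ⟨1, 1, by simp, by simp, by simp⟩
    · exact ⟨-1, -1, by simp, by simp, by simp⟩
    · exact ⟨1, -1, by simp, by simp, by simp⟩
  · rintro ⟨e, e', rfl | rfl, rfl | rfl, rfl⟩
    · exact ⟨((2, 1), (1, 0)), by simp, by simp⟩
    · exact ⟨((2, -1), (1, 0)), by simp, by simp⟩
    · exact ⟨((-2, 1), (1, 0)), by simp, by simp⟩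
    · exact ⟨((-2, -1), (1, 0)), by simp, by simp⟩

/-- Each step with the parallel rule appends one binary digit to both coordinates, by `grid_succ`.
-/
theorem gridTile_isSupertile {S : Set Rule} (hS : parallelRule ⊆ S) (k : ℕ) :
    IsSupertile S k (gridTile k) := by
  induction k with
  | zero =>
    have : gridTile 0 = {1} := by
      ext γ
      have h1 : shiftBy 0 0 = 1 := by
        ext p i
        rw [shiftBy, LatticeIsom.isom_apply]
        fin_cases i <;> simp [Nat.iterate]
      simp [gridTile, grid_zero, h1]
    rw [this]
    exact .base
  | succ k ih =>
    convert ih.subst (fun _ => stdRule parallelPat) fun g _ =>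
      hS (parallelRule_eq ▸ stdRule_mem _) using 1
    ext γ
    simp only [Set.mem_iUnion, Set.mem_image, exists_prop, mem_stdRule_parallel, gridTile,
      Set.mem_ofPred_eq, grid_succ]
    constructor
    · rintro ⟨_, _, ⟨a, e, ha, he, rfl⟩, ⟨b, e', hb, he', rfl⟩, rfl⟩
      refine ⟨_, ⟨a, b, ha, hb, rfl⟩, _, ⟨e, e', he, he', rfl⟩, ?_⟩
      rw [inflate_shiftBy, shiftBy_mul]
      congr 1; ring
    · rintro ⟨_, ⟨a, b, ha, hb, rfl⟩, _, ⟨e, e', he, he', rfl⟩, rfl⟩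
      refine ⟨2 * a + e, 2 * b + e', ⟨a, e, ha, he, rfl⟩, ⟨b, e', hb, he', rfl⟩, ?_⟩
      rw [inflate_shiftBy, shiftBy_mul]
      congr 1; ring

/-- The children in a half of a square that is filled with parallel dominoes. -/
def fillPat (w : Bool) : List ((ℤ × ℤ) × (ℤ × ℤ)) := if w then perpPat else parallelPat

/-- A square is covered by two dominoes, for `e = 1` and `e = -1`. One application of the parallel
or of the perpendicular rule to both of them fills it with eight dominoes of the same direction. -/
theorem fillPat_fill : ∀ w, ∀ e ∈ [(1 : ℤ), -1], ∀ x ∈ fillPat w,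
    x.2 = axis w ∧ (2 * x.1.1, 4 * e + 2 * x.1.2) ∈ fillCells w := by decide

theorem fill_fillPat : ∀ w, ∀ c ∈ fillCells w, ∃ e ∈ [(1 : ℤ), -1], ∃ x ∈ fillPat w,
    c = (2 * x.1.1, 4 * e + 2 * x.1.2) := by decide

/-- The image of a direction under a lattice symmetry. -/
def LatticeIsom.turnAxis (g : LatticeIsom) (w : Bool) : Bool := (g.lin (axis w)).1 = 0

theorem LatticeIsom.lin_fill : ∀ b k w, ∀ c ∈ fillCells w,
    (⟨b, k, 0⟩ : LatticeIsom).lin c ∈ fillCells ((⟨b, k, 0⟩ : LatticeIsom).turnAxis w) := by decide +kernel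

theorem LatticeIsom.fill_lin : ∀ b k w, ∀ c ∈ fillCells ((⟨b, k, 0⟩ : LatticeIsom).turnAxis w),
    ∃ c' ∈ fillCells w, c = (⟨b, k, 0⟩ : LatticeIsom).lin c' := by decide +kernel

theorem LatticeIsom.exists_turnAxis : ∀ b k u, ∃ w, (⟨b, k, 0⟩ : LatticeIsom).turnAxis w = u := by
  decide +kernel

theorem LatticeIsom.fill_iff (g : LatticeIsom) {w : Bool} {c : ℤ × ℤ} :
    c ∈ fillCells (g.turnAxis w) ↔ ∃ c' ∈ fillCells w, c = g.lin c' :=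
  ⟨fill_lin g.flip g.turns w c, fun ⟨c', h, e⟩ => e ▸ lin_fill g.flip g.turns w c' h⟩

theorem LatticeIsom.pos_add_sub (g : LatticeIsom) (p q : ℤ × ℤ) : g.pos (p + q) - g.pos p = g.lin q := by
  rw [pos_eq_lin, pos_eq_lin, lin_add]; abel

section
variable {f : ℤ × ℤ → Cell} {n : ℕ}

/-- The dominoes in the squares inside `d`. -/
def fineIn (f : ℤ × ℤ → Cell) (n : ℕ) (d : (ℤ × ℤ) × Bool) : Set ((ℤ × ℤ) × Bool) :=
  {x | ∃ z, Along f z x.2 ∧ Inside n d z ∧ x.1 - z ∈ fillCells x.2}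

theorem inflate_child (G : LatticeIsom) (a y : ℤ) (x : (ℤ × ℤ) × (ℤ × ℤ)) {w : Bool} (hx : x.2 = axis w) :
    (G.isom (1 / 4) * (inflate (shiftBy (2 * a) y) *
      (⟨false, if x.2.1 = 0 then 1 else 0, x.1⟩ : LatticeIsom).isom (1 / 2)) : Isom) '' domino =
    rect (1 / 4) (G.pos (8 * a + 2 * x.1.1, 4 * y + 2 * x.1.2), G.turnAxis w) := by
  have h1 : inflate (shiftBy (2 * a) y) = (⟨false, 0, (8 * a, 4 * y)⟩ : LatticeIsom).isom (1 / 4) := by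
    rw [inflate_shiftBy]
    ext p i
    simp only [shiftBy, LatticeIsom.isom_apply]
    fin_cases i <;> simp [Nat.iterate] <;> ring
  have h2 : (⟨false, if x.2.1 = 0 then 1 else 0, x.1⟩ : LatticeIsom).isom (1 / 2) =
      (⟨false, if w then 1 else 0, (2 * x.1.1, 2 * x.1.2)⟩ : LatticeIsom).isom (1 / 4) := by
    rw [hx]
    ext p i
    simp only [LatticeIsom.isom_apply]
    cases w <;> fin_cases i <;> simp [Nat.iterate, axis] <;> ring
  rw [h1, h2, ← LatticeIsom.isom_comp, ← LatticeIsom.isom_comp, LatticeIsom.isom_image_domino]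
  congr 1
  have h3 : (⟨false, 0, (8 * a, 4 * y)⟩ : LatticeIsom).comp
      ⟨false, if w then 1 else 0, (2 * x.1.1, 2 * x.1.2)⟩ =
      ⟨false, if w then 1 else 0, (8 * a + 2 * x.1.1, 4 * y + 2 * x.1.2)⟩ := by
    cases w <;> simp [LatticeIsom.comp, LatticeIsom.pos, Nat.iterate, add_comm]
  rw [h3, LatticeIsom.key_comp]
  rfl

/-- After `m + 1` steps with the parallel rule each square inside the domino is covered by two
dominoes. In the last step both receive the same rule, chosen by the direction of the half-block in
that square. -/
theorem Tiled.fineIn_isSupertile (ht : Tiled tiles1 f) {m : ℕ} {d : (ℤ × ℤ) × Bool}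
    (hd : d ∈ dominoSet f (m + 2)) : ∃ P, IsSupertile (parallelRule ∪ perpRule) (m + 2) P ∧
      placed P = rect (1 / 4) '' fineIn f (m + 2) d := by
  classical
  set G := frameOf d with hG
  -- the direction, in the frame of `d`, in the square that contains a given domino of the grid
  let W : ℤ → ℤ → Bool → Prop := fun a y w => ∃ b e, Grid m b ∧ (e = 1 ∨ e = -1) ∧ y = 2 * b + e ∧
    Along f (G.pos (8 * a, 8 * b)) (G.turnAxis w)
  have hW : ∀ {a b e w}, Grid m b → (e = 1 ∨ e = -1) → W a (2 * b + e) w →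
      Along f (G.pos (8 * a, 8 * b)) (G.turnAxis w) := by
    rintro a b e w hb he ⟨b', e', hb', he', h, hv⟩
    obtain ⟨rfl, -⟩ := grid_unique hb hb' he he' h
    exact hv
  -- A choice of rules is a function of the placing isometry; it is consistent because `shiftBy` is
  -- injective and the direction in a square is unique.
  let σ : Isom → Rule := fun γ =>
    if ∃ a y, γ = shiftBy (2 * a) y ∧ W a y true then stdRule perpPat else stdRule parallelPat
  have hσ : ∀ {a b e w}, Grid m b → (e = 1 ∨ e = -1) →
      Along f (G.pos (8 * a, 8 * b)) (G.turnAxis w) →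
      σ (shiftBy (2 * a) (2 * b + e)) = stdRule (fillPat w) := by
    intro a b e w hb he h
    have : (∃ a' y, shiftBy (2 * a) (2 * b + e) = shiftBy (2 * a') y ∧ W a' y true) ↔ w = true := by
      constructor
      · rintro ⟨a', y, h1, h2⟩
        obtain ⟨h3, rfl⟩ := shiftBy_injective h1
        obtain rfl : a = a' := by omega
        have := h.unique (hW hb he h2)
        revert this
        rw [hG]
        obtain ⟨c, v⟩ := d
        cases v <;> cases w <;> simp [frameOf, LatticeIsom.turnAxis, LatticeIsom.lin, LatticeIsom.pos,
          Nat.iterate, axis]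
      · rintro rfl
        exact ⟨a, _, rfl, b, e, hb, he, rfl, h⟩
    simp only [σ, this]
    cases w <;> simp [fillPat]
  have h1 := (((gridTile_isSupertile (S := parallelRule ∪ perpRule) Set.subset_union_left (m + 1)).subst
    σ fun g _ => by
      simp only [σ]
      split_ifs
      · exact .inr (perpRule_eq ▸ stdRule_mem _)
      · exact .inl (parallelRule_eq ▸ stdRule_mem _))).move (G.isom (1 / 4))
  refine ⟨_, h1, ?_⟩
  ext t
  simp only [placed, Set.mem_image, Set.mem_iUnion, exists_prop]
  constructor
  · rintro ⟨_, ⟨_, ⟨_, ⟨a, y, ha, hy, rfl⟩, γ, hγ, rfl⟩, rfl⟩, rfl⟩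
    obtain ⟨b, e, hb, he, rfl⟩ := grid_succ.1 hy
    have hz := ht.frameOf_mem hd ha hb
    obtain ⟨u, hu⟩ := exists_along hz
    obtain ⟨w, rfl⟩ := LatticeIsom.exists_turnAxis G.flip G.turns u
    change Along f (G.pos (8 * a, 8 * b)) (G.turnAxis w) at hu
    rw [hσ hb he hu] at hγ
    obtain ⟨x, hx, rfl⟩ := hγ
    obtain ⟨hx1, hx2⟩ := fillPat_fill w e (by simpa using he) x hx
    refine ⟨_, ⟨_, hu, ((ht.inside_iff hd).2 ⟨a, b, ha, hb, rfl⟩).2, ?_⟩,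
      (inflate_child G a (2 * b + e) x hx1).symm⟩
    have : ((8 * a + 2 * x.1.1, 4 * (2 * b + e) + 2 * x.1.2) : ℤ × ℤ) =
        (8 * a, 8 * b) + (2 * x.1.1, 4 * e + 2 * x.1.2) := by
      ext <;> simp; ring
    rw [this, LatticeIsom.pos_add_sub, LatticeIsom.fill_iff]
    exact ⟨_, hx2, rfl⟩
  · rintro ⟨⟨p, u⟩, ⟨z, hz, hi, hp⟩, rfl⟩
    obtain ⟨a, b, ha, hb, rfl⟩ := (ht.inside_iff hd).1 ⟨hz.mem, hi⟩
    dsimp only at hz hp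
    obtain ⟨w, rfl⟩ := LatticeIsom.exists_turnAxis G.flip G.turns u
    change Along f (G.pos (8 * a, 8 * b)) (G.turnAxis w) at hz
    obtain ⟨c, hc, e1⟩ := (LatticeIsom.fill_iff G).1 hp
    obtain ⟨e, he, x, hx, rfl⟩ := fill_fillPat w c hc
    have he : e = 1 ∨ e = -1 := by simpa using he
    have hx1 := (fillPat_fill w e (by simpa using he) x hx).1
    have hy : Grid (m + 1) (2 * b + e) := grid_succ.2 ⟨b, e, hb, he, rfl⟩
    refine ⟨_, ⟨_, ⟨_, ⟨a, 2 * b + e, ha, hy, rfl⟩,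
      (⟨false, if x.2.1 = 0 then 1 else 0, x.1⟩ : LatticeIsom).isom (1 / 2), ?_, rfl⟩, rfl⟩, ?_⟩
    · rw [hσ hb he hz]
      exact ⟨x, hx, rfl⟩
    · rw [inflate_child G a (2 * b + e) x hx1]
      congr 2
      have : ((8 * a + 2 * x.1.1, 4 * (2 * b + e) + 2 * x.1.2) : ℤ × ℤ) =
          (8 * a, 8 * b) + (2 * x.1.1, 4 * e + 2 * x.1.2) := by
        ext <;> simp; ring
      rw [this]
      rw [← LatticeIsom.pos_add_sub G (8 * a, 8 * b), sub_left_inj] at e1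
      exact e1.symm

end

/-! ### The tiling with filled squares is hierarchical -/

section
variable {f : ℤ × ℤ → Cell} {n : ℕ}

theorem turnAxis_frameOf (d : (ℤ × ℤ) × Bool) : (frameOf d).turnAxis false = d.2 := by
  obtain ⟨c, v⟩ := d
  cases v <;> simp [frameOf, LatticeIsom.turnAxis, LatticeIsom.lin, LatticeIsom.pos, Nat.iterate, axis]

theorem isom_shiftBy_image (G : LatticeIsom) (x y : ℤ) :
    (G.isom (1 / 4) * shiftBy x y : Isom) '' domino =
      rect (1 / 4) (G.pos (2 * x, 2 * y), G.turnAxis false) := by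
  have h1 : shiftBy x y = (⟨false, 0, (2 * x, 2 * y)⟩ : LatticeIsom).isom (1 / 4) := by
    ext p i
    simp only [shiftBy, LatticeIsom.isom_apply]
    fin_cases i <;> simp [Nat.iterate] <;> ring
  rw [h1, ← LatticeIsom.isom_comp, LatticeIsom.isom_image_domino]
  exact congrArg _ (LatticeIsom.key_comp G _ false)

theorem placed_gridTile (d : (ℤ × ℤ) × Bool) (k : ℕ) :
    placed ((fun x => (frameOf d).isom (1 / 4) * x) '' gridTile k) =
      rect (1 / 4) '' {e | ∃ x y, Grid k x ∧ Grid k y ∧ e = ((frameOf d).pos (4 * x, 2 * y), d.2)} := by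
  ext t
  simp only [placed, Set.mem_image, gridTile, Set.mem_ofPred_eq]
  constructor
  · rintro ⟨_, ⟨_, ⟨x, y, hx, hy, rfl⟩, rfl⟩, rfl⟩
    refine ⟨_, ⟨x, y, hx, hy, rfl⟩, ?_⟩
    rw [isom_shiftBy_image, turnAxis_frameOf]
    rw [show 2 * (2 * x) = 4 * x by ring]
  · rintro ⟨_, ⟨x, y, hx, hy, rfl⟩, rfl⟩
    refine ⟨_, ⟨_, ⟨x, y, hx, hy, rfl⟩, rfl⟩, ?_⟩
    rw [isom_shiftBy_image, turnAxis_frameOf]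
    rw [show 2 * (2 * x) = 4 * x by ring]

/-- Each domino in a square belongs to a half of the square. -/
theorem exists_half : ∀ u, ∀ c ∈ fillCells u, ∃ h : ℤ × ℤ,
    (∃ e ∈ [(1 : ℤ), -1], ∃ e' ∈ [(1 : ℤ), -1], c = (frameOf (h, u)).pos (4 * e, 2 * e')) ∧
    ∀ e ∈ [(1 : ℤ), -1], ∀ e' ∈ [(1 : ℤ), -1], (frameOf (h, u)).pos (4 * e, 2 * e') ∈ fillCells u := by
  have : ∀ u, ∀ c ∈ fillCells u, ∃ h ∈ [((4 : ℤ), (0 : ℤ)), (-4, 0), (0, 4), (0, -4)],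
    (∃ e ∈ [(1 : ℤ), -1], ∃ e' ∈ [(1 : ℤ), -1], c = (frameOf (h, u)).pos (4 * e, 2 * e')) ∧
    ∀ e ∈ [(1 : ℤ), -1], ∀ e' ∈ [(1 : ℤ), -1],
      (frameOf (h, u)).pos (4 * e, 2 * e') ∈ fillCells u := by decide +kernel
  intro u c hc
  obtain ⟨h, -, h'⟩ := this u c hc
  exact ⟨h, h'⟩

theorem frameOf_add (z c : ℤ × ℤ) (u : Bool) (p : ℤ × ℤ) :
    (frameOf (z + c, u)).pos p = z + (frameOf (c, u)).pos p := by
  rw [LatticeIsom.pos_eq_lin, LatticeIsom.pos_eq_lin]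
  change (frameOf (c, u)).lin p + (z + c) = z + ((frameOf (c, u)).lin p + c)
  abel

theorem grid_one {a : ℤ} : Grid 1 a ↔ a = 1 ∨ a = -1 := by
  simp [Grid]; omega

theorem Tiled.exists_dominoSet (ht : Tiled tiles1 f) {z : ℤ × ℤ} (hz : z ∈ levelQ f 3) :
    ∃ d ∈ dominoSet f 2, Inside 2 d z := by
  obtain ⟨g, hg, rfl⟩ := exists_pt hz
  have hd : Dom f 2 (g.shift + (2 ^ 3 : ℤ) • g.lin (0, -1)) (g.lin (0, -1)) :=
    ⟨g, hg, by simp, rfl⟩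
  refine ⟨_, ht.mem_dominoSet hd g.lin_south, ?_⟩
  obtain ⟨b, k, x, y⟩ := g
  cases b <;> fin_cases k <;>
    simp [LatticeIsom.lin, LatticeIsom.pos, Nat.iterate, Inside, halfWidth, halfHeight]

/-- The chain of supertiles begins with the domino and the half of its square that contains it. From
level `2` on it consists of the contents of a domino of that level, each such domino lying inside
its successor. -/
theorem Tiled.fine_isHierarchical (ht : Tiled tiles1 f) :
    IsHierarchical (parallelRule ∪ perpRule) (rect (1 / 4) '' fineSet f) := by
  refine ⟨ht.fine_isDominoTiling, ?_⟩
  rintro _ ⟨⟨p, u⟩, ⟨z, hz, hp⟩, rfl⟩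
  dsimp only at hz hp
  obtain ⟨h, ⟨e, he, e', he', hc⟩, hh⟩ := exists_half u _ hp
  obtain ⟨d₀, hd₀, hi₀⟩ := ht.exists_dominoSet hz.mem
  -- the dominoes of the levels from `2` on
  have hD : ∃ D : ℕ → (ℤ × ℤ) × Bool, D 0 = d₀ ∧ ∀ m, D m ∈ dominoSet f (m + 2) ∧
      ∀ z, Inside (m + 2) (D m) z → Inside (m + 3) (D (m + 1)) z := by
    choose! par hpar hins using fun n d (hd : d ∈ dominoSet f n) => ht.exists_parent_inside hd
    let D : ℕ → (ℤ × ℤ) × Bool := fun m => Nat.rec d₀ (fun m d => par (m + 2) d) m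
    have hm : ∀ m, D m ∈ dominoSet f (m + 2) := by
      intro m
      induction m with
      | zero => exact hd₀
      | succ m ih => exact hpar _ _ ih
    exact ⟨D, rfl, fun m => ⟨hm m, hins _ _ (hm m)⟩⟩
  obtain ⟨D, rfl, hD⟩ := hD
  choose R hR hR' using fun m => ht.fineIn_isSupertile (hD m).1
  have hk : ∀ k, IsSupertile (parallelRule ∪ perpRule) k (gridTile k) :=
    gridTile_isSupertile Set.subset_union_left
  let P : ℕ → Set Isom
    | 0 => (fun x => (frameOf (p, u)).isom (1 / 4) * x) '' gridTile 0
    | 1 => (fun x => (frameOf (z + h, u)).isom (1 / 4) * x) '' gridTile 1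
    | m + 2 => R m
  let A : ℕ → Set ((ℤ × ℤ) × Bool)
    | 0 => {(p, u)}
    | 1 => {x | ∃ a b, Grid 1 a ∧ Grid 1 b ∧ x = ((frameOf (z + h, u)).pos (4 * a, 2 * b), u)}
    | m + 2 => fineIn f (m + 2) (D m)
  have h0 : placed (P 0) = rect (1 / 4) '' A 0 := by
    simp only [P, A, placed_gridTile, grid_zero]
    congr 1
    ext x
    simp [frameOf_pos]
  have hPA : ∀ n, placed (P n) = rect (1 / 4) '' A n := by
    rintro (_ | _ | m)
    · exact h0
    · simp only [P, A, placed_gridTile]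
    · exact hR' m
  have hone : ∀ x ∈ A 1, x.2 = u ∧ x.1 - z ∈ fillCells u := by
    rintro _ ⟨a, b, ha, hb, rfl⟩
    rw [grid_one] at ha hb
    refine ⟨rfl, ?_⟩
    rw [frameOf_add, add_sub_cancel_left]
    exact hh a (by simpa using ha) b (by simpa using hb)
  refine ⟨P, ?_, fun n => ⟨?_, ?_, ?_⟩⟩
  · rw [h0, Set.image_singleton]
  · match n with
    | 0 => exact (hk 0).move _
    | 1 => exact (hk 1).move _
    | m + 2 => exact hR m
  · rw [hPA, hPA]
    refine Set.image_mono ?_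
    match n with
    | 0 =>
      rintro _ rfl
      refine ⟨e, e', grid_one.2 (by simpa using he), grid_one.2 (by simpa using he'), ?_⟩
      rw [frameOf_add, ← hc, add_sub_cancel]
    | 1 =>
      intro x hx
      obtain ⟨h1, h2⟩ := hone x hx
      exact ⟨z, h1 ▸ hz, hi₀, h1 ▸ h2⟩
    | m + 2 =>
      rintro x ⟨y, h1, h2, h3⟩
      exact ⟨y, h1, (hD m).2 y h2, h3⟩
  · rw [hPA]
    refine Set.image_mono ?_
    match n with
    | 0 =>
      rintro _ rfl
      exact ⟨z, hz, hp⟩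
    | 1 =>
      intro x hx
      obtain ⟨h1, h2⟩ := hone x hx
      exact ⟨z, h1 ▸ hz, h1 ▸ h2⟩
    | m + 2 =>
      rintro x ⟨y, h1, h2, h3⟩
      exact ⟨y, h1, h3⟩

end

/-! ### Deriving the refined tiling locally -/

section
variable {f : ℤ × ℤ → Cell} {n : ℕ}

/-- A single copy of `tileA` already forces its half-block. Thus a half-block of level `2` can be
recognized by three tiles. -/
theorem Tiled.H_iff_tileA (ht : Tiled tiles1 f) {g : LatticeIsom} :
    H f n g ↔ g.pos (2 ^ n, 2 ^ n) ∈ levelQ f n ∧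
      ∃ c, f (g.pos (2 ^ n, 2 ^ n)) = Cell.move g.flip g.turns (tileA c) := by
  have e : ∀ c, f (g.pos (2 ^ n, 2 ^ n)) = Cell.move g.flip g.turns (tileA c) ↔
      DominoTiles.view g f (2 ^ n, 2 ^ n) = tileA c := by
    intro c
    rw [DominoTiles.view]
    exact ⟨fun h => by rw [h, Cell.unmove_move], fun h => by rw [← h, Cell.move_unmove]⟩
  simp only [e]
  constructor
  · intro h
    exact h.ne
  · rintro ⟨h, c, hc⟩
    exact ((ht.level n).view g).halfBlock (ht.toValid.view g) h hc

/-- A cornered tile and two tiles that determine a half-block of level `2`. -/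
def blockPattern (x : (Bool × Fin 4) × (Bool × Fin 4) × Bool × Bool) : Config :=
  {((4, 4), tileA x.2.2.1),
   ((⟨x.1.1, x.1.2, (4, 4)⟩ : LatticeIsom).pos (2, 2), Cell.move x.1.1 x.1.2 (tileA x.2.2.2)),
   ((⟨x.2.1.1, x.2.1.2, (⟨x.1.1, x.1.2, (4, 4)⟩ : LatticeIsom).pos (2, 2)⟩ : LatticeIsom).pos (1, 1),
      Cell.move x.2.1.1 x.2.1.2 (tileA true))}

theorem Tiled.halfBlock_iff (ht : Tiled tiles1 f) :
    H f 2 ⟨false, 0, 0⟩ ↔ ∃ x, ∀ y ∈ blockPattern x, f y.1 = y.2 := by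
  have e0 : ∀ p, (⟨false, 0, 0⟩ : LatticeIsom).pos p = p := fun p => by simp [LatticeIsom.pos]
  have e1 : ∀ c, Cell.move false 0 c = c := fun c => rfl
  have hc : ∀ b k c, (Cell.move b k c).cornered = c.cornered := by
    intro b k c
    cases b <;> fin_cases k <;> simp [Cell.move, Nat.iterate, Cell.turn, Cell.flip]
  rw [ht.H_iff_tileA, e0]
  simp only [e1, blockPattern]
  constructor
  · rintro ⟨h, c₁, h₁⟩
    norm_num [-Bool.exists_bool] at h h₁
    obtain ⟨b, k, h⟩ : ∃ b k, H f 1 ⟨b, k, (4, 4)⟩ := h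
    obtain ⟨h, c₂, h₂⟩ := ht.H_iff_tileA.1 h
    norm_num [-Bool.exists_bool] at h h₂
    obtain ⟨b', k', h⟩ : ∃ b' k', H f 0 ⟨b', k', (⟨b, k, (4, 4)⟩ : LatticeIsom).pos (2, 2)⟩ := h
    obtain ⟨h, c₃, h₃⟩ := ht.H_iff_tileA.1 h
    norm_num [-Bool.exists_bool] at h h₃
    have h : (f _).cornered = true := h
    rw [h₃, hc] at h
    obtain rfl : c₃ = true := h
    refine ⟨((b, k), (b', k'), c₁, c₂), ?_⟩
    rintro _ (rfl | rfl | rfl)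
    · exact h₁
    · exact h₂
    · exact h₃
  · rintro ⟨⟨⟨b, k⟩, ⟨b', k'⟩, c₁, c₂⟩, h⟩
    have h₁ := h _ (.inl rfl)
    have h₂ := h _ (.inr (.inl rfl))
    have h₃ := h _ (.inr (.inr rfl))
    dsimp only at h₁ h₂ h₃
    have q₁ : H f 0 ⟨b', k', (⟨b, k, (4, 4)⟩ : LatticeIsom).pos (2, 2)⟩ := by
      rw [ht.H_iff_tileA]
      norm_num [-Bool.exists_bool]
      refine ⟨?_, _, h₃⟩
      change (f _).cornered = true
      rw [h₃, hc]
      rfl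
    have q₂ : H f 1 ⟨b, k, (4, 4)⟩ := by
      rw [ht.H_iff_tileA]
      norm_num [-Bool.exists_bool]
      exact ⟨HB.mem q₁, _, h₂⟩
    norm_num [-Bool.exists_bool]
    exact ⟨HB.mem q₂, _, h₁⟩

theorem along_iff {z : ℤ × ℤ} {u : Bool} :
    Along f z u ↔ ∃ g : LatticeIsom, H f 2 g ∧ g.shift = z ∧ g.turnAxis true = u := by
  have key : ∀ g : LatticeIsom, ∀ u, g.lin (0, -1) = axis u ∨ g.lin (0, -1) = -axis u ↔
      g.turnAxis true = u := by
    rintro ⟨b, k, x⟩ u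
    clear z
    change (⟨b, k, 0⟩ : LatticeIsom).lin (0, -1) = axis u ∨
      (⟨b, k, 0⟩ : LatticeIsom).lin (0, -1) = -axis u ↔ (⟨b, k, 0⟩ : LatticeIsom).turnAxis true = u
    revert b k u
    clear * -
    decide +kernel
  constructor
  · rintro (⟨g, h, e, h'⟩ | ⟨g, h, e, h'⟩)
    · exact ⟨g, h, e, (key g u).1 (.inl h')⟩
    · exact ⟨g, h, e, (key g u).1 (.inr h')⟩
  · rintro ⟨g, h, e, h'⟩
    exact ((key g u).2 h').imp (fun h' => ⟨g, h, e, h'⟩) fun h' => ⟨g, h, e, h'⟩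

/-- In terms of frames, every half-block contributes the same set of dominoes, moved by its frame;
this is the form of a local derivation. -/
theorem fineSet_eq : rect (1 / 4) '' fineSet f =
    {t | ∃ g : LatticeIsom, H f 2 g ∧ ∃ c ∈ fillCells true, t = g.plane '' rect (1 / 4) (c, true)} := by
  have key : ∀ (g : LatticeIsom) c, g.plane '' rect (1 / 4) (c, true) =
      rect (1 / 4) (g.pos c, g.turnAxis true) := by
    intro g c
    rw [LatticeIsom.plane_eq, LatticeIsom.image_rect]
    rfl
  simp only [key]
  ext t
  constructor
  · rintro ⟨⟨p, u⟩, ⟨z, hz, hp⟩, rfl⟩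
    obtain ⟨g, hg, rfl, rfl⟩ := along_iff.1 hz
    obtain ⟨c, hc, e⟩ := g.fill_iff.1 hp
    refine ⟨g, hg, c, hc, ?_⟩
    rw [LatticeIsom.pos_eq_lin, ← e, sub_add_cancel]
  · rintro ⟨g, hg, c, hc, rfl⟩
    refine ⟨_, ⟨g.shift, along_iff.2 ⟨g, hg, rfl, rfl⟩, g.fill_iff.2 ⟨c, hc, ?_⟩⟩, rfl⟩
    dsimp only
    rw [LatticeIsom.pos_eq_lin, add_sub_cancel_right]

theorem IsDominoConfig.subset {C C' : Set (Set Plane)} (h : IsDominoConfig C) (hC : C' ⊆ C) :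
    IsDominoConfig C' :=
  ⟨fun t ht => h.1 t (hC ht), h.2.mono hC⟩

theorem image_plane_id (s : Set Plane) : (⟨false, 0, 0⟩ : LatticeIsom).plane '' s = s := by
  have : (⟨false, 0, 0⟩ : LatticeIsom).plane = id := by
    funext p
    ext i
    fin_cases i <;> simp [LatticeIsom.plane]
  rw [this, Set.image_id]

/-- The tiles enforce the substitution system of all rules with parallel children in either half
of the parent, by a local derivation that ignores the smallest blocks. -/
theorem enforces_parallel_perp : Enforces tiles1 (parallelRule ∪ perpRule) := by
  classical
  -- Keeping only the patterns that occur in tilings guarantees that they are admitted and that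
  -- their dominoes have disjoint interiors.
  let B : Set Config := {C | ∃ x, C = blockPattern x ∧ ∃ f, Tiled tiles1 f ∧ ∀ y ∈ C, f y.1 = y.2}
  let F : Set (Set Plane) := (fun c => rect (1 / 4) (c, true)) '' {c | c ∈ fillCells true}
  have hF : F.Finite := (List.finite_toSet _).image _
  refine ⟨B ∪ (fun t => {(0, t)}) '' tiles1, fun C => if C ∈ B then F else ∅, ?_, ?_, ?_⟩
  · refine Set.Finite.union ((Set.finite_range blockPattern).subset ?_) (tiles1_finite.image _)
    rintro _ ⟨x, rfl, -⟩
    exact ⟨x, rfl⟩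
  · have hB : ∀ C ∈ B, C.Finite ∧ Admitted tiles1 C ∧ IsDominoConfig F := by
      rintro _ ⟨x, rfl, f, ht, h⟩
      refine ⟨by unfold blockPattern; exact Set.toFinite _, ht.isTiling.admitted.subset fun y hy => (h y hy).symm,
        ht.fine_isDominoTiling.1.subset ?_⟩
      rw [fineSet_eq]
      rintro _ ⟨c, hc, rfl⟩
      exact ⟨_, ht.halfBlock_iff.2 ⟨x, h⟩, c, hc, (image_plane_id _).symm⟩
    intro C hC
    by_cases hCB : C ∈ B
    · simp only [hCB, if_true]
      exact ⟨(hB C hCB).1, (hB C hCB).2.1, hF, (hB C hCB).2.2⟩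
    · obtain ⟨t, ht, rfl⟩ := hC.resolve_left hCB
      simp only [hCB, if_false]
      exact ⟨Set.finite_singleton _, admitted_singleton ht, Set.finite_empty, isDominoConfig_empty⟩
  · intro τ hτ
    constructor
    · intro x hx
      obtain ⟨g, t, ht, h⟩ := singleton_cover hτ hx
      exact ⟨g, _, .inr ⟨t, ht, rfl⟩, h⟩
    · obtain ⟨f, ht, rfl⟩ := hτ.exists_graph
      convert ht.fine_isHierarchical using 1
      rw [fineSet_eq]
      ext t
      simp only [derive, Set.mem_ofPred_eq]
      refine exists_congr fun g => ?_
      have hg : H f 2 g ↔ ∃ C ∈ B, g.config C ⊆ graph f := by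
        rw [← LatticeIsom.comp_id g, ← H_view, (ht.view g).halfBlock_iff, LatticeIsom.comp_id]
        simp only [config_subset_graph]
        constructor
        · rintro ⟨x, h⟩
          exact ⟨_, ⟨x, rfl, _, ht.view g, h⟩, h⟩
        · rintro ⟨_, ⟨x, rfl, -⟩, h⟩
          exact ⟨x, h⟩
      rw [hg]
      constructor
      · rintro ⟨C, -, hC, s, hs, rfl⟩
        split_ifs at hs with hCB
        · obtain ⟨c, hc, rfl⟩ := hs
          exact ⟨⟨C, hCB, hC⟩, c, hc, rfl⟩
        · exact hs.elim
      · rintro ⟨⟨C, hCB, hC⟩, c, hc, rfl⟩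
        exact ⟨C, .inl hCB, hC, _, by rw [if_pos hCB]; exact ⟨c, hc, rfl⟩, rfl⟩

end

end DominoTiles

/-! ### The theorem -/

open DominoTiles in
theorem theorem1 :
    (∀ row ∈ ([
        (tableTiles, tableRule),
        (parallelTiles, parallelRule),
        (perpTiles, perpRule),
        (asymTiles, parallelRule ∪ perpRule ∪ asymRules),
        (tableTiles ∪ parallelTiles, tableRule ∪ parallelRule),
        (tableTiles ∪ perpTiles, tableRule ∪ perpRule),
        (parallelTiles ∪ perpTiles, parallelRule ∪ perpRule),
        (tableTiles ∪ parallelTiles ∪ perpTiles, tableRule ∪ parallelRule ∪ perpRule),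
        (tiles1, tableRule ∪ parallelRule ∪ perpRule ∪ asymRules)] :
          List (Set Cell × Set Rule)),
      Enforces row.1 row.2 ∧
      (∀ τ, IsTiling row.1 τ → IsHierarchical row.2 (erase τ)) ∧
      Aperiodic row.1 ∧
      Enforces (row.1 ∪ restTiles1) row.2 ∧
      ∀ S : Set Rule, Enforces (row.1 ∪ restTiles1) S → Enforces row.1 S) ∧
    (∀ T ∈ ({tableTiles, parallelTiles, perpTiles} : Set (Set Cell)),
      ∀ T' ⊂ T, ¬ ∃ τ, IsTiling T' τ) := by
  refine ⟨fun row hrow => ?_, ?_⟩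
  · have ho := outwardTiles_subset_rows row hrow
    have hT := rows_subset row hrow
    have hU : row.1 ∪ restTiles1 ⊆ tiles1 := Set.union_subset hT restTiles1_subset
    refine ⟨(rulesFor_rows row hrow).enforces ho hT,
      fun τ h => h.erase_isHierarchical hT (rulesFor_rows row hrow), aperiodic_rows row hrow, ?_,
      fun S => Enforces.anti_tiles Set.subset_union_left⟩
    rcases rulesFor_rows_union row hrow with h | h | h
    · exact h.enforces (ho.trans Set.subset_union_left) hU
    -- The added tiles contain `mixTiles`, so `RulesFor` no longer excludes asymmetric children; in
    -- this case and the next the derivation with parallel dominoes in each square is used instead.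
    · rw [h]
      exact enforces_parallel_perp.anti_tiles hU
    · rw [h]
      refine (enforces_parallel_perp.anti_tiles hU).mono_rules ?_
      rw [Set.union_assoc]
      exact Set.subset_union_right
  · rintro T (rfl | rfl | rfl)
    · exact no_tiling_of_ssubset tableTiles_subset occurs_tableTiles
    · exact no_tiling_of_ssubset parallelTiles_subset occurs_parallelTiles
    · exact no_tiling_of_ssubset perpTiles_subset occurs_perpTiles
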